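/- Let $q(x,t)$, $x,t\in\mathbb R$, be a $C^2$ solution of $i q_t+\tfrac12 q_{xx}+(|q|^2-q_0^2)q=0$ (the gauge-transformed Kundu--Eckhaus equation) such that, locally uniformly in $t$, $q\to q_\pm$ and $q_x\to0$ as $x\to\pm\infty$, where $|q_\pm|=q_0>0$, and such that for every $t$ we have $(1+|x|)(q-q_\pm)\in L^1(\mathbb R^\pm)$ and $q_x,q_{xx}\in L^1(\mathbb R)$. **Scattering data.** Put $k(z)=\tfrac12(z-q_0^2/z)$, $\lambda(z)=\tfrac12(z+q_0^2/z)$, $\theta(x,t;z)=\lambda(x+kt)$, $\gamma=1+q_0^2/z^2$, $Q=\begin{pmatrix}0&q\\-q^*&0\end{pmatrix}$, $Q_\pm=\lim_{x\to\pm\infty}Q$, $\sigma_3=\mathrm{diag}(1,-1)$. The Jost columns $\psi_{\pm,1},\psi_{\pm,2}$ are the simultaneous solutions of $$\psi_x=(-ik\sigma_3+Q)\psi,\qquad \psi_t=\bigl(-ik^2\sigma_3+kQ-\tfrac i2Q_x\sigma_3-\tfrac i2(Q^2+q_0^2)\sigma_3\bigr)\psi$$ for which the columns of $u_\pm=\psi_\pm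 e^{i\theta\sigma_3}$ tend to those of $I-\tfrac iz\sigma_3Q_\pm$ as $x\to\pm\infty$ (each column is used only for those $z$ for which this determines it: $\psi_{-,1},\psi_{+,2}$ in $D^+$, $\psi_{+,1},\psi_{-,2}$ in $D^-$, all four on $\Sigma\setminus\{0,\pm iq_0\}$). Let $D^\pm=\{\pm(|z|^2-q_0^2)\operatorname{Im}z>0\}$ and $\Sigma=\mathbb R\cup\{|z|=q_0\}$, oriented with $D^+$ on its left. Let $s_{11}=\det(\psi_{+,1},\psi_{-,2})/\gamma$, $s_{22}=\det(\psi_{-,1},\psi_{+,2})/\gamma$, $s_{12}=\det(\psi_{+,2},\psi_{-,2})/\gamma$, $s_{21}=\det(\psi_{-,1},\psi_{+,1})/\gamma$, $\rho=s_{21}/s_{11}$, $\tilde\rho=s_{12}/s_{22}$, and $$M^+=\bigl(u_{-,1},u_{+,2}/s_{22}\bigr),\quad M^-=\bigl(u_{+,1}/s_{11},u_{-,2}\bigr),\quad G=\begin{pmatrix}0&-\tilde\rho e^{-2i\theta}\\ \rho e^{2i\theta}&\rho\tilde\rho\end{pmatrix},$$ with $M=M^\pm$ in $D^\pm$ (so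 that $M^+=M^-(I-G)$ on $\Sigma$). Suppose that $s_{11}$ has in $D^-\cap\{\operatorname{Im}z<0\}$ exactly the distinct zeros $z_1,\dots,z_N$ ($N\ge0$), that they are simple, and that $1/s_{11}$ is bounded in $D^-$ near every point of $\Sigma$ (no spectral singularities). Put $\xi_n=z_n$, $\xi_{N+n}=-q_0^2/z_n^*$ for $1\le n\le N$, $\hat\xi_n=-q_0^2/\xi_n$ for $1\le n\le 2N$, and $C_+[\hat\xi_n]=b_+(\hat\xi_n)/s_{22}'(\hat\xi_n)$, where $\psi_{+,2}(\hat\xi_n)=b_+(\hat\xi_n)\psi_{-,1}(\hat\xi_n)$ for all $x,t$. Let $\omega_j=C_+[\hat\xi_j]e^{-2i\theta(x,t;\hat\xi_j)}$ and $\nu_j=iq_- /\xi_j$. **Claim.** For all $x,t$: 1. There is a matrix $M^{(1)}(x,t)$ with $M(x,t;z)=I+M^{(1)}(x,t)/z+O(1/z^2)$ as $z\to\infty$ off $\Sigma$, and $q=i\,(M^{(1)})_{12}$. 2. The function $(M^-G)_{12}$ is absolutely integrable along $\Sigma$ and $$q=q_-+i\sum_{n=1}^{2N}\omega_n\,u_{-,11}(x,t;\hat\xi_n)+\frac1{2\pi}\int_\Sigma(M^-G)_{12}(x,t;\zeta)\,d\zeta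 .$$ 3. For $s=1,\dots,2N$ the function $(M^-G)_{12}(x,t;\zeta)/(\zeta-\xi_s)$ is absolutely integrable along $\Sigma$ and $$\sum_{n=1}^{2N}\Bigl(\frac{\omega_n}{\xi_s-\hat\xi_n}+\nu_s\delta_{sn}\Bigr)u_{-,11}(x,t;\hat\xi_n)-\frac{iq_-}{\xi_s}-\frac1{2\pi i}\int_\Sigma\frac{(M^-G)_{12}(x,t;\zeta)}{\zeta-\xi_s}\,d\zeta=0 .$$ 4. In the reflectionless case, i.e. if $G(x,t;\zeta)=0$ for all $x,t$ and all $\zeta\in\Sigma\setminus\{0,\pm iq_0\}$, the $2N\times2N$ matrix $T$ with entries $t_{sj}=\omega_j/(\xi_s-\hat\xi_j)+\nu_s\delta_{sj}$ satisfies $\det T\ne0$ and $$q=q_--i\,\frac{\det\begin{pmatrix}T&\nu\\ \omega^{T}&0\end{pmatrix}}{\det T}.$$ -/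

import Mathlib

open Filter Topology Matrix Complex Bornology

/-- A potential `q(x,t)` together with its two boundary values: `qm` at `x → -∞`
and `qp` at `x → +∞`. -/
structure KEPotential where
  q : ℝ → ℝ → ℂ
  qm : ℂ
  qp : ℂ

namespace KEPotential

noncomputable section

/-- The modulus `q₀ = |q_-|` of the background. -/
def q0 (P : KEPotential) : ℝ := ‖P.qm‖

/-- The spatial derivative `q_x(x,t)`. -/
def qx (P : KEPotential) (x t : ℝ) : ℂ := deriv (fun y => P.q y t) x

/-- The second spatial derivative `q_xx(x,t)`. -/
def qxx (P : KEPotential) (x t : ℝ) : ℂ := deriv (fun y => P.qx y t) x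

/-- The class of potentials: classical solutions of
`i q_t + q_xx / 2 + (|q|² - q₀²) q = 0` (the compatibility condition of the Lax pair) on a
nonzero background `q → q_±`, `|q_±| = q₀ > 0`. -/
structure Admissible (P : KEPotential) : Prop where
  qm_ne : P.qm ≠ 0
  norm_qp : ‖P.qp‖ = P.q0
  smooth : ContDiff ℝ 2 (Function.uncurry P.q)
  nls : ∀ x t, I * deriv (fun s => P.q x s) t + (1 / 2) * P.qxx x t
    + ((‖P.q x t‖ : ℂ) ^ 2 - (P.q0 : ℂ) ^ 2) * P.q x t = 0
  lim_bot : TendstoLocallyUniformly (fun x t => P.q x t) (fun _ => P.qm) atBot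
  lim_top : TendstoLocallyUniformly (fun x t => P.q x t) (fun _ => P.qp) atTop
  lim_qx_bot : TendstoLocallyUniformly (fun x t => P.qx x t) (fun _ => 0) atBot
  lim_qx_top : TendstoLocallyUniformly (fun x t => P.qx x t) (fun _ => 0) atTop
  moment_bot : ∀ t, MeasureTheory.IntegrableOn
    (fun x : ℝ => (1 + |x|) * ‖P.q x t - P.qm‖) (Set.Iic 0)
  moment_top : ∀ t, MeasureTheory.IntegrableOn
    (fun x : ℝ => (1 + |x|) * ‖P.q x t - P.qp‖) (Set.Ici 0)
  integrable_qx : ∀ t, MeasureTheory.Integrable (fun x => P.qx x t)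
  integrable_qxx : ∀ t, MeasureTheory.Integrable (fun x => P.qxx x t)

/-! ### Uniformization and Lax pair -/

/-- `k(z) = (z - q₀²/z)/2`. -/
def kk (P : KEPotential) (z : ℂ) : ℂ := (z - (P.q0 : ℂ) ^ 2 / z) / 2

/-- `λ(z) = (z + q₀²/z)/2`. -/
def lam (P : KEPotential) (z : ℂ) : ℂ := (z + (P.q0 : ℂ) ^ 2 / z) / 2

/-- `θ(x,t;z) = λ(z)(x + k(z) t)`. -/
def theta (P : KEPotential) (x t : ℝ) (z : ℂ) : ℂ := P.lam z * (x + P.kk z * t)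

/-- `γ(z) = 1 + q₀²/z²`. -/
def gam (P : KEPotential) (z : ℂ) : ℂ := 1 + (P.q0 : ℂ) ^ 2 / z ^ 2

def sigma3 : Matrix (Fin 2) (Fin 2) ℂ := !![1, 0; 0, -1]

/-- The matrix with off-diagonal entries `a` and `-a*`. -/
def offDiag (a : ℂ) : Matrix (Fin 2) (Fin 2) ℂ := !![0, a; -(starRingEnd ℂ) a, 0]

/-- `X = -i k σ₃ + Q`. -/
def laxX (P : KEPotential) (z : ℂ) (x t : ℝ) : Matrix (Fin 2) (Fin 2) ℂ :=
  -(I * P.kk z) • sigma3 + offDiag (P.q x t)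

/-- `T = -i k² σ₃ + k Q - (i/2) Q_x σ₃ - (i/2) (Q² + q₀²) σ₃`. -/
def laxT (P : KEPotential) (z : ℂ) (x t : ℝ) : Matrix (Fin 2) (Fin 2) ℂ :=
  -(I * P.kk z ^ 2) • sigma3 + P.kk z • offDiag (P.q x t)
    - (I / 2) • (offDiag (P.qx x t) * sigma3)
    - (I / 2) • ((offDiag (P.q x t) * offDiag (P.q x t) + ((P.q0 : ℂ) ^ 2) • 1) * sigma3)

/-- `Y(z) = 1 - (i/z) σ₃ Q_±`, where `a` is the boundary value `q_±`. -/
def asympY (a z : ℂ) : Matrix (Fin 2) (Fin 2) ℂ := 1 - (I / z) • (sigma3 * offDiag a)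

/-- The diagonal entries of `e^{iθσ₃}`. -/
def expTheta (P : KEPotential) (x t : ℝ) (z : ℂ) (j : Fin 2) : ℂ :=
  exp (I * P.theta x t z * sigma3 j j)

/-! ### Jost functions and scattering coefficients -/

/-- `ψ` is the `j`-th Jost column at the spatial end `l` with boundary value `a`: a simultaneous
solution of the Lax pair such that `ψ e^{±iθ}` tends to the `j`-th column of `Y`. -/
def IsJost (P : KEPotential) (l : Filter ℝ) (a : ℂ) (j : Fin 2) (z : ℂ)
    (ψ : ℝ → ℝ → Fin 2 → ℂ) : Prop :=
  (∀ x t, HasDerivAt (fun y => ψ y t) (P.laxX z x t *ᵥ ψ x t) x) ∧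
  (∀ x t, HasDerivAt (fun s => ψ x s) (P.laxT z x t *ᵥ ψ x t) t) ∧
  ∀ t, Tendsto (fun x => P.expTheta x t z j • ψ x t) l (𝓝 (fun i => asympY a z i j))

/-- The Jost columns `ψ_{-,1}` (`j = 0`) and `ψ_{-,2}` (`j = 1`). -/
def psiM (P : KEPotential) (j : Fin 2) (z : ℂ) : ℝ → ℝ → Fin 2 → ℂ :=
  Classical.epsilon (P.IsJost atBot P.qm j z)

/-- The Jost columns `ψ_{+,1}` (`j = 0`) and `ψ_{+,2}` (`j = 1`). -/
def psiP (P : KEPotential) (j : Fin 2) (z : ℂ) : ℝ → ℝ → Fin 2 → ℂ :=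
  Classical.epsilon (P.IsJost atTop P.qp j z)

/-- The columns of `u_- = ψ_- e^{iθσ₃}`. -/
def uM (P : KEPotential) (j : Fin 2) (x t : ℝ) (z : ℂ) : Fin 2 → ℂ :=
  P.expTheta x t z j • P.psiM j z x t

/-- The columns of `u_+ = ψ_+ e^{iθσ₃}`. -/
def uP (P : KEPotential) (j : Fin 2) (x t : ℝ) (z : ℂ) : Fin 2 → ℂ :=
  P.expTheta x t z j • P.psiP j z x t

/-- The Wronskian of two columns. -/
def wr (a b : Fin 2 → ℂ) : ℂ := a 0 * b 1 - a 1 * b 0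

/-- The scattering coefficients, as Wronskians of Jost columns. These Wronskians do not depend on
`(x,t)`, because the Lax matrices are traceless; they are evaluated at `(0,0)`. -/
def s11 (P : KEPotential) (z : ℂ) : ℂ := wr (P.psiP 0 z 0 0) (P.psiM 1 z 0 0) / P.gam z

def s22 (P : KEPotential) (z : ℂ) : ℂ := wr (P.psiM 0 z 0 0) (P.psiP 1 z 0 0) / P.gam z

def s12 (P : KEPotential) (z : ℂ) : ℂ := wr (P.psiP 1 z 0 0) (P.psiM 1 z 0 0) / P.gam z

def s21 (P : KEPotential) (z : ℂ) : ℂ := wr (P.psiM 0 z 0 0) (P.psiP 0 z 0 0) / P.gam z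

/-- The reflection coefficients `ρ` and `ρ̃`. -/
def rho (P : KEPotential) (z : ℂ) : ℂ := P.s21 z / P.s11 z

def rhoT (P : KEPotential) (z : ℂ) : ℂ := P.s12 z / P.s22 z

/-! ### Regions, contour, and the sectionally meromorphic matrix -/

/-- `D⁺ = {(|z|² - q₀²) Im z > 0}`. -/
def Dplus (P : KEPotential) : Set ℂ := {z | 0 < (‖z‖ ^ 2 - P.q0 ^ 2) * z.im}

/-- `D⁻ = {(|z|² - q₀²) Im z < 0}`. -/
def Dminus (P : KEPotential) : Set ℂ := {z | (‖z‖ ^ 2 - P.q0 ^ 2) * z.im < 0}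

/-- `Σ`: the real axis together with the circle of radius `q₀`. -/
def Sig (P : KEPotential) : Set ℂ := {z | z.im = 0 ∨ ‖z‖ = P.q0}

/-- `M⁺ = (u_{-,1}, u_{+,2}/s₂₂)`. -/
def MPlus (P : KEPotential) (x t : ℝ) (z : ℂ) : Matrix (Fin 2) (Fin 2) ℂ :=
  Matrix.of fun i j => ![P.uM 0 x t z i, P.uP 1 x t z i / P.s22 z] j

/-- `M⁻ = (u_{+,1}/s₁₁, u_{-,2})`. -/
def MMinus (P : KEPotential) (x t : ℝ) (z : ℂ) : Matrix (Fin 2) (Fin 2) ℂ :=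
  Matrix.of fun i j => ![P.uP 0 x t z i / P.s11 z, P.uM 1 x t z i] j

open Classical in
/-- The sectionally meromorphic matrix: `M⁺` in `D⁺` and `M⁻` in `D⁻`
(only used off the contour). -/
def MM (P : KEPotential) (x t : ℝ) (z : ℂ) : Matrix (Fin 2) (Fin 2) ℂ :=
  if z ∈ P.Dplus then P.MPlus x t z else P.MMinus x t z

/-- The jump matrix `G`, for which `M⁺ = M⁻ (1 - G)` on the contour. -/
def GG (P : KEPotential) (x t : ℝ) (z : ℂ) : Matrix (Fin 2) (Fin 2) ℂ :=
  !![0, -P.rhoT z * exp (-2 * I * P.theta x t z);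
     P.rho z * exp (2 * I * P.theta x t z), P.rho z * P.rhoT z]

/-- The integrand obtained from `f` by parametrizing the circle of radius `r` by the angle. -/
def circlePull (r : ℝ) (f : ℂ → ℂ) (φ : ℝ) : ℂ := f (r * exp (I * φ)) * (I * r * exp (I * φ))

/-- Absolute integrability along `Σ`. -/
def SigIntegrable (P : KEPotential) (f : ℂ → ℂ) : Prop :=
  MeasureTheory.Integrable (fun s : ℝ => f s) ∧
  IntervalIntegrable (circlePull P.q0 f) MeasureTheory.volume (-Real.pi) Real.pi

/-- The integral along `Σ`, oriented with `D⁺` on the left: the real axis is traversed to the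
right for `|s| > q₀` and to the left for `|s| < q₀`, the upper semicircle is traversed clockwise and
the lower one counterclockwise. -/
def sigIntegral (P : KEPotential) (f : ℂ → ℂ) : ℂ :=
  (∫ s : ℝ in Set.Iio (-P.q0), f s) - (∫ s : ℝ in (-P.q0)..P.q0, f s)
    + (∫ s : ℝ in Set.Ioi P.q0, f s)
    - (∫ φ : ℝ in (0 : ℝ)..Real.pi, circlePull P.q0 f φ)
    + ∫ φ : ℝ in (-Real.pi)..0, circlePull P.q0 f φ

/-! ### Discrete spectrum and norming constants -/

/-- `z₁, …, z_N` are the zeros of `s₁₁` in `D⁻ ∩ {Im z < 0}`; they are distinct and simple, and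
`1/s₁₁` stays bounded near every point of `Σ` (there are no spectral singularities). -/
structure SimpleSpectrum (P : KEPotential) {N : ℕ} (z : Fin N → ℂ) : Prop where
  inj : Function.Injective z
  mem : ∀ n, z n ∈ P.Dminus ∧ (z n).im < 0
  zeros : ∀ w ∈ P.Dminus, w.im < 0 → (P.s11 w = 0 ↔ ∃ n, w = z n)
  simple : ∀ n, deriv P.s11 (z n) ≠ 0
  no_singularity : ∀ ζ ∈ P.Sig, ∃ c : ℝ, 0 < c ∧ ∀ᶠ w in 𝓝[P.Dminus] ζ, c ≤ ‖P.s11 w‖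

/-- The proportionality constant in `ψ_{+,2}(ζ) = b₊(ζ) ψ_{-,1}(ζ)` at a zero `ζ` of `s₂₂`. -/
def bPlus (P : KEPotential) (ζ : ℂ) : ℂ :=
  Classical.epsilon fun b : ℂ => ∀ x t, P.psiP 1 ζ x t = b • P.psiM 0 ζ x t

/-- The norming constant `C₊[ζ] = b₊(ζ) / s₂₂'(ζ)`. -/
def CPlus (P : KEPotential) (ζ : ℂ) : ℂ := P.bPlus ζ / deriv P.s22 ζ

/-- The `2N` points `ξ`: first `z_n`, then `-q₀²/z_n*`. -/
def xi (P : KEPotential) {N : ℕ} (z : Fin N → ℂ) : Fin N ⊕ Fin N → ℂ :=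
  Sum.elim z fun n => -(P.q0 : ℂ) ^ 2 / (starRingEnd ℂ) (z n)

/-- `ξ̂_n = -q₀²/ξ_n`. -/
def xiHat (P : KEPotential) {N : ℕ} (z : Fin N → ℂ) (n : Fin N ⊕ Fin N) : ℂ :=
  -(P.q0 : ℂ) ^ 2 / P.xi z n

/-- `ω_j = C₊[ξ̂_j] e^{-2iθ(x,t;ξ̂_j)}`. -/
def omega (P : KEPotential) {N : ℕ} (z : Fin N → ℂ) (x t : ℝ) (j : Fin N ⊕ Fin N) : ℂ :=
  P.CPlus (P.xiHat z j) * exp (-2 * I * P.theta x t (P.xiHat z j))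

/-- `ν_j = i q_- / ξ_j`. -/
def nu (P : KEPotential) {N : ℕ} (z : Fin N → ℂ) (j : Fin N ⊕ Fin N) : ℂ :=
  I * P.qm / P.xi z j

/-- `t_{sj} = ω_j / (ξ_s - ξ̂_j) + ν_s δ_{sj}`. -/
def matT (P : KEPotential) {N : ℕ} (z : Fin N → ℂ) (x t : ℝ) :
    Matrix (Fin N ⊕ Fin N) (Fin N ⊕ Fin N) ℂ :=
  Matrix.of fun s j =>
    P.omega z x t j / (P.xi z s - P.xiHat z j) + if s = j then P.nu z s else 0

/-- The bordered matrix with rows `(T, ν)` and `(ωᵀ, 0)`. -/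
def bordered (P : KEPotential) {N : ℕ} (z : Fin N → ℂ) (x t : ℝ) :
    Matrix ((Fin N ⊕ Fin N) ⊕ Unit) ((Fin N ⊕ Fin N) ⊕ Unit) ℂ :=
  Matrix.fromBlocks (P.matT z x t) (Matrix.replicateCol Unit (P.nu z))
    (Matrix.replicateRow Unit (P.omega z x t)) 0

end

end KEPotential

/-! ### Estimates and Volterra equations on half-lines -/

open MeasureTheory Set in
/-- A forced scalar linear equation with nonexpanding homogeneous part, started at `-∞`. -/
theorem norm_le_integral_Iic_of_hasDerivAt {f g : ℝ → ℂ} {h : ℝ → ℝ} {μ : ℂ} {x : ℝ}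
    (hμ : μ.re ≤ 0) (hf : ∀ y ≤ x, HasDerivAt f (μ * f y + g y) y)
    (hlim : Tendsto f atBot (𝓝 0)) (hg : ContinuousOn g (Iic x)) (hgh : ∀ y ≤ x, ‖g y‖ ≤ h y)
    (hh : IntegrableOn h (Iic x)) : ‖f x‖ ≤ ∫ y in Iic x, h y := by
  have key : ∀ a ≤ x, ‖f x‖ ≤ ‖f a‖ + ∫ y in Iic x, h y := by
    intro a ha
    -- The integrating factor equals `1` at `y = x` and has modulus at most `1` for `y ≤ x` because
    -- `Re μ ≤ 0`, so the final bound does not involve `μ`.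
    have hF : ∀ y ≤ x, HasDerivAt (fun y : ℝ => exp (μ * ((x - y : ℝ) : ℂ)) * f y)
        (exp (μ * ((x - y : ℝ) : ℂ)) * g y) y := by
      intro y hy
      have h1 : HasDerivAt (fun y : ℝ => μ * ((x - y : ℝ) : ℂ)) (μ * ((-1 : ℝ) : ℂ)) y :=
        (((hasDerivAt_id y).const_sub x).ofReal_comp).const_mul μ
      have := (h1.cexp).mul (hf y hy)
      refine this.congr_deriv ?_
      push_cast
      ring
    have hE : Continuous fun y : ℝ => exp (μ * ((x - y : ℝ) : ℂ)) := by fun_prop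
    have hcont : ContinuousOn (fun y : ℝ => exp (μ * ((x - y : ℝ) : ℂ)) * g y) (Icc a x) :=
      hE.continuousOn.mul (hg.mono Icc_subset_Iic_self)
    have hint := intervalIntegral.integral_eq_sub_of_hasDerivAt (a := a) (b := x)
      (fun y hy => hF y (by rw [uIcc_of_le ha] at hy; exact hy.2))
      (hcont.intervalIntegrable_of_Icc ha)
    have hexp : ∀ y ≤ x, ‖exp (μ * ((x - y : ℝ) : ℂ))‖ ≤ 1 := by
      intro y hy
      rw [norm_exp, re_mul_ofReal, Real.exp_le_one_iff]
      exact mul_nonpos_of_nonpos_of_nonneg hμ (by linarith)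
    have hfx : f x = exp (μ * ((x - a : ℝ) : ℂ)) * f a
        + ∫ y in a..x, exp (μ * ((x - y : ℝ) : ℂ)) * g y := by
      rw [hint]; simp
    have hhI : IntervalIntegrable h volume a x :=
      (intervalIntegrable_iff_integrableOn_Ioc_of_le ha).2
        (hh.mono_set (Ioc_subset_Iic_self))
    have hb1 : ‖∫ y in a..x, exp (μ * ((x - y : ℝ) : ℂ)) * g y‖ ≤ ∫ y in a..x, h y := by
      refine intervalIntegral.norm_integral_le_of_norm_le ha ?_ hhI
      refine Eventually.of_forall fun y hy => ?_
      rw [norm_mul]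
      calc _ ≤ 1 * ‖g y‖ := by gcongr; exact hexp y hy.2
        _ ≤ h y := by rw [one_mul]; exact hgh y hy.2
    have hb2 : ∫ y in a..x, h y ≤ ∫ y in Iic x, h y := by
      rw [intervalIntegral.integral_of_le ha]
      refine setIntegral_mono_set hh ?_ (Ioc_subset_Iic_self.eventuallyLE)
      refine (ae_restrict_iff' measurableSet_Iic).2 (Eventually.of_forall fun y hy => ?_)
      exact (norm_nonneg _).trans (hgh y hy)
    rw [hfx]
    refine (norm_add_le _ _).trans (add_le_add ?_ (hb1.trans hb2))
    rw [norm_mul]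
    exact mul_le_of_le_one_left (norm_nonneg _) (hexp a ha)
  have hl : Tendsto (fun a => ‖f a‖ + ∫ y in Iic x, h y) atBot (𝓝 (0 + ∫ y in Iic x, h y)) :=
    (by simpa using hlim.norm : Tendsto (fun a => ‖f a‖) atBot (𝓝 0)).add_const _
  rw [zero_add] at hl
  exact ge_of_tendsto hl ((eventually_le_atBot x).mono key)

open MeasureTheory Set in
theorem hasDerivAt_integral_Iic {E : Type*} [NormedAddCommGroup E] [NormedSpace ℝ E]
    [CompleteSpace E] {f : ℝ → E} (hf : Continuous f) (hi : ∀ x, IntegrableOn f (Iic x)) (x : ℝ) :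
    HasDerivAt (fun x => ∫ y in Iic x, f y) (f x) x := by
  have h : (fun x => ∫ y in Iic x, f y) = fun x => (∫ y in Iic 0, f y) + ∫ y in (0 : ℝ)..x, f y := by
    funext u
    rw [← intervalIntegral.integral_Iic_sub_Iic (hi 0) (hi u)]
    abel
  rw [h]
  exact (intervalIntegral.integral_hasDerivAt_right (hf.intervalIntegrable _ _)
    (hf.stronglyMeasurableAtFilter _ _) hf.continuousAt).const_add _

open MeasureTheory Set in
theorem tendsto_integral_Iic_atBot {E : Type*} [NormedAddCommGroup E] [NormedSpace ℝ E]
    {f : ℝ → E} {x : ℝ} (hi : IntegrableOn f (Iic x)) :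
    Tendsto (fun a => ∫ y in Iic a, f y) atBot (𝓝 0) := by
  have h := intervalIntegral_tendsto_integral_Iic x hi tendsto_id
  have h2 : Tendsto (fun a => (∫ y in Iic x, f y) - ∫ y in a..x, f y) atBot (𝓝 0) := by
    simpa using h.const_sub (∫ y in Iic x, f y)
  refine h2.congr' ?_
  filter_upwards [eventually_le_atBot x] with a ha
  rw [← intervalIntegral.integral_Iic_sub_Iic (hi.mono_set (Iic_subset_Iic.2 ha)) hi]
  abel

open MeasureTheory Set in
/-- Gronwall's inequality started at `-∞`. -/
theorem le_mul_exp_of_le_add_integral_Iic {f w : ℝ → ℝ} {C x₀ : ℝ} (hf : Continuous f)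
    (hw : Continuous w) (hw0 : ∀ y, 0 ≤ w y) (hwi : ∀ x, IntegrableOn w (Iic x))
    (hfi : ∀ x, IntegrableOn (fun y => w y * f y) (Iic x))
    (h : ∀ x ≤ x₀, f x ≤ C + ∫ y in Iic x, w y * f y) :
    f x₀ ≤ C * Real.exp (∫ y in Iic x₀, w y) := by
  set W : ℝ → ℝ := fun x => ∫ y in Iic x, w y with hW
  set F : ℝ → ℝ := fun x => C + ∫ y in Iic x, w y * f y with hF
  have hWd : ∀ x, HasDerivAt W (w x) x := hasDerivAt_integral_Iic hw hwi
  have hFd : ∀ x, HasDerivAt F (w x * f x) x := fun x =>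
    (hasDerivAt_integral_Iic (hw.mul hf) hfi x).const_add C
  have hGd : ∀ x, HasDerivAt (fun x => F x * Real.exp (-W x))
      (w x * f x * Real.exp (-W x) + F x * (Real.exp (-W x) * (-w x))) x := fun x =>
    (hFd x).mul ((hWd x).neg.exp)
  -- Since `F' = w f ≤ w F`, the product `F exp (-W)` decreases from its limit `C` at `-∞`.
  have hanti : AntitoneOn (fun x => F x * Real.exp (-W x)) (Iic x₀) := by
    refine antitoneOn_of_deriv_nonpos (convex_Iic x₀)
      (fun x _ => (hGd x).continuousAt.continuousWithinAt)
      (fun x _ => (hGd x).differentiableAt.differentiableWithinAt) fun x hx => ?_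
    rw [interior_Iic] at hx
    rw [(hGd x).deriv]
    have h1 := h x (le_of_lt hx)
    have h2 := Real.exp_pos (-W x)
    have h3 : w x * (f x - F x) * Real.exp (-W x) ≤ 0 :=
      mul_nonpos_of_nonpos_of_nonneg
        (mul_nonpos_of_nonneg_of_nonpos (hw0 x) (by simp only [hF]; linarith)) h2.le
    linarith
  have hlim : Tendsto (fun x => F x * Real.exp (-W x)) atBot (𝓝 C) := by
    have h1 : Tendsto F atBot (𝓝 (C + 0)) := (tendsto_integral_Iic_atBot (hfi 0)).const_add C
    have h2 : Tendsto W atBot (𝓝 0) := tendsto_integral_Iic_atBot (hwi 0)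
    have h3 := h1.mul ((Real.continuous_exp.tendsto _).comp h2.neg)
    simpa using h3
  have hG : F x₀ * Real.exp (-W x₀) ≤ C :=
    ge_of_tendsto hlim ((eventually_le_atBot x₀).mono fun a ha =>
      hanti (mem_Iic.2 ha) (mem_Iic.2 le_rfl) ha)
  have := h x₀ le_rfl
  calc f x₀ ≤ F x₀ := this
    _ = F x₀ * Real.exp (-W x₀) * Real.exp (W x₀) := by
      rw [mul_assoc, ← Real.exp_add]; simp
    _ ≤ C * Real.exp (W x₀) := by gcongr

open MeasureTheory Set in
/-- Holomorphic dependence of an integral on a parameter. -/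
theorem differentiableOn_integral_of_dominated {α E : Type*} [MeasurableSpace α] {m : Measure α}
    [NormedAddCommGroup E] [NormedSpace ℂ E] [CompleteSpace E] {U : Set ℂ} (hU : IsOpen U)
    {F : ℂ → α → E} {b : α → ℝ} (hm : ∀ z ∈ U, AEStronglyMeasurable (F z) m)
    (hd : ∀ᵐ a ∂m, DifferentiableOn ℂ (fun z => F z a) U)
    (hb : ∀ᵐ a ∂m, ∀ z ∈ U, ‖F z a‖ ≤ b a) (hbi : Integrable b m) :
    DifferentiableOn ℂ (fun z => ∫ a, F z a ∂m) U := by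
  intro z₀ hz₀
  obtain ⟨ε, hε, hball⟩ := Metric.isOpen_iff.1 hU z₀ hz₀
  have hε2 : 0 < ε / 2 := by positivity
  have hsub : ∀ z ∈ Metric.ball z₀ (ε / 2), Metric.closedBall z (ε / 4) ⊆ U := fun z hz y hy =>
    hball (by
      rw [Metric.mem_ball] at hz ⊢
      rw [Metric.mem_closedBall] at hy
      linarith [dist_triangle y z z₀])
  have hmemU : ∀ z ∈ Metric.ball z₀ (ε / 2), z ∈ U := fun z hz =>
    hsub z hz (Metric.mem_closedBall_self (by positivity))
  set F' : ℂ → α → E := fun z a => deriv (fun z => F z a) z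
  have hderiv : ∀ᵐ a ∂m, ∀ z ∈ Metric.ball z₀ (ε / 2), HasDerivAt (F · a) (F' z a) z := by
    filter_upwards [hd] with a ha z hz
    exact (ha.differentiableAt (hU.mem_nhds (hmemU z hz))).hasDerivAt
  -- Cauchy's estimate on circles of radius `ε / 4` converts the bound on `F` into one on its
  -- derivative, so only `F` itself has to be dominated.
  have hbound : ∀ᵐ a ∂m, ∀ z ∈ Metric.ball z₀ (ε / 2), ‖F' z a‖ ≤ b a / (ε / 4) := by
    filter_upwards [hd, hb] with a ha hba z hz
    refine Complex.norm_deriv_le_of_forall_mem_sphere_norm_le (by positivity) ?_ ?_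
    · refine DifferentiableOn.diffContOnCl (ha.mono ?_)
      exact (Metric.closure_ball_subset_closedBall).trans (hsub z hz)
    · intro y hy
      exact hba y (hsub z hz (Metric.sphere_subset_closedBall hy))
  -- The derivative at `z₀` is an a.e. limit of difference quotients along a sequence inside the
  -- ball; this is where its measurability comes from.
  have hmeas' : AEStronglyMeasurable (F' z₀) m := by
    have hseq : Tendsto (fun n : ℕ => z₀ + ((ε / 2 / (n + 2) : ℝ) : ℂ)) atTop (𝓝[≠] z₀) := by
      rw [tendsto_nhdsWithin_iff]
      constructor
      · have : Tendsto (fun n : ℕ => (ε / 2 / ((n : ℝ) + 2) : ℝ)) atTop (𝓝 0) := by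
          refine Tendsto.const_div_atTop ?_ _
          exact tendsto_atTop_add_const_right _ _ tendsto_natCast_atTop_atTop
        have h2 := (continuous_ofReal.tendsto _).comp this
        simpa using h2.const_add z₀
      · refine Eventually.of_forall fun n => ?_
        have : (ε / 2 / ((n : ℝ) + 2) : ℝ) ≠ 0 := by positivity
        simp only [mem_compl_iff, mem_singleton_iff, add_eq_left]
        exact_mod_cast this
    refine aestronglyMeasurable_of_tendsto_ae (u := atTop)
      (f := fun (n : ℕ) a => slope (fun z => F z a) z₀ (z₀ + ((ε / 2 / (n + 2) : ℝ) : ℂ))) ?_ ?_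
    · intro n
      have hin : z₀ + ((ε / 2 / (n + 2) : ℝ) : ℂ) ∈ U := by
        refine hball ?_
        have h2 : (0:ℝ) < ε / 2 / ((n : ℝ) + 2) := by positivity
        have h3 : ε / 2 / ((n : ℝ) + 2) < ε := by
          rw [div_lt_iff₀ (by positivity)]
          nlinarith [(Nat.cast_nonneg n : (0:ℝ) ≤ n)]
        rw [Metric.mem_ball, dist_eq_norm, add_sub_cancel_left, norm_real, Real.norm_eq_abs,
          abs_of_pos h2]
        exact h3
      simp only [slope, vsub_eq_sub]
      exact ((hm _ hin).sub (hm _ hz₀)).const_smul _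
    · filter_upwards [hderiv] with a ha
      exact ((ha z₀ (Metric.mem_ball_self hε2)).tendsto_slope).comp hseq
  have hint : Integrable (F z₀) m :=
    hbi.mono' (hm z₀ hz₀) (hb.mono fun a ha => ha z₀ hz₀)
  exact (hasDerivAt_integral_of_dominated_loc_of_deriv_le (Metric.ball_mem_nhds z₀ hε2)
    (by filter_upwards [hU.mem_nhds hz₀] with z hz using hm z hz) hint hmeas' hbound
    (hbi.div_const _) hderiv).2.differentiableAt.differentiableWithinAt

/-- Successive terms of the Neumann series of a Volterra equation on `(-∞, x]`. -/
noncomputable def volterraTerm {E : Type*} [NormedAddCommGroup E] [NormedSpace ℂ E]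
    (κ : ℂ → ℝ → ℝ → E →L[ℂ] E) (v : E) : ℕ → ℂ → ℝ → E
  | 0, _, _ => v
  | n + 1, z, x => ∫ y in Set.Iic x, κ z x y (volterraTerm κ v n z y)

-- The integrand is the derivative of `W^(n+1) / (n+1)!`, where `W` is the running integral of `w`
-- and vanishes at `-∞`. These factorials make the Neumann series converge with no smallness
-- condition on `w`.
open MeasureTheory Set in
theorem integral_Iic_mul_pow_div_factorial {w : ℝ → ℝ} (hw : Continuous w) (hw0 : ∀ y, 0 ≤ w y)
    (hwi : ∀ x, IntegrableOn w (Iic x)) (n : ℕ) (x : ℝ) :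
    IntegrableOn (fun y => w y * ((∫ s in Iic y, w s) ^ n / n.factorial)) (Iic x) ∧
    ∫ y in Iic x, w y * ((∫ s in Iic y, w s) ^ n / n.factorial)
      = (∫ s in Iic x, w s) ^ (n + 1) / (n + 1).factorial := by
  set W : ℝ → ℝ := fun x => ∫ y in Iic x, w y
  have hWd : ∀ x, HasDerivAt W (w x) x := hasDerivAt_integral_Iic hw hwi
  have hWc : Continuous W := continuous_iff_continuousAt.2 fun x => (hWd x).continuousAt
  have hW0 : ∀ x, 0 ≤ W x := fun x => setIntegral_nonneg measurableSet_Iic fun y _ => hw0 y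
  have hWm : Monotone W := fun a b hab =>
    setIntegral_mono_set (hwi b) (Eventually.of_forall hw0) (Iic_subset_Iic.2 hab).eventuallyLE
  have hI : IntegrableOn (fun y => w y * (W y ^ n / n.factorial)) (Iic x) := by
    refine Integrable.mono' (g := fun y => w y * (W x ^ n / n.factorial))
      ((hwi x).mul_const _) (by fun_prop) ?_
    refine (ae_restrict_iff' measurableSet_Iic).2 (Eventually.of_forall fun y hy => ?_)
    rw [Real.norm_of_nonneg (mul_nonneg (hw0 y) (by have := hW0 y; positivity))]
    have := hW0 y
    have := hWm (mem_Iic.1 hy)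
    have := hw0 y
    gcongr
  refine ⟨hI, ?_⟩
  have hd : ∀ y ∈ Iic x, HasDerivAt (fun y => W y ^ (n + 1) / ((n + 1).factorial : ℝ))
      (w y * (W y ^ n / n.factorial)) y := by
    intro y _
    refine (((hWd y).pow (n + 1)).div_const _).congr_deriv ?_
    rw [Nat.factorial_succ]
    have : ((n.factorial : ℕ) : ℝ) ≠ 0 := by positivity
    have : ((n : ℝ) + 1) ≠ 0 := by positivity
    push_cast
    field_simp
  have hl : Tendsto (fun y => W y ^ (n + 1) / ((n + 1).factorial : ℝ)) atBot (𝓝 0) := by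
    have := ((tendsto_integral_Iic_atBot (hwi 0)).pow (n + 1)).div_const ((n + 1).factorial : ℝ)
    simpa using this
  rw [integral_Iic_of_hasDerivAt_of_tendsto' hd hI hl, sub_zero]

open MeasureTheory Set in
/-- Solution of a Volterra equation on `(-∞, x]` by its Neumann series, with continuous and
holomorphic dependence on a parameter. -/
theorem exists_volterra {E : Type*} [NormedAddCommGroup E] [NormedSpace ℂ E] [CompleteSpace E]
    {Z U : Set ℂ} (hU : IsOpen U) (hUZ : U ⊆ Z) {κ : ℂ → ℝ → ℝ → E →L[ℂ] E} {w : ℝ → ℝ}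
    (hw : Continuous w) (hw0 : ∀ y, 0 ≤ w y) (hwi : ∀ x, IntegrableOn w (Iic x))
    (hκw : ∀ z ∈ Z, ∀ x y, y ≤ x → ‖κ z x y‖ ≤ w y)
    (hcont : ∀ z ∈ Z, ∀ d : ℝ → E, Continuous d → (∀ x, ∃ C, ∀ y ≤ x, ‖d y‖ ≤ C) →
      Continuous fun x => ∫ y in Iic x, κ z x y (d y))
    (hκy : ∀ z ∈ Z, ∀ x, Continuous (κ z x))
    (hκc : ∀ x y, y ≤ x → ContinuousOn (fun z => κ z x y) Z)
    (hκd : ∀ x y, y ≤ x → DifferentiableOn ℂ (fun z => κ z x y) U) (v : E) :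
    ∃ c : ℂ → ℝ → E, (∀ z ∈ Z, Continuous (c z) ∧
        (∀ x, ‖c z x‖ ≤ ‖v‖ * Real.exp (∫ y in Iic x, w y)) ∧
        ∀ x, c z x = v + ∫ y in Iic x, κ z x y (c z y)) ∧
      ∀ x, ContinuousOn (fun z => c z x) Z ∧ DifferentiableOn ℂ (fun z => c z x) U := by
  set W : ℝ → ℝ := fun x => ∫ y in Iic x, w y with hWdef
  have hW0 : ∀ x, 0 ≤ W x := fun x => setIntegral_nonneg measurableSet_Iic fun y _ => hw0 y
  have hWm : Monotone W := fun a b hab =>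
    setIntegral_mono_set (hwi b) (Eventually.of_forall hw0) (Iic_subset_Iic.2 hab).eventuallyLE
  set d := volterraTerm κ v with hd
  set B : ℕ → ℝ → ℝ := fun n x => ‖v‖ * (W x ^ n / n.factorial) with hB
  have hBm : ∀ n x y, y ≤ x → B n y ≤ B n x := fun n x y hy => by
    have := hW0 y
    have := hWm hy
    simp only [hB]
    gcongr
  have hwB : ∀ n x, IntegrableOn (fun y => w y * B n y) (Iic x) ∧
      ∫ y in Iic x, w y * B n y = B (n + 1) x := fun n x => by
    have h1 := integral_Iic_mul_pow_div_factorial hw hw0 hwi n x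
    have h2 : (fun y => w y * B n y) = fun y => ‖v‖ * (w y * (W y ^ n / n.factorial)) := by
      funext y; simp only [hB]; ring
    rw [h2]
    exact ⟨h1.1.const_mul _, by rw [integral_const_mul, h1.2]⟩
  -- Continuity in `x`, the bound by `B n` and the regularity in `z` go through the induction
  -- together. As `B n` does not depend on `z`, it dominates the next integrand uniformly in the
  -- parameter.
  have hmain : ∀ n, (∀ z ∈ Z, Continuous (d n z) ∧ ∀ x, ‖d n z x‖ ≤ B n x) ∧
      ∀ x, ContinuousOn (fun z => d n z x) Z ∧ DifferentiableOn ℂ (fun z => d n z x) U := by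
    intro n
    induction n with
    | zero =>
      refine ⟨fun z _ => ⟨continuous_const, fun x => by simp [hd, hB, volterraTerm]⟩, fun x => ?_⟩
      exact ⟨continuousOn_const, differentiableOn_const _⟩
    | succ n ih =>
      have hnorm : ∀ z ∈ Z, ∀ x y, y ≤ x → ‖κ z x y (d n z y)‖ ≤ w y * B n y := by
        intro z hz x y hy
        refine ((κ z x y).le_opNorm _).trans ?_
        exact mul_le_mul (hκw z hz x y hy) ((ih.1 z hz).2 y) (norm_nonneg _) (hw0 y)
      have hmeas : ∀ z ∈ Z, ∀ x, AEStronglyMeasurable (fun y => κ z x y (d n z y))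
          (volume.restrict (Iic x)) := fun z hz x =>
        ((hκy z hz x).clm_apply (ih.1 z hz).1).aestronglyMeasurable
      refine ⟨fun z hz => ⟨?_, fun x => ?_⟩, fun x => ⟨?_, ?_⟩⟩
      · exact hcont z hz _ (ih.1 z hz).1 fun x =>
          ⟨B n x, fun y hy => ((ih.1 z hz).2 y).trans (hBm n x y hy)⟩
      · change ‖∫ y in Iic x, κ z x y (d n z y)‖ ≤ _
        rw [← (hwB n x).2]
        exact norm_integral_le_of_norm_le (hwB n x).1
          ((ae_restrict_iff' measurableSet_Iic).2 (Eventually.of_forall fun y hy =>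
            hnorm z hz x y hy))
      · change ContinuousOn (fun z => ∫ y in Iic x, κ z x y (d n z y)) Z
        refine continuousOn_of_dominated (bound := fun y => w y * B n y)
          (fun z hz => hmeas z hz x) (fun z hz => ?_) (hwB n x).1 ?_
        · exact (ae_restrict_iff' measurableSet_Iic).2 (Eventually.of_forall fun y hy =>
            hnorm z hz x y hy)
        · exact (ae_restrict_iff' measurableSet_Iic).2 (Eventually.of_forall fun y hy =>
            (hκc x y hy).clm_apply (ih.2 y).1)
      · change DifferentiableOn ℂ (fun z => ∫ y in Iic x, κ z x y (d n z y)) U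
        refine differentiableOn_integral_of_dominated hU (b := fun y => w y * B n y)
          (fun z hz => hmeas z (hUZ hz) x) ?_ ?_ (hwB n x).1
        · exact (ae_restrict_iff' measurableSet_Iic).2 (Eventually.of_forall fun y hy =>
            (hκd x y hy).clm_apply (ih.2 y).2)
        · exact (ae_restrict_iff' measurableSet_Iic).2 (Eventually.of_forall fun y hy z hz =>
            hnorm z (hUZ hz) x y hy)
  have hBsum : ∀ x, HasSum (fun n => B n x) (‖v‖ * Real.exp (W x)) := fun x => by
    have := NormedSpace.expSeries_div_hasSum_exp (W x)
    rw [← Real.exp_eq_exp_ℝ] at this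
    exact this.mul_left _
  have hdsum : ∀ z ∈ Z, ∀ x, Summable fun n => d n z x := fun z hz x =>
    Summable.of_norm_bounded (hBsum x).summable fun n => ((hmain n).1 z hz).2 x
  have hcb : ∀ z ∈ Z, ∀ x, ‖∑' n, d n z x‖ ≤ ‖v‖ * Real.exp (W x) := fun z hz x =>
    tsum_of_norm_bounded (hBsum x) fun n => ((hmain n).1 z hz).2 x
  refine ⟨fun z x => ∑' n, d n z x, fun z hz => ⟨?_, hcb z hz, fun x => ?_⟩,
    fun x => ⟨?_, ?_⟩⟩
  · rw [continuous_iff_continuousAt]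
    intro x
    have : ContinuousOn (fun x => ∑' n, d n z x) (Iic (x + 1)) :=
      continuousOn_tsum (fun n => ((hmain n).1 z hz).1.continuousOn) (hBsum (x + 1)).summable
        fun n y hy => (((hmain n).1 z hz).2 y).trans (hBm n _ _ hy)
    exact this.continuousAt (Iic_mem_nhds (by linarith))
  · have hI : ∀ n, IntegrableOn (fun y => κ z x y (d n z y)) (Iic x) := fun n =>
      Integrable.mono' (hwB n x).1
        ((hκy z hz x).clm_apply ((hmain n).1 z hz).1).aestronglyMeasurable
        ((ae_restrict_iff' measurableSet_Iic).2 (Eventually.of_forall fun y hy =>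
          ((κ z x y).le_opNorm _).trans (mul_le_mul (hκw z hz x y hy)
            (((hmain n).1 z hz).2 y) (norm_nonneg _) (hw0 y))))
    have hS : Summable fun n => ∫ y in Iic x, ‖κ z x y (d n z y)‖ := by
      refine Summable.of_nonneg_of_le (fun n => integral_nonneg fun y => norm_nonneg _)
        (fun n => ?_) ((summable_nat_add_iff 1).2 (hBsum x).summable)
      rw [← (hwB n x).2]
      refine setIntegral_mono_on (hI n).norm (hwB n x).1 measurableSet_Iic fun y hy => ?_
      exact ((κ z x y).le_opNorm _).trans (mul_le_mul (hκw z hz x y hy)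
            (((hmain n).1 z hz).2 y) (norm_nonneg _) (hw0 y))
    have h1 := hasSum_integral_of_summable_integral_norm hI hS
    have h2 : (∫ y in Iic x, ∑' n, κ z x y (d n z y)) = ∫ y in Iic x, κ z x y (∑' n, d n z y) := by
      refine integral_congr_ae (Eventually.of_forall fun y => ?_)
      exact ((κ z x y).map_tsum (hdsum z hz y)).symm
    rw [h2] at h1
    change ∑' n, d n z x = v + ∫ y in Iic x, κ z x y (∑' n, d n z y)
    rw [(hdsum z hz x).tsum_eq_zero_add]
    congr 1
    exact h1.tsum_eq
  · exact continuousOn_tsum (fun n => ((hmain n).2 x).1) (hBsum x).summable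
      fun n z hz => ((hmain n).1 z hz).2 x
  · exact differentiableOn_tsum_of_summable_norm (hBsum x).summable (fun n => ((hmain n).2 x).2) hU
      fun n z hz => ((hmain n).1 z (hUZ hz)).2 x

open Set in
theorem exists_norm_le_of_tendsto_atBot {E : Type*} [NormedAddCommGroup E] {f : ℝ → E} {l : E}
    (hf : Continuous f) (hl : Tendsto f atBot (𝓝 l)) (x : ℝ) : ∃ C, ∀ y ≤ x, ‖f y‖ ≤ C := by
  have h1 : ∀ᶠ y in atBot, ‖f y‖ ≤ ‖l‖ + 1 := by
    filter_upwards [hl.norm.eventually (gt_mem_nhds (lt_add_one ‖l‖))] with y hy using hy.le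
  obtain ⟨A, hA⟩ := eventually_atBot.1 h1
  obtain ⟨C, hC⟩ := (isCompact_Icc (a := A) (b := x)).exists_bound_of_continuousOn hf.continuousOn
  refine ⟨max (‖l‖ + 1) C, fun y hy => ?_⟩
  rcases le_total y A with h | h
  · exact (hA y h).trans (le_max_left _ _)
  · exact (hC y ⟨h, hy⟩).trans (le_max_right _ _)

-- Variation of constants gives a Volterra equation whose kernel has the rows `(b₀, b₁)` and
-- `e^{μ(x-y)} (b₂, b₃)`. For `y ≤ x` the exponential has modulus at most `1`, so `w` dominates the
-- kernel. The component with exponent `0` is the one that can be normalized to `1` at `-∞`.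
open MeasureTheory Set in
theorem exists_system_atBot {Z U : Set ℂ} (hU : IsOpen U) (hUZ : U ⊆ Z) {μ : ℂ → ℂ}
    {b : Fin 4 → ℂ → ℝ → ℂ} {w : ℝ → ℝ} (hw : Continuous w) (hw0 : ∀ y, 0 ≤ w y)
    (hwi : ∀ x, IntegrableOn w (Iic x)) (hμ : ∀ z ∈ Z, (μ z).re ≤ 0) (hμc : ContinuousOn μ Z)
    (hμd : DifferentiableOn ℂ μ U)
    (hbw : ∀ z ∈ Z, ∀ y, ‖b 0 z y‖ + ‖b 1 z y‖ + ‖b 2 z y‖ + ‖b 3 z y‖ ≤ w y)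
    (hby : ∀ i, ∀ z ∈ Z, Continuous (b i z)) (hbc : ∀ i y, ContinuousOn (fun z => b i z y) Z)
    (hbd : ∀ i y, DifferentiableOn ℂ (fun z => b i z y) U) :
    ∃ c₁ c₂ : ℂ → ℝ → ℂ, (∀ z ∈ Z,
        (∀ x, HasDerivAt (c₁ z) (b 0 z x * c₁ z x + b 1 z x * c₂ z x) x) ∧
        (∀ x, HasDerivAt (c₂ z) (μ z * c₂ z x + (b 2 z x * c₁ z x + b 3 z x * c₂ z x)) x) ∧
        Tendsto (c₁ z) atBot (𝓝 1) ∧ Tendsto (c₂ z) atBot (𝓝 0)) ∧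
      ∀ x, (ContinuousOn (fun z => c₁ z x) Z ∧ DifferentiableOn ℂ (fun z => c₁ z x) U) ∧
        ContinuousOn (fun z => c₂ z x) Z ∧ DifferentiableOn ℂ (fun z => c₂ z x) U := by
  set e : ℂ → ℝ → ℝ → ℂ := fun z x y => exp (μ z * ((x - y : ℝ) : ℂ)) with he
  -- The four matrix units of `ℂ × ℂ`; each has norm at most `1`, so the kernel is bounded by the
  -- sum of the moduli of its entries.
  set L0 : ℂ × ℂ →L[ℂ] ℂ × ℂ := (ContinuousLinearMap.inl ℂ ℂ ℂ).comp (.fst ℂ ℂ ℂ)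
  set L1 : ℂ × ℂ →L[ℂ] ℂ × ℂ := (ContinuousLinearMap.inl ℂ ℂ ℂ).comp (.snd ℂ ℂ ℂ)
  set L2 : ℂ × ℂ →L[ℂ] ℂ × ℂ := (ContinuousLinearMap.inr ℂ ℂ ℂ).comp (.fst ℂ ℂ ℂ)
  set L3 : ℂ × ℂ →L[ℂ] ℂ × ℂ := (ContinuousLinearMap.inr ℂ ℂ ℂ).comp (.snd ℂ ℂ ℂ)
  have hL0 : ‖L0‖ ≤ 1 := ContinuousLinearMap.opNorm_le_bound _ zero_le_one fun p => by
    simp only [L0, ContinuousLinearMap.comp_apply, ContinuousLinearMap.inl_apply, ContinuousLinearMap.coe_fst', Prod.norm_def, norm_zero, one_mul]; exact max_le (le_max_left _ _) (by positivity)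
  have hL1 : ‖L1‖ ≤ 1 := ContinuousLinearMap.opNorm_le_bound _ zero_le_one fun p => by
    simp only [L1, ContinuousLinearMap.comp_apply, ContinuousLinearMap.inl_apply, ContinuousLinearMap.coe_snd', Prod.norm_def, norm_zero, one_mul]; exact max_le (le_max_right _ _) (by positivity)
  have hL2 : ‖L2‖ ≤ 1 := ContinuousLinearMap.opNorm_le_bound _ zero_le_one fun p => by
    simp only [L2, ContinuousLinearMap.comp_apply, ContinuousLinearMap.inr_apply, ContinuousLinearMap.coe_fst', Prod.norm_def, norm_zero, one_mul]; exact max_le (by positivity) (le_max_left _ _)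
  have hL3 : ‖L3‖ ≤ 1 := ContinuousLinearMap.opNorm_le_bound _ zero_le_one fun p => by
    simp only [L3, ContinuousLinearMap.comp_apply, ContinuousLinearMap.inr_apply, ContinuousLinearMap.coe_snd', Prod.norm_def, norm_zero, one_mul]; exact max_le (by positivity) (le_max_right _ _)
  set κ : ℂ → ℝ → ℝ → (ℂ × ℂ →L[ℂ] ℂ × ℂ) := fun z x y =>
    b 0 z y • L0 + b 1 z y • L1 + (e z x y * b 2 z y) • L2 + (e z x y * b 3 z y) • L3 with hκ
  have hexp : ∀ z ∈ Z, ∀ x y, y ≤ x → ‖e z x y‖ ≤ 1 := by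
    intro z hz x y hy
    rw [he, norm_exp, re_mul_ofReal, Real.exp_le_one_iff]
    exact mul_nonpos_of_nonpos_of_nonneg (hμ z hz) (by linarith)
  have hsm : ∀ (s : ℂ) (t : ℝ) (L : ℂ × ℂ →L[ℂ] ℂ × ℂ), ‖s‖ ≤ t → ‖L‖ ≤ 1 → ‖s • L‖ ≤ t :=
    fun s t L hs hL => by
      rw [norm_smul]
      exact (mul_le_of_le_one_right (norm_nonneg _) hL).trans hs
  have hκapp : ∀ z x y (p : ℂ × ℂ), κ z x y p =
      (b 0 z y * p.1 + b 1 z y * p.2, e z x y * (b 2 z y * p.1 + b 3 z y * p.2)) := by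
    intro z x y p
    simp [hκ, L0, L1, L2, L3, mul_add, mul_assoc]
  -- Pulling out `e^{μx}` leaves an integrand without `x`, so the integral can be differentiated in
  -- `x`. The factor `e^{-μy}` that remains is bounded for `y ≤ x`, again because `Re μ ≤ 0`.
  have hesplit : ∀ z x y, e z x y = exp (μ z * (x : ℂ)) * exp (-(μ z * (y : ℂ))) := by
    intro z x y
    simp only [he]
    rw [← exp_add]; congr 1; push_cast; ring
  have hκw : ∀ z ∈ Z, ∀ x y, y ≤ x → ‖κ z x y‖ ≤ w y := by
    intro z hz x y hy
    have h2 : ∀ s, ‖e z x y * s‖ ≤ ‖s‖ := fun s => by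
      rw [norm_mul]; exact mul_le_of_le_one_left (norm_nonneg _) (hexp z hz x y hy)
    refine le_trans ?_ (hbw z hz y)
    refine (norm_add_le _ _).trans (add_le_add ((norm_add_le _ _).trans (add_le_add
      ((norm_add_le _ _).trans (add_le_add ?_ ?_)) ?_)) ?_)
    · exact hsm _ _ _ le_rfl hL0
    · exact hsm _ _ _ le_rfl hL1
    · exact hsm _ _ _ (h2 _) hL2
    · exact hsm _ _ _ (h2 _) hL3
  have hbi : ∀ i, ∀ z ∈ Z, ∀ y, ‖b i z y‖ ≤ w y := by
    intro i z hz y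
    have := hbw z hz y
    have := norm_nonneg (b 0 z y)
    have := norm_nonneg (b 1 z y)
    have := norm_nonneg (b 2 z y)
    have := norm_nonneg (b 3 z y)
    fin_cases i <;> simp only [Fin.zero_eta, Fin.mk_one, Fin.reduceFinMk] <;> linarith
  have hint : ∀ z ∈ Z, ∀ i j, ∀ d : ℝ → ℂ × ℂ, Continuous d → (∀ x, ∃ C, ∀ y ≤ x, ‖d y‖ ≤ C) →
      (Continuous fun y => b i z y * (d y).1 + b j z y * (d y).2) ∧ ∀ x,
      IntegrableOn (fun y => b i z y * (d y).1 + b j z y * (d y).2) (Iic x) ∧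
      IntegrableOn (fun y : ℝ => exp (-(μ z * (y : ℂ))) * (b i z y * (d y).1 + b j z y * (d y).2))
        (Iic x) := by
    intro z hz i j d hd hdb
    have hi := hby i z hz
    have hj := hby j z hz
    have hcont : Continuous fun y => b i z y * (d y).1 + b j z y * (d y).2 := by fun_prop
    refine ⟨hcont, fun x => ?_⟩
    obtain ⟨C, hC⟩ := hdb x
    have hn : ∀ y ≤ x, ‖b i z y * (d y).1 + b j z y * (d y).2‖ ≤ w y * (2 * C) := by
      intro y hy
      have h1 := (norm_fst_le (d y)).trans (hC y hy)
      have h2 := (norm_snd_le (d y)).trans (hC y hy)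
      have := hw0 y
      calc _ ≤ ‖b i z y‖ * ‖(d y).1‖ + ‖b j z y‖ * ‖(d y).2‖ := by
            refine (norm_add_le _ _).trans ?_
            rw [norm_mul, norm_mul]
        _ ≤ w y * C + w y * C := by
            gcongr
            · exact hbi i z hz y
            · exact hbi j z hz y
        _ = _ := by ring
    constructor
    · exact Integrable.mono' ((hwi x).mul_const (2 * C)) hcont.aestronglyMeasurable
        ((ae_restrict_iff' measurableSet_Iic).2 (Eventually.of_forall hn))
    · refine Integrable.mono' (((hwi x).mul_const (2 * C)).const_mul (Real.exp (-(μ z).re * x)))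
        (Continuous.aestronglyMeasurable (by fun_prop))
        ((ae_restrict_iff' measurableSet_Iic).2 (Eventually.of_forall fun y hy => ?_))
      rw [norm_mul]
      refine mul_le_mul ?_ (hn y hy) (norm_nonneg _) (Real.exp_pos _).le
      rw [norm_exp, neg_re, re_mul_ofReal, Real.exp_le_exp, neg_mul]
      have := mul_le_mul_of_nonneg_left (mem_Iic.1 hy) (neg_nonneg.2 (hμ z hz))
      linarith
  have hform : ∀ z ∈ Z, ∀ d : ℝ → ℂ × ℂ, Continuous d → (∀ x, ∃ C, ∀ y ≤ x, ‖d y‖ ≤ C) → ∀ x,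
      ∫ y in Iic x, κ z x y (d y) = (∫ y in Iic x, (b 0 z y * (d y).1 + b 1 z y * (d y).2),
        exp (μ z * (x : ℂ)) * ∫ y in Iic x,
          exp (-(μ z * (y : ℂ))) * (b 2 z y * (d y).1 + b 3 z y * (d y).2)) := by
    intro z hz d hd hdb x
    simp only [hκapp, hesplit, mul_assoc]
    rw [integral_pair ((hint z hz 0 1 d hd hdb).2 x).1
      (((hint z hz 2 3 d hd hdb).2 x).2.const_mul _), integral_const_mul]
  have hder : ∀ z ∈ Z, ∀ d : ℝ → ℂ × ℂ, Continuous d → (∀ x, ∃ C, ∀ y ≤ x, ‖d y‖ ≤ C) → ∀ x,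
      HasDerivAt (fun x => ∫ y in Iic x, (b 0 z y * (d y).1 + b 1 z y * (d y).2))
        (b 0 z x * (d x).1 + b 1 z x * (d x).2) x ∧
      HasDerivAt (fun x : ℝ => exp (μ z * (x : ℂ)) * ∫ y in Iic x,
          exp (-(μ z * (y : ℂ))) * (b 2 z y * (d y).1 + b 3 z y * (d y).2))
        (μ z * (exp (μ z * (x : ℂ)) * ∫ y in Iic x,
          exp (-(μ z * (y : ℂ))) * (b 2 z y * (d y).1 + b 3 z y * (d y).2))
          + (b 2 z x * (d x).1 + b 3 z x * (d x).2)) x := by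
    intro z hz d hd hdb x
    have h1 := hint z hz 0 1 d hd hdb
    have h2 := hint z hz 2 3 d hd hdb
    refine ⟨hasDerivAt_integral_Iic h1.1 (fun x => (h1.2 x).1) x, ?_⟩
    have hc2 : Continuous fun y : ℝ =>
        exp (-(μ z * (y : ℂ))) * (b 2 z y * (d y).1 + b 3 z y * (d y).2) := by
      have := h2.1
      fun_prop
    have h3 := hasDerivAt_integral_Iic hc2 (fun x => (h2.2 x).2) x
    have h4 : HasDerivAt (fun x : ℝ => exp (μ z * (x : ℂ)))
        (exp (μ z * (x : ℂ)) * (μ z * ((1 : ℝ) : ℂ))) x :=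
      (((hasDerivAt_id x).ofReal_comp).const_mul (μ z)).cexp
    refine (h4.mul h3).congr_deriv ?_
    rw [← mul_assoc (exp (μ z * (x : ℂ))) (exp _), ← exp_add, add_neg_cancel, exp_zero]
    push_cast
    ring
  obtain ⟨c, hc, hcz⟩ := exists_volterra hU hUZ hw hw0 hwi hκw
    (by
      intro z hz d hd hdb
      have : (fun x => ∫ y in Iic x, κ z x y (d y)) = fun x => _ :=
        funext fun x => hform z hz d hd hdb x
      rw [this, continuous_iff_continuousAt]
      exact fun x => ((hder z hz d hd hdb x).1.continuousAt).prodMk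
        (hder z hz d hd hdb x).2.continuousAt)
    (by
      intro z hz x
      have h0 := hby 0 z hz
      have h1 := hby 1 z hz
      have h2 := hby 2 z hz
      have h3 := hby 3 z hz
      simp only [hκ, he]
      fun_prop)
    (by
      intro x y _
      have h0 := hbc 0 y
      have h1 := hbc 1 y
      have h2 := hbc 2 y
      have h3 := hbc 3 y
      simp only [hκ, he]
      fun_prop)
    (by
      intro x y _
      have h0 := hbd 0 y
      have h1 := hbd 1 y
      have h2 := hbd 2 y
      have h3 := hbd 3 y
      simp only [hκ, he]
      fun_prop) ((1, 0) : ℂ × ℂ)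
  have hv : ‖((1, 0) : ℂ × ℂ)‖ = 1 := by simp [Prod.norm_def]
  have hW : ∀ x, 0 ≤ ∫ y in Iic x, w y := fun x =>
    setIntegral_nonneg measurableSet_Iic fun y _ => hw0 y
  have hWm : Monotone fun x => ∫ y in Iic x, w y := fun a b hab =>
    setIntegral_mono_set (hwi b) (Eventually.of_forall hw0) (Iic_subset_Iic.2 hab).eventuallyLE
  have hcb : ∀ z ∈ Z, ∀ x, ∀ y ≤ x, ‖c z y‖ ≤ Real.exp (∫ y in Iic x, w y) := by
    intro z hz x y hy
    have := (hc z hz).2.1 y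
    rw [hv, one_mul] at this
    exact this.trans (Real.exp_le_exp.2 (hWm hy))
  refine ⟨fun z x => (c z x).1, fun z x => (c z x).2, fun z hz => ?_, fun x => ?_⟩
  · have hb : ∀ x, ∃ C, ∀ y ≤ x, ‖c z y‖ ≤ C := fun x => ⟨_, hcb z hz x⟩
    have h1 : ∀ x, (c z x).1 = 1 + ∫ y in Iic x, (b 0 z y * (c z y).1 + b 1 z y * (c z y).2) := by
      intro x
      have := (hc z hz).2.2 x
      rw [hform z hz _ (hc z hz).1 hb x] at this
      simpa using congrArg Prod.fst this
    have h2 : ∀ x, (c z x).2 = exp (μ z * (x : ℂ)) * ∫ y in Iic x,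
          exp (-(μ z * (y : ℂ))) * (b 2 z y * (c z y).1 + b 3 z y * (c z y).2) := by
      intro x
      have := (hc z hz).2.2 x
      rw [hform z hz _ (hc z hz).1 hb x] at this
      simpa using congrArg Prod.snd this
    have hlim : Tendsto (c z) atBot (𝓝 (1, 0)) := by
      rw [tendsto_iff_norm_sub_tendsto_zero]
      have hbnd : ∀ x ≤ 0, ‖c z x - (1, 0)‖
          ≤ (∫ y in Iic x, w y) * Real.exp (∫ y in Iic 0, w y) := by
        intro x hx
        have := (hc z hz).2.2 x
        rw [this, add_sub_cancel_left, ← integral_mul_const]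
        refine norm_integral_le_of_norm_le ((hwi x).mul_const _)
          ((ae_restrict_iff' measurableSet_Iic).2 (Eventually.of_forall fun y hy => ?_))
        exact ((κ z x y).le_opNorm _).trans (mul_le_mul (hκw z hz x y hy)
          (hcb z hz 0 y ((mem_Iic.1 hy).trans hx)) (norm_nonneg _) (hw0 y))
      refine tendsto_of_tendsto_of_tendsto_of_le_of_le' tendsto_const_nhds
        (h := fun x => (∫ y in Iic x, w y) * Real.exp (∫ y in Iic 0, w y)) ?_
        (Eventually.of_forall fun x => norm_nonneg _) ((eventually_le_atBot 0).mono hbnd)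
      simpa using (tendsto_integral_Iic_atBot (hwi 0)).mul_const (Real.exp (∫ y in Iic 0, w y))
    refine ⟨fun x => ?_, fun x => ?_, ?_, ?_⟩
    · have := (hder z hz _ (hc z hz).1 hb x).1.const_add (1 : ℂ)
      exact this.congr_of_eventuallyEq (Eventually.of_forall h1)
    · have := (hder z hz _ (hc z hz).1 hb x).2
      rw [← h2 x] at this
      exact this.congr_of_eventuallyEq (Eventually.of_forall h2)
    · exact (continuous_fst.tendsto _).comp hlim
    · exact (continuous_snd.tendsto _).comp hlim
  · exact ⟨⟨continuous_fst.comp_continuousOn (hcz x).1, (hcz x).2.fst⟩,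
      continuous_snd.comp_continuousOn (hcz x).1, (hcz x).2.snd⟩

-- Integrating both equations from `-∞` bounds `|d₁| + |d₂|` by the integral of `w (|d₁| + |d₂|)`,
-- and Gronwall's inequality with constant `0` finishes.
open MeasureTheory Set in
theorem eq_zero_of_system_atBot {μ : ℂ} {b : Fin 4 → ℝ → ℂ} {w : ℝ → ℝ} (hw : Continuous w)
    (hwi : ∀ x, IntegrableOn w (Iic x)) (hμ : μ.re ≤ 0)
    (hbw : ∀ y, ‖b 0 y‖ + ‖b 1 y‖ + ‖b 2 y‖ + ‖b 3 y‖ ≤ w y) (hb : ∀ i, Continuous (b i))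
    {d₁ d₂ : ℝ → ℂ} (h₁ : ∀ x, HasDerivAt d₁ (b 0 x * d₁ x + b 1 x * d₂ x) x)
    (h₂ : ∀ x, HasDerivAt d₂ (μ * d₂ x + (b 2 x * d₁ x + b 3 x * d₂ x)) x)
    (hl₁ : Tendsto d₁ atBot (𝓝 0)) (hl₂ : Tendsto d₂ atBot (𝓝 0)) (x : ℝ) :
    d₁ x = 0 ∧ d₂ x = 0 := by
  have hc1 : Continuous d₁ := continuous_iff_continuousAt.2 fun x => (h₁ x).continuousAt
  have hc2 : Continuous d₂ := continuous_iff_continuousAt.2 fun x => (h₂ x).continuousAt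
  have hw0 : ∀ y, 0 ≤ w y := fun y => le_trans (by positivity) (hbw y)
  have hb0 := hb 0
  have hb1 := hb 1
  have hb2 := hb 2
  have hb3 := hb 3
  set f : ℝ → ℝ := fun y => ‖d₁ y‖ + ‖d₂ y‖ with hf
  have hfc : Continuous f := by fun_prop
  have hf0 : ∀ y, 0 ≤ f y := fun y => by positivity
  have hfi : ∀ (p : ℝ → ℝ), Continuous p → (∀ y, 0 ≤ p y) → (∀ y, p y ≤ w y) → ∀ x,
      IntegrableOn (fun y => p y * f y) (Iic x) := by
    intro p hp hp0 hpw x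
    obtain ⟨C₁, hC₁⟩ := exists_norm_le_of_tendsto_atBot hc1 hl₁ x
    obtain ⟨C₂, hC₂⟩ := exists_norm_le_of_tendsto_atBot hc2 hl₂ x
    refine Integrable.mono' ((hwi x).mul_const (C₁ + C₂))
      (hp.mul hfc).aestronglyMeasurable
      ((ae_restrict_iff' measurableSet_Iic).2 (Eventually.of_forall fun y hy => ?_))
    rw [Real.norm_of_nonneg (mul_nonneg (hp0 y) (hf0 y))]
    exact mul_le_mul (hpw y) (add_le_add (hC₁ y hy) (hC₂ y hy)) (hf0 y) (hw0 y)
  have hn : ∀ i j y, ‖b i y * d₁ y + b j y * d₂ y‖ ≤ (‖b i y‖ + ‖b j y‖) * f y := by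
    intro i j y
    refine (norm_add_le _ _).trans ?_
    rw [norm_mul, norm_mul]
    have := norm_nonneg (b i y)
    have := norm_nonneg (b j y)
    have := norm_nonneg (d₁ y)
    have := norm_nonneg (d₂ y)
    simp only [hf]
    nlinarith
  have hle : ∀ x ≤ x, f x ≤ 0 + ∫ y in Iic x, w y * f y := by
    intro x _
    have hi1 := hfi (fun y => ‖b 0 y‖ + ‖b 1 y‖) (by fun_prop) (fun y => by positivity)
      (fun y => by have := hbw y; have := norm_nonneg (b 2 y); have := norm_nonneg (b 3 y); linarith) x
    have hi2 := hfi (fun y => ‖b 2 y‖ + ‖b 3 y‖) (by fun_prop) (fun y => by positivity)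
      (fun y => by have := hbw y; have := norm_nonneg (b 0 y); have := norm_nonneg (b 1 y); linarith) x
    have e1 := norm_le_integral_Iic_of_hasDerivAt (μ := 0) (x := x) (f := d₁)
      (g := fun y => b 0 y * d₁ y + b 1 y * d₂ y) (by simp)
      (fun y _ => by simpa using h₁ y) hl₁ (Continuous.continuousOn (by fun_prop))
      (fun y _ => hn 0 1 y) hi1
    have e2 := norm_le_integral_Iic_of_hasDerivAt (x := x) hμ (fun y _ => h₂ y) hl₂
      (Continuous.continuousOn (by fun_prop)) (fun y _ => hn 2 3 y) hi2
    rw [zero_add]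
    calc f x ≤ _ := add_le_add e1 e2
      _ = ∫ y in Iic x, ((‖b 0 y‖ + ‖b 1 y‖) * f y + (‖b 2 y‖ + ‖b 3 y‖) * f y) :=
          (integral_add hi1 hi2).symm
      _ ≤ _ := by
          refine setIntegral_mono_on (hi1.add hi2) (hfi w hw hw0 (fun y => le_rfl) x)
            measurableSet_Iic fun y _ => ?_
          rw [← add_mul]
          exact mul_le_mul_of_nonneg_right (by linarith [hbw y]) (hf0 y)
  have hfin := le_mul_exp_of_le_add_integral_Iic (C := 0) (x₀ := x) hfc hw hw0 hwi
    (hfi w hw hw0 fun y => le_rfl) fun x _ => hle x le_rfl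
  rw [zero_mul] at hfin
  have h1 := norm_nonneg (d₁ x)
  have h2 := norm_nonneg (d₂ x)
  exact ⟨norm_le_zero_iff.1 (by simp only [hf] at hfin; linarith),
    norm_le_zero_iff.1 (by simp only [hf] at hfin; linarith)⟩

/-! ### The first Jost column at a fixed time -/

/-- The closure of `D⁺` for the radius `r`, without the branch points `0`, `±ir`. -/
def closedPos (r : ℝ) : Set ℂ := {z | z ≠ 0 ∧ z ^ 2 + (r : ℂ) ^ 2 ≠ 0 ∧ 0 ≤ (‖z‖ ^ 2 - r ^ 2) * z.im}

/-- The region `D⁺` for the radius `r`. -/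
def openPos (r : ℝ) : Set ℂ := {z | 0 < (‖z‖ ^ 2 - r ^ 2) * z.im}

theorem isOpen_openPos (r : ℝ) : IsOpen (openPos r) :=
  isOpen_lt continuous_const (by fun_prop)

theorem openPos_subset_closedPos (r : ℝ) : openPos r ⊆ closedPos r := by
  intro z hz
  have hz' : 0 < (‖z‖ ^ 2 - r ^ 2) * z.im := hz
  refine ⟨?_, ?_, hz'.le⟩
  · rintro rfl
    simp at hz'
  · intro h
    have h1 : z ^ 2 = -(r : ℂ) ^ 2 := eq_neg_of_add_eq_zero_left h
    have h2 := congrArg norm h1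
    rw [norm_pow, norm_neg, norm_pow, norm_real, Real.norm_eq_abs, sq_abs] at h2
    rw [h2] at hz'
    simp at hz'

/-- The number on the left is `2iλ`, the nonzero eigenvalue of the limiting system; this identity is
why the sign of `(|z|² - r²) Im z` decides where the first Jost column at `-∞` exists. -/
theorem re_I_mul_add_div {r : ℝ} {z : ℂ} (hz : z ≠ 0) :
    (I * (z + (r : ℂ) ^ 2 / z)).re = -((‖z‖ ^ 2 - r ^ 2) * z.im) / ‖z‖ ^ 2 := by
  have h : ‖z‖ ≠ 0 := norm_ne_zero_iff.2 hz
  have h1 : ((r : ℂ) ^ 2 / z).im = -(r ^ 2 * z.im) / ‖z‖ ^ 2 := by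
    have : (r : ℂ) ^ 2 = ((r ^ 2 : ℝ) : ℂ) := by push_cast; rfl
    rw [this, div_eq_mul_inv, im_ofReal_mul, inv_im, normSq_eq_norm_sq]
    ring
  rw [I_mul_re, add_im, h1]
  field_simp
  ring

theorem re_I_mul_add_div_nonpos {r : ℝ} {z : ℂ} (hz : z ∈ closedPos r) :
    (I * (z + (r : ℂ) ^ 2 / z)).re ≤ 0 := by
  rw [re_I_mul_add_div hz.1]
  exact div_nonpos_of_nonpos_of_nonneg (neg_nonpos.2 hz.2.2) (by positivity)

open MeasureTheory in
/-- A continuous potential that tends to a nonzero constant at `-∞`, with a first moment. -/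
structure DecaysAtBot (q : ℝ → ℂ) (a : ℂ) : Prop where
  ne : a ≠ 0
  cont : Continuous q
  lim : Tendsto q atBot (𝓝 a)
  moment : ∀ x, IntegrableOn (fun y : ℝ => (1 + |y|) * ‖q y - a‖) (Set.Iic x)

open MeasureTheory in
theorem DecaysAtBot.integrableOn {q : ℝ → ℂ} {a : ℂ} (h : DecaysAtBot q a) (x : ℝ) :
    IntegrableOn (fun y : ℝ => ‖q y - a‖) (Set.Iic x) := by
  have hc := h.cont
  refine Integrable.mono' (h.moment x) (Continuous.aestronglyMeasurable (by fun_prop))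
    (Eventually.of_forall fun y => ?_)
  rw [norm_norm]
  have := norm_nonneg (q y - a)
  nlinarith [abs_nonneg y]

/-- The first Jost column at `-∞`, multiplied by `e^{iλx}`, with components `u`, `v`. -/
structure XJost (q : ℝ → ℂ) (a z : ℂ) (u v : ℝ → ℂ) : Prop where
  deriv_fst : ∀ x, HasDerivAt u (I * (‖a‖ : ℂ) ^ 2 / z * u x + q x * v x) x
  deriv_snd : ∀ x, HasDerivAt v (I * z * v x - (starRingEnd ℂ) (q x) * u x) x
  lim_fst : Tendsto u atBot (𝓝 1)
  lim_snd : Tendsto v atBot (𝓝 (-(I / z) * (starRingEnd ℂ) a))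

/-- The coefficients of the Lax system in the eigenbasis of its limit at `-∞`. -/
noncomputable def eigenCoeff (q : ℝ → ℂ) (a : ℂ) (i : Fin 4) (z : ℂ) (y : ℝ) : ℂ :=
  ![(q y - a) * (-(I / z) * (starRingEnd ℂ) a) + (-(I / z) * a) * (starRingEnd ℂ) (q y - a),
    (q y - a) + (-(I / z) * a) ^ 2 * (starRingEnd ℂ) (q y - a),
    -((-(I / z) * (starRingEnd ℂ) a) ^ 2 * (q y - a) + (starRingEnd ℂ) (q y - a)),
    -((q y - a) * (-(I / z) * (starRingEnd ℂ) a)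
      + (-(I / z) * a) * (starRingEnd ℂ) (q y - a))] i / (1 + (‖a‖ : ℂ) ^ 2 / z ^ 2)

/-- Finite and continuous on `closedPos ‖a‖`, but the denominator `|γ|` tends to `0` at `±i‖a‖`: the
estimates in the eigenbasis are only locally uniform in `z`. -/
noncomputable def eigenBound (a z : ℂ) : ℝ :=
  (4 * (‖a‖ / ‖z‖) + 2 * (1 + (‖a‖ / ‖z‖) ^ 2)) / ‖1 + (‖a‖ : ℂ) ^ 2 / z ^ 2‖

theorem one_add_div_sq_ne_zero {r : ℝ} {z : ℂ} (hz : z ∈ closedPos r) :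
    1 + (r : ℂ) ^ 2 / z ^ 2 ≠ 0 := by
  have h0 := hz.1
  intro h
  apply hz.2.1
  field_simp at h
  simpa using h

theorem norm_eigenCoeff_le (q : ℝ → ℂ) (a z : ℂ) (y : ℝ) :
    ‖eigenCoeff q a 0 z y‖ + ‖eigenCoeff q a 1 z y‖ + ‖eigenCoeff q a 2 z y‖
      + ‖eigenCoeff q a 3 z y‖ ≤ eigenBound a z * ‖q y - a‖ := by
  have hα : ‖-(I / z) * a‖ = ‖a‖ / ‖z‖ := by
    rw [norm_mul, norm_neg, norm_div, norm_I]; ring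
  have hβ : ‖-(I / z) * (starRingEnd ℂ) a‖ = ‖a‖ / ‖z‖ := by
    rw [norm_mul, norm_neg, norm_div, norm_I, RCLike.norm_conj]; ring
  have hD : ‖(starRingEnd ℂ) (q y - a)‖ = ‖q y - a‖ := RCLike.norm_conj _
  simp only [eigenCoeff, eigenBound, norm_div]
  simp only [Matrix.cons_val]
  rw [← add_div, ← add_div, ← add_div, div_mul_eq_mul_div]
  refine div_le_div_of_nonneg_right ?_ (norm_nonneg _)
  set α := -(I / z) * a
  set β := -(I / z) * (starRingEnd ℂ) a
  set D := (starRingEnd ℂ) (q y - a)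
  set δ := q y - a
  set s := ‖a‖ / ‖z‖
  clear_value α β D s
  rw [norm_neg, norm_neg]
  have h1 : ‖δ * β + α * D‖ ≤ 2 * s * ‖δ‖ := by
    refine (norm_add_le _ _).trans (le_of_eq ?_)
    rw [norm_mul, norm_mul, hα, hβ, hD]; ring
  have h2 : ‖δ + α ^ 2 * D‖ ≤ (1 + s ^ 2) * ‖δ‖ := by
    refine (norm_add_le _ _).trans (le_of_eq ?_)
    rw [norm_mul, norm_pow, hα, hD]; ring
  have h3 : ‖β ^ 2 * δ + D‖ ≤ (1 + s ^ 2) * ‖δ‖ := by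
    refine (norm_add_le _ _).trans (le_of_eq ?_)
    rw [norm_mul, norm_pow, hβ, hD]; ring
  linarith

/-- Let `S` have the eigenvector columns `(1, β)` and `(α, 1)`, with `β = -(i/z) a*` and `α = -(i/z)
a`; its determinant is `γ`. The coefficients form `B = S⁻¹ ΔQ S`, and these are the four entries of
`S B = ΔQ S`. -/
theorem eigenCoeff_identities (q : ℝ → ℂ) (a : ℂ) {z : ℂ} (hz : z ∈ closedPos ‖a‖) (y : ℝ) :
    eigenCoeff q a 0 z y + (-(I / z) * a) * eigenCoeff q a 2 z y
      = (q y - a) * (-(I / z) * (starRingEnd ℂ) a) ∧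
    eigenCoeff q a 1 z y + (-(I / z) * a) * eigenCoeff q a 3 z y = q y - a ∧
    eigenCoeff q a 2 z y + (-(I / z) * (starRingEnd ℂ) a) * eigenCoeff q a 0 z y
      = -(starRingEnd ℂ) (q y - a) ∧
    eigenCoeff q a 3 z y + (-(I / z) * (starRingEnd ℂ) a) * eigenCoeff q a 1 z y
      = -(starRingEnd ℂ) (q y - a) * (-(I / z) * a) := by
  have hγ := one_add_div_sq_ne_zero hz
  have hγ' : 1 + (‖a‖ : ℂ) ^ 2 / z ^ 2 = 1 - (-(I / z) * a) * (-(I / z) * (starRingEnd ℂ) a) := by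
    rw [← mul_conj' a]
    linear_combination (a * (starRingEnd ℂ) a) / z ^ 2 * I_sq
  simp only [eigenCoeff]
  simp only [Matrix.cons_val]
  set α := -(I / z) * a
  set β := -(I / z) * (starRingEnd ℂ) a
  set D := (starRingEnd ℂ) (q y - a)
  set δ := q y - a
  set γ := 1 + (‖a‖ : ℂ) ^ 2 / z ^ 2
  refine ⟨?_, ?_, ?_, ?_⟩
  · field_simp
    rw [hγ']; ring
  · field_simp
    rw [hγ']; ring
  · field_simp
    rw [hγ']; ring
  · field_simp
    rw [hγ']; ring

-- The difference of two solutions tends to `0` at `-∞`. Written in the eigenbasis it satisfies the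
-- homogeneous system of `eq_zero_of_system_atBot`, with `μ = 2iλ`, and therefore vanishes.
open MeasureTheory in
theorem DecaysAtBot.xjost_unique {q : ℝ → ℂ} {a : ℂ} (h : DecaysAtBot q a) {z : ℂ}
    (hz : z ∈ closedPos ‖a‖) {u v u' v' : ℝ → ℂ} (hu : XJost q a z u v) (hu' : XJost q a z u' v') :
    u = u' ∧ v = v' := by
  have hz0 := hz.1
  have hγ := one_add_div_sq_ne_zero hz
  have hqc := h.cont
  have haa : a * (starRingEnd ℂ) a = (‖a‖ : ℂ) ^ 2 := mul_conj' a
  have hγ' : 1 + (‖a‖ : ℂ) ^ 2 / z ^ 2 = 1 - (-(I / z) * a) * (-(I / z) * (starRingEnd ℂ) a) := by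
    rw [← haa]
    linear_combination (a * (starRingEnd ℂ) a) / z ^ 2 * I_sq
  set α := -(I / z) * a with hα
  set β := -(I / z) * (starRingEnd ℂ) a with hβ
  set γ := 1 + (‖a‖ : ℂ) ^ 2 / z ^ 2 with hγdef
  set μ := I * (z + (‖a‖ : ℂ) ^ 2 / z) with hμ
  -- These relations say that `(1, β)` and `(α, 1)` are eigenvectors of the limiting matrix, for the
  -- eigenvalues `0` and `μ`.
  have e1 : I * (‖a‖ : ℂ) ^ 2 / z = -(a * β) := by rw [← haa, hβ]; ring
  have e2 : I * z = μ + a * β := by rw [hμ, hβ, ← haa]; ring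
  have e3 : a = α * (μ + a * β) := by
    rw [← e2, hα]; field_simp; linear_combination a * I_sq
  have e4 : (starRingEnd ℂ) a * α = a * β := by rw [hα, hβ]; ring
  have e5 : (starRingEnd ℂ) a = β * (μ + a * β) := by
    rw [← e2, hβ]; field_simp; linear_combination (starRingEnd ℂ) a * I_sq
  have hid := eigenCoeff_identities q a hz
  rw [← hα, ← hβ] at hid
  set U := fun x => u x - u' x with hU
  set V := fun x => v x - v' x with hV
  have dU : ∀ x, HasDerivAt U (-(a * β) * U x + q x * V x) x := fun x => by
    refine ((hu.deriv_fst x).sub (hu'.deriv_fst x)).congr_deriv ?_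
    simp only [hU, hV, e1]; ring
  have dV : ∀ x, HasDerivAt V ((μ + a * β) * V x - (starRingEnd ℂ) (q x) * U x) x := fun x => by
    refine ((hu.deriv_snd x).sub (hu'.deriv_snd x)).congr_deriv ?_
    simp only [hU, hV, e2]; ring
  have lU : Tendsto U atBot (𝓝 0) := by simpa using hu.lim_fst.sub hu'.lim_fst
  have lV : Tendsto V atBot (𝓝 0) := by simpa using hu.lim_snd.sub hu'.lim_snd
  have hcb : ∀ i, Continuous (eigenCoeff q a i z) := by
    intro i
    have : Continuous fun y => (starRingEnd ℂ) (q y) := continuous_conj.comp hqc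
    fin_cases i <;> (unfold eigenCoeff; simp only [Fin.zero_eta, Fin.mk_one, Fin.reduceFinMk, Matrix.cons_val, map_sub]; fun_prop)
  clear_value α β γ μ U V
  have key := eq_zero_of_system_atBot (μ := μ) (b := fun i => eigenCoeff q a i z)
    (w := fun y => eigenBound a z * ‖q y - a‖) (by fun_prop)
    (fun x => (h.integrableOn x).const_mul _) (by rw [hμ]; exact re_I_mul_add_div_nonpos hz)
    (norm_eigenCoeff_le q a z) hcb (d₁ := fun x => (U x - α * V x) / γ)
    (d₂ := fun x => (V x - β * U x) / γ)
    (fun x => by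
      refine (((dU x).sub ((dV x).const_mul α)).div_const γ).congr_deriv ?_
      obtain ⟨i1, i2, i3, i4⟩ := hid x
      have hγU : U x = (U x - α * V x) / γ + α * ((V x - β * U x) / γ) := by
        field_simp; rw [hγ']; ring
      have hγV : V x = (V x - β * U x) / γ + β * ((U x - α * V x) / γ) := by
        field_simp; rw [hγ']; ring
      set c := (U x - α * V x) / γ
      set d := (V x - β * U x) / γ
      clear_value c d
      rw [hγU, hγV, div_eq_iff hγ, hγ']
      rw [map_sub] at i3 i4
      linear_combination c * e4 + α * d * e4 + (β * c + d) * e3 - c * i1 + α * c * i3 - d * i2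
        + α * d * i4)
    (fun x => by
      refine (((dV x).sub ((dU x).const_mul β)).div_const γ).congr_deriv ?_
      obtain ⟨i1, i2, i3, i4⟩ := hid x
      have hγU : U x = (U x - α * V x) / γ + α * ((V x - β * U x) / γ) := by
        field_simp; rw [hγ']; ring
      have hγV : V x = (V x - β * U x) / γ + β * ((U x - α * V x) / γ) := by
        field_simp; rw [hγ']; ring
      set c := (U x - α * V x) / γ
      set d := (V x - β * U x) / γ
      clear_value c d
      rw [hγU, hγV, div_eq_iff hγ, hγ']
      rw [map_sub] at i3 i4
      linear_combination -c * e5 - d * β * e3 - d * e4 - c * i3 + β * c * i1 - d * i4 + β * d * i2)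
    (by simpa using (lU.sub (lV.const_mul α)).div_const γ)
    (by simpa using (lV.sub (lU.const_mul β)).div_const γ)
  have hzero : ∀ x, U x = 0 ∧ V x = 0 := by
    intro x
    obtain ⟨k1, k2⟩ := key x
    rw [div_eq_zero_iff, or_iff_left hγ] at k1 k2
    have hg : 1 - α * β ≠ 0 := by rwa [← hγ']
    constructor
    · refine (mul_eq_zero.1 (?_ : (1 - α * β) * U x = 0)).resolve_left hg
      linear_combination k1 + α * k2
    · refine (mul_eq_zero.1 (?_ : (1 - α * β) * V x = 0)).resolve_left hg
      linear_combination k2 + β * k1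
  refine ⟨funext fun x => sub_eq_zero.1 ?_, funext fun x => sub_eq_zero.1 ?_⟩
  · simpa [hU] using (hzero x).1
  · simpa [hV] using (hzero x).2

theorem continuousOn_eigenBound (a : ℂ) : ContinuousOn (eigenBound a) (closedPos ‖a‖) := by
  intro z hz
  have h0 := hz.1
  have h1 := one_add_div_sq_ne_zero hz
  have h2 : ‖z‖ ≠ 0 := norm_ne_zero_iff.2 h0
  have h3 : ‖1 + (‖a‖ : ℂ) ^ 2 / z ^ 2‖ ≠ 0 := norm_ne_zero_iff.2 h1
  have h4 : z ^ 2 ≠ 0 := pow_ne_zero 2 h0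
  refine ContinuousAt.continuousWithinAt ?_
  unfold eigenBound
  fun_prop (disch := assumption)

theorem eigenBound_nonneg (a z : ℂ) : 0 ≤ eigenBound a z := by
  unfold eigenBound
  positivity

theorem differentiableAt_eigenCoeff (q : ℝ → ℂ) (a : ℂ) (i : Fin 4) (y : ℝ) {z : ℂ}
    (hz : z ∈ closedPos ‖a‖) : DifferentiableAt ℂ (fun z => eigenCoeff q a i z y) z := by
  have h0 := hz.1
  have h1 := one_add_div_sq_ne_zero hz
  have h4 : z ^ 2 ≠ 0 := pow_ne_zero 2 h0
  unfold eigenCoeff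
  fin_cases i <;> simp only [Fin.zero_eta, Fin.mk_one, Fin.reduceFinMk, Matrix.cons_val] <;>
    fun_prop (disch := assumption)

-- On a sublevel set of `eigenBound` the weight `C ‖q - a‖` dominates the coefficients for all `z`
-- at once, as `exists_system_atBot` requires. Every `z` lies in such a set, and uniqueness makes
-- the solutions for different `C` agree.
open MeasureTheory in
theorem DecaysAtBot.exists_xjost_of_lt {q : ℝ → ℂ} {a : ℂ} (h : DecaysAtBot q a) {C : ℝ}
    (hC : 0 < C) : ∃ u v : ℂ → ℝ → ℂ,
      (∀ z ∈ closedPos ‖a‖ ∩ {z | eigenBound a z < C}, XJost q a z (u z) (v z)) ∧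
      ∀ x, (ContinuousOn (fun z => u z x) (closedPos ‖a‖ ∩ {z | eigenBound a z < C}) ∧
          DifferentiableOn ℂ (fun z => u z x) (openPos ‖a‖ ∩ {z | eigenBound a z < C})) ∧
        ContinuousOn (fun z => v z x) (closedPos ‖a‖ ∩ {z | eigenBound a z < C}) ∧
          DifferentiableOn ℂ (fun z => v z x) (openPos ‖a‖ ∩ {z | eigenBound a z < C}) := by
  have hqc := h.cont
  have hsub := openPos_subset_closedPos ‖a‖
  have hU : IsOpen (openPos ‖a‖ ∩ {z | eigenBound a z < C}) :=
    ((continuousOn_eigenBound a).mono hsub).isOpen_inter_preimage (isOpen_openPos _) isOpen_Iio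
  have hμd : ∀ z ∈ closedPos ‖a‖, DifferentiableAt ℂ (fun z => I * (z + (‖a‖ : ℂ) ^ 2 / z)) z := by
    intro z hz
    have := hz.1
    fun_prop (disch := assumption)
  have hcb : ∀ i z, Continuous (eigenCoeff q a i z) := by
    intro i z
    have : Continuous fun y => (starRingEnd ℂ) (q y) := continuous_conj.comp hqc
    fin_cases i <;> (unfold eigenCoeff; simp only [Fin.zero_eta, Fin.mk_one, Fin.reduceFinMk, Matrix.cons_val, map_sub]; fun_prop)
  obtain ⟨c, d, hcd, hreg⟩ := exists_system_atBot hU (Set.inter_subset_inter_left _ hsub)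
    (μ := fun z => I * (z + (‖a‖ : ℂ) ^ 2 / z)) (b := eigenCoeff q a)
    (w := fun y => C * ‖q y - a‖) (by fun_prop) (fun y => by positivity)
    (fun x => (h.integrableOn x).const_mul _) (fun z hz => re_I_mul_add_div_nonpos hz.1)
    (fun z hz => (hμd z hz.1).continuousAt.continuousWithinAt)
    (fun z hz => (hμd z (hsub hz.1)).differentiableWithinAt)
    (fun z hz y => (norm_eigenCoeff_le q a z y).trans
      (mul_le_mul_of_nonneg_right (le_of_lt hz.2) (norm_nonneg _)))
    (fun i z _ => hcb i z)
    (fun i y z hz => (differentiableAt_eigenCoeff q a i y hz.1).continuousAt.continuousWithinAt)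
    (fun i y z hz => (differentiableAt_eigenCoeff q a i y (hsub hz.1)).differentiableWithinAt)
  have hα : ∀ s : ℂ, ∀ z ∈ closedPos ‖a‖, DifferentiableAt ℂ (fun z => -(I / z) * s) z := by
    intro s z hz
    have := hz.1
    fun_prop (disch := assumption)
  refine ⟨fun z x => c z x + (-(I / z) * a) * d z x,
    fun z x => d z x + (-(I / z) * (starRingEnd ℂ) a) * c z x, fun z hz => ?_, fun x => ?_⟩
  · have hz0 := hz.1.1
    have haa : a * (starRingEnd ℂ) a = (‖a‖ : ℂ) ^ 2 := mul_conj' a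
    obtain ⟨dc, dd, lc, ld⟩ := hcd z hz
    have hid := eigenCoeff_identities q a hz.1
    set α := -(I / z) * a with hαd
    set β := -(I / z) * (starRingEnd ℂ) a with hβ
    have e2 : I * z = I * (z + (‖a‖ : ℂ) ^ 2 / z) + a * β := by rw [hβ, ← haa]; ring
    set μ := I * (z + (‖a‖ : ℂ) ^ 2 / z) with hμ
    have e1 : I * (‖a‖ : ℂ) ^ 2 / z = -(a * β) := by rw [← haa, hβ]; ring
    have e3 : a = α * (μ + a * β) := by
      rw [← e2, hαd]; field_simp; linear_combination a * I_sq
    have e4 : (starRingEnd ℂ) a * α = a * β := by rw [hαd, hβ]; ring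
    have e5 : (starRingEnd ℂ) a = β * (μ + a * β) := by
      rw [← e2, hβ]; field_simp; linear_combination (starRingEnd ℂ) a * I_sq
    change XJost q a z (fun x => c z x + α * d z x) (fun x => d z x + β * c z x)
    clear_value α β μ
    refine ⟨fun x => ?_, fun x => ?_, ?_, ?_⟩
    · refine ((dc x).add ((dd x).const_mul α)).congr_deriv ?_
      obtain ⟨i1, i2, i3, i4⟩ := hid x
      rw [map_sub] at i3 i4
      rw [e1]
      linear_combination c z x * i1 + d z x * i2 - d z x * e3
    · refine ((dd x).add ((dc x).const_mul β)).congr_deriv ?_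
      obtain ⟨i1, i2, i3, i4⟩ := hid x
      rw [map_sub] at i3 i4
      rw [e2]
      linear_combination c z x * i3 + d z x * i4 + c z x * e5 + d z x * e4
    · simpa using lc.add (ld.const_mul α)
    · simpa [hβ] using ld.add (lc.const_mul β)
  · obtain ⟨⟨c1, c2⟩, c3, c4⟩ := hreg x
    have k1 : ∀ s, ContinuousOn (fun z => -(I / z) * s)
        (closedPos ‖a‖ ∩ {z | eigenBound a z < C}) := fun s z hz =>
      (hα s z hz.1).continuousAt.continuousWithinAt
    have k2 : ∀ s, DifferentiableOn ℂ (fun z => -(I / z) * s)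
        (openPos ‖a‖ ∩ {z | eigenBound a z < C}) := fun s z hz =>
      (hα s z (hsub hz.1)).differentiableWithinAt
    exact ⟨⟨c1.add ((k1 a).mul c3), c2.add ((k2 a).mul c4)⟩, c3.add ((k1 _).mul c1),
      c4.add ((k2 _).mul c2)⟩

theorem DecaysAtBot.exists_xjost {q : ℝ → ℂ} {a : ℂ} (h : DecaysAtBot q a) {z : ℂ}
    (hz : z ∈ closedPos ‖a‖) : ∃ u v, XJost q a z u v := by
  obtain ⟨u, v, huv, _⟩ := h.exists_xjost_of_lt (C := eigenBound a z + 1)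
    (by have := eigenBound_nonneg a z; linarith)
  exact ⟨u z, v z, huv z ⟨hz, lt_add_one (eigenBound a z)⟩⟩

/-- Jost columns depend continuously on the spectral parameter up to the contour, and
holomorphically inside. -/
theorem DecaysAtBot.xjost_regular {q : ℝ → ℂ} {a : ℂ} (h : DecaysAtBot q a) {u v : ℂ → ℝ → ℂ}
    (huv : ∀ z ∈ closedPos ‖a‖, XJost q a z (u z) (v z)) (x : ℝ) :
    (ContinuousOn (fun z => u z x) (closedPos ‖a‖) ∧
      DifferentiableOn ℂ (fun z => u z x) (openPos ‖a‖)) ∧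
    ContinuousOn (fun z => v z x) (closedPos ‖a‖) ∧
      DifferentiableOn ℂ (fun z => v z x) (openPos ‖a‖) := by
  have hsub := openPos_subset_closedPos ‖a‖
  -- Regularity is local: the sublevel set of `eigenBound` at the value for `z₀` plus `1` is a
  -- relative neighbourhood of `z₀`, and uniqueness identifies the given family with the one
  -- constructed there.
  have key : ∀ z₀ ∈ closedPos ‖a‖, ∃ S : Set ℂ, S ∈ 𝓝[closedPos ‖a‖] z₀ ∧
      (z₀ ∈ openPos ‖a‖ → S ∩ openPos ‖a‖ ∈ 𝓝 z₀) ∧ z₀ ∈ S ∧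
      (ContinuousOn (fun z => u z x) S ∧
      DifferentiableOn ℂ (fun z => u z x) (S ∩ openPos ‖a‖)) ∧
      ContinuousOn (fun z => v z x) S ∧ DifferentiableOn ℂ (fun z => v z x) (S ∩ openPos ‖a‖) := by
    intro z₀ hz₀
    set C := eigenBound a z₀ + 1 with hC
    obtain ⟨U, V, hUV, hreg⟩ := h.exists_xjost_of_lt (C := C)
      (by have := eigenBound_nonneg a z₀; linarith)
    set S := closedPos ‖a‖ ∩ {z | eigenBound a z < C} with hS
    have hSe : S ∩ openPos ‖a‖ = openPos ‖a‖ ∩ {z | eigenBound a z < C} := by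
      ext z
      simp only [hS, Set.mem_inter_iff]
      exact ⟨fun hz => ⟨hz.2, hz.1.2⟩, fun hz => ⟨⟨hsub hz.1, hz.2⟩, hz.1⟩⟩
    have hu : ∀ z ∈ S, u z = U z ∧ v z = V z := fun z hz =>
      h.xjost_unique hz.1 (huv z hz.1) (hUV z hz)
    have hmem : z₀ ∈ S := ⟨hz₀, lt_add_one (eigenBound a z₀)⟩
    obtain ⟨⟨c1, c2⟩, c3, c4⟩ := hreg x
    rw [← hSe] at c2 c4
    refine ⟨S, ?_, fun hz => ?_, hmem, ⟨?_, ?_⟩, ?_, ?_⟩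
    · refine inter_mem self_mem_nhdsWithin ?_
      exact (continuousOn_eigenBound a z₀ hz₀).eventually (gt_mem_nhds (lt_add_one _))
    · rw [hSe]
      exact (((continuousOn_eigenBound a).mono hsub).isOpen_inter_preimage (isOpen_openPos _)
        isOpen_Iio).mem_nhds ⟨hz, lt_add_one (eigenBound a z₀)⟩
    · exact c1.congr fun z hz => congrFun (hu z hz).1 x
    · exact c2.congr fun z hz => congrFun (hu z hz.1).1 x
    · exact c3.congr fun z hz => congrFun (hu z hz).2 x
    · exact c4.congr fun z hz => congrFun (hu z hz.1).2 x
  refine ⟨⟨fun z hz => ?_, fun z hz => ?_⟩, fun z hz => ?_, fun z hz => ?_⟩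
  · obtain ⟨S, h1, _, h3, ⟨h4, _⟩, _, _⟩ := key z hz
    exact (h4 z h3).mono_of_mem_nhdsWithin h1
  · obtain ⟨S, _, h2, h3, ⟨_, h5⟩, _, _⟩ := key z (hsub hz)
    exact (h5.differentiableAt (h2 hz)).differentiableWithinAt
  · obtain ⟨S, h1, _, h3, ⟨_, _⟩, h6, _⟩ := key z hz
    exact (h6 z h3).mono_of_mem_nhdsWithin h1
  · obtain ⟨S, _, h2, h3, ⟨_, _⟩, _, h7⟩ := key z (hsub hz)
    exact (h7.differentiableAt (h2 hz)).differentiableWithinAt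

/-- The quotient `(e^{μs} - 1)/μ` is thus bounded by `s` however small `μ` is. Near the branch
points, where `μ → 0`, the first moment of the potential absorbs this factor `s`. -/
theorem norm_exp_mul_sub_one_le {μ : ℂ} (hμ : μ.re ≤ 0) {s : ℝ} (hs : 0 ≤ s) :
    ‖exp (μ * (s : ℂ)) - 1‖ ≤ ‖μ‖ * s := by
  have hd : ∀ t ∈ Set.Icc 0 s, HasDerivWithinAt (fun t : ℝ => exp (μ * (t : ℂ)))
      (exp (μ * (t : ℂ)) * (μ * ((1 : ℝ) : ℂ))) (Set.Icc 0 s) t := fun t _ =>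
    ((((hasDerivAt_id t).ofReal_comp).const_mul μ).cexp).hasDerivWithinAt
  have := norm_image_sub_le_of_norm_deriv_le_segment' hd (C := ‖μ‖) (fun t ht => by
    rw [norm_mul, norm_exp, re_mul_ofReal, ofReal_one, mul_one]
    refine mul_le_of_le_one_left (norm_nonneg _) (Real.exp_le_one_iff.2 ?_)
    exact mul_nonpos_of_nonpos_of_nonneg hμ ht.1) s ⟨hs, le_rfl⟩
  simpa using this

open MeasureTheory in
/-- Jost columns stay bounded near the branch points `±i‖a‖`. -/
theorem DecaysAtBot.xjost_bounded {q : ℝ → ℂ} {a : ℂ} (h : DecaysAtBot q a) {ε : ℝ} (hε : 0 < ε)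
    (R x₀ : ℝ) : ∃ C, ∀ z ∈ closedPos ‖a‖, ε ≤ ‖z‖ → ‖z‖ ≤ R → ∀ u v, XJost q a z u v →
      ‖u x₀‖ + ‖v x₀‖ ≤ C := by
  -- `K` bounds each row sum of the limiting matrix for `ε ≤ |z| ≤ R`. The leading `2` in `K'` is
  -- there because each of the two components uses up `w / 2`.
  set K : ℝ := ‖a‖ ^ 2 / ε + 2 * ‖a‖ + R + 1 with hK
  set K' : ℝ := 2 * ((K + 1) * (1 + |x₀|)) with hK'
  set w : ℝ → ℝ := fun y => K' * ((1 + |y|) * ‖q y - a‖) with hw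
  refine ⟨(1 + ‖a‖ / ε) * Real.exp (∫ y in Set.Iic x₀, w y), fun z hz hzε hzR u v huv => ?_⟩
  have hqc := h.cont
  have hz0 := hz.1
  have hn0 : 0 < ‖z‖ := norm_pos_iff.2 hz0
  have hR : 0 < R := hn0.trans_le hzR
  have hK0 : 0 ≤ K := by positivity
  have hw0 : ∀ y, 0 ≤ w y := fun y => by positivity
  have hwc : Continuous w := by fun_prop
  have hwi : ∀ x, IntegrableOn w (Set.Iic x) := fun x => (h.moment x).const_mul _
  have hcu : Continuous u := continuous_iff_continuousAt.2 fun x => (huv.deriv_fst x).continuousAt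
  have hcv : Continuous v := continuous_iff_continuousAt.2 fun x => (huv.deriv_snd x).continuousAt
  have haa : a * (starRingEnd ℂ) a = (‖a‖ : ℂ) ^ 2 := mul_conj' a
  set μ := I * (z + (‖a‖ : ℂ) ^ 2 / z) with hμ
  have hμre : μ.re ≤ 0 := re_I_mul_add_div_nonpos hz
  have hμ0 : μ ≠ 0 := by
    refine mul_ne_zero I_ne_zero fun h0 => hz.2.1 ?_
    field_simp at h0
    simpa using h0
  set f : ℝ → ℝ := fun y => ‖u y‖ + ‖v y‖ with hf
  have hfc : Continuous f := by fun_prop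
  have hf0 : ∀ y, 0 ≤ f y := fun y => by positivity
  have hfi : ∀ x, IntegrableOn (fun y => w y * f y) (Set.Iic x) := by
    intro x
    obtain ⟨C₁, hC₁⟩ := exists_norm_le_of_tendsto_atBot hcu huv.lim_fst x
    obtain ⟨C₂, hC₂⟩ := exists_norm_le_of_tendsto_atBot hcv huv.lim_snd x
    refine Integrable.mono' ((hwi x).mul_const (C₁ + C₂)) (hwc.mul hfc).aestronglyMeasurable
      ((ae_restrict_iff' measurableSet_Iic).2 (Eventually.of_forall fun y hy => ?_))
    rw [Real.norm_of_nonneg (mul_nonneg (hw0 y) (hf0 y))]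
    exact mul_le_mul_of_nonneg_left (add_le_add (hC₁ y hy) (hC₂ y hy)) (hw0 y)
  -- one component of the variation-of-constants formula at the point `x`
  have comp : ∀ x ≤ x₀, ∀ (g p s₀ s₁ : ℝ → ℂ) (l : ℂ), Continuous s₀ → Continuous s₁ →
      (∀ y, HasDerivAt g (p y + s₀ y) y) → (∀ y, HasDerivAt p (μ * p y + s₁ y) y) →
      Tendsto g atBot (𝓝 l) → Tendsto p atBot (𝓝 0) → (∀ y, ‖s₀ y‖ ≤ ‖q y - a‖ * f y) →
      (∀ y, ‖s₁ y‖ ≤ K * (‖q y - a‖ * f y)) →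
      ‖g x‖ ≤ ‖l‖ + ∫ y in Set.Iic x, w y / 2 * f y := by
    intro x hx g p s₀ s₁ l hc₀ hc₁ hg hp hgl hpl hb₀ hb₁
    -- Since `E' = -e^{μ(x-y)}` and `μ E = e^{μ(x-y)} - 1`, adding `E p` to `g` cancels every term
    -- with `p` and leaves the derivative `s₀ + E s₁`. At `y = x` the correction is zero, so `g x`
    -- itself is estimated, without dividing by `γ`.
    set E : ℝ → ℂ := fun y => (exp (μ * ((x - y : ℝ) : ℂ)) - 1) / μ with hE
    have hEd : ∀ y, HasDerivAt E (-exp (μ * ((x - y : ℝ) : ℂ))) y := fun y => by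
      have h1 : HasDerivAt (fun y : ℝ => μ * ((x - y : ℝ) : ℂ)) (μ * ((-1 : ℝ) : ℂ)) y :=
        (((hasDerivAt_id y).const_sub x).ofReal_comp).const_mul μ
      refine ((h1.cexp.sub_const 1).div_const μ).congr_deriv ?_
      field_simp
      push_cast
      ring
    have hEc : Continuous E := continuous_iff_continuousAt.2 fun y => (hEd y).continuousAt
    have hEb : ∀ y ≤ x, ‖E y‖ ≤ x - y := fun y hy => by
      simp only [hE]
      rw [norm_div, div_le_iff₀ (norm_pos_iff.2 hμ0)]
      exact (norm_exp_mul_sub_one_le hμre (sub_nonneg.2 hy)).trans_eq (mul_comm _ _)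
    have hEb' : ∀ y ≤ x, ‖E y‖ ≤ 2 / ‖μ‖ := fun y hy => by
      rw [hE, norm_div]
      refine div_le_div_of_nonneg_right ((norm_sub_le _ _).trans ?_) (norm_nonneg _)
      have : ‖exp (μ * ((x - y : ℝ) : ℂ))‖ ≤ 1 := by
        rw [norm_exp, re_mul_ofReal, Real.exp_le_one_iff]
        exact mul_nonpos_of_nonpos_of_nonneg hμre (by linarith)
      rw [norm_one]
      linarith
    have hF : ∀ y, HasDerivAt (fun y => g y + E y * p y - l) (s₀ y + E y * s₁ y) y := fun y => by
      refine (((hg y).add ((hEd y).mul (hp y))).sub_const l).congr_deriv ?_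
      simp only [hE]
      field_simp
      ring
    have hlim : Tendsto (fun y => g y + E y * p y - l) atBot (𝓝 0) := by
      have h1 : Tendsto (fun y => E y * p y) atBot (𝓝 0) := by
        rw [tendsto_zero_iff_norm_tendsto_zero]
        refine tendsto_of_tendsto_of_tendsto_of_le_of_le' tendsto_const_nhds
          (h := fun y => 2 / ‖μ‖ * ‖p y‖) ?_ (Eventually.of_forall fun y => norm_nonneg _)
          ((eventually_le_atBot x).mono fun y hy => ?_)
        · simpa using hpl.norm.const_mul (2 / ‖μ‖)
        · rw [norm_mul]
          exact mul_le_mul_of_nonneg_right (hEb' y hy) (norm_nonneg _)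
      simpa using (hgl.add h1).sub_const l
    have hb : ∀ y ≤ x, ‖s₀ y + E y * s₁ y‖ ≤ w y / 2 * f y := by
      intro y hy
      have hxy : x - y ≤ |x₀| + |y| := by
        have := le_abs_self x₀
        have := neg_abs_le y
        linarith
      have hδ := mul_nonneg (norm_nonneg (q y - a)) (hf0 y)
      calc ‖s₀ y + E y * s₁ y‖ ≤ ‖s₀ y‖ + ‖E y‖ * ‖s₁ y‖ := by
            refine (norm_add_le _ _).trans ?_
            rw [norm_mul]
        _ ≤ ‖q y - a‖ * f y + (|x₀| + |y|) * (K * (‖q y - a‖ * f y)) := by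
            gcongr
            · exact hb₀ y
            · exact (hEb y hy).trans hxy
            · exact hb₁ y
        _ = (1 + (|x₀| + |y|) * K) * (‖q y - a‖ * f y) := by ring
        _ ≤ ((K + 1) * (1 + |x₀|) * (1 + |y|)) * (‖q y - a‖ * f y) := by
            refine mul_le_mul_of_nonneg_right ?_ hδ
            nlinarith [abs_nonneg x₀, abs_nonneg y, mul_nonneg (abs_nonneg x₀) (abs_nonneg y),
              mul_nonneg hK0 (mul_nonneg (abs_nonneg x₀) (abs_nonneg y))]
        _ = w y / 2 * f y := by simp only [hw, hK']; ring
    have := norm_le_integral_Iic_of_hasDerivAt (μ := 0) (x := x) (by simp)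
      (fun y _ => by simpa using hF y) hlim (Continuous.continuousOn (by fun_prop)) hb
      (by
        have := (hfi x).div_const 2
        refine this.congr (Eventually.of_forall fun y => ?_)
        simp only; ring)
    have hEx : E x = 0 := by simp [hE]
    rw [hEx, zero_mul, add_zero] at this
    calc ‖g x‖ = ‖l + (g x - l)‖ := by congr 1; ring
      _ ≤ _ := (norm_add_le _ _).trans (by linarith)
  have hcq : Continuous fun y => (starRingEnd ℂ) (q y - a) :=
    continuous_conj.comp (hqc.sub continuous_const)
  have hcD : ∀ y, ‖(starRingEnd ℂ) (q y - a)‖ = ‖q y - a‖ := fun y => RCLike.norm_conj _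
  have hI : ‖I * (‖a‖ : ℂ) ^ 2 / z‖ ≤ ‖a‖ ^ 2 / ε := by
    rw [norm_div, norm_mul, norm_I, one_mul, norm_pow, norm_real, norm_norm]
    gcongr
  have hbound : ∀ (c d : ℂ) y, ‖c‖ + ‖d‖ ≤ K →
      ‖c * ((q y - a) * v y) + d * ((starRingEnd ℂ) (q y - a) * u y)‖
        ≤ K * (‖q y - a‖ * f y) := by
    intro c d y hcd
    refine (norm_add_le _ _).trans ?_
    rw [norm_mul, norm_mul, norm_mul, norm_mul, hcD]
    have h1 := norm_nonneg (u y)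
    have h2 := norm_nonneg (v y)
    have h3 := norm_nonneg (q y - a)
    have h4 := norm_nonneg c
    have h5 := norm_nonneg d
    calc _ ≤ ‖c‖ * (‖q y - a‖ * f y) + ‖d‖ * (‖q y - a‖ * f y) := by
          simp only [hf]
          gcongr <;> linarith
      _ = (‖c‖ + ‖d‖) * (‖q y - a‖ * f y) := by ring
      _ ≤ _ := by gcongr
  have hbound₀ : ∀ y, ‖(q y - a) * v y‖ ≤ ‖q y - a‖ * f y ∧
      ‖-((starRingEnd ℂ) (q y - a) * u y)‖ ≤ ‖q y - a‖ * f y := by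
    intro y
    have h1 := norm_nonneg (u y)
    have h2 := norm_nonneg (v y)
    rw [norm_neg, norm_mul, norm_mul, hcD]
    constructor <;> (simp only [hf]; gcongr; linarith)
  have hna : ‖(starRingEnd ℂ) a‖ = ‖a‖ := RCLike.norm_conj _
  have ha0 := norm_nonneg a
  have haε : 0 ≤ ‖a‖ ^ 2 / ε := by positivity
  have main : ∀ x ≤ x₀, f x ≤ (1 + ‖a‖ / ε) + ∫ y in Set.Iic x, w y * f y := by
    intro x hx
    -- The limiting matrix `A` has eigenvalues `0` and `μ`, so `A² = μ A`, and `p = A (u, v)`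
    -- satisfies `p' = μ p` up to terms with `q - a`. It tends to `0` because the limit of `(u, v)`
    -- lies in the kernel of `A`.
    have e1 := comp x hx u (fun y => I * (‖a‖ : ℂ) ^ 2 / z * u y + a * v y)
      (fun y => (q y - a) * v y)
      (fun y => (I * (‖a‖ : ℂ) ^ 2 / z) * ((q y - a) * v y)
        + (-a) * ((starRingEnd ℂ) (q y - a) * u y)) 1 (by fun_prop) (by fun_prop)
      (fun y => by
        refine (huv.deriv_fst y).congr_deriv ?_
        ring)
      (fun y => by
        refine (((huv.deriv_fst y).const_mul _).add ((huv.deriv_snd y).const_mul a)).congr_deriv ?_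
        rw [hμ, map_sub]
        field_simp
        linear_combination (-(z ^ 2 * u y)) * haa - (‖a‖ : ℂ) ^ 2 * z ^ 2 * u y * I_sq)
      huv.lim_fst
      (by
        have h0 : I * (‖a‖ : ℂ) ^ 2 / z * 1 + a * (-(I / z) * (starRingEnd ℂ) a) = 0 := by
          rw [← haa]; ring
        rw [← h0]
        exact (huv.lim_fst.const_mul _).add (huv.lim_snd.const_mul a))
      (fun y => (hbound₀ y).1)
      (fun y => hbound _ _ y (by rw [norm_neg]; simp only [hK]; linarith))
    have e2 := comp x hx v (fun y => -(starRingEnd ℂ) a * u y + I * z * v y)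
      (fun y => -((starRingEnd ℂ) (q y - a) * u y))
      (fun y => (-(starRingEnd ℂ) a) * ((q y - a) * v y)
        + (-(I * z)) * ((starRingEnd ℂ) (q y - a) * u y)) (-(I / z) * (starRingEnd ℂ) a)
      (by fun_prop) (by fun_prop)
      (fun y => by
        refine (huv.deriv_snd y).congr_deriv ?_
        rw [map_sub]
        ring)
      (fun y => by
        refine (((huv.deriv_fst y).const_mul _).add ((huv.deriv_snd y).const_mul _)).congr_deriv ?_
        rw [hμ, map_sub]
        field_simp
        linear_combination (-(z * v y)) * haa - (‖a‖ : ℂ) ^ 2 * z * v y * I_sq)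
      huv.lim_snd
      (by
        have h0 : -(starRingEnd ℂ) a * 1 + I * z * (-(I / z) * (starRingEnd ℂ) a) = 0 := by
          field_simp
          linear_combination -(starRingEnd ℂ) a * I_sq
        rw [← h0]
        exact (huv.lim_fst.const_mul _).add (huv.lim_snd.const_mul _))
      (fun y => (hbound₀ y).2)
      (fun y => hbound _ _ y (by
        rw [norm_neg, norm_neg, hna, norm_mul, norm_I, one_mul]; simp only [hK]; linarith))
    rw [norm_one] at e1
    rw [norm_mul, norm_neg, norm_div, norm_I, hna] at e2
    have e3 : 1 / ‖z‖ * ‖a‖ ≤ ‖a‖ / ε := by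
      rw [div_mul_eq_mul_div, one_mul]
      gcongr
    have e4 : ∫ y in Set.Iic x, w y * f y = 2 * ∫ y in Set.Iic x, w y / 2 * f y := by
      rw [← integral_const_mul]
      congr 1
      funext y
      ring
    rw [e4]
    simp only [hf]
    linarith
  exact le_mul_exp_of_le_add_integral_Iic hfc hwc hw0 hwi hfi main

/-! ### Large-`z` expansion of the Jost column -/

open MeasureTheory in
/-- A decaying potential with two integrable derivatives. -/
structure SmoothAtBot (q : ℝ → ℂ) (a : ℂ) (q₁ q₂ : ℝ → ℂ) : Prop extends DecaysAtBot q a where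
  deriv₁ : ∀ x, HasDerivAt q (q₁ x) x
  deriv₂ : ∀ x, HasDerivAt q₁ (q₂ x) x
  cont₂ : Continuous q₂
  lim₁ : Tendsto q₁ atBot (𝓝 0)
  int₁ : ∀ x, IntegrableOn q₁ (Set.Iic x)
  int₂ : ∀ x, IntegrableOn q₂ (Set.Iic x)

/-- Bookkeeping for `SmoothAtBot.xjost_asymptotics`: `κ = i/z` and `ν = 1/μ` count as order `ε =
1/|z|`. Every term has order `ε²` except `ε T`, and this one gains a second `ε` once `t` is known to
be of order `ε`. -/
theorem norm_source_fst_le {κ ν η u t q q' q₁ q₂ : ℂ} {ε h U T Q : ℝ} (hκ : ‖κ‖ ≤ ε)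
    (hν : ‖ν‖ ≤ 2 * ε) (hu : ‖u‖ ≤ U) (ht : ‖t‖ ≤ T) (hq : ‖q‖ ≤ Q) (hq' : ‖q'‖ ≤ Q) (hq₁ : ‖q₁‖ ≤ Q)
    (hη : ‖η‖ ≤ h) (hh₁ : ‖q₁‖ ≤ h) (hh₂ : ‖q₂‖ ≤ h) :
    ‖κ * η * t - κ ^ 2 * q * η * u + κ * ν * (q₂ * u + q₁ * (-κ * η * u + q' * t))‖
      ≤ h * (ε * T + ε ^ 2 * Q * U + 2 * ε ^ 2 * (U + Q * ε * U + Q * T)) := by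
  have hε : 0 ≤ ε := (norm_nonneg _).trans hκ
  have hU : 0 ≤ U := (norm_nonneg _).trans hu
  have hT : 0 ≤ T := (norm_nonneg _).trans ht
  have hQ : 0 ≤ Q := (norm_nonneg _).trans hq
  have hh : 0 ≤ h := (norm_nonneg _).trans hη
  calc _ ≤ ‖κ‖ * ‖η‖ * ‖t‖ + ‖κ‖ ^ 2 * ‖q‖ * ‖η‖ * ‖u‖
        + ‖κ‖ * ‖ν‖ * (‖q₂‖ * ‖u‖ + (‖q₁‖ * (‖κ‖ * ‖η‖ * ‖u‖) + ‖q₁‖ * (‖q'‖ * ‖t‖))) := by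
        refine (norm_add_le _ _).trans (add_le_add ((norm_sub_le _ _).trans (le_of_eq ?_)) ?_)
        · simp only [norm_mul, norm_pow]
        · rw [norm_mul, norm_mul]
          refine mul_le_mul_of_nonneg_left ?_ (by positivity)
          refine (norm_add_le _ _).trans (add_le_add (le_of_eq (norm_mul _ _)) ?_)
          rw [mul_add]
          refine (norm_add_le _ _).trans (le_of_eq ?_)
          simp only [norm_mul, norm_neg]
    _ ≤ ε * h * T + ε ^ 2 * Q * h * U + ε * (2 * ε) * (h * U + (Q * (ε * h * U) + h * (Q * T))) := by
        gcongr
    _ = _ := by ring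

theorem norm_source_snd_le {κ ν η u t q q' q₁ q₁' : ℂ} {ε h U T Q : ℝ} (hκ : ‖κ‖ ≤ ε)
    (hν : ‖ν‖ ≤ 2 * ε) (hu : ‖u‖ ≤ U) (ht : ‖t‖ ≤ T) (hq : ‖q‖ ≤ Q) (hq' : ‖q'‖ ≤ Q)
    (hη : ‖η‖ ≤ h) (hh₁ : ‖q₁‖ ≤ h) (hh₁' : ‖q₁'‖ ≤ h) :
    ‖ν * (q₁ * t + κ * q * η * t + κ * q * q₁' * u - κ ^ 2 * q * q' * η * u)‖
      ≤ h * (2 * ε * (T + ε * Q * T + ε * Q * U + ε ^ 2 * Q ^ 2 * U)) := by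
  have hε : 0 ≤ ε := (norm_nonneg _).trans hκ
  have hU : 0 ≤ U := (norm_nonneg _).trans hu
  have hT : 0 ≤ T := (norm_nonneg _).trans ht
  have hQ : 0 ≤ Q := (norm_nonneg _).trans hq
  have hh : 0 ≤ h := (norm_nonneg _).trans hη
  calc _ ≤ ‖ν‖ * (‖q₁‖ * ‖t‖ + ‖κ‖ * ‖q‖ * ‖η‖ * ‖t‖ + ‖κ‖ * ‖q‖ * ‖q₁'‖ * ‖u‖
        + ‖κ‖ ^ 2 * ‖q‖ * ‖q'‖ * ‖η‖ * ‖u‖) := by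
        rw [norm_mul]
        refine mul_le_mul_of_nonneg_left ?_ (norm_nonneg _)
        refine (norm_sub_le _ _).trans (add_le_add ((norm_add_le _ _).trans (add_le_add
          ((norm_add_le _ _).trans (add_le_add (le_of_eq ?_) (le_of_eq ?_))) (le_of_eq ?_)))
          (le_of_eq ?_)) <;> simp only [norm_mul, norm_pow]
    _ ≤ 2 * ε * (h * T + ε * Q * h * T + ε * Q * h * U + ε ^ 2 * Q * Q * h * U) := by
        gcongr
    _ = _ := by ring

set_option maxHeartbeats 1000000 in
open MeasureTheory in
/-- Large-`z` expansion of the Jost column up to `O(1/z²)`. -/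
theorem SmoothAtBot.xjost_asymptotics {q : ℝ → ℂ} {a : ℂ} {q₁ q₂ : ℝ → ℂ}
    (h : SmoothAtBot q a q₁ q₂) (x₀ : ℝ) : ∃ C R, ∀ z ∈ closedPos ‖a‖, R ≤ ‖z‖ →
      ∀ u v, XJost q a z u v →
        ‖u x₀ - (1 - I / z * ∫ y in Set.Iic x₀, ((‖q y‖ ^ 2 - ‖a‖ ^ 2 : ℝ) : ℂ))‖ ≤ C / ‖z‖ ^ 2 ∧
        ‖v x₀ + I / z * (starRingEnd ℂ) (q x₀)‖ ≤ C / ‖z‖ ^ 2 := by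
  have hqc := h.cont
  have hc₁ : Continuous q₁ := continuous_iff_continuousAt.2 fun x => (h.deriv₂ x).continuousAt
  have hc₂ := h.cont₂
  obtain ⟨Q₀, hQ₀⟩ := exists_norm_le_of_tendsto_atBot hqc h.lim x₀
  obtain ⟨Q₁, hQ₁⟩ := exists_norm_le_of_tendsto_atBot hc₁ h.lim₁ x₀
  set Q : ℝ := max Q₀ Q₁ with hQdef
  have hQq : ∀ y ≤ x₀, ‖q y‖ ≤ Q := fun y hy => (hQ₀ y hy).trans (le_max_left _ _)
  have hQq₁ : ∀ y ≤ x₀, ‖q₁ y‖ ≤ Q := fun y hy => (hQ₁ y hy).trans (le_max_right _ _)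
  have hQ : 0 ≤ Q := (norm_nonneg _).trans (hQq x₀ le_rfl)
  set η : ℝ → ℂ := fun y => ((‖q y‖ ^ 2 - ‖a‖ ^ 2 : ℝ) : ℂ) with hη
  have hηc : Continuous η := by fun_prop
  have hηq : ∀ y, η y = q y * (starRingEnd ℂ) (q y) - (‖a‖ : ℂ) ^ 2 := fun y => by
    rw [mul_conj']; simp only [hη]; push_cast; ring
  have hηi : IntegrableOn η (Set.Iic x₀) := by
    refine Integrable.mono' ((h.integrableOn x₀).const_mul (Q + ‖a‖)) hηc.aestronglyMeasurable
      ((ae_restrict_iff' measurableSet_Iic).2 (Eventually.of_forall fun y hy => ?_))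
    rw [hη, norm_real, Real.norm_eq_abs, sq_sub_sq, abs_mul]
    have h1 : |‖q y‖ + ‖a‖| ≤ Q + ‖a‖ := by
      rw [abs_of_nonneg (by positivity)]
      linarith [hQq y hy]
    exact mul_le_mul h1 (abs_norm_sub_norm_le _ _) (abs_nonneg _) (by positivity)
  set k : ℝ → ℝ := fun y => ‖η y‖ + ‖q₁ y‖ + ‖q₂ y‖ with hk
  have hki : IntegrableOn k (Set.Iic x₀) := (hηi.norm.add (h.int₁ x₀).norm).add (h.int₂ x₀).norm
  have hk0 : ∀ y, 0 ≤ k y := fun y => by positivity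
  set H : ℝ := ∫ y in Set.Iic x₀, k y with hH
  have hH0 : 0 ≤ H := setIntegral_nonneg measurableSet_Iic fun y _ => hk0 y
  -- `C₁` and `C₂` are the coefficients of `ε S` in the first-round bounds for `t` and `u - 1`; `D₁
  -- H` and `D₂ H` collect the terms with `H` in the coefficients of `ε²` in the second round.
  set C₁ : ℝ := (3 + 5 * Q) * H + 2 * Q with hC₁
  set C₂ : ℝ := (1 + 2 * (1 + 2 * Q + Q ^ 2)) * H + 2 * Q with hC₂
  set C₃ : ℝ := C₁ + C₂ with hC₃
  have hC₁0 : 0 ≤ C₁ := by positivity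
  have hC₂0 : 0 ≤ C₂ := by positivity
  have hC₃0 : 0 ≤ C₃ := by positivity
  set D₁ : ℝ := 2 * C₃ + 2 * Q + 2 * (2 + 2 * Q + Q * (2 * C₃)) with hD₁
  set D₂ : ℝ := 2 * C₃ + 2 * (2 * C₃ + Q * (2 * C₃) + 2 * Q + 2 * Q ^ 2) with hD₂
  refine ⟨max (D₁ * H + 4 * Q + 2 * Q * C₃) (D₂ * H + 4 * Q * C₃),
    max (max 1 (2 * ‖a‖)) (2 * C₃), fun z hz hzR u v huv => ?_⟩
  have hz1 : 1 ≤ ‖z‖ := ((le_max_left _ _).trans (le_max_left _ _)).trans hzR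
  have hza : 2 * ‖a‖ ≤ ‖z‖ := ((le_max_right _ _).trans (le_max_left _ _)).trans hzR
  have hzC : 2 * C₃ ≤ ‖z‖ := (le_max_right _ _).trans hzR
  have hz0 := hz.1
  have hn0 : 0 < ‖z‖ := norm_pos_iff.2 hz0
  set ε : ℝ := 1 / ‖z‖ with hε
  have hε0 : 0 ≤ ε := by positivity
  have hε1 : ε ≤ 1 := by rw [hε, div_le_one hn0]; exact hz1
  have hεz : ε * ‖z‖ = 1 := by rw [hε]; field_simp
  set μ := I * (z + (‖a‖ : ℂ) ^ 2 / z) with hμ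
  have hμre : μ.re ≤ 0 := re_I_mul_add_div_nonpos hz
  have hμn : ‖z‖ / 2 ≤ ‖μ‖ := by
    rw [hμ, norm_mul, norm_I, one_mul]
    have h1 : ‖(‖a‖ : ℂ) ^ 2 / z‖ ≤ ‖z‖ / 2 := by
      rw [norm_div, norm_pow, norm_real, norm_norm, div_le_iff₀ hn0]
      nlinarith [norm_nonneg a]
    have h2 := norm_sub_norm_le z (-((‖a‖ : ℂ) ^ 2 / z))
    rw [sub_neg_eq_add, norm_neg] at h2
    linarith
  have hμ0 : μ ≠ 0 := norm_pos_iff.1 (by linarith)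
  set κ := I / z with hκ
  set ν := 1 / μ with hν
  have hκn : ‖κ‖ = ε := by rw [hκ, norm_div, norm_I]
  have hνn : ‖ν‖ ≤ 2 * ε := by
    rw [hν, norm_div, norm_one, hε, div_le_iff₀ (norm_pos_iff.2 hμ0)]
    have : 2 * (1 / ‖z‖) * (‖z‖ / 2) = 1 := by field_simp
    calc (1 : ℝ) = 2 * (1 / ‖z‖) * (‖z‖ / 2) := this.symm
      _ ≤ _ := by gcongr
  have hνμ : ν * μ = 1 := by rw [hν]; field_simp
  have hcu : Continuous u := continuous_iff_continuousAt.2 fun x => (huv.deriv_fst x).continuousAt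
  have hcv : Continuous v := continuous_iff_continuousAt.2 fun x => (huv.deriv_snd x).continuousAt
  set c : ℝ → ℂ := fun y => (starRingEnd ℂ) (q y) with hc
  set c₁ : ℝ → ℂ := fun y => (starRingEnd ℂ) (q₁ y) with hc1
  set c₂ : ℝ → ℂ := fun y => (starRingEnd ℂ) (q₂ y) with hc2
  have hcc : Continuous c := continuous_conj.comp hqc
  have hcc₁ : Continuous c₁ := continuous_conj.comp hc₁
  have hcc₂ : Continuous c₂ := continuous_conj.comp hc₂
  have hdc : ∀ y, HasDerivAt c (c₁ y) y := fun y => (h.deriv₁ y).star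
  have hdc₁ : ∀ y, HasDerivAt c₁ (c₂ y) y := fun y => (h.deriv₂ y).star
  have hcn : ∀ y, ‖c y‖ = ‖q y‖ := fun y => RCLike.norm_conj _
  have hcn₁ : ∀ y, ‖c₁ y‖ = ‖q₁ y‖ := fun y => RCLike.norm_conj _
  have hcn₂ : ∀ y, ‖c₂ y‖ = ‖q₂ y‖ := fun y => RCLike.norm_conj _
  have hμκ : I * z = μ - κ * (‖a‖ : ℂ) ^ 2 := by rw [hμ, hκ]; ring
  have hκz : κ * (I * z) = -1 := by rw [hκ]; field_simp; exact I_sq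
  have hκa : I * (‖a‖ : ℂ) ^ 2 / z = κ * (‖a‖ : ℂ) ^ 2 := by rw [hκ]; ring
  -- the second component without its leading term
  set t : ℝ → ℂ := fun y => v y + κ * c y * u y with ht
  have htc : Continuous t := by fun_prop
  have hdu : ∀ y, HasDerivAt u (-κ * η y * u y + q y * t y) y := fun y => by
    refine (huv.deriv_fst y).congr_deriv ?_
    rw [hκa, hηq y]; simp only [ht, hc]; ring
  have hdt : ∀ y, HasDerivAt t (μ * t y + (κ * η y * t y + κ * c₁ y * u y
      - κ ^ 2 * c y * η y * u y)) y := fun y => by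
    refine ((huv.deriv_snd y).add (((hdc y).const_mul κ).mul (hdu y))).congr_deriv ?_
    have e1 : v y = t y - κ * c y * u y := by simp only [ht]; ring
    have e2 : (starRingEnd ℂ) (q y) = c y := rfl
    rw [e1, e2, hηq y, e2]
    linear_combination (t y) * hμκ - (c y * u y) * hκz
  clear_value κ ν μ
  -- An integration by parts against `e^{μ(x-y)}`: since `ν μ = 1`, the added term cancels the
  -- source `κ c₁ u`, which is only of order `1/z`, at the cost of a second derivative of `q`.
  set V : ℝ → ℂ := fun y => t y + κ * ν * c₁ y * u y with hV
  have hdV : ∀ y, HasDerivAt V (μ * V y + (κ * η y * t y - κ ^ 2 * c y * η y * u y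
      + κ * ν * (c₂ y * u y + c₁ y * (-κ * η y * u y + q y * t y)))) y := fun y => by
    refine ((hdt y).add (((hdc₁ y).const_mul (κ * ν)).mul (hdu y))).congr_deriv ?_
    simp only [hV]
    linear_combination (-(κ * c₁ y * u y)) * hνμ
  -- In the same way, subtracting `ν q t` removes the term `q t` from `u'`, because `ν (μ t) = t`.
  set w : ℝ → ℂ := fun y => u y - ν * q y * t y with hw
  have hdw : ∀ y, HasDerivAt w (-κ * η y * u y - ν * (q₁ y * t y + κ * q y * η y * t y
      + κ * q y * c₁ y * u y - κ ^ 2 * q y * c y * η y * u y)) y := fun y => by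
    refine ((hdu y).sub ((((h.deriv₁ y).const_mul ν).mul (hdt y)))).congr_deriv ?_
    linear_combination (-(q y * t y)) * hνμ
  have hl0 : Tendsto c atBot (𝓝 ((starRingEnd ℂ) a)) := (continuous_conj.tendsto _).comp h.lim
  have hlc₁ : Tendsto c₁ atBot (𝓝 0) := by
    have := (continuous_conj.tendsto _).comp h.lim₁
    rwa [map_zero] at this
  have hlt : Tendsto t atBot (𝓝 0) := by
    have := huv.lim_snd.add ((hl0.const_mul κ).mul huv.lim_fst)
    have h0 : -(I / z) * (starRingEnd ℂ) a + κ * (starRingEnd ℂ) a * 1 = 0 := by rw [hκ]; ring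
    rwa [h0] at this
  have hlV : Tendsto V atBot (𝓝 0) := by
    simpa using hlt.add ((hlc₁.const_mul (κ * ν)).mul huv.lim_fst)
  have hlw : Tendsto w atBot (𝓝 1) := by
    simpa using huv.lim_fst.sub ((h.lim.const_mul ν).mul hlt)
  have hkη : ∀ y, ‖η y‖ ≤ k y := fun y => by simp only [hk]; linarith [norm_nonneg (q₁ y), norm_nonneg (q₂ y)]
  have hk₁ : ∀ y, ‖q₁ y‖ ≤ k y := fun y => by simp only [hk]; linarith [norm_nonneg (η y), norm_nonneg (q₂ y)]
  have hk₂ : ∀ y, ‖q₂ y‖ ≤ k y := fun y => by simp only [hk]; linarith [norm_nonneg (η y), norm_nonneg (q₁ y)]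
  have hHm : ∀ y ≤ x₀, ∀ B, 0 ≤ B → ∫ s in Set.Iic y, k s * B ≤ H * B := by
    intro y hy B hB
    rw [integral_mul_const]
    refine mul_le_mul_of_nonneg_right ?_ hB
    exact setIntegral_mono_set hki (Eventually.of_forall hk0) (Set.Iic_subset_Iic.2 hy).eventuallyLE
  have hkiB : ∀ y ≤ x₀, ∀ B, IntegrableOn (fun s => k s * B) (Set.Iic y) := fun y hy B =>
    (hki.mono_set (Set.Iic_subset_Iic.2 hy)).mul_const B
  clear_value t V w k c c₁ c₂ H η Q
  -- bounds on `V` and `w` from bounds on `u` and `t`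
  have estV : ∀ U T, (∀ y ≤ x₀, ‖u y‖ ≤ U) → (∀ y ≤ x₀, ‖t y‖ ≤ T) → ∀ y ≤ x₀,
      ‖V y‖ ≤ H * (ε * T + ε ^ 2 * Q * U + 2 * ε ^ 2 * (U + Q * ε * U + Q * T)) := by
    intro U T hU hT y hy
    have hU0 : 0 ≤ U := (norm_nonneg _).trans (hU y hy)
    have hT0 : 0 ≤ T := (norm_nonneg _).trans (hT y hy)
    set B : ℝ := ε * T + ε ^ 2 * Q * U + 2 * ε ^ 2 * (U + Q * ε * U + Q * T) with hB
    have hB0 : 0 ≤ B := by positivity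
    have hg : ∀ s ≤ y, ‖κ * η s * t s - κ ^ 2 * c s * η s * u s
        + κ * ν * (c₂ s * u s + c₁ s * (-κ * η s * u s + q s * t s))‖ ≤ k s * B := fun s hs =>
      norm_source_fst_le hκn.le hνn (hU s (hs.trans hy)) (hT s (hs.trans hy))
        ((hcn s).trans_le (hQq s (hs.trans hy))) (hQq s (hs.trans hy))
        ((hcn₁ s).trans_le (hQq₁ s (hs.trans hy)))
        (hkη s) ((hcn₁ s).trans_le (hk₁ s)) ((hcn₂ s).trans_le (hk₂ s))
    exact (norm_le_integral_Iic_of_hasDerivAt hμre (fun s _ => hdV s) hlV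
      (Continuous.continuousOn (by fun_prop)) hg (hkiB y hy B)).trans (hHm y hy B hB0)
  have estw : ∀ U T B (r : ℝ → ℂ), (∀ y ≤ x₀, ‖u y‖ ≤ U) → (∀ y ≤ x₀, ‖t y‖ ≤ T) → 0 ≤ B →
      Continuous r → (∀ y ≤ x₀, ‖r y‖ ≤ B) → ∀ f : ℝ → ℂ,
      (∀ y, HasDerivAt f (-κ * η y * r y - ν * (q₁ y * t y + κ * q y * η y * t y
      + κ * q y * c₁ y * u y - κ ^ 2 * q y * c y * η y * u y)) y) → Tendsto f atBot (𝓝 0) →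
      ∀ y ≤ x₀, ‖f y‖ ≤ H * (ε * B + 2 * ε * (T + ε * Q * T + ε * Q * U + ε ^ 2 * Q ^ 2 * U)) := by
    intro U T B r hU hT hB0 hrc hB f hf hfl y hy
    have hU0 : 0 ≤ U := (norm_nonneg _).trans (hU y hy)
    have hT0 : 0 ≤ T := (norm_nonneg _).trans (hT y hy)
    refine (norm_le_integral_Iic_of_hasDerivAt (μ := 0) (by simp)
      (fun s _ => by simpa using hf s) hfl
      (Continuous.continuousOn (by fun_prop)) (fun s hs => ?_)
      (hkiB y hy _)).trans (hHm y hy _ (by positivity))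
    have hs' := hs.trans hy
    rw [mul_add]
    refine (norm_sub_le _ _).trans (add_le_add ?_ (norm_source_snd_le hκn.le hνn (hU s hs')
      (hT s hs') (hQq s hs') ((hcn s).trans_le (hQq s hs')) (hkη s) (hk₁ s)
      ((hcn₁ s).trans_le (hk₁ s))))
    rw [norm_neg, norm_mul, norm_mul, hκn]
    calc ε * ‖η s‖ * ‖r s‖ ≤ ε * k s * B := by
          have := hk0 s
          gcongr
          · exact hkη s
          · exact hB s hs'
      _ = _ := by ring
  have tV : ∀ y ≤ x₀, ∀ U, ‖u y‖ ≤ U → ‖t y‖ ≤ ‖V y‖ + 2 * ε ^ 2 * Q * U := by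
    intro y hy U hU
    have e : t y = V y - κ * ν * c₁ y * u y := by rw [hV]; ring
    rw [e]
    refine (norm_sub_le _ _).trans (add_le_add le_rfl ?_)
    rw [norm_mul, norm_mul, norm_mul, hκn, hcn₁]
    calc _ ≤ ε * (2 * ε) * Q * U := by
          gcongr
          exact hQq₁ y hy
      _ = _ := by ring
  have νqt : ∀ y ≤ x₀, ∀ T, ‖t y‖ ≤ T → ‖ν * q y * t y‖ ≤ 2 * ε * Q * T := by
    intro y hy T hT
    rw [norm_mul, norm_mul]
    gcongr
    exact hQq y hy
  have hε2 : ε ^ 2 ≤ ε := by nlinarith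
  -- a priori bound
  obtain ⟨S, hSb, hS2⟩ : ∃ S, (∀ y ≤ x₀, ‖u y‖ ≤ S ∧ ‖t y‖ ≤ S) ∧ S ≤ 1 + C₃ * ε * S := by
    obtain ⟨B₁, hB₁⟩ := exists_norm_le_of_tendsto_atBot hcu huv.lim_fst x₀
    obtain ⟨B₂, hB₂⟩ := exists_norm_le_of_tendsto_atBot htc hlt x₀
    -- The supremum `S` over the half-line is finite since both functions have limits at `-∞`. It
    -- satisfies `S ≤ 1 + C₃ ε S`, and the condition `|z| ≥ 2 C₃` makes the last term at most `S /
    -- 2`, whence `S ≤ 2`.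
    set A : Set ℝ := (fun y => max ‖u y‖ ‖t y‖) '' Set.Iic x₀ with hA
    have hAb : BddAbove A := ⟨max B₁ B₂, by
      rintro _ ⟨y, hy, rfl⟩
      exact max_le_max (hB₁ y hy) (hB₂ y hy)⟩
    have hle : ∀ y ≤ x₀, max ‖u y‖ ‖t y‖ ≤ sSup A := fun y hy => le_csSup hAb ⟨y, hy, rfl⟩
    set S := sSup A
    have hu : ∀ y ≤ x₀, ‖u y‖ ≤ S := fun y hy => (le_max_left _ _).trans (hle y hy)
    have ht' : ∀ y ≤ x₀, ‖t y‖ ≤ S := fun y hy => (le_max_right _ _).trans (hle y hy)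
    have hS0 : 0 ≤ S := (norm_nonneg _).trans (hu x₀ le_rfl)
    refine ⟨S, fun y hy => ⟨hu y hy, ht' y hy⟩, ?_⟩
    refine csSup_le ⟨_, x₀, Set.mem_Iic.2 le_rfl, rfl⟩ ?_
    rintro _ ⟨y, hy, rfl⟩
    have b1 : ‖t y‖ ≤ C₁ * ε * S := by
      calc ‖t y‖ ≤ ‖V y‖ + 2 * ε ^ 2 * Q * S := tV y hy S (hu y hy)
        _ ≤ H * (ε * S + ε ^ 2 * Q * S + 2 * ε ^ 2 * (S + Q * ε * S + Q * S))
            + 2 * ε ^ 2 * Q * S := by gcongr; exact estV S S hu ht' y hy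
        _ ≤ H * (ε * S + ε * Q * S + 2 * ε * (S + Q * 1 * S + Q * S)) + 2 * ε * Q * S := by
            gcongr
        _ = C₁ * ε * S := by rw [hC₁]; ring
    have b2 : ‖u y‖ ≤ 1 + C₂ * ε * S := by
      have e : u y = 1 + ((w y - 1) + ν * q y * t y) := by rw [hw]; ring
      rw [e]
      refine (norm_add_le _ _).trans (add_le_add norm_one.le ((norm_add_le _ _).trans ?_))
      calc _ ≤ H * (ε * S + 2 * ε * (S + ε * Q * S + ε * Q * S + ε ^ 2 * Q ^ 2 * S))
            + 2 * ε * Q * S := by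
            refine add_le_add (estw S S S u hu ht' hS0 hcu hu (fun y => w y - 1)
              (fun y => (hdw y).sub_const 1) (by simpa using hlw.sub_const 1) y hy)
              (νqt y hy S (ht' y hy))
        _ ≤ H * (ε * S + 2 * ε * (S + 1 * Q * S + 1 * Q * S + 1 ^ 2 * Q ^ 2 * S))
            + 2 * ε * Q * S := by gcongr
        _ = C₂ * ε * S := by rw [hC₂]; ring
    have h1 : 0 ≤ C₁ * ε * S := by positivity
    have h2 : 0 ≤ C₂ * ε * S := by positivity
    have h3 : C₃ * ε * S = C₁ * ε * S + C₂ * ε * S := by rw [hC₃]; ring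
    refine max_le ?_ ?_ <;> linarith
  have hC₃ε : C₃ * ε ≤ 1 / 2 := by
    have := mul_le_mul_of_nonneg_right hzC hε0
    rw [mul_comm ‖z‖, hεz] at this
    linarith
  have hS0 : 0 ≤ S := (norm_nonneg _).trans (hSb x₀ le_rfl).1
  have hS : S ≤ 2 := by
    have := mul_le_mul_of_nonneg_right hC₃ε hS0
    linarith
  have hu2 : ∀ y ≤ x₀, ‖u y‖ ≤ 2 := fun y hy => (hSb y hy).1.trans hS
  have b1 : ∀ y ≤ x₀, ‖t y‖ ≤ 2 * C₃ * ε := by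
    intro y hy
    calc ‖t y‖ ≤ ‖V y‖ + 2 * ε ^ 2 * Q * S := tV y hy S (hSb y hy).1
      _ ≤ H * (ε * S + ε ^ 2 * Q * S + 2 * ε ^ 2 * (S + Q * ε * S + Q * S))
          + 2 * ε ^ 2 * Q * S := by
          gcongr
          exact estV S S (fun y hy => (hSb y hy).1) (fun y hy => (hSb y hy).2) y hy
      _ ≤ H * (ε * S + ε * Q * S + 2 * ε * (S + Q * 1 * S + Q * S)) + 2 * ε * Q * S := by
          gcongr
      _ = C₁ * ε * S := by rw [hC₁]; ring
      _ ≤ C₃ * ε * 2 := by gcongr; rw [hC₃]; linarith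
      _ = _ := by ring
  have b2 : ∀ y ≤ x₀, ‖u y - 1‖ ≤ 2 * C₃ * ε := by
    intro y hy
    have e : u y - 1 = (w y - 1) + ν * q y * t y := by rw [hw]; ring
    rw [e]
    refine (norm_add_le _ _).trans ?_
    calc _ ≤ H * (ε * S + 2 * ε * (S + ε * Q * S + ε * Q * S + ε ^ 2 * Q ^ 2 * S))
          + 2 * ε * Q * S := by
          refine add_le_add (estw S S S u (fun y hy => (hSb y hy).1) (fun y hy => (hSb y hy).2)
            hS0 hcu (fun y hy => (hSb y hy).1) (fun y => w y - 1)
            (fun y => (hdw y).sub_const 1) (by simpa using hlw.sub_const 1) y hy)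
            (νqt y hy S (hSb y hy).2)
      _ ≤ H * (ε * S + 2 * ε * (S + 1 * Q * S + 1 * Q * S + 1 ^ 2 * Q ^ 2 * S))
          + 2 * ε * Q * S := by gcongr
      _ = C₂ * ε * S := by rw [hC₂]; ring
      _ ≤ C₃ * ε * 2 := by gcongr; rw [hC₃]; linarith
      _ = _ := by ring
  have hdiv : ∀ B : ℝ, B / ‖z‖ ^ 2 = B * ε ^ 2 := fun B => by rw [hε]; ring
  constructor
  · have hηi' : ∀ x, IntegrableOn η (Set.Iic x) := fun x => by
      rcases le_total x x₀ with hx | hx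
      · exact hηi.mono_set (Set.Iic_subset_Iic.2 hx)
      · rw [← Set.Iic_union_Icc_eq_Iic hx]
        exact hηi.union (hηc.integrableOn_Icc)
    have hdI := fun y => hasDerivAt_integral_Iic hηc hηi' y
    -- Adding `κ ∫ η` replaces `-κ η u` in the source by `-κ η (u - 1)`, which is of order `ε²` by
    -- the first round; the added integral is the `1/z` term of the expansion.
    have b3 := estw 2 (2 * C₃ * ε) (2 * C₃ * ε) (fun y => u y - 1) hu2 b1 (by positivity)
      (by fun_prop) b2 (fun y => w y - 1 + κ * ∫ s in Set.Iic y, η s)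
      (fun y => (((hdw y).sub_const 1).add ((hdI y).const_mul κ)).congr_deriv (by ring))
      (by
        have := (hlw.sub_const 1).add ((tendsto_integral_Iic_atBot hηi).const_mul κ)
        simpa using this) x₀ le_rfl
    have e : u x₀ - (1 - κ * ∫ y in Set.Iic x₀, η y)
        = (w x₀ - 1 + κ * ∫ s in Set.Iic x₀, η s) + ν * q x₀ * t x₀ := by rw [hw]; ring
    rw [e, hdiv]
    refine (norm_add_le _ _).trans ((add_le_add b3 (νqt x₀ le_rfl _ (b1 x₀ le_rfl))).trans ?_)
    calc _ ≤ H * (ε * (2 * C₃ * ε) + 2 * ε * (2 * C₃ * ε + 1 * Q * (2 * C₃ * ε) + ε * Q * 2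
            + (ε * 1) * Q ^ 2 * 2)) + 2 * ε * Q * (2 * C₃ * ε) := by
          gcongr
          rw [pow_two]
          gcongr
      _ = (D₂ * H + 4 * Q * C₃) * ε ^ 2 := by rw [hD₂]; ring
      _ ≤ _ := by gcongr; exact le_max_right _ _
  · have b3 := tV x₀ le_rfl 2 (hu2 x₀ le_rfl)
    have b4 := estV 2 (2 * C₃ * ε) hu2 b1 x₀ le_rfl
    have e : v x₀ + κ * (starRingEnd ℂ) (q x₀) = t x₀ - κ * c x₀ * (u x₀ - 1) := by
      simp only [ht, hc]; ring
    rw [e, hdiv]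
    refine (norm_sub_le _ _).trans ?_
    have b5 : ‖κ * c x₀ * (u x₀ - 1)‖ ≤ ε * Q * (2 * C₃ * ε) := by
      rw [norm_mul, norm_mul, hκn, hcn]
      gcongr
      · exact hQq x₀ le_rfl
      · exact b2 x₀ le_rfl
    calc _ ≤ H * (ε * (2 * C₃ * ε) + ε ^ 2 * Q * 2 + 2 * ε ^ 2 * (2 + Q * ε * 2
            + Q * (2 * C₃ * ε))) + 2 * ε ^ 2 * Q * 2 + ε * Q * (2 * C₃ * ε) := by linarith
      _ ≤ H * (ε * (2 * C₃ * ε) + ε ^ 2 * Q * 2 + 2 * ε ^ 2 * (2 + Q * 1 * 2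
            + Q * (2 * C₃ * 1))) + 2 * ε ^ 2 * Q * 2 + ε * Q * (2 * C₃ * ε) := by gcongr
      _ = (D₁ * H + 4 * Q + 2 * Q * C₃) * ε ^ 2 := by rw [hD₁]; ring
      _ ≤ _ := by gcongr; exact le_max_left _ _

/-! ### Linear differential equations and flat systems -/

theorem gronwallBound_le {δ K ε x : ℝ} (hε : 0 ≤ ε) (hK : 0 ≤ K) :
    gronwallBound δ K ε x ≤ (δ + ε * x) * Real.exp (K * x) := by
  rcases hK.eq_or_lt with rfl | hK
  · simp [gronwallBound_K0]
  · rw [gronwallBound_of_K_ne_0 hK.ne', add_mul]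
    refine add_le_add le_rfl ?_
    have h1 : Real.exp (K * x) - 1 ≤ K * x * Real.exp (K * x) := by
      have h2 := Real.add_one_le_exp (-(K * x))
      have h3 := Real.exp_pos (K * x)
      have h4 : Real.exp (-(K * x)) * Real.exp (K * x) = 1 := by rw [← Real.exp_add]; simp
      nlinarith
    calc ε / K * (Real.exp (K * x) - 1) ≤ ε / K * (K * x * Real.exp (K * x)) := by gcongr
      _ = ε * x * Real.exp (K * x) := by field_simp

/-- Gronwall's inequality between two points in either order. -/
theorem norm_le_of_norm_hasDerivAt_le {E : Type*} [NormedAddCommGroup E] [NormedSpace ℝ E]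
    {f f' : ℝ → E} {K ε a b : ℝ} (hK : 0 ≤ K) (hε : 0 ≤ ε) (hf : ∀ x, HasDerivAt f (f' x) x)
    (hb : ∀ x ∈ Set.uIcc a b, ‖f' x‖ ≤ K * ‖f x‖ + ε) :
    ‖f b‖ ≤ (‖f a‖ + ε * |b - a|) * Real.exp (K * |b - a|) := by
  rcases le_total a b with h | h
  · rw [Set.uIcc_of_le h] at hb
    have := norm_le_gronwallBound_of_norm_deriv_right_le (a := a) (b := b)
      (fun x _ => (hf x).continuousAt.continuousWithinAt) (fun x _ => (hf x).hasDerivWithinAt)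
      le_rfl (fun x hx => hb x ⟨hx.1, hx.2.le⟩) b ⟨h, le_rfl⟩
    rw [abs_of_nonneg (by linarith)]
    exact this.trans (gronwallBound_le hε hK)
  · rw [Set.uIcc_of_ge h] at hb
    have hd : ∀ x, HasDerivAt (fun s => f (-s)) (-f' (-x)) x := fun x => by
      have h := (hf (-x)).scomp x (hasDerivAt_neg x)
      rw [neg_one_smul] at h
      exact h
    have := norm_le_gronwallBound_of_norm_deriv_right_le (a := -a) (b := -b)
      (fun x _ => (hd x).continuousAt.continuousWithinAt) (fun x _ => (hd x).hasDerivWithinAt)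
      le_rfl (fun x hx => by
        rw [norm_neg]
        exact hb (-x) ⟨by linarith [hx.2], by linarith [hx.1]⟩) (-b) ⟨by linarith, le_rfl⟩
    simp only [neg_neg] at this
    rw [abs_of_nonpos (by linarith), show -(b - a) = -b - -a by ring]
    exact this.trans (gronwallBound_le hε hK)

/-- Successive terms of the Dyson series of a linear differential equation. -/
noncomputable def dysonTerm {E : Type*} [NormedAddCommGroup E] [NormedSpace ℂ E]
    (A : ℝ → E →L[ℂ] E) (v : E) : ℕ → ℝ → E
  | 0, _ => v
  | n + 1, t => ∫ s in (0 : ℝ)..t, A s (dysonTerm A v n s)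

-- On each bounded interval the iterated integrals are at most `‖v‖ (K|t|)^n / n!`, so both the
-- series and its termwise derivative converge uniformly. No smallness of the interval is needed,
-- which makes the solution global.
open MeasureTheory in
theorem exists_linear_ode {E : Type*} [NormedAddCommGroup E] [NormedSpace ℂ E] [CompleteSpace E]
    {A : ℝ → E →L[ℂ] E} (hA : Continuous A) (v : E) :
    ∃ u : ℝ → E, u 0 = v ∧ ∀ t, HasDerivAt u (A t (u t)) t := by
  set d := dysonTerm A v with hd
  have hdc : ∀ n, Continuous (d n) ∧ ∀ t, HasDerivAt (d (n + 1)) (A t (d n t)) t := by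
    intro n
    have step : ∀ n, Continuous (d n) → ∀ t, HasDerivAt (d (n + 1)) (A t (d n t)) t := by
      intro n hn t
      have hc : Continuous fun s => A s (d n s) := hA.clm_apply hn
      exact intervalIntegral.integral_hasDerivAt_right (hc.intervalIntegrable _ _)
        (hc.stronglyMeasurableAtFilter _ _) hc.continuousAt
    induction n with
    | zero => exact ⟨continuous_const, step 0 continuous_const⟩
    | succ n ih =>
      have h : Continuous (d (n + 1)) := continuous_iff_continuousAt.2 fun t => (ih.2 t).continuousAt
      exact ⟨h, step _ h⟩
  have hbound : ∀ R, 0 ≤ R → ∀ K, 0 ≤ K → (∀ s, |s| ≤ R → ‖A s‖ ≤ K) → ∀ n t, |t| ≤ R →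
      ‖d n t‖ ≤ ‖v‖ * (K ^ n * |t| ^ n / n.factorial) := by
    intro R hR K hK hAK n
    induction n with
    | zero => intro t _; simp [hd, dysonTerm]
    | succ n ih =>
      intro t ht
      change ‖∫ s in (0 : ℝ)..t, A s (d n s)‖ ≤ _
      have hi : Continuous fun s => A s (d n s) := hA.clm_apply (hdc n).1
      have hs : ∀ s ∈ Set.uIoc 0 t, |s| ≤ R := by
        intro s hs
        rcases le_total 0 t with h | h
        · rw [Set.uIoc_of_le h] at hs
          rw [abs_of_pos hs.1]
          exact hs.2.trans ((le_abs_self t).trans ht)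
        · rw [Set.uIoc_of_ge h] at hs
          rw [abs_of_nonpos hs.2]
          linarith [neg_abs_le t, hs.1]
      calc ‖∫ s in (0 : ℝ)..t, A s (d n s)‖ ≤ ∫ s in Set.uIoc 0 t, ‖A s (d n s)‖ :=
            intervalIntegral.norm_integral_le_integral_norm_uIoc
        _ ≤ ∫ s in Set.uIoc 0 t, ‖v‖ * K ^ (n + 1) / n.factorial * |s - 0| ^ n := by
            refine setIntegral_mono_on hi.norm.integrableOn_uIoc
              (Continuous.integrableOn_uIoc (by fun_prop)) measurableSet_uIoc fun s hs' => ?_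
            calc ‖A s (d n s)‖ ≤ ‖A s‖ * ‖d n s‖ := (A s).le_opNorm _
              _ ≤ K * (‖v‖ * (K ^ n * |s| ^ n / n.factorial)) := by
                  gcongr
                  · exact hAK s (hs s hs')
                  · exact ih s (hs s hs')
              _ = _ := by rw [sub_zero]; ring
        _ = _ := by
            rw [integral_const_mul, integral_pow_abs_sub_uIoc, sub_zero, Nat.factorial_succ]
            have : ((n.factorial : ℕ) : ℝ) ≠ 0 := by positivity
            push_cast
            field_simp
  refine ⟨fun t => ∑' n, d n t, ?_, fun t => ?_⟩
  · change ∑' n, d n 0 = v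
    rw [tsum_eq_single 0]
    · rfl
    · intro n hn
      obtain ⟨m, rfl⟩ := Nat.exists_eq_succ_of_ne_zero hn
      simp [hd, dysonTerm]
  · set R : ℝ := |t| + 1 with hR
    have hR0 : 0 ≤ R := by positivity
    obtain ⟨K, hK⟩ := (isCompact_Icc (a := -R) (b := R)).exists_bound_of_continuousOn hA.continuousOn
    have hK' : ∀ s, |s| ≤ R → ‖A s‖ ≤ K := fun s hs => hK s (abs_le.1 hs)
    have hK0 : 0 ≤ K := (norm_nonneg _).trans (hK' 0 (by simpa using hR0))
    have hb := hbound R hR0 K hK0 hK'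
    have hb' : ∀ n s, |s| ≤ R → ‖d n s‖ ≤ ‖v‖ * ((K * R) ^ n / n.factorial) := fun n s hs => by
      refine (hb n s hs).trans ?_
      rw [← mul_pow]
      gcongr
    have hsum : Summable fun n : ℕ => ‖v‖ * ((K * R) ^ n / n.factorial) :=
      (Real.summable_pow_div_factorial _).mul_left _
    have hds : ∀ s, |s| ≤ R → Summable fun n => d n s := fun s hs =>
      Summable.of_norm_bounded hsum fun n => hb' n s hs
    set g : ℕ → ℝ → E := fun n s => Nat.casesOn n 0 fun m => A s (d m s) with hg
    set U : ℕ → ℝ := fun n => Nat.casesOn n 0 fun m => K * (‖v‖ * ((K * R) ^ m / m.factorial)) with hU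
    have hUs : Summable U := by
      rw [← summable_nat_add_iff 1]
      exact hsum.mul_left K
    have hmem : ∀ s ∈ Set.Ioo (-R) R, |s| ≤ R := fun s hs => abs_le.2 ⟨hs.1.le, hs.2.le⟩
    have htR : t ∈ Set.Ioo (-R) R := by
      constructor
      · linarith [neg_abs_le t]
      · linarith [le_abs_self t]
    have key := hasDerivAt_tsum_of_isPreconnected (g := d) (g' := g) (t := Set.Ioo (-R) R) hUs
      isOpen_Ioo isPreconnected_Ioo
      (fun n s hs => by
        cases n with
        | zero => exact hasDerivAt_const s v
        | succ m => exact (hdc m).2 s)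
      (fun n s hs => by
        cases n with
        | zero => simp [hg, hU]
        | succ m =>
          exact ((A s).le_opNorm _).trans (mul_le_mul (hK' s (hmem s hs)) (hb' m s (hmem s hs))
            (norm_nonneg _) hK0))
      htR (hds t (hmem t htR)) htR
    refine key.congr_deriv ?_
    have hgs : Summable fun n => g n t := Summable.of_norm_bounded hUs fun n => by
      cases n with
      | zero => simp [hg, hU]
      | succ m =>
        exact ((A t).le_opNorm _).trans (mul_le_mul (hK' t (hmem t htR)) (hb' m t (hmem t htR))
          (norm_nonneg _) hK0)
    rw [hgs.tsum_eq_zero_add]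
    have : g 0 t = 0 := rfl
    rw [this, zero_add, (A t).map_tsum (hds t (hmem t htR))]

theorem HasDerivAt.complex_clm_apply {E F : Type*} [NormedAddCommGroup E] [NormedSpace ℂ E]
    [NormedAddCommGroup F] [NormedSpace ℂ F] {c : ℝ → E →L[ℂ] F} {c' : E →L[ℂ] F} {u : ℝ → E}
    {u' : E} {x : ℝ} (hc : HasDerivAt c c' x) (hu : HasDerivAt u u' x) :
    HasDerivAt (fun y => c y (u y)) (c' (u x) + c x u') x :=
  ((ContinuousLinearMap.restrictScalarsL ℂ E F ℝ ℝ).hasFDerivAt.comp_hasDerivAt x hc).clm_apply hu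

/-- A solution of the first equation of a flat linear system that satisfies the second one on the
line `x = 0` satisfies it everywhere. -/
theorem hasDerivAt_of_flat {E : Type*} [NormedAddCommGroup E] [NormedSpace ℂ E]
    {X T Xt Tx : ℝ → ℝ → E →L[ℂ] E} (hX : Continuous (Function.uncurry X))
    (hXt : ∀ x t, HasDerivAt (fun s => X x s) (Xt x t) t)
    (hXtc : Continuous (Function.uncurry Xt)) (hTx : ∀ x t, HasDerivAt (fun y => T y t) (Tx x t) x)
    (hflat : ∀ x t v, Xt x t v + X x t (T x t v) = Tx x t v + T x t (X x t v))
    {ψ : ℝ → ℝ → E} (hψ : ∀ x t, HasDerivAt (fun y => ψ y t) (X x t (ψ x t)) x)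
    (hψ₀ : ∀ t, HasDerivAt (fun s => ψ 0 s) (T 0 t (ψ 0 t)) t) (x t : ℝ) :
    HasDerivAt (fun s => ψ x s) (T x t (ψ x t)) t := by
  set S : Set (ℝ × ℝ) := Set.uIcc 0 x ×ˢ Set.Icc (t - 1) (t + 1) with hS
  have hSc : IsCompact S := isCompact_uIcc.prod isCompact_Icc
  obtain ⟨K, hK⟩ := hSc.exists_bound_of_continuousOn hX.continuousOn
  obtain ⟨K₁, hK₁⟩ := hSc.exists_bound_of_continuousOn hXtc.continuousOn
  have hψc : Continuous fun y => ψ y t := continuous_iff_continuousAt.2 fun y => (hψ y t).continuousAt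
  obtain ⟨B, hB⟩ := (isCompact_uIcc (a := 0) (b := x)).exists_bound_of_continuousOn hψc.continuousOn
  have h0mem : (0 : ℝ) ∈ Set.uIcc 0 x := Set.left_mem_uIcc
  have htmem : t ∈ Set.Icc (t - 1) (t + 1) := ⟨by linarith, by linarith⟩
  have hK0 : 0 ≤ K := (norm_nonneg _).trans (hK (0, t) ⟨h0mem, htmem⟩)
  have hK₁0 : 0 ≤ K₁ := (norm_nonneg _).trans (hK₁ (0, t) ⟨h0mem, htmem⟩)
  have hB0 : 0 ≤ B := (norm_nonneg _).trans (hB 0 h0mem)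
  have hsub : ∀ y ∈ Set.uIcc 0 x, Set.uIcc 0 y ⊆ Set.uIcc 0 x := fun y hy =>
    Set.uIcc_subset_uIcc h0mem hy
  have habs : ∀ y ∈ Set.uIcc 0 x, |y - 0| ≤ |x| := fun y hy => by
    simpa using Set.abs_sub_left_of_mem_uIcc hy
  set e : ℝ := Real.exp (K * |x|) with he
  have he0 : 0 < e := Real.exp_pos _
  have hexp : ∀ y ∈ Set.uIcc 0 x, Real.exp (K * |y - 0|) ≤ e := fun y hy =>
    Real.exp_le_exp.2 (mul_le_mul_of_nonneg_left (habs y hy) hK0)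
  have hmv : ∀ y ∈ Set.uIcc 0 x, ∀ h, |h| ≤ 1 → ‖X y (t + h) - X y t‖ ≤ K₁ * |h| := by
    intro y hy h hh
    have := (convex_Icc (t - 1) (t + 1)).norm_image_sub_le_of_norm_hasDerivWithin_le
      (f := fun s => X y s) (f' := fun s => Xt y s) (C := K₁) (x := t) (y := t + h)
      (fun s _ => (hXt y s).hasDerivWithinAt) (fun s hs => hK₁ (y, s) ⟨hy, hs⟩) htmem
      ⟨by linarith [(abs_le.1 hh).1], by linarith [(abs_le.1 hh).2]⟩
    simpa using this
  -- Lipschitz dependence on time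
  obtain ⟨C, hC0, hC⟩ : ∃ C, 0 ≤ C ∧ ∀ᶠ h in 𝓝 (0 : ℝ), ∀ y ∈ Set.uIcc 0 x,
      ‖ψ y (t + h) - ψ y t‖ ≤ C * |h| := by
    have hO := (hasDerivAt_iff_isLittleO_nhds_zero.1 (hψ₀ t)).bound (zero_lt_one)
    set C₀ := 1 + ‖T 0 t (ψ 0 t)‖ with hC₀
    refine ⟨(C₀ + K₁ * B * |x|) * e, by positivity, ?_⟩
    filter_upwards [hO, Metric.closedBall_mem_nhds (0 : ℝ) one_pos] with h hh hh1 y hy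
    have hh1 : |h| ≤ 1 := by simpa using hh1
    have h0 : ‖ψ 0 (t + h) - ψ 0 t‖ ≤ C₀ * |h| := by
      have h2 : ψ 0 (t + h) - ψ 0 t
          = (ψ 0 (t + h) - ψ 0 t - h • T 0 t (ψ 0 t)) + h • T 0 t (ψ 0 t) := by abel
      rw [h2]
      refine (norm_add_le _ _).trans ?_
      rw [norm_smul]
      rw [Real.norm_eq_abs] at hh ⊢
      rw [hC₀]
      linarith
    have key := norm_le_of_norm_hasDerivAt_le (f := fun y => ψ y (t + h) - ψ y t)
      (f' := fun y => X y (t + h) (ψ y (t + h)) - X y t (ψ y t)) (a := 0) (b := y) hK0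
      (ε := K₁ * |h| * B) (by positivity) (fun y => (hψ y (t + h)).sub (hψ y t))
      (fun s hs => by
        have hs' := hsub y hy hs
        have e1 : X s (t + h) (ψ s (t + h)) - X s t (ψ s t)
            = X s (t + h) (ψ s (t + h) - ψ s t) + (X s (t + h) - X s t) (ψ s t) := by
          simp
        rw [e1]
        refine (norm_add_le _ _).trans (add_le_add ?_ ?_)
        · refine ((X s (t + h)).le_opNorm _).trans (mul_le_mul_of_nonneg_right ?_ (norm_nonneg _))
          exact hK (s, t + h) ⟨hs', by linarith [(abs_le.1 hh1).1], by linarith [(abs_le.1 hh1).2]⟩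
        · refine (ContinuousLinearMap.le_opNorm _ _).trans ?_
          exact mul_le_mul (hmv s hs' h hh1) (hB s hs') (norm_nonneg _) (by positivity))
    calc _ ≤ _ := key
      _ ≤ (C₀ * |h| + K₁ * |h| * B * |x|) * e := by
          have h5 := habs y hy
          have h6 := hexp y hy
          gcongr
      _ = _ := by ring
  rw [hasDerivAt_iff_isLittleO_nhds_zero, Asymptotics.isLittleO_iff]
  intro c hc
  -- Chosen so that the last Gronwall bound comes out as `c / 2 * |h|`.
  set ε : ℝ := c / (2 * (1 + (B + C + 1) * |x|) * e) with hε
  have hε0 : 0 < ε := by positivity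
  -- The first-order expansion of `X` in time, uniform for `y` between `0` and `x`: mean value
  -- inequality together with uniform continuity of `Xt` on a compact rectangle.
  have hunif : ∀ᶠ h in 𝓝 (0 : ℝ), ∀ y ∈ Set.uIcc 0 x,
      ‖X y (t + h) - X y t - h • Xt y t‖ ≤ ε * |h| := by
    have huc := hSc.uniformContinuousOn_of_continuous hXtc.continuousOn
    obtain ⟨δ, hδ, hδ'⟩ := Metric.uniformContinuousOn_iff_le.1 huc ε hε0
    have hm : 0 < min δ 1 := lt_min hδ one_pos
    filter_upwards [Metric.closedBall_mem_nhds (0 : ℝ) hm] with h hh y hy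
    have hh' : |h| ≤ min δ 1 := by simpa using hh
    have hh1 := hh'.trans (min_le_right _ _)
    have hhδ := hh'.trans (min_le_left _ _)
    have hsI : Set.uIcc t (t + h) ⊆ Set.Icc (t - 1) (t + 1) := by
      exact Set.uIcc_subset_Icc htmem
        ⟨by linarith [(abs_le.1 hh1).1], by linarith [(abs_le.1 hh1).2]⟩
    have := (convex_uIcc t (t + h)).norm_image_sub_le_of_norm_hasDerivWithin_le
      (f := fun s => X y s - (s - t) • Xt y t) (f' := fun s => Xt y s - (1 : ℝ) • Xt y t) (C := ε)
      (x := t) (y := t + h)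
      (fun s _ => ((hXt y s).sub (((hasDerivAt_id s).sub_const t).smul_const
        (Xt y t))).hasDerivWithinAt)
      (fun s hs => by
        rw [one_smul]
        have := hδ' (y, s) ⟨hy, hsI hs⟩ (y, t) ⟨hy, htmem⟩ (by
          rw [Prod.dist_eq, dist_self, Real.dist_eq]
          refine max_le hδ.le ((Set.abs_sub_left_of_mem_uIcc hs).trans ?_)
          simpa using hhδ)
        rwa [dist_eq_norm] at this) Set.left_mem_uIcc Set.right_mem_uIcc
    simp only [sub_self, zero_smul, sub_zero, add_sub_cancel_left] at this
    rw [sub_right_comm] at this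
    simpa [Real.norm_eq_abs] using this
  have h0o := (hasDerivAt_iff_isLittleO_nhds_zero.1 (hψ₀ t)).bound hε0
  have hsmall : ∀ᶠ h in 𝓝 (0 : ℝ), K₁ * C * |h| ≤ ε := by
    have : Tendsto (fun h : ℝ => K₁ * C * |h|) (𝓝 0) (𝓝 (K₁ * C * |0|)) :=
      (Continuous.tendsto (by fun_prop) 0)
    rw [abs_zero, mul_zero] at this
    exact (this.eventually (gt_mem_nhds hε0)).mono fun h hh => hh.le
  filter_upwards [hC, hunif, h0o, hsmall, Metric.closedBall_mem_nhds (0 : ℝ) one_pos]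
    with h h1 h2 h3 h4 h5
  have h5 : |h| ≤ 1 := by simpa using h5
  -- By flatness the remainder `ψ(t+h) - ψ(t) - h T ψ(t)` solves the `x`-equation up to a source
  -- `o(h)`. At `x = 0` it is `o(h)` by hypothesis, so Gronwall in `x` keeps it `o(h)`.
  have key := norm_le_of_norm_hasDerivAt_le
    (f := fun y => ψ y (t + h) - ψ y t - h • T y t (ψ y t))
    (f' := fun y => X y (t + h) (ψ y (t + h)) - X y t (ψ y t)
      - h • (Tx y t (ψ y t) + T y t (X y t (ψ y t)))) (a := 0) (b := x) hK0
    (ε := ε * |h| * (B + C + 1)) (by positivity)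
    (fun y => ((hψ y (t + h)).sub (hψ y t)).sub
      (((hTx y t).complex_clm_apply (hψ y t)).const_smul h))
    (fun s hs => by
      have e1 : X s (t + h) (ψ s (t + h)) - X s t (ψ s t)
          - h • (Tx s t (ψ s t) + T s t (X s t (ψ s t)))
          = X s t (ψ s (t + h) - ψ s t - h • T s t (ψ s t))
            + ((X s (t + h) - X s t - h • Xt s t) (ψ s (t + h))
              + h • Xt s t (ψ s (t + h) - ψ s t)) := by
        rw [← hflat]
        simp only [map_sub, _root_.sub_apply, _root_.smul_apply,
          smul_add, smul_sub]
        have : X s t (h • T s t (ψ s t)) = h • X s t (T s t (ψ s t)) :=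
          (X s t).map_smul_of_tower h _
        rw [this]
        abel
      rw [e1]
      refine (norm_add_le _ _).trans (add_le_add ?_ ?_)
      · exact ((X s t).le_opNorm _).trans (mul_le_mul_of_nonneg_right (hK (s, t) ⟨hs, htmem⟩)
          (norm_nonneg _))
      · have hb : ‖ψ s (t + h)‖ ≤ B + C := by
          have e2 : ψ s (t + h) = ψ s t + (ψ s (t + h) - ψ s t) := by abel
          rw [e2]
          refine (norm_add_le _ _).trans (add_le_add (hB s hs) ((h1 s hs).trans ?_))
          exact mul_le_of_le_one_right hC0 h5
        calc _ ≤ ε * |h| * (B + C) + |h| * (K₁ * (C * |h|)) := by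
              refine (norm_add_le _ _).trans (add_le_add ?_ ?_)
              · exact (ContinuousLinearMap.le_opNorm _ _).trans
                  (mul_le_mul (h2 s hs) hb (norm_nonneg _) (by positivity))
              · rw [norm_smul, Real.norm_eq_abs]
                refine mul_le_mul_of_nonneg_left ?_ (abs_nonneg _)
                exact (ContinuousLinearMap.le_opNorm _ _).trans
                  (mul_le_mul (hK₁ (s, t) ⟨hs, htmem⟩) (h1 s hs) (norm_nonneg _) hK₁0)
          _ ≤ ε * |h| * (B + C) + |h| * ε := by
              gcongr
              linarith
          _ = _ := by ring)
  rw [sub_zero, Real.norm_eq_abs] at *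
  calc _ ≤ _ := key
    _ ≤ (ε * |h| + ε * |h| * (B + C + 1) * |x|) * e := by gcongr
    _ = (ε * ((1 + (B + C + 1) * |x|) * e)) * |h| := by ring
    _ ≤ c * |h| := by
        gcongr
        rw [hε]
        have : c / (2 * (1 + (B + C + 1) * |x|) * e) * ((1 + (B + C + 1) * |x|) * e) = c / 2 := by
          field_simp
        rw [this]
        linarith

/-! ### The Lax pair and its simultaneous solutions -/

/-- The continuous linear map with the given matrix entries. -/
noncomputable def mat2 (a b c d : ℂ) : (Fin 2 → ℂ) →L[ℂ] (Fin 2 → ℂ) :=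
  a • (ContinuousLinearMap.proj 0).smulRight ![1, 0]
    + b • (ContinuousLinearMap.proj 1).smulRight ![1, 0]
    + c • (ContinuousLinearMap.proj 0).smulRight ![0, 1]
    + d • (ContinuousLinearMap.proj 1).smulRight ![0, 1]

theorem mat2_apply (a b c d : ℂ) (v : Fin 2 → ℂ) :
    mat2 a b c d v = ![a * v 0 + b * v 1, c * v 0 + d * v 1] := by
  ext i
  fin_cases i <;> simp [mat2]

theorem mat2_eq_mulVec (a b c d : ℂ) (v : Fin 2 → ℂ) :
    mat2 a b c d v = !![a, b; c, d] *ᵥ v := by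
  rw [mat2_apply]
  ext i
  fin_cases i <;> simp [Matrix.mulVec, dotProduct, Fin.sum_univ_two]

theorem HasDerivAt.mat2 {a b c d : ℝ → ℂ} {a' b' c' d' : ℂ} {x : ℝ} (ha : HasDerivAt a a' x)
    (hb : HasDerivAt b b' x) (hc : HasDerivAt c c' x) (hd : HasDerivAt d d' x) :
    HasDerivAt (fun y => mat2 (a y) (b y) (c y) (d y)) (mat2 a' b' c' d') x := by
  have key : ∀ {f : ℝ → ℂ} {f' : ℂ} (_ : HasDerivAt f f' x) (E : (Fin 2 → ℂ) →L[ℂ] (Fin 2 → ℂ)),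
      HasDerivAt (fun y => f y • E) (f' • E) x := fun hf E => hf.smul_const E
  exact (((key ha _).add (key hb _)).add (key hc _)).add (key hd _)

theorem Continuous.mat2 {α : Type*} [TopologicalSpace α] {a b c d : α → ℂ} (ha : Continuous a)
    (hb : Continuous b) (hc : Continuous c) (hd : Continuous d) :
    Continuous fun y => mat2 (a y) (b y) (c y) (d y) :=
  (((ha.smul continuous_const).add (hb.smul continuous_const)).add
    (hc.smul continuous_const)).add (hd.smul continuous_const)

/-- The matrix `X` of the Lax pair as a function of the values of `k` and `q`. -/
noncomputable def laxXMap (k q : ℂ) : (Fin 2 → ℂ) →L[ℂ] (Fin 2 → ℂ) :=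
  mat2 (-(I * k)) q (-(starRingEnd ℂ) q) (I * k)

/-- The matrix `T` of the Lax pair as a function of the values of `k`, `q₀²`, `q` and `q_x`. -/
noncomputable def laxTMap (k m q p : ℂ) : (Fin 2 → ℂ) →L[ℂ] (Fin 2 → ℂ) :=
  mat2 (-(I * k ^ 2) - I / 2 * (m - q * (starRingEnd ℂ) q)) (k * q + I / 2 * p)
    (-(k * (starRingEnd ℂ) q) + I / 2 * (starRingEnd ℂ) p)
    (I * k ^ 2 + I / 2 * (m - q * (starRingEnd ℂ) q))

/-- A linear differential equation has a unique solution with a given value at `0`. -/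
theorem linear_ode_unique {E : Type*} [NormedAddCommGroup E] [NormedSpace ℂ E]
    {A : ℝ → E →L[ℂ] E} (hA : Continuous A) {u v : ℝ → E} (hu : ∀ t, HasDerivAt u (A t (u t)) t)
    (hv : ∀ t, HasDerivAt v (A t (v t)) t) (h0 : u 0 = v 0) : u = v := by
  funext t
  obtain ⟨K, hK⟩ := (isCompact_uIcc (a := 0) (b := t)).exists_bound_of_continuousOn hA.continuousOn
  have hK0 : 0 ≤ K := (norm_nonneg _).trans (hK 0 Set.left_mem_uIcc)
  have := norm_le_of_norm_hasDerivAt_le (f := fun s => u s - v s) (ε := 0) (a := 0) (b := t) hK0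
    le_rfl (fun s => (hu s).sub (hv s)) (fun s hs => by
      rw [← map_sub, add_zero]
      exact ((A s).le_opNorm _).trans (mul_le_mul_of_nonneg_right (hK s hs) (norm_nonneg _)))
  simp only [h0, sub_self, norm_zero, zero_mul, add_zero] at this
  exact sub_eq_zero.1 (norm_le_zero_iff.1 this)

namespace KEPotential

variable {P : KEPotential}

theorem laxX_mulVec (z : ℂ) (x t : ℝ) (v : Fin 2 → ℂ) :
    P.laxX z x t *ᵥ v = laxXMap (P.kk z) (P.q x t) v := by
  rw [laxXMap, mat2_eq_mulVec]
  congr 1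
  ext i j
  fin_cases i <;> fin_cases j <;> simp [laxX, sigma3, offDiag]

theorem laxT_mulVec (z : ℂ) (x t : ℝ) (v : Fin 2 → ℂ) :
    P.laxT z x t *ᵥ v = laxTMap (P.kk z) ((P.q0 : ℂ) ^ 2) (P.q x t) (P.qx x t) v := by
  rw [laxTMap, mat2_eq_mulVec]
  congr 1
  ext i j
  fin_cases i <;> fin_cases j <;> 
    simp [laxT, sigma3, offDiag, Matrix.one_fin_two] <;> ring

theorem asympY_apply (a z : ℂ) :
    asympY a z = !![1, -(I / z * a); -(I / z * (starRingEnd ℂ) a), 1] := by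
  ext i j
  fin_cases i <;> fin_cases j <;> simp [asympY, sigma3, offDiag]

theorem expTheta_zero (x t : ℝ) (z : ℂ) : P.expTheta x t z 0 = exp (I * P.theta x t z) := by
  simp [expTheta, sigma3]

theorem expTheta_one (x t : ℝ) (z : ℂ) : P.expTheta x t z 1 = exp (-(I * P.theta x t z)) := by
  simp [expTheta, sigma3]

namespace Admissible

variable (hP : P.Admissible)

include hP

theorem q0_pos : 0 < P.q0 := norm_pos_iff.2 hP.qm_ne

theorem contDiff_q : ContDiff ℝ 2 (fun p : ℝ × ℝ => P.q p.1 p.2) := hP.smooth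

theorem continuous_q : Continuous fun p : ℝ × ℝ => P.q p.1 p.2 := hP.smooth.continuous

theorem hasDerivAt_q (x t : ℝ) : HasDerivAt (fun y => P.q y t) (P.qx x t) x := by
  have : ContDiff ℝ 2 fun y => P.q y t := hP.contDiff_q.comp (contDiff_id.prodMk contDiff_const)
  exact (this.differentiable (by norm_num) x).hasDerivAt

theorem qx_eq (x t : ℝ) : P.qx x t = fderiv ℝ (fun p : ℝ × ℝ => P.q p.1 p.2) (x, t) (1, 0) := by
  have h := (hP.contDiff_q.differentiable (by norm_num) (x, t)).hasFDerivAt.comp_hasDerivAt x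
    ((hasDerivAt_id x).prodMk (hasDerivAt_const x t))
  exact h.deriv

theorem hasDerivAt_q_snd (x t : ℝ) : HasDerivAt (fun s => P.q x s)
    (fderiv ℝ (fun p : ℝ × ℝ => P.q p.1 p.2) (x, t) (0, 1)) t :=
  (hP.contDiff_q.differentiable (by norm_num) (x, t)).hasFDerivAt.comp_hasDerivAt t
    ((hasDerivAt_const t x).prodMk (hasDerivAt_id t))

theorem contDiff_qx : ContDiff ℝ 1 fun p : ℝ × ℝ => P.qx p.1 p.2 := by
  have h : ContDiff ℝ 1 (fderiv ℝ fun p : ℝ × ℝ => P.q p.1 p.2) :=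
    hP.contDiff_q.fderiv_right (by norm_num)
  have h2 : (fun p : ℝ × ℝ => P.qx p.1 p.2)
      = fun p => fderiv ℝ (fun p : ℝ × ℝ => P.q p.1 p.2) p (1, 0) :=
    funext fun p => hP.qx_eq p.1 p.2
  rw [h2]
  exact h.clm_apply contDiff_const

theorem continuous_qx : Continuous fun p : ℝ × ℝ => P.qx p.1 p.2 := hP.contDiff_qx.continuous

theorem continuous_deriv_snd : Continuous fun p : ℝ × ℝ => deriv (fun s => P.q p.1 s) p.2 := by
  have h : ContDiff ℝ 1 (fderiv ℝ fun p : ℝ × ℝ => P.q p.1 p.2) :=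
    hP.contDiff_q.fderiv_right (by norm_num)
  have h2 : (fun p : ℝ × ℝ => deriv (fun s => P.q p.1 s) p.2)
      = fun p => fderiv ℝ (fun p : ℝ × ℝ => P.q p.1 p.2) p (0, 1) :=
    funext fun p => (hP.hasDerivAt_q_snd p.1 p.2).deriv
  rw [h2]
  exact (h.clm_apply contDiff_const).continuous

theorem hasDerivAt_q_time (x t : ℝ) :
    HasDerivAt (fun s => P.q x s) (deriv (fun s => P.q x s) t) t :=
  (hP.hasDerivAt_q_snd x t).differentiableAt.hasDerivAt

theorem hasDerivAt_qx (x t : ℝ) : HasDerivAt (fun y => P.qx y t) (P.qxx x t) x := by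
  have : ContDiff ℝ 1 fun y => P.qx y t := hP.contDiff_qx.comp (contDiff_id.prodMk contDiff_const)
  exact (this.differentiable (by norm_num) x).hasDerivAt

theorem continuous_qxx (t : ℝ) : Continuous fun x => P.qxx x t := by
  have : ContDiff ℝ 1 fun y => P.qx y t := hP.contDiff_qx.comp (contDiff_id.prodMk contDiff_const)
  exact this.continuous_deriv le_rfl

theorem smoothAtBot (t : ℝ) :
    SmoothAtBot (fun x => P.q x t) P.qm (fun x => P.qx x t) (fun x => P.qxx x t) where
  ne := hP.qm_ne
  cont := hP.continuous_q.comp (continuous_id.prodMk continuous_const)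
  lim := (hP.lim_bot.tendstoLocallyUniformlyOn (s := Set.univ)).tendsto_at (Set.mem_univ t)
  moment x := by
    have hc : Continuous fun y : ℝ => (1 + |y|) * ‖P.q y t - P.qm‖ :=
      (by fun_prop : Continuous fun y : ℝ => 1 + |y|).mul
        ((hP.continuous_q.comp (continuous_id.prodMk continuous_const)).sub continuous_const).norm
    rcases le_total x 0 with h | h
    · exact (hP.moment_bot t).mono_set (Set.Iic_subset_Iic.2 h)
    · rw [← Set.Iic_union_Icc_eq_Iic h]
      exact (hP.moment_bot t).union hc.continuousOn.integrableOn_Icc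
  deriv₁ x := hP.hasDerivAt_q x t
  deriv₂ x := hP.hasDerivAt_qx x t
  cont₂ := hP.continuous_qxx t
  lim₁ := (hP.lim_qx_bot.tendstoLocallyUniformlyOn (s := Set.univ)).tendsto_at (Set.mem_univ t)
  int₁ x := (hP.integrable_qx t).integrableOn
  int₂ x := (hP.integrable_qxx t).integrableOn

theorem continuous_laxXMap (k : ℂ) : Continuous fun p : ℝ × ℝ => laxXMap k (P.q p.1 p.2) :=
  continuous_const.mat2 hP.continuous_q (continuous_conj.comp hP.continuous_q).neg continuous_const

theorem continuous_laxTMap (k m : ℂ) :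
    Continuous fun p : ℝ × ℝ => laxTMap k m (P.q p.1 p.2) (P.qx p.1 p.2) := by
  have h1 := hP.continuous_q
  have h2 := hP.continuous_qx
  refine Continuous.mat2 ?_ ?_ ?_ ?_ <;> fun_prop

omit hP in
theorem jost_deriv_eq {z : ℂ} {ψ : ℝ → ℝ → Fin 2 → ℂ} {a : ℂ} {l : Filter ℝ} {j : Fin 2}
    (h : P.IsJost l a j z ψ) :
    (∀ x t, HasDerivAt (fun y => ψ y t) (laxXMap (P.kk z) (P.q x t) (ψ x t)) x) ∧
    (∀ x t, HasDerivAt (fun s => ψ x s)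
      (laxTMap (P.kk z) ((P.q0 : ℂ) ^ 2) (P.q x t) (P.qx x t) (ψ x t)) t) :=
  ⟨fun x t => P.laxX_mulVec z x t _ ▸ h.1 x t, fun x t => P.laxT_mulVec z x t _ ▸ h.2.1 x t⟩

/-- Zero curvature, `X_t + X T = T_x + T X`. Its diagonal entries are identities; the off-diagonal
ones are the equation for `q` and its complex conjugate. -/
theorem flat (k : ℂ) (x t : ℝ) (v : Fin 2 → ℂ) :
    mat2 0 (deriv (fun s => P.q x s) t) (-(starRingEnd ℂ) (deriv (fun s => P.q x s) t)) 0 v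
      + laxXMap k (P.q x t) (laxTMap k ((P.q0 : ℂ) ^ 2) (P.q x t) (P.qx x t) v)
    = mat2 (I / 2 * (P.qx x t * (starRingEnd ℂ) (P.q x t) + P.q x t * (starRingEnd ℂ) (P.qx x t)))
        (k * P.qx x t + I / 2 * P.qxx x t)
        (-(k * (starRingEnd ℂ) (P.qx x t)) + I / 2 * (starRingEnd ℂ) (P.qxx x t))
        (-(I / 2 * (P.qx x t * (starRingEnd ℂ) (P.q x t)
          + P.q x t * (starRingEnd ℂ) (P.qx x t)))) v
      + laxTMap k ((P.q0 : ℂ) ^ 2) (P.q x t) (P.qx x t) (laxXMap k (P.q x t) v) := by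
  have h := hP.nls x t
  rw [← mul_conj'] at h
  have h' := congrArg (starRingEnd ℂ) h
  simp only [map_add, map_mul, map_sub, map_pow, conj_I, conj_conj, conj_ofReal, map_div₀, map_one,
    map_ofNat, map_zero] at h'
  simp only [laxXMap, laxTMap, mat2_apply]
  have hI : I ^ 2 = -1 := I_sq
  ext i
  fin_cases i
  · simp only [Fin.zero_eta, Pi.add_apply, cons_val_zero, cons_val_one]
    linear_combination (-I * v 1) * h + (v 1 * deriv (fun s => P.q x s) t - v 1 * k * P.qx x t) * hI
  · simp only [Fin.mk_one, Pi.add_apply, cons_val_zero, cons_val_one]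
    linear_combination (-I * v 0) * h' - (v 0 * (starRingEnd ℂ) (deriv (fun s => P.q x s) t)
      - v 0 * k * (starRingEnd ℂ) (P.qx x t)) * hI

theorem hasDerivAt_laxTMap (k : ℂ) (x t : ℝ) :
    HasDerivAt (fun y => laxTMap k ((P.q0 : ℂ) ^ 2) (P.q y t) (P.qx y t))
      (mat2 (I / 2 * (P.qx x t * (starRingEnd ℂ) (P.q x t) + P.q x t * (starRingEnd ℂ) (P.qx x t)))
        (k * P.qx x t + I / 2 * P.qxx x t)
        (-(k * (starRingEnd ℂ) (P.qx x t)) + I / 2 * (starRingEnd ℂ) (P.qxx x t))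
        (-(I / 2 * (P.qx x t * (starRingEnd ℂ) (P.q x t)
          + P.q x t * (starRingEnd ℂ) (P.qx x t))))) x := by
  have h1 := hP.hasDerivAt_q x t
  have h2 := hP.hasDerivAt_qx x t
  have h1' : HasDerivAt (fun y => (starRingEnd ℂ) (P.q y t)) ((starRingEnd ℂ) (P.qx x t)) x :=
    h1.star
  have h2' : HasDerivAt (fun y => (starRingEnd ℂ) (P.qx y t)) ((starRingEnd ℂ) (P.qxx x t)) x :=
    h2.star
  have h3 := ((h1.mul h1').const_sub ((P.q0 : ℂ) ^ 2)).const_mul (I / 2)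
  refine ((h3.const_sub _).congr_deriv ?_).mat2 ((h1.const_mul k).add (h2.const_mul (I / 2)))
    ((h1'.const_mul k).neg.add (h2'.const_mul (I / 2))) ((h3.const_add _).congr_deriv ?_) <;> ring

/-- The simultaneous solution of the Lax pair with prescribed restriction to `t = 0`. -/
theorem exists_lax_solution (z : ℂ) {φ : ℝ → Fin 2 → ℂ}
    (hφ : ∀ x, HasDerivAt φ (laxXMap (P.kk z) (P.q x 0) (φ x)) x) :
    ∃ ψ : ℝ → ℝ → Fin 2 → ℂ, (∀ x, ψ x 0 = φ x) ∧
      (∀ x t, HasDerivAt (fun y => ψ y t) (laxXMap (P.kk z) (P.q x t) (ψ x t)) x) ∧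
      ∀ x t, HasDerivAt (fun s => ψ x s)
        (laxTMap (P.kk z) ((P.q0 : ℂ) ^ 2) (P.q x t) (P.qx x t) (ψ x t)) t := by
  have hTc : Continuous fun t => laxTMap (P.kk z) ((P.q0 : ℂ) ^ 2) (P.q 0 t) (P.qx 0 t) :=
    (hP.continuous_laxTMap (P.kk z) ((P.q0 : ℂ) ^ 2)).comp (f := fun t : ℝ => ((0 : ℝ), t))
      (by fun_prop)
  -- Solve in time along `x = 0`, then in `x` from each point of that line. Flatness yields the time
  -- equation elsewhere, and uniqueness in `x` recovers `φ` at time `0`.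
  obtain ⟨g, hg0, hg⟩ := exists_linear_ode hTc (φ 0)
  have hXc : ∀ t, Continuous fun x => laxXMap (P.kk z) (P.q x t) := fun t =>
    (hP.continuous_laxXMap (P.kk z)).comp (f := fun x : ℝ => (x, t)) (by fun_prop)
  choose w hw0 hw using fun t => exists_linear_ode (hXc t) (g t)
  have hXt : ∀ x t, HasDerivAt (fun s => laxXMap (P.kk z) (P.q x s))
      (mat2 0 (deriv (fun s => P.q x s) t) (-(starRingEnd ℂ) (deriv (fun s => P.q x s) t)) 0) t :=
    fun x t => (hasDerivAt_const t _).mat2 (hP.hasDerivAt_q_time x t)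
      (hP.hasDerivAt_q_time x t).star.neg (hasDerivAt_const t _)
  have hXtc : Continuous (Function.uncurry fun x t => mat2 0 (deriv (fun s => P.q x s) t)
      (-(starRingEnd ℂ) (deriv (fun s => P.q x s) t)) 0) :=
    continuous_const.mat2 hP.continuous_deriv_snd
      (continuous_conj.comp hP.continuous_deriv_snd).neg continuous_const
  have hw₀ : ∀ t, HasDerivAt (fun s => w s 0)
      (laxTMap (P.kk z) ((P.q0 : ℂ) ^ 2) (P.q 0 t) (P.qx 0 t) (w t 0)) t := fun t => by
    have : (fun s => w s 0) = g := funext hw0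
    rw [this, hw0]
    exact hg t
  have hflat := hasDerivAt_of_flat (X := fun x t => laxXMap (P.kk z) (P.q x t))
    (T := fun x t => laxTMap (P.kk z) ((P.q0 : ℂ) ^ 2) (P.q x t) (P.qx x t))
    (Xt := fun x t => mat2 0 (deriv (fun s => P.q x s) t)
      (-(starRingEnd ℂ) (deriv (fun s => P.q x s) t)) 0) (ψ := fun x t => w t x)
    (hP.continuous_laxXMap (P.kk z)) hXt hXtc (hP.hasDerivAt_laxTMap (P.kk z))
    (hP.flat (P.kk z)) (fun x t => hw t x) hw₀
  refine ⟨fun x t => w t x, fun x => ?_, fun x t => hw t x, hflat⟩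
  exact congrFun (linear_ode_unique (hXc 0) (hw 0) hφ (by rw [hw0, hg0])) x

end Admissible

/-! ### Jost solutions of the Lax pair -/

/-- The profile of the first Jost column at `-∞` solves the Jost system at each time. -/
theorem IsJost.xjost {z : ℂ} {ψ : ℝ → ℝ → Fin 2 → ℂ}
    (h : P.IsJost atBot P.qm 0 z ψ) (t : ℝ) :
    XJost (fun x => P.q x t) P.qm z (fun x => exp (I * P.theta x t z) * ψ x t 0)
      (fun x => exp (I * P.theta x t z) * ψ x t 1) := by
  have h1 := fun x => (Admissible.jost_deriv_eq h).1 x t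
  have hθ : ∀ x : ℝ, HasDerivAt (fun y : ℝ => exp (I * P.theta y t z))
      (exp (I * P.theta x t z) * (I * P.lam z)) x := fun x => by
    have : HasDerivAt (fun y : ℝ => I * P.theta y t z) (I * (P.lam z * 1)) x :=
      (((hasDerivAt_id x).ofReal_comp.add_const (P.kk z * t)).const_mul (P.lam z)).const_mul I
    simpa using this.cexp
  have hl : P.lam z - P.kk z = (P.q0 : ℂ) ^ 2 / z := by simp only [lam, kk]; ring
  have hl' : P.lam z + P.kk z = z := by simp only [lam, kk]; ring
  refine ⟨fun x => ?_, fun x => ?_, ?_, ?_⟩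
  · refine ((hθ x).mul ((hasDerivAt_pi.1 (h1 x)) 0)).congr_deriv ?_
    rw [laxXMap, mat2_apply]
    simp only [cons_val_zero]
    change _ = I * (P.q0 : ℂ) ^ 2 / z * _ + _
    rw [mul_div_assoc, ← hl]
    ring
  · refine ((hθ x).mul ((hasDerivAt_pi.1 (h1 x)) 1)).congr_deriv ?_
    rw [laxXMap, mat2_apply]
    simp only [cons_val_zero, cons_val_one]
    rw [show P.kk z = z - P.lam z by linear_combination hl']
    ring
  · have := (tendsto_pi_nhds.1 (h.2.2 t)) 0
    simpa [asympY_apply, expTheta_zero] using this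
  · have := (tendsto_pi_nhds.1 (h.2.2 t)) 1
    simpa [asympY_apply, expTheta_zero] using this

namespace Admissible

variable (hP : P.Admissible)

include hP

theorem isJost_unique {z : ℂ} (hz : z ∈ closedPos P.q0) {ψ φ : ℝ → ℝ → Fin 2 → ℂ}
    (h : P.IsJost atBot P.qm 0 z ψ) (h' : P.IsJost atBot P.qm 0 z φ) : ψ = φ := by
  funext x t i
  obtain ⟨h1, h2⟩ := (hP.smoothAtBot t).toDecaysAtBot.xjost_unique hz (h.xjost t)
    (h'.xjost t)
  have e1 : exp (I * P.theta x t z) * ψ x t 0 = exp (I * P.theta x t z) * φ x t 0 := congrFun h1 x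
  have e2 : exp (I * P.theta x t z) * ψ x t 1 = exp (I * P.theta x t z) * φ x t 1 := congrFun h2 x
  fin_cases i
  · exact mul_left_cancel₀ (exp_ne_zero _) e1
  · exact mul_left_cancel₀ (exp_ne_zero _) e2

/-- The column at time `0` is extended by the Lax pair, and the point is that the normalization
survives. The limiting `T` has the asymptotic column `Y` as an eigenvector, and `e^{iθ}` compensates
its eigenvalue. Hence `e^{iθ} ψ - Y` solves a linear equation in `t` whose source tends to `0` as `x
→ -∞`. -/
theorem exists_isJost {z : ℂ} (hz : z ∈ closedPos P.q0) : ∃ ψ, P.IsJost atBot P.qm 0 z ψ := by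
  obtain ⟨u, v, huv⟩ := (hP.smoothAtBot 0).toDecaysAtBot.exists_xjost hz
  have hz0 := hz.1
  have hl : P.lam z - P.kk z = (P.q0 : ℂ) ^ 2 / z := by simp only [lam, kk]; ring
  have hl' : P.lam z + P.kk z = z := by simp only [lam, kk]; ring
  have hexp : ∀ x : ℝ, HasDerivAt (fun y : ℝ => exp (-(I * P.lam z * y)))
      (exp (-(I * P.lam z * x)) * (-(I * P.lam z))) x := fun x => by
    have : HasDerivAt (fun y : ℝ => -(I * P.lam z * y)) (-(I * P.lam z * 1)) x :=
      ((hasDerivAt_id x).ofReal_comp.const_mul (I * P.lam z)).neg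
    simpa using this.cexp
  obtain ⟨ψ, hψ0, hψx, hψt⟩ := hP.exists_lax_solution z
    (φ := fun x => ![exp (-(I * P.lam z * x)) * u x, exp (-(I * P.lam z * x)) * v x])
    (fun x => by
      rw [hasDerivAt_pi]
      intro i
      fin_cases i
      · refine ((hexp x).mul (huv.deriv_fst x)).congr_deriv ?_
        rw [laxXMap, mat2_apply]
        simp only [Fin.zero_eta, cons_val_zero, cons_val_one]
        change _ + _ * (I * (P.q0 : ℂ) ^ 2 / z * _ + _) = _
        rw [mul_div_assoc, ← hl]
        ring
      · refine ((hexp x).mul (huv.deriv_snd x)).congr_deriv ?_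
        rw [laxXMap, mat2_apply]
        simp only [Fin.mk_one, cons_val_zero, cons_val_one]
        rw [show P.kk z = z - P.lam z by linear_combination hl']
        ring)
  refine ⟨ψ, fun x t => ?_, fun x t => ?_, fun t => ?_⟩
  · rw [laxX_mulVec]; exact hψx x t
  · rw [laxT_mulVec]; exact hψt x t
  set Y : Fin 2 → ℂ := fun i => asympY P.qm z i 0 with hY
  set k := P.kk z with hk
  set m : ℂ := (P.q0 : ℂ) ^ 2 with hm
  set T₀ := laxTMap k m P.qm 0 with hT₀
  -- The eigenvalue `-iλk` is exactly opposite to the time derivative `iλk` of `iθ`.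
  have hTY : T₀ Y = -(I * P.lam z * k) • Y := by
    have hqq : P.qm * (starRingEnd ℂ) P.qm = m := mul_conj' _
    have hl2 : P.lam z = z - k := by linear_combination hl'
    have hm2 : m = z * (z - 2 * k) := by
      have : m / z = z - 2 * k := by rw [← hl, hk]; linear_combination hl'
      rw [← this]; field_simp
    have hz1 : I / z * z = I := by field_simp
    have hI : I ^ 2 = -1 := I_sq
    ext i
    rw [hT₀, laxTMap, mat2_apply, hY, asympY_apply, hqq, hl2]
    fin_cases i
    · simp
      linear_combination (-k * (I / z)) * hqq - k * (I / z) * hm2 - k * (z - 2 * k) * hz1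
    · simp
      linear_combination (-k * (starRingEnd ℂ) P.qm * I) * hz1 - k * (starRingEnd ℂ) P.qm * hI
  have hw : ∀ x s : ℝ, HasDerivAt (fun s => P.expTheta x s z 0 • ψ x s - Y)
      ((I * P.lam z * k) • (P.expTheta x s z 0 • ψ x s)
        + laxTMap k m (P.q x s) (P.qx x s) (P.expTheta x s z 0 • ψ x s)) s := fun x s => by
    have h1 : HasDerivAt (fun s : ℝ => P.expTheta x s z 0)
        (P.expTheta x s z 0 * (I * P.lam z * k)) s := by
      simp only [expTheta_zero]
      have : HasDerivAt (fun s : ℝ => I * P.theta x s z) (I * (P.lam z * (k * 1))) s :=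
        ((((hasDerivAt_id s).ofReal_comp.const_mul k).const_add (x : ℂ)).const_mul
          (P.lam z)).const_mul I
      refine this.cexp.congr_deriv (by ring)
    refine ((h1.smul (hψt x s)).sub_const Y).congr_deriv ?_
    rw [map_smul, smul_smul, mul_comm (I * P.lam z * k), add_comm]
  rw [← tendsto_sub_nhds_zero_iff, tendsto_zero_iff_norm_tendsto_zero]
  have hw0 : Tendsto (fun x => ‖P.expTheta x 0 z 0 • ψ x 0 - Y‖) atBot (𝓝 0) := by
    rw [← tendsto_zero_iff_norm_tendsto_zero, tendsto_sub_nhds_zero_iff, tendsto_pi_nhds]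
    have he : ∀ x : ℝ, ∀ c, P.expTheta x 0 z 0 * (exp (-(I * P.lam z * x)) * c) = c := fun x c => by
      rw [expTheta_zero, ← mul_assoc, ← Complex.exp_add]
      simp [theta, mul_assoc]
    intro i
    fin_cases i
    · refine huv.lim_fst.congr' ?_ |>.trans (by simp [hY, asympY_apply])
      exact Eventually.of_forall fun x => by simp [hψ0, he]
    · refine huv.lim_snd.congr' ?_ |>.trans (by simp [hY, asympY_apply])
      exact Eventually.of_forall fun x => by simp [hψ0, he]
  set K : ℝ := ‖I * P.lam z * k‖ + ‖T₀‖ + 1 with hK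
  have hK0 : 0 ≤ K := by positivity
  -- Uniformity over the times between `0` and `t` is needed for Gronwall in time; here the locally
  -- uniform limits of `q` and `q_x` are used.
  have hTlim : ∀ ε > 0, ∀ᶠ x in atBot, ∀ s ∈ Set.uIcc 0 t,
      ‖laxTMap k m (P.q x s) (P.qx x s) - T₀‖ ≤ ε := by
    intro ε hε
    have hcont : Continuous fun p : ℂ × ℂ => laxTMap k m p.1 p.2 := by
      refine Continuous.mat2 ?_ ?_ ?_ ?_ <;> fun_prop
    obtain ⟨δ, hδ, hδ'⟩ := Metric.continuousAt_iff.1 (hcont.continuousAt (x := (P.qm, 0))) ε hε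
    have h1 := Metric.tendstoUniformlyOn_iff.1
      (tendstoLocallyUniformlyOn_iff_tendstoUniformlyOn_of_compact isCompact_uIcc |>.1
        (hP.lim_bot.tendstoLocallyUniformlyOn (s := Set.uIcc 0 t))) δ hδ
    have h2 := Metric.tendstoUniformlyOn_iff.1
      (tendstoLocallyUniformlyOn_iff_tendstoUniformlyOn_of_compact isCompact_uIcc |>.1
        (hP.lim_qx_bot.tendstoLocallyUniformlyOn (s := Set.uIcc 0 t))) δ hδ
    filter_upwards [h1, h2] with x hx1 hx2 s hs
    rw [← dist_eq_norm]
    refine (hδ' (x := (P.q x s, P.qx x s)) ?_).le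
    rw [Prod.dist_eq, dist_comm, dist_comm (P.qx x s)]
    exact max_lt (hx1 s hs) (hx2 s hs)
  have hbound : ∀ ε > 0, ∀ᶠ x in atBot, ‖P.expTheta x t z 0 • ψ x t - Y‖
      ≤ (‖P.expTheta x 0 z 0 • ψ x 0 - Y‖ + ε * ‖Y‖ * |t - 0|) * Real.exp (K * |t - 0|) := by
    intro ε hε
    filter_upwards [hTlim ε hε, hTlim 1 one_pos] with x hx hx1
    refine norm_le_of_norm_hasDerivAt_le (f := fun s => P.expTheta x s z 0 • ψ x s - Y) hK0
      (by positivity) (hw x) fun s hs => ?_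
    set e := P.expTheta x s z 0 • ψ x s with he
    set T := laxTMap k m (P.q x s) (P.qx x s) with hT
    have e1 : (I * P.lam z * k) • e + T e
        = (I * P.lam z * k) • (e - Y) + (T₀ (e - Y) + (T - T₀) (e - Y)) + (T - T₀) Y := by
      simp only [map_sub, _root_.sub_apply, smul_sub, hTY, neg_smul]
      abel
    rw [e1]
    have hx := hx s hs
    have hx1 := hx1 s hs
    refine (norm_add_le _ _).trans (add_le_add ?_ ?_)
    · refine (norm_add_le _ _).trans ?_
      rw [norm_smul, hK, add_mul, add_mul, add_assoc]
      refine add_le_add le_rfl ((norm_add_le _ _).trans (add_le_add (T₀.le_opNorm _) ?_))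
      exact ((T - T₀).le_opNorm _).trans (mul_le_mul_of_nonneg_right hx1 (norm_nonneg _))
    · exact ((T - T₀).le_opNorm _).trans (mul_le_mul_of_nonneg_right hx (norm_nonneg _))
  rw [Metric.tendsto_nhds]
  intro ε hε
  set e := Real.exp (K * |t - 0|) with he
  have he0 : 0 < e := Real.exp_pos _
  set η : ℝ := ε / (2 * e * (1 + ‖Y‖ * |t - 0|)) with hη
  have hη0 : 0 < η := by positivity
  filter_upwards [hbound η hη0, hw0.eventually (gt_mem_nhds hη0)] with x h1 h2
  rw [Real.dist_eq, sub_zero, abs_of_nonneg (norm_nonneg _)]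
  calc _ ≤ _ := h1
    _ ≤ (η + η * ‖Y‖ * |t - 0|) * e := by gcongr
    _ = η * (e * (1 + ‖Y‖ * |t - 0|)) := by ring
    _ = ε / 2 := by rw [hη]; field_simp
    _ < ε := by linarith

theorem isJost_psiM_zero {z : ℂ} (hz : z ∈ closedPos P.q0) :
    P.IsJost atBot P.qm 0 z (P.psiM 0 z) :=
  Classical.epsilon_spec (hP.exists_isJost hz)

theorem xjost_uM_zero {z : ℂ} (hz : z ∈ closedPos P.q0) (t : ℝ) :
    XJost (fun x => P.q x t) P.qm z (fun x => P.uM 0 x t z 0) (fun x => P.uM 0 x t z 1) := by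
  have := (hP.isJost_psiM_zero hz).xjost t
  simpa only [uM, expTheta_zero, Pi.smul_apply, smul_eq_mul] using this

end Admissible

end KEPotential

/-! ### Symmetries: conjugation, inversion, reflection -/

/-- The mirror image of `closedPos`. -/
def closedNeg (r : ℝ) : Set ℂ :=
  {z | z ≠ 0 ∧ z ^ 2 + (r : ℂ) ^ 2 ≠ 0 ∧ (‖z‖ ^ 2 - r ^ 2) * z.im ≤ 0}

/-- The inversion `z ↦ -r²/z`. -/
noncomputable def hat (r : ℝ) (z : ℂ) : ℂ := -(r : ℂ) ^ 2 / z

theorem conj_mem_closedNeg {r : ℝ} {z : ℂ} (hz : z ∈ closedPos r) :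
    (starRingEnd ℂ) z ∈ closedNeg r := by
  refine ⟨by simpa using hz.1, fun h => hz.2.1 ?_, by simpa using hz.2.2⟩
  simpa using congrArg (starRingEnd ℂ) h

theorem conj_mem_closedPos {r : ℝ} {z : ℂ} (hz : z ∈ closedNeg r) :
    (starRingEnd ℂ) z ∈ closedPos r := by
  refine ⟨by simpa using hz.1, fun h => hz.2.1 ?_, by simpa using hz.2.2⟩
  simpa using congrArg (starRingEnd ℂ) h

theorem hat_ne_zero {r : ℝ} (hr : 0 < r) {z : ℂ} (hz : z ≠ 0) : hat r z ≠ 0 :=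
  div_ne_zero (neg_ne_zero.2 (pow_ne_zero _ (ofReal_ne_zero.2 hr.ne'))) hz

theorem hat_hat {r : ℝ} (hr : 0 < r) {z : ℂ} (hz : z ≠ 0) : hat r (hat r z) = z := by
  have : (r : ℂ) ≠ 0 := ofReal_ne_zero.2 hr.ne'
  simp only [hat]; field_simp

theorem norm_hat (r : ℝ) (z : ℂ) : ‖hat r z‖ = r ^ 2 / ‖z‖ := by
  rw [hat, norm_div, norm_neg, norm_pow, norm_real, Real.norm_eq_abs, sq_abs]

theorem hat_im (r : ℝ) (z : ℂ) : (hat r z).im = r ^ 2 * z.im / ‖z‖ ^ 2 := by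
  rw [hat, div_im, ← ofReal_pow, ← ofReal_neg, ofReal_im, ofReal_re, normSq_eq_norm_sq]
  ring

theorem hat_region {r : ℝ} {z : ℂ} (hz : z ≠ 0) :
    (‖hat r z‖ ^ 2 - r ^ 2) * (hat r z).im
      = -((r ^ 2 / ‖z‖ ^ 2) ^ 2 * ((‖z‖ ^ 2 - r ^ 2) * z.im)) := by
  have : ‖z‖ ≠ 0 := norm_ne_zero_iff.2 hz
  rw [norm_hat, hat_im]; field_simp; ring

theorem hat_sq_add {r : ℝ} (hr : 0 < r) {z : ℂ} (hz : z ≠ 0) (h : z ^ 2 + (r : ℂ) ^ 2 ≠ 0) :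
    hat r z ^ 2 + (r : ℂ) ^ 2 ≠ 0 := by
  have hr' : (r : ℂ) ≠ 0 := ofReal_ne_zero.2 hr.ne'
  have : hat r z ^ 2 + (r : ℂ) ^ 2 = (r : ℂ) ^ 2 / z ^ 2 * (z ^ 2 + (r : ℂ) ^ 2) := by
    simp only [hat]; field_simp; ring
  rw [this]
  exact mul_ne_zero (div_ne_zero (pow_ne_zero _ hr') (pow_ne_zero _ hz)) h

theorem hat_mem_closedNeg {r : ℝ} (hr : 0 < r) {z : ℂ} (hz : z ∈ closedPos r) :
    hat r z ∈ closedNeg r := by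
  refine ⟨hat_ne_zero hr hz.1, hat_sq_add hr hz.1 hz.2.1, ?_⟩
  rw [hat_region hz.1, neg_nonpos]
  exact mul_nonneg (by positivity) hz.2.2

theorem hat_mem_closedPos {r : ℝ} (hr : 0 < r) {z : ℂ} (hz : z ∈ closedNeg r) :
    hat r z ∈ closedPos r := by
  refine ⟨hat_ne_zero hr hz.1, hat_sq_add hr hz.1 hz.2.1, ?_⟩
  rw [hat_region hz.1, ← mul_neg]
  exact mul_nonneg (by positivity) (neg_nonneg.2 hz.2.2)

namespace KEPotential

variable {P : KEPotential}

theorem kk_conj (z : ℂ) : P.kk ((starRingEnd ℂ) z) = (starRingEnd ℂ) (P.kk z) := by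
  simp [kk, Complex.conj_ofNat]

theorem lam_conj (z : ℂ) : P.lam ((starRingEnd ℂ) z) = (starRingEnd ℂ) (P.lam z) := by
  simp [lam, Complex.conj_ofNat]

theorem theta_conj (x t : ℝ) (z : ℂ) :
    P.theta x t ((starRingEnd ℂ) z) = (starRingEnd ℂ) (P.theta x t z) := by
  simp [theta, kk_conj, lam_conj]

theorem expTheta_conj (x t : ℝ) (z : ℂ) :
    (starRingEnd ℂ) (P.expTheta x t ((starRingEnd ℂ) z) 0) = P.expTheta x t z 1 := by
  rw [expTheta_zero, expTheta_one, theta_conj, ← exp_conj]; simp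

theorem kk_hat (h0 : 0 < P.q0) {z : ℂ} (hz : z ≠ 0) : P.kk (hat P.q0 z) = P.kk z := by
  have : (P.q0 : ℂ) ≠ 0 := ofReal_ne_zero.2 h0.ne'
  simp only [kk, hat]; field_simp; ring

theorem lam_hat (h0 : 0 < P.q0) {z : ℂ} (hz : z ≠ 0) : P.lam (hat P.q0 z) = -P.lam z := by
  have : (P.q0 : ℂ) ≠ 0 := ofReal_ne_zero.2 h0.ne'
  simp only [lam, hat]; field_simp; ring

theorem theta_hat (h0 : 0 < P.q0) (x t : ℝ) {z : ℂ} (hz : z ≠ 0) :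
    P.theta x t (hat P.q0 z) = -P.theta x t z := by
  simp only [theta, kk_hat h0 hz, lam_hat h0 hz]; ring

theorem expTheta_hat (h0 : 0 < P.q0) (x t : ℝ) {z : ℂ} (hz : z ≠ 0) :
    P.expTheta x t (hat P.q0 z) 0 = P.expTheta x t z 1 := by
  rw [expTheta_zero, expTheta_one, theta_hat h0 x t hz]; simp

/-! ### Conjugation -/

/-- With `J = !![0, -1; 1, 0]` one has `J X(z*)* J⁻¹ = X(z)`, and the same for `T`, because `k(z*) =
k(z)*`. The map `φ ↦ J φ*` thus carries solutions at `z*` to solutions at `z` and exchanges the two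
columns of `Y`. -/
theorem IsJost.of_conj {l : Filter ℝ} {a z : ℂ} {φ : ℝ → ℝ → Fin 2 → ℂ}
    (h : P.IsJost l a 0 ((starRingEnd ℂ) z) φ) :
    P.IsJost l a 1 z fun x t => ![-(starRingEnd ℂ) (φ x t 1), (starRingEnd ℂ) (φ x t 0)] := by
  refine ⟨fun x t => ?_, fun x t => ?_, fun t => ?_⟩
  · have h1 := hasDerivAt_pi.1 ((Admissible.jost_deriv_eq h).1 x t)
    rw [laxX_mulVec, hasDerivAt_pi]
    intro i
    fin_cases i
    · refine ((h1 1).star.neg).congr_deriv ?_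
      simp [laxXMap, mat2_apply, kk_conj]
    · refine ((h1 0).star).congr_deriv ?_
      simp [laxXMap, mat2_apply, kk_conj]; ring
  · have h1 := hasDerivAt_pi.1 ((Admissible.jost_deriv_eq h).2 x t)
    rw [laxT_mulVec, hasDerivAt_pi]
    intro i
    fin_cases i
    · refine ((h1 1).star.neg).congr_deriv ?_
      simp [laxTMap, mat2_apply, kk_conj]; ring
    · refine ((h1 0).star).congr_deriv ?_
      simp [laxTMap, mat2_apply, kk_conj]; ring
  · have h2 := tendsto_pi_nhds.1 (h.2.2 t)
    rw [tendsto_pi_nhds]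
    intro i
    fin_cases i
    · have := ((continuous_conj.tendsto _).comp (h2 1)).neg
      simpa [asympY_apply, Function.comp_def, expTheta_conj, div_eq_mul_inv] using this
    · have := (continuous_conj.tendsto _).comp (h2 0)
      simpa [asympY_apply, Function.comp_def, expTheta_conj, div_eq_mul_inv] using this

theorem IsJost.conj {l : Filter ℝ} {a z : ℂ} {φ : ℝ → ℝ → Fin 2 → ℂ}
    (h : P.IsJost l a 1 z φ) : P.IsJost l a 0 ((starRingEnd ℂ) z)
      fun x t => ![(starRingEnd ℂ) (φ x t 1), -(starRingEnd ℂ) (φ x t 0)] := by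
  refine ⟨fun x t => ?_, fun x t => ?_, fun t => ?_⟩
  · have h1 := hasDerivAt_pi.1 ((Admissible.jost_deriv_eq h).1 x t)
    rw [laxX_mulVec, hasDerivAt_pi]
    intro i
    fin_cases i
    · refine ((h1 1).star).congr_deriv ?_
      simp [laxXMap, mat2_apply, kk_conj]; ring
    · refine ((h1 0).star.neg).congr_deriv ?_
      simp [laxXMap, mat2_apply, kk_conj]
  · have h1 := hasDerivAt_pi.1 ((Admissible.jost_deriv_eq h).2 x t)
    rw [laxT_mulVec, hasDerivAt_pi]
    intro i
    fin_cases i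
    · refine ((h1 1).star).congr_deriv ?_
      simp [laxTMap, mat2_apply, kk_conj]; ring
    · refine ((h1 0).star.neg).congr_deriv ?_
      simp [laxTMap, mat2_apply, kk_conj]; ring
  · have h2 := tendsto_pi_nhds.1 (h.2.2 t)
    rw [tendsto_pi_nhds]
    have he : ∀ x : ℝ, (starRingEnd ℂ) (P.expTheta x t z 1) = P.expTheta x t ((starRingEnd ℂ) z) 0 :=
      fun x => by rw [← expTheta_conj, conj_conj]
    intro i
    fin_cases i
    · have := (continuous_conj.tendsto _).comp (h2 1)
      simpa [asympY_apply, Function.comp_def, he, div_eq_mul_inv] using this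
    · have := ((continuous_conj.tendsto _).comp (h2 0)).neg
      simpa [asympY_apply, Function.comp_def, he, div_eq_mul_inv] using this

/-! ### Inversion -/

/-- Inversion fixes `k`, hence both Lax matrices, and reverses the sign of `λ`, so the two
exponentials are exchanged. The scalar is the ratio of the second column of `Y(z)` to the first
column of `Y(-q₀²/z)`; the two are parallel because `|a| = q₀`. -/
theorem IsJost.smul_iff {l : Filter ℝ} {a z : ℂ} (h0 : 0 < P.q0) (ha : ‖a‖ = P.q0) (hz : z ≠ 0)
    {φ : ℝ → ℝ → Fin 2 → ℂ} : P.IsJost l a 1 z (fun x t => (-(I * a / z)) • φ x t)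
      ↔ P.IsJost l a 0 (hat P.q0 z) φ := by
  have ha0 : a ≠ 0 := norm_pos_iff.1 (ha ▸ h0)
  set c : ℂ := -(I * a / z) with hc
  have hc0 : c ≠ 0 := neg_ne_zero.2 (div_ne_zero (mul_ne_zero I_ne_zero ha0) hz)
  have hY : (fun i => asympY a z i 1) = c • fun i => asympY a (hat P.q0 z) i 0 := by
    have haa : a * (starRingEnd ℂ) a = (P.q0 : ℂ) ^ 2 := by rw [mul_conj', ha]
    have hq : (P.q0 : ℂ) ≠ 0 := ofReal_ne_zero.2 h0.ne'
    ext i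
    fin_cases i
    · simp [asympY_apply, hc]; ring
    · simp [asympY_apply, hc, hat]
      field_simp
      linear_combination (-1) * haa + (a * (starRingEnd ℂ) a) * I_sq
  have hx : P.laxX (hat P.q0 z) = P.laxX z := by
    funext x t; simp only [laxX, kk_hat h0 hz]
  have ht : P.laxT (hat P.q0 z) = P.laxT z := by
    funext x t; simp only [laxT, kk_hat h0 hz]
  have hcan : ∀ (f : ℝ → Fin 2 → ℂ) (M : Matrix (Fin 2) (Fin 2) ℂ) (v : Fin 2 → ℂ) (x : ℝ),
      HasDerivAt (fun y => c • f y) (M *ᵥ (c • v)) x ↔ HasDerivAt f (M *ᵥ v) x := fun f M v x => by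
    rw [Matrix.mulVec_smul]
    constructor
    · intro h
      have h' := h.const_smul c⁻¹
      rw [inv_smul_smul₀ hc0] at h'
      refine h'.congr_of_eventuallyEq (Eventually.of_forall fun y => ?_)
      simp only [Pi.smul_apply, inv_smul_smul₀ hc0]
    · exact fun h => h.const_smul c
  simp only [IsJost, hx, ht, hcan, hY, expTheta_hat h0 _ _ hz]
  refine and_congr Iff.rfl (and_congr Iff.rfl (forall_congr' fun t => ?_))
  simp only [smul_comm _ c]
  constructor
  · intro h
    have := h.const_smul c⁻¹
    simpa only [inv_smul_smul₀ hc0] using this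
  · exact fun h => h.const_smul c

/-! ### Reflection -/

/-- The potential `q(-x,-t)*`. -/
def reflect (P : KEPotential) : KEPotential where
  q x t := (starRingEnd ℂ) (P.q (-x) (-t))
  qm := (starRingEnd ℂ) P.qp
  qp := (starRingEnd ℂ) P.qm

theorem reflect_q (x t : ℝ) : P.reflect.q x t = (starRingEnd ℂ) (P.q (-x) (-t)) := rfl

theorem reflect_qm : P.reflect.qm = (starRingEnd ℂ) P.qp := rfl

theorem reflect_qp : P.reflect.qp = (starRingEnd ℂ) P.qm := rfl

theorem Admissible.reflect_q0 (hP : P.Admissible) : P.reflect.q0 = P.q0 := by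
  simpa [q0, reflect] using hP.norm_qp

theorem hasDerivAt_comp_neg {E : Type*} [NormedAddCommGroup E] [NormedSpace ℝ E] {f : ℝ → E}
    {f' : E} {x : ℝ} (h : HasDerivAt f f' (-x)) : HasDerivAt (fun y => f (-y)) (-f') x := by
  have := h.scomp x (hasDerivAt_neg x)
  rw [neg_one_smul] at this
  exact this

theorem Admissible.reflect_qx (hP : P.Admissible) (x t : ℝ) :
    P.reflect.qx x t = -(starRingEnd ℂ) (P.qx (-x) (-t)) :=
  ((hasDerivAt_comp_neg (hP.hasDerivAt_q (-x) (-t))).star.congr_deriv (by simp)).deriv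

theorem Admissible.reflect_qxx (hP : P.Admissible) (x t : ℝ) :
    P.reflect.qxx x t = (starRingEnd ℂ) (P.qxx (-x) (-t)) := by
  have h : (fun y => P.reflect.qx y t) = fun y => -(starRingEnd ℂ) (P.qx (-y) (-t)) :=
    funext fun y => hP.reflect_qx y t
  rw [qxx, h]
  exact ((hasDerivAt_comp_neg (hP.hasDerivAt_qx (-x) (-t))).star.neg.congr_deriv (by simp)).deriv

theorem tendstoLocallyUniformly_reflect {f : ℝ → ℝ → ℂ} {a : ℂ} {l l' : Filter ℝ}
    (hl : Tendsto (fun x : ℝ => -x) l l')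
    (h : TendstoLocallyUniformly (fun x t => f x t) (fun _ => a) l') :
    TendstoLocallyUniformly (fun x t => (starRingEnd ℂ) (f (-x) (-t)))
      (fun _ => (starRingEnd ℂ) a) l := by
  rw [Metric.tendstoLocallyUniformly_iff] at h ⊢
  intro ε hε t
  obtain ⟨s, hs, hs'⟩ := h ε hε (-t)
  refine ⟨Neg.neg ⁻¹' s, continuous_neg.continuousAt.preimage_mem_nhds hs, ?_⟩
  filter_upwards [hl.eventually hs'] with x hx y hy
  have := hx (-y) hy
  rwa [dist_eq_norm, ← map_sub, RCLike.norm_conj, ← dist_eq_norm]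

open MeasureTheory in
theorem Admissible.reflect (hP : P.Admissible) : P.reflect.Admissible where
  qm_ne := by
    have : P.qp ≠ 0 := norm_pos_iff.1 (hP.norm_qp ▸ hP.q0_pos)
    simpa [KEPotential.reflect] using this
  norm_qp := by rw [hP.reflect_q0]; simp [KEPotential.reflect, q0]
  smooth := by
    have h : ContDiff ℝ 2 fun p : ℝ × ℝ => P.q (-p.1) (-p.2) :=
      hP.contDiff_q.comp (contDiff_fst.neg.prodMk contDiff_snd.neg)
    exact (conjCLE : ℂ ≃L[ℝ] ℂ).contDiff.comp h
  nls x t := by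
    have h := congrArg (starRingEnd ℂ) (hP.nls (-x) (-t))
    have ht : deriv (fun s => P.reflect.q x s) t
        = -(starRingEnd ℂ) (deriv (fun s => P.q (-x) s) (-t)) :=
      ((hasDerivAt_comp_neg (hP.hasDerivAt_q_time (-x) (-t))).star.congr_deriv (by simp)).deriv
    rw [ht, hP.reflect_qxx, hP.reflect_q0]
    simp only [map_add, map_mul, map_sub, map_pow, conj_I, conj_ofReal, map_div₀, map_one,
      map_ofNat, map_zero] at h
    simp only [KEPotential.reflect, RCLike.norm_conj]
    linear_combination h
  lim_bot := tendstoLocallyUniformly_reflect tendsto_neg_atBot_atTop hP.lim_top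
  lim_top := tendstoLocallyUniformly_reflect tendsto_neg_atTop_atBot hP.lim_bot
  lim_qx_bot := by
    have := (tendstoLocallyUniformly_reflect tendsto_neg_atBot_atTop hP.lim_qx_top).neg
    simp only [map_zero] at this
    refine (this.congr fun x t => (hP.reflect_qx x t).symm).congr_right fun t => ?_
    simp
  lim_qx_top := by
    have := (tendstoLocallyUniformly_reflect tendsto_neg_atTop_atBot hP.lim_qx_bot).neg
    simp only [map_zero] at this
    refine (this.congr fun x t => (hP.reflect_qx x t).symm).congr_right fun t => ?_
    simp
  moment_bot t := by
    have := (integrable_indicator_iff measurableSet_Ici).2 (hP.moment_top (-t))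
    rw [← integrable_indicator_iff measurableSet_Iic]
    refine (this.comp_neg).congr (Eventually.of_forall fun x => ?_)
    simp only [Set.indicator, Set.mem_Ici, Set.mem_Iic, Left.nonneg_neg_iff, abs_neg,
      KEPotential.reflect, ← map_sub, RCLike.norm_conj]
  moment_top t := by
    have := (integrable_indicator_iff measurableSet_Iic).2 (hP.moment_bot (-t))
    rw [← integrable_indicator_iff measurableSet_Ici]
    refine (this.comp_neg).congr (Eventually.of_forall fun x => ?_)
    simp only [Set.indicator, Set.mem_Ici, Set.mem_Iic, Left.neg_nonpos_iff, abs_neg,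
      KEPotential.reflect, ← map_sub, RCLike.norm_conj]
  integrable_qx t := by
    have : (fun x => P.reflect.qx x t) = fun x => -(starRingEnd ℂ) (P.qx (-x) (-t)) :=
      funext fun x => hP.reflect_qx x t
    rw [this]
    exact ((conjCLE : ℂ ≃L[ℝ] ℂ).toContinuousLinearMap.integrable_comp
      (hP.integrable_qx (-t)).comp_neg).neg
  integrable_qxx t := by
    have : (fun x => P.reflect.qxx x t) = fun x => (starRingEnd ℂ) (P.qxx (-x) (-t)) :=
      funext fun x => hP.reflect_qxx x t
    rw [this]
    exact (conjCLE : ℂ ≃L[ℝ] ℂ).toContinuousLinearMap.integrable_comp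
      (hP.integrable_qxx (-t)).comp_neg

theorem Admissible.reflect_kk (hP : P.Admissible) (z : ℂ) : P.reflect.kk z = P.kk z := by
  simp only [kk, hP.reflect_q0]

theorem Admissible.reflect_expTheta (hP : P.Admissible) (x t : ℝ) (z : ℂ) :
    P.reflect.expTheta (-x) (-t) z 0 = P.expTheta x t z 1 := by
  simp only [expTheta_zero, expTheta_one, theta, hP.reflect_kk, lam, hP.reflect_q0]
  congr 1; push_cast; ring

/-- The reversal `(x,t) ↦ (-x,-t)` changes the sign of both Lax matrices, and swapping components
together with conjugating `q` changes it back. Since `θ` is odd under the reversal, what is proved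
for `ψ_{-,1}` transfers to `ψ_{+,2}` at the same `z`. -/
theorem IsJost.reflect (hP : P.Admissible) {z : ℂ} {φ : ℝ → ℝ → Fin 2 → ℂ}
    (h : P.reflect.IsJost atBot P.reflect.qm 0 z φ) :
    P.IsJost atTop P.qp 1 z fun x t => ![φ (-x) (-t) 1, φ (-x) (-t) 0] := by
  refine ⟨fun x t => ?_, fun x t => ?_, fun t => ?_⟩
  · have h1 := hasDerivAt_pi.1 ((Admissible.jost_deriv_eq h).1 (-x) (-t))
    rw [laxX_mulVec, hasDerivAt_pi]
    intro i
    fin_cases i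
    · refine (hasDerivAt_comp_neg (h1 1)).congr_deriv ?_
      simp [laxXMap, mat2_apply, hP.reflect_kk, reflect_q]; try ring
    · refine (hasDerivAt_comp_neg (h1 0)).congr_deriv ?_
      simp [laxXMap, mat2_apply, hP.reflect_kk, reflect_q]; try ring
  · have h1 := hasDerivAt_pi.1 ((Admissible.jost_deriv_eq h).2 (-x) (-t))
    rw [laxT_mulVec, hasDerivAt_pi]
    intro i
    fin_cases i
    · refine (hasDerivAt_comp_neg (h1 1)).congr_deriv ?_
      simp [laxTMap, mat2_apply, hP.reflect_kk, hP.reflect_q0, hP.reflect_qx]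
      simp only [reflect_q, neg_neg, conj_conj]; ring
    · refine (hasDerivAt_comp_neg (h1 0)).congr_deriv ?_
      simp [laxTMap, mat2_apply, hP.reflect_kk, hP.reflect_q0, hP.reflect_qx]
      simp only [reflect_q, neg_neg, conj_conj]; ring
  · have h2 := tendsto_pi_nhds.1 (h.2.2 (-t))
    rw [tendsto_pi_nhds]
    intro i
    fin_cases i
    · have := (h2 1).comp tendsto_neg_atTop_atBot
      simpa [asympY_apply, Function.comp_def, hP.reflect_expTheta, reflect_qm] using this
    · have := (h2 0).comp tendsto_neg_atTop_atBot
      simpa [asympY_apply, Function.comp_def, hP.reflect_expTheta, reflect_qm] using this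

theorem IsJost.reflect_symm (hP : P.Admissible) {z : ℂ} {φ : ℝ → ℝ → Fin 2 → ℂ}
    (h : P.IsJost atTop P.qp 1 z φ) : P.reflect.IsJost atBot P.reflect.qm 0 z
      fun x t => ![φ (-x) (-t) 1, φ (-x) (-t) 0] := by
  refine ⟨fun x t => ?_, fun x t => ?_, fun t => ?_⟩
  · have h1 := hasDerivAt_pi.1 ((Admissible.jost_deriv_eq h).1 (-x) (-t))
    rw [laxX_mulVec, hasDerivAt_pi]
    intro i
    fin_cases i
    · refine (hasDerivAt_comp_neg (h1 1)).congr_deriv ?_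
      simp [laxXMap, mat2_apply, hP.reflect_kk, reflect_q]; try ring
    · refine (hasDerivAt_comp_neg (h1 0)).congr_deriv ?_
      simp [laxXMap, mat2_apply, hP.reflect_kk, reflect_q]; try ring
  · have h1 := hasDerivAt_pi.1 ((Admissible.jost_deriv_eq h).2 (-x) (-t))
    rw [laxT_mulVec, hasDerivAt_pi]
    intro i
    fin_cases i
    · refine (hasDerivAt_comp_neg (h1 1)).congr_deriv ?_
      simp [laxTMap, mat2_apply, hP.reflect_kk, hP.reflect_q0, hP.reflect_qx]
      simp only [reflect_q, conj_conj]; ring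
    · refine (hasDerivAt_comp_neg (h1 0)).congr_deriv ?_
      simp [laxTMap, mat2_apply, hP.reflect_kk, hP.reflect_q0, hP.reflect_qx]
      simp only [reflect_q, conj_conj]; ring
  · have h2 := tendsto_pi_nhds.1 (h.2.2 (-t))
    have he : ∀ x : ℝ, P.expTheta (-x) (-t) z 1 = P.reflect.expTheta x t z 0 := fun x => by
      rw [← hP.reflect_expTheta, neg_neg, neg_neg]
    rw [tendsto_pi_nhds]
    intro i
    fin_cases i
    · have := (h2 1).comp tendsto_neg_atBot_atTop
      simpa [asympY_apply, Function.comp_def, he, reflect_qm] using this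
    · have := (h2 0).comp tendsto_neg_atBot_atTop
      simpa [asympY_apply, Function.comp_def, he, reflect_qm] using this

namespace Admissible

variable (hP : P.Admissible)

include hP

theorem isJost_psiM_one {z : ℂ} (hz : z ∈ closedNeg P.q0) :
    P.IsJost atBot P.qm 1 z (P.psiM 1 z) :=
  Classical.epsilon_spec ⟨_, (hP.isJost_psiM_zero (conj_mem_closedPos hz)).of_conj⟩

theorem psiM_one_eq {z : ℂ} (hz : z ∈ closedNeg P.q0) {φ : ℝ → ℝ → Fin 2 → ℂ}
    (h : P.IsJost atBot P.qm 1 z φ) : P.psiM 1 z = φ := by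
  have := hP.isJost_unique (conj_mem_closedPos hz) (hP.isJost_psiM_one hz).conj h.conj
  funext x t i
  have := congrFun (congrFun this x) t
  fin_cases i
  · exact (starRingEnd ℂ).injective (by simpa using congrFun this 1)
  · exact (starRingEnd ℂ).injective (by simpa using congrFun this 0)

theorem isJost_psiP_one {z : ℂ} (hz : z ∈ closedPos P.q0) :
    P.IsJost atTop P.qp 1 z (P.psiP 1 z) :=
  Classical.epsilon_spec ⟨_, IsJost.reflect hP
    (hP.reflect.isJost_psiM_zero (hP.reflect_q0.symm ▸ hz))⟩

theorem psiP_one_eq {z : ℂ} (hz : z ∈ closedPos P.q0) {φ : ℝ → ℝ → Fin 2 → ℂ}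
    (h : P.IsJost atTop P.qp 1 z φ) : P.psiP 1 z = φ := by
  have := hP.reflect.isJost_unique (hP.reflect_q0.symm ▸ hz)
    ((hP.isJost_psiP_one hz).reflect_symm hP) (h.reflect_symm hP)
  funext x t i
  have := congrFun (congrFun this (-x)) (-t)
  fin_cases i
  · simpa using congrFun this 1
  · simpa using congrFun this 0

theorem isJost_psiP_zero {z : ℂ} (hz : z ∈ closedNeg P.q0) :
    P.IsJost atTop P.qp 0 z (P.psiP 0 z) :=
  Classical.epsilon_spec ⟨_, by
    have := (hP.isJost_psiP_one (conj_mem_closedPos hz)).conj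
    rwa [conj_conj] at this⟩

theorem psiP_zero_eq {z : ℂ} (hz : z ∈ closedNeg P.q0) {φ : ℝ → ℝ → Fin 2 → ℂ}
    (h : P.IsJost atTop P.qp 0 z φ) : P.psiP 0 z = φ := by
  have h' := hP.isJost_psiP_zero hz
  rw [← conj_conj z] at h h'
  have := (hP.psiP_one_eq (conj_mem_closedPos hz) h'.of_conj).symm.trans
    (hP.psiP_one_eq (conj_mem_closedPos hz) h.of_conj)
  rw [conj_conj] at this
  funext x t i
  have := congrFun (congrFun this x) t
  fin_cases i
  · exact (starRingEnd ℂ).injective (by simpa using congrFun this 1)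
  · exact (starRingEnd ℂ).injective (by simpa using congrFun this 0)

theorem psiM_one_conj {z : ℂ} (hz : z ∈ closedNeg P.q0) (x t : ℝ) :
    P.psiM 1 z x t = ![-(starRingEnd ℂ) (P.psiM 0 ((starRingEnd ℂ) z) x t 1),
      (starRingEnd ℂ) (P.psiM 0 ((starRingEnd ℂ) z) x t 0)] := by
  rw [hP.psiM_one_eq hz (hP.isJost_psiM_zero (conj_mem_closedPos hz)).of_conj]

theorem psiM_one_hat {z : ℂ} (hz : z ∈ closedNeg P.q0) (x t : ℝ) :
    P.psiM 1 z x t = (-(I * P.qm / z)) • P.psiM 0 (hat P.q0 z) x t := by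
  rw [hP.psiM_one_eq hz ((IsJost.smul_iff hP.q0_pos rfl hz.1).2
    (hP.isJost_psiM_zero (hat_mem_closedPos hP.q0_pos hz)))]

theorem psiP_one_reflect {z : ℂ} (hz : z ∈ closedPos P.q0) (x t : ℝ) :
    P.psiP 1 z x t
      = ![P.reflect.psiM 0 z (-x) (-t) 1, P.reflect.psiM 0 z (-x) (-t) 0] := by
  rw [hP.psiP_one_eq hz (IsJost.reflect hP
    (hP.reflect.isJost_psiM_zero (hP.reflect_q0.symm ▸ hz)))]

theorem psiP_zero_conj {z : ℂ} (hz : z ∈ closedNeg P.q0) (x t : ℝ) :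
    P.psiP 0 z x t = ![(starRingEnd ℂ) (P.psiP 1 ((starRingEnd ℂ) z) x t 1),
      -(starRingEnd ℂ) (P.psiP 1 ((starRingEnd ℂ) z) x t 0)] := by
  have h := (hP.isJost_psiP_one (conj_mem_closedPos hz)).conj
  rw [conj_conj] at h
  rw [hP.psiP_zero_eq hz h]

theorem psiP_one_hat {z : ℂ} (hz : z ∈ closedPos P.q0) (x t : ℝ) :
    P.psiP 1 z x t = (-(I * P.qp / z)) • P.psiP 0 (hat P.q0 z) x t := by
  rw [hP.psiP_one_eq hz ((IsJost.smul_iff hP.q0_pos hP.norm_qp hz.1).2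
    (hP.isJost_psiP_zero (hat_mem_closedNeg hP.q0_pos hz)))]

theorem uM_one_conj {z : ℂ} (hz : z ∈ closedNeg P.q0) (x t : ℝ) :
    P.uM 1 x t z = ![-(starRingEnd ℂ) (P.uM 0 x t ((starRingEnd ℂ) z) 1),
      (starRingEnd ℂ) (P.uM 0 x t ((starRingEnd ℂ) z) 0)] := by
  ext i
  fin_cases i <;> simp [uM, hP.psiM_one_conj hz, expTheta_conj]

theorem uM_one_hat {z : ℂ} (hz : z ∈ closedNeg P.q0) (x t : ℝ) :
    P.uM 1 x t z = (-(I * P.qm / z)) • P.uM 0 x t (hat P.q0 z) := by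
  rw [uM, uM, hP.psiM_one_hat hz, expTheta_hat hP.q0_pos x t hz.1, smul_comm]

theorem uP_one_reflect {z : ℂ} (hz : z ∈ closedPos P.q0) (x t : ℝ) :
    P.uP 1 x t z = ![P.reflect.uM 0 (-x) (-t) z 1, P.reflect.uM 0 (-x) (-t) z 0] := by
  ext i
  fin_cases i <;> simp [uM, uP, hP.psiP_one_reflect hz, hP.reflect_expTheta]

theorem uP_zero_conj {z : ℂ} (hz : z ∈ closedNeg P.q0) (x t : ℝ) :
    P.uP 0 x t z = ![(starRingEnd ℂ) (P.uP 1 x t ((starRingEnd ℂ) z) 1),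
      -(starRingEnd ℂ) (P.uP 1 x t ((starRingEnd ℂ) z) 0)] := by
  have he : (starRingEnd ℂ) (P.expTheta x t ((starRingEnd ℂ) z) 1) = P.expTheta x t z 0 := by
    rw [← expTheta_conj, conj_conj, conj_conj]
  ext i
  fin_cases i <;> simp [uP, hP.psiP_zero_conj hz, he]

theorem uP_one_hat {z : ℂ} (hz : z ∈ closedPos P.q0) (x t : ℝ) :
    P.uP 1 x t z = (-(I * P.qp / z)) • P.uP 0 x t (hat P.q0 z) := by
  rw [uP, uP, hP.psiP_one_hat hz, expTheta_hat hP.q0_pos x t hz.1, smul_comm]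

end Admissible

end KEPotential

/-! ### Wronskians, scattering coefficients and the jump -/

/-- Each contour point can be left in a direction that enters the open region: outwards or inwards
from the circle according to the sign of `Im w`, up or down from the axis according to the sign of
`|w| - r`, and along `w - i` where both factors vanish. This lets lower bounds valid in `D⁻` pass to
the contour. -/
theorem closedNeg_subset_closure (r : ℝ) :
    closedNeg r ⊆ closure {z | (‖z‖ ^ 2 - r ^ 2) * z.im < 0} := by
  intro w hw
  set F : ℂ → ℝ := fun z => (‖z‖ ^ 2 - r ^ 2) * z.im with hF
  rcases hw.2.2.lt_or_eq with h | h
  · exact subset_closure h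
  have hn : ∀ z : ℂ, ‖z‖ ^ 2 = z.re ^ 2 + z.im ^ 2 := fun z => by
    rw [← normSq_eq_norm_sq, normSq_apply]; ring
  have key : ∀ d : ℂ, (∀ᶠ ε : ℝ in 𝓝[>] 0, F (w + ε * d) < 0) → w ∈ closure {z | F z < 0} := by
    intro d hd
    have ht : Tendsto (fun ε : ℝ => w + ε * d) (𝓝[>] 0) (𝓝 w) := by
      have : Continuous fun ε : ℝ => w + ε * d := by fun_prop
      simpa using (this.tendsto 0).mono_left nhdsWithin_le_nhds
    exact mem_closure_of_tendsto ht hd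
  rcases mul_eq_zero.1 h with h1 | h1
  · rcases lt_trichotomy w.im 0 with h2 | h2 | h2
    · refine key w ?_
      filter_upwards [self_mem_nhdsWithin] with ε hε
      have hε : 0 < ε := hε
      rw [hn] at h1
      simp only [hF, hn, add_re, add_im, mul_re, mul_im, ofReal_re, ofReal_im, zero_mul, sub_zero,
        add_zero]
      have e1 : (w.re + ε * w.re) ^ 2 + (w.im + ε * w.im) ^ 2 - r ^ 2
          = (2 * ε + ε ^ 2) * (w.re ^ 2 + w.im ^ 2) := by linear_combination h1
      rw [e1]
      have : 0 < w.re ^ 2 + w.im ^ 2 := by nlinarith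
      exact mul_neg_of_pos_of_neg (by positivity) (by nlinarith)
    · refine key (w - I) ?_
      filter_upwards [self_mem_nhdsWithin] with ε hε
      have hε : 0 < ε := hε
      rw [hn] at h1
      simp only [hF, hn, add_re, add_im, mul_re, mul_im, ofReal_re, ofReal_im, zero_mul, sub_zero,
        add_zero, sub_re, sub_im, I_re, I_im, h2]
      rw [h2] at h1
      have e1 : (w.re + ε * w.re) ^ 2 + (0 + ε * (0 - 1)) ^ 2 - r ^ 2
          = (2 * ε + ε ^ 2) * w.re ^ 2 + ε ^ 2 := by linear_combination h1
      rw [e1]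
      exact mul_neg_of_pos_of_neg (by positivity) (by linarith)
    · refine key (-w) ?_
      filter_upwards [Ioo_mem_nhdsGT (zero_lt_one' ℝ)] with ε hε
      rw [hn] at h1
      simp only [hF, hn, add_re, add_im, mul_re, mul_im, ofReal_re, ofReal_im, zero_mul, sub_zero,
        add_zero, neg_re, neg_im]
      have e1 : (w.re + ε * -w.re) ^ 2 + (w.im + ε * -w.im) ^ 2 - r ^ 2
          = -(ε * (2 - ε) * (w.re ^ 2 + w.im ^ 2)) := by linear_combination h1
      rw [e1]
      have : 0 < w.re ^ 2 + w.im ^ 2 := by nlinarith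
      have h3 : 0 < 2 - ε := by linarith [hε.2]
      have h4 : 0 < w.im + ε * -w.im := by nlinarith [hε.2]
      have h5 := hε.1
      exact mul_neg_of_neg_of_pos (neg_neg_of_pos (by positivity)) h4
  · rcases lt_trichotomy (‖w‖ ^ 2 - r ^ 2) 0 with h2 | h2 | h2
    · refine key I ?_
      have hc : Continuous fun ε : ℝ => ‖w + ε * I‖ ^ 2 - r ^ 2 := by fun_prop
      have := (hc.tendsto 0).eventually (gt_mem_nhds (show _ < (0 : ℝ) by simpa using h2))
      filter_upwards [self_mem_nhdsWithin, this.filter_mono nhdsWithin_le_nhds] with ε hε h3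
      refine mul_neg_of_neg_of_pos h3 ?_
      simpa [h1] using hε
    · refine key (w - I) ?_
      filter_upwards [self_mem_nhdsWithin] with ε hε
      have hε : 0 < ε := hε
      rw [hn] at h2
      simp only [hF, hn, add_re, add_im, mul_re, mul_im, ofReal_re, ofReal_im, zero_mul, sub_zero,
        add_zero, sub_re, sub_im, I_re, I_im, h1]
      rw [h1] at h2
      have e1 : (w.re + ε * w.re) ^ 2 + (0 + ε * (0 - 1)) ^ 2 - r ^ 2
          = (2 * ε + ε ^ 2) * w.re ^ 2 + ε ^ 2 := by linear_combination h2
      rw [e1]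
      exact mul_neg_of_pos_of_neg (by positivity) (by linarith)
    · refine key (-I) ?_
      have hc : Continuous fun ε : ℝ => ‖w + ε * -I‖ ^ 2 - r ^ 2 := by fun_prop
      have := (hc.tendsto 0).eventually (lt_mem_nhds (show (0 : ℝ) < _ by simpa using h2))
      filter_upwards [self_mem_nhdsWithin, this.filter_mono nhdsWithin_le_nhds] with ε hε h3
      refine mul_neg_of_pos_of_neg h3 ?_
      simpa [h1] using hε

theorem differentiableOn_hat (r : ℝ) : DifferentiableOn ℂ (hat r) {z | z ≠ 0} := fun z hz =>
  ((differentiableAt_const (-(r : ℂ) ^ 2)).div (differentiableAt_id (x := z))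
    hz).differentiableWithinAt

namespace KEPotential

theorem wr_identity (a b c : Fin 2 → ℂ) (i : Fin 2) :
    wr a b * c i + wr b c * a i + wr c a * b i = 0 := by
  fin_cases i <;> simp [wr] <;> ring

theorem wr_plucker (a b c d : Fin 2 → ℂ) :
    wr a b * wr c d - wr a c * wr b d + wr a d * wr b c = 0 := by
  simp only [wr]; ring

theorem wr_smul_smul (a b : ℂ) (u v : Fin 2 → ℂ) : wr (a • u) (b • v) = a * b * wr u v := by
  simp only [wr, Pi.smul_apply, smul_eq_mul]; ring

variable {P : KEPotential}

/-- Both Lax matrices are traceless, so a Wronskian of two simultaneous solutions has zero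
derivative in `x` and in `t`. -/
theorem IsJost.wr_eq {l l' : Filter ℝ} {a a' z : ℂ} {j j' : Fin 2} {ψ φ : ℝ → ℝ → Fin 2 → ℂ}
    (hψ : P.IsJost l a j z ψ) (hφ : P.IsJost l' a' j' z φ) (x t : ℝ) :
    wr (ψ x t) (φ x t) = wr (ψ 0 0) (φ 0 0) := by
  have hx : ∀ x t, HasDerivAt (fun y => wr (ψ y t) (φ y t)) 0 x := fun x t => by
    have h1 := hasDerivAt_pi.1 ((Admissible.jost_deriv_eq hψ).1 x t)
    have h2 := hasDerivAt_pi.1 ((Admissible.jost_deriv_eq hφ).1 x t)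
    refine (((h1 0).mul (h2 1)).sub ((h1 1).mul (h2 0))).congr_deriv ?_
    simp [laxXMap, mat2_apply]; ring
  have ht : ∀ x t, HasDerivAt (fun s => wr (ψ x s) (φ x s)) 0 t := fun x t => by
    have h1 := hasDerivAt_pi.1 ((Admissible.jost_deriv_eq hψ).2 x t)
    have h2 := hasDerivAt_pi.1 ((Admissible.jost_deriv_eq hφ).2 x t)
    refine (((h1 0).mul (h2 1)).sub ((h1 1).mul (h2 0))).congr_deriv ?_
    simp [laxTMap, mat2_apply]; ring
  have e1 := is_const_of_deriv_eq_zero (f := fun y => wr (ψ y t) (φ y t))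
    (fun y => (hx y t).differentiableAt) (fun y => (hx y t).deriv) x 0
  have e2 := is_const_of_deriv_eq_zero (f := fun s => wr (ψ 0 s) (φ 0 s))
    (fun s => (ht 0 s).differentiableAt) (fun s => (ht 0 s).deriv) t 0
  exact e1.trans e2

/-- The factors `e^{±iθ}` cancel in the Wronskian, so its constant value is its limit, namely `det
Y`. -/
theorem IsJost.wr_eq_gam {l : Filter ℝ} [l.NeBot] {a z : ℂ} (ha : ‖a‖ = P.q0)
    {ψ φ : ℝ → ℝ → Fin 2 → ℂ} (hψ : P.IsJost l a 0 z ψ) (hφ : P.IsJost l a 1 z φ) (x t : ℝ) :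
    wr (ψ x t) (φ x t) = P.gam z := by
  rw [hψ.wr_eq hφ]
  have h1 := tendsto_pi_nhds.1 (hψ.2.2 0)
  have h2 := tendsto_pi_nhds.1 (hφ.2.2 0)
  have h3 := ((h1 0).mul (h2 1)).sub ((h1 1).mul (h2 0))
  have h4 : (fun x => (P.expTheta x 0 z 0 • ψ x 0) 0 * (P.expTheta x 0 z 1 • φ x 0) 1
      - (P.expTheta x 0 z 0 • ψ x 0) 1 * (P.expTheta x 0 z 1 • φ x 0) 0)
      = fun _ => wr (ψ 0 0) (φ 0 0) := by
    funext x
    change wr (P.expTheta x 0 z 0 • ψ x 0) (P.expTheta x 0 z 1 • φ x 0) = _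
    rw [wr_smul_smul, hψ.wr_eq hφ, expTheta_zero, expTheta_one, ← Complex.exp_add]
    simp
  rw [h4] at h3
  rw [tendsto_nhds_unique tendsto_const_nhds h3]
  have haa : a * (starRingEnd ℂ) a = (P.q0 : ℂ) ^ 2 := by rw [mul_conj', ha]
  simp only [asympY_apply, gam, of_apply, cons_val', cons_val_zero, cons_val_one,
    cons_val_fin_one]
  rw [← haa]
  ring_nf
  rw [I_sq]; ring

theorem gam_ne_zero {z : ℂ} (hz : z ∈ closedPos P.q0) : P.gam z ≠ 0 := one_add_div_sq_ne_zero hz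

theorem gam_conj (z : ℂ) : P.gam ((starRingEnd ℂ) z) = (starRingEnd ℂ) (P.gam z) := by
  simp [gam]

theorem gam_ne_zero' {z : ℂ} (hz : z ∈ closedNeg P.q0) : P.gam z ≠ 0 := by
  have := gam_ne_zero (conj_mem_closedPos hz)
  rwa [gam_conj, Ne, map_eq_zero] at this

theorem wr_uM_uP (x t : ℝ) (z : ℂ) :
    wr (P.uM 0 x t z) (P.uP 1 x t z) = wr (P.psiM 0 z x t) (P.psiP 1 z x t) := by
  rw [uM, uP, wr_smul_smul, expTheta_zero, expTheta_one, ← Complex.exp_add]; simp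

theorem wr_uP_uM (x t : ℝ) (z : ℂ) :
    wr (P.uP 0 x t z) (P.uM 1 x t z) = wr (P.psiP 0 z x t) (P.psiM 1 z x t) := by
  rw [uM, uP, wr_smul_smul, expTheta_zero, expTheta_one, ← Complex.exp_add]; simp

namespace Admissible

variable (hP : P.Admissible)

include hP

theorem qp_ne : P.qp ≠ 0 := norm_pos_iff.1 (hP.norm_qp ▸ hP.q0_pos)

omit hP in
theorem qm_mul_conj : P.qm * (starRingEnd ℂ) P.qm = (P.q0 : ℂ) ^ 2 := mul_conj' _

theorem qp_mul_conj : P.qp * (starRingEnd ℂ) P.qp = (P.q0 : ℂ) ^ 2 := by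
  rw [mul_conj', hP.norm_qp]

theorem s22_eq {z : ℂ} (hz : z ∈ closedPos P.q0) (x t : ℝ) :
    P.s22 z = wr (P.uM 0 x t z) (P.uP 1 x t z) / P.gam z := by
  rw [s22, wr_uM_uP, (hP.isJost_psiM_zero hz).wr_eq (hP.isJost_psiP_one hz) x t]

theorem s11_eq {z : ℂ} (hz : z ∈ closedNeg P.q0) (x t : ℝ) :
    P.s11 z = wr (P.uP 0 x t z) (P.uM 1 x t z) / P.gam z := by
  rw [s11, wr_uP_uM, (hP.isJost_psiP_zero hz).wr_eq (hP.isJost_psiM_one hz) x t]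

theorem s11_conj {z : ℂ} (hz : z ∈ closedNeg P.q0) :
    P.s11 z = (starRingEnd ℂ) (P.s22 ((starRingEnd ℂ) z)) := by
  rw [hP.s11_eq hz 0 0, hP.s22_eq (conj_mem_closedPos hz) 0 0, hP.uP_zero_conj hz,
    hP.uM_one_conj hz, map_div₀, gam_conj, conj_conj]
  congr 1
  simp [wr]; ring

theorem uP_zero_hat {z : ℂ} (hz : z ∈ closedNeg P.q0) (x t : ℝ) :
    P.uP 0 x t z = (-(I * (starRingEnd ℂ) P.qp / z)) • P.uP 1 x t (hat P.q0 z) := by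
  rw [hP.uP_one_hat (hat_mem_closedPos hP.q0_pos hz), hat_hat hP.q0_pos hz.1, smul_smul]
  have hz0 := hz.1
  have hq : (P.q0 : ℂ) ≠ 0 := ofReal_ne_zero.2 hP.q0_pos.ne'
  have : -(I * (starRingEnd ℂ) P.qp / z) * -(I * P.qp / hat P.q0 z) = 1 := by
    rw [hat]
    field_simp
    linear_combination (-I ^ 2) * hP.qp_mul_conj - (P.q0 : ℂ) ^ 2 * I_sq
  rw [this, one_smul]

theorem s11_hat {z : ℂ} (hz : z ∈ closedNeg P.q0) :
    P.s11 z = P.qm / P.qp * P.s22 (hat P.q0 z) := by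
  have hz0 := hz.1
  have hq : (P.q0 : ℂ) ≠ 0 := ofReal_ne_zero.2 hP.q0_pos.ne'
  have hqp := hP.qp_ne
  have hh := hat_mem_closedPos hP.q0_pos hz
  have h1 : wr (P.uM 0 0 0 (hat P.q0 z)) (P.uP 1 0 0 (hat P.q0 z))
      = P.gam (hat P.q0 z) * P.s22 (hat P.q0 z) := by
    rw [hP.s22_eq hh 0 0]; field_simp [gam_ne_zero hh]
  have h2 : wr (P.uP 1 0 0 (hat P.q0 z)) (P.uM 0 0 0 (hat P.q0 z))
      = -(P.gam (hat P.q0 z) * P.s22 (hat P.q0 z)) := by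
    rw [← h1]; simp only [wr]; ring
  rw [hP.s11_eq hz 0 0, hP.uP_zero_hat hz, hP.uM_one_hat hz, wr_smul_smul, h2, div_eq_iff
    (gam_ne_zero' hz)]
  generalize P.s22 (hat P.q0 z) = S
  simp only [gam, hat]
  field_simp
  linear_combination (P.qm * S * (z ^ 2 + P.q0 ^ 2)) *
    (-I ^ 2 * hP.qp_mul_conj - (P.q0 : ℂ) ^ 2 * I_sq)

theorem continuousOn_uM_zero (x t : ℝ) (i : Fin 2) :
    ContinuousOn (fun z => P.uM 0 x t z i) (closedPos P.q0) := by
  have h := (hP.smoothAtBot t).toDecaysAtBot.xjost_regular (u := fun z x => P.uM 0 x t z 0)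
    (v := fun z x => P.uM 0 x t z 1) (fun z hz => hP.xjost_uM_zero hz t) x
  fin_cases i
  · exact h.1.1
  · exact h.2.1

theorem differentiableOn_uM_zero (x t : ℝ) (i : Fin 2) :
    DifferentiableOn ℂ (fun z => P.uM 0 x t z i) P.Dplus := by
  have h := (hP.smoothAtBot t).toDecaysAtBot.xjost_regular (u := fun z x => P.uM 0 x t z 0)
    (v := fun z x => P.uM 0 x t z 1) (fun z hz => hP.xjost_uM_zero hz t) x
  fin_cases i
  · exact h.1.2
  · exact h.2.2

theorem bounded_uM_zero (x t : ℝ) (i : Fin 2) {ζ : ℂ} (hζ : ζ ≠ 0) :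
    ∃ C, ∀ᶠ z in 𝓝[closedPos P.q0] ζ, ‖P.uM 0 x t z i‖ ≤ C := by
  have hpos : 0 < ‖ζ‖ := norm_pos_iff.2 hζ
  obtain ⟨C, hC⟩ := (hP.smoothAtBot t).toDecaysAtBot.xjost_bounded (half_pos hpos) (2 * ‖ζ‖) x
  refine ⟨C, ?_⟩
  have h1 : ∀ᶠ z in 𝓝 ζ, ‖ζ‖ / 2 < ‖z‖ :=
    (continuous_norm.tendsto ζ).eventually (lt_mem_nhds (by linarith))
  have h2 : ∀ᶠ z in 𝓝 ζ, ‖z‖ < 2 * ‖ζ‖ :=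
    (continuous_norm.tendsto ζ).eventually (gt_mem_nhds (by linarith))
  filter_upwards [self_mem_nhdsWithin, h1.filter_mono nhdsWithin_le_nhds,
    h2.filter_mono nhdsWithin_le_nhds] with z hz h3 h4
  have := hC z hz h3.le h4.le _ _ (hP.xjost_uM_zero hz t)
  fin_cases i
  · exact (le_add_of_nonneg_right (norm_nonneg _)).trans this
  · exact (le_add_of_nonneg_left (norm_nonneg _)).trans this

theorem uP_one_apply {z : ℂ} (hz : z ∈ closedPos P.q0) (x t : ℝ) (i : Fin 2) :
    P.uP 1 x t z i = P.reflect.uM 0 (-x) (-t) z (1 - i) := by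
  rw [hP.uP_one_reflect hz]; fin_cases i <;> rfl

theorem continuousOn_uP_one (x t : ℝ) (i : Fin 2) :
    ContinuousOn (fun z => P.uP 1 x t z i) (closedPos P.q0) := by
  have h := hP.reflect.continuousOn_uM_zero (-x) (-t) (1 - i)
  rw [hP.reflect_q0] at h
  exact h.congr fun z hz => hP.uP_one_apply hz x t i

theorem differentiableOn_uP_one (x t : ℝ) (i : Fin 2) :
    DifferentiableOn ℂ (fun z => P.uP 1 x t z i) P.Dplus := by
  have h := hP.reflect.differentiableOn_uM_zero (-x) (-t) (1 - i)
  rw [Dplus, hP.reflect_q0] at h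
  exact h.congr fun z hz => hP.uP_one_apply (openPos_subset_closedPos _ hz) x t i

theorem bounded_uP_one (x t : ℝ) (i : Fin 2) {ζ : ℂ} (hζ : ζ ≠ 0) :
    ∃ C, ∀ᶠ z in 𝓝[closedPos P.q0] ζ, ‖P.uP 1 x t z i‖ ≤ C := by
  obtain ⟨C, hC⟩ := hP.reflect.bounded_uM_zero (-x) (-t) (1 - i) hζ
  rw [hP.reflect_q0] at hC
  refine ⟨C, ?_⟩
  filter_upwards [hC, self_mem_nhdsWithin] with z h1 hz
  rwa [hP.uP_one_apply hz]

omit hP in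
theorem continuousOn_gam : ContinuousOn P.gam (closedPos P.q0) :=
  continuousOn_const.add (continuousOn_const.div (continuousOn_id.pow 2)
    fun _ hz => pow_ne_zero _ hz.1)

omit hP in
theorem differentiableAt_gam {z : ℂ} (hz : z ≠ 0) : DifferentiableAt ℂ P.gam z :=
  (differentiableAt_const _).add ((differentiableAt_const _).div (differentiableAt_id.pow 2)
    (pow_ne_zero _ hz))

theorem continuousOn_s22 : ContinuousOn P.s22 (closedPos P.q0) :=
  ((((hP.continuousOn_uM_zero 0 0 0).mul (hP.continuousOn_uP_one 0 0 1)).sub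
    ((hP.continuousOn_uM_zero 0 0 1).mul (hP.continuousOn_uP_one 0 0 0))).div continuousOn_gam
      fun _ hz => gam_ne_zero hz).congr fun _ hz => hP.s22_eq hz 0 0

theorem differentiableOn_s22 : DifferentiableOn ℂ P.s22 P.Dplus :=
  ((((hP.differentiableOn_uM_zero 0 0 0).mul (hP.differentiableOn_uP_one 0 0 1)).sub
    ((hP.differentiableOn_uM_zero 0 0 1).mul (hP.differentiableOn_uP_one 0 0 0))).div
      (fun _ hz => (differentiableAt_gam
        (openPos_subset_closedPos _ hz).1).differentiableWithinAt)
      fun _ hz => gam_ne_zero (openPos_subset_closedPos _ hz)).congr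
        fun _ hz => hP.s22_eq (openPos_subset_closedPos _ hz) 0 0

theorem continuousOn_s11 : ContinuousOn P.s11 (closedNeg P.q0) := by
  have h := (continuous_conj.comp_continuousOn hP.continuousOn_s22).comp
    continuous_conj.continuousOn (s := closedNeg P.q0) fun z hz => conj_mem_closedPos hz
  exact h.congr fun z hz => hP.s11_conj hz

/-- On the contour all four Jost columns live in one plane. Three-term Wronskian identities expand
`ψ_{-,2}` and `ψ_{+,1}` in the others with scattering coefficients, and Plücker's relation gives
`s₁₁ s₂₂ - s₁₂ s₂₁ = 1`; these are what the two columns of the jump relation need. -/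
theorem jump {z : ℂ} (hz : z ∈ closedPos P.q0) (hz' : z ∈ closedNeg P.q0) (h1 : P.s11 z ≠ 0)
    (h2 : P.s22 z ≠ 0) (x t : ℝ) :
    P.MMinus x t z * P.GG x t z = P.MMinus x t z - P.MPlus x t z := by
  have hM0 := hP.isJost_psiM_zero hz
  have hM1 := hP.isJost_psiM_one hz'
  have hP0 := hP.isJost_psiP_zero hz'
  have hP1 := hP.isJost_psiP_one hz
  have hg := gam_ne_zero hz
  have e11 : wr (P.psiP 0 z x t) (P.psiM 1 z x t) = P.gam z * P.s11 z := by
    rw [hP0.wr_eq hM1, s11]; field_simp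
  have e22 : wr (P.psiM 0 z x t) (P.psiP 1 z x t) = P.gam z * P.s22 z := by
    rw [hM0.wr_eq hP1, s22]; field_simp
  have e12 : wr (P.psiP 1 z x t) (P.psiM 1 z x t) = P.gam z * P.s12 z := by
    rw [hP1.wr_eq hM1, s12]; field_simp
  have e21 : wr (P.psiM 0 z x t) (P.psiP 0 z x t) = P.gam z * P.s21 z := by
    rw [hM0.wr_eq hP0, s21]; field_simp
  have eM := hM0.wr_eq_gam rfl hM1 x t
  have eP := hP0.wr_eq_gam hP.norm_qp hP1 x t
  have hneg : ∀ a b : Fin 2 → ℂ, wr a b = -wr b a := fun a b => by simp only [wr]; ring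
  have det : P.s11 z * P.s22 z - P.s12 z * P.s21 z = 1 := by
    have := wr_plucker (P.psiP 0 z x t) (P.psiM 1 z x t) (P.psiM 0 z x t) (P.psiP 1 z x t)
    rw [e11, e22, eP, hneg (P.psiP 0 z x t) (P.psiM 0 z x t), e21, hneg (P.psiM 1 z x t), e12,
      hneg (P.psiM 1 z x t), eM] at this
    have h3 : P.gam z ^ 2 * (P.s11 z * P.s22 z - P.s12 z * P.s21 z - 1) = 0 := by
      linear_combination this
    have := (mul_eq_zero.1 h3).resolve_left (pow_ne_zero _ hg)
    linear_combination this
  have k1 : ∀ i, P.psiM 1 z x t i = P.s11 z * P.psiP 1 z x t i - P.s12 z * P.psiP 0 z x t i := by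
    intro i
    have := wr_identity (P.psiP 1 z x t) (P.psiM 1 z x t) (P.psiP 0 z x t) i
    rw [e12, hneg (P.psiM 1 z x t), e11, eP] at this
    have h3 : P.gam z * (P.psiM 1 z x t i
      - (P.s11 z * P.psiP 1 z x t i - P.s12 z * P.psiP 0 z x t i)) = 0 := by
      linear_combination this
    exact sub_eq_zero.1 ((mul_eq_zero.1 h3).resolve_left hg)
  have k2 : ∀ i, P.psiP 0 z x t i = P.s11 z * P.psiM 0 z x t i + P.s21 z * P.psiM 1 z x t i := by
    intro i
    have := wr_identity (P.psiP 0 z x t) (P.psiM 1 z x t) (P.psiM 0 z x t) i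
    rw [e11, hneg (P.psiM 1 z x t), eM, e21] at this
    have h3 : P.gam z * (P.psiP 0 z x t i
      - (P.s11 z * P.psiM 0 z x t i + P.s21 z * P.psiM 1 z x t i)) = 0 := by
      linear_combination -this
    exact sub_eq_zero.1 ((mul_eq_zero.1 h3).resolve_left hg)
  have he1 : exp (2 * I * P.theta x t z) * P.expTheta x t z 1 = P.expTheta x t z 0 := by
    rw [expTheta_zero, expTheta_one, ← Complex.exp_add]; congr 1; ring
  have he2 : exp (-2 * I * P.theta x t z) * P.expTheta x t z 0 = P.expTheta x t z 1 := by
    rw [expTheta_zero, expTheta_one, ← Complex.exp_add]; congr 1; ring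
  have c0 : ∀ i, (P.MMinus x t z * P.GG x t z) i 0 = (P.MMinus x t z - P.MPlus x t z) i 0 := by
    intro i
    simp only [MMinus, MPlus, GG, Matrix.mul_apply, Fin.sum_univ_two, of_apply, cons_val_zero,
      cons_val_one, cons_val', cons_val_fin_one, Matrix.sub_apply, uM, uP, Pi.smul_apply,
      smul_eq_mul, rho]
    rw [k2 i, ← he1]
    field_simp
    ring
  have c1 : ∀ i, (P.MMinus x t z * P.GG x t z) i 1 = (P.MMinus x t z - P.MPlus x t z) i 1 := by
    intro i
    simp only [MMinus, MPlus, GG, Matrix.mul_apply, Fin.sum_univ_two, of_apply, cons_val_zero,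
      cons_val_one, cons_val', cons_val_fin_one, Matrix.sub_apply, uM, uP, Pi.smul_apply,
      smul_eq_mul, rho, rhoT]
    rw [← he2]
    field_simp
    linear_combination P.expTheta x t z 0 * ((P.psiM 1 z x t i) * (-det) - k1 i)
  ext i j
  fin_cases j
  · exact c0 i
  · exact c1 i

end Admissible

end KEPotential

/-! ### Cauchy's theorem on the contour -/

-- Each half of the circle passes through one branch point, where the integrands are bounded but
-- need not be continuous.
open MeasureTheory in
theorem intervalIntegrable_of_continuousOn_diff_singleton {f : ℝ → ℂ} {a b p B : ℝ}
    (hc : ContinuousOn f (Set.uIcc a b \ {p})) (hb : ∀ x ∈ Set.uIcc a b, x ≠ p → ‖f x‖ ≤ B) :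
    IntervalIntegrable f volume a b := by
  rw [intervalIntegrable_iff]
  have hm : MeasurableSet (Set.uIcc a b \ {p}) := measurableSet_uIcc.diff (measurableSet_singleton p)
  have h1 : IntegrableOn f (Set.uIcc a b \ {p}) := by
    refine IntegrableOn.of_bound ?_ (hc.aestronglyMeasurable hm) B ?_
    · exact (measure_mono Set.sdiff_subset).trans_lt isCompact_uIcc.measure_lt_top
    · exact (ae_restrict_iff' hm).2 (Eventually.of_forall fun x hx => hb x hx.1 hx.2)
  refine (h1.congr_set_ae ?_).mono_set Set.uIoc_subset_uIcc
  exact (sdiff_null_ae_eq_self (by simp)).symm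

/-- The closed upper outer region with the point `ir` removed. -/
def outerUpper (r : ℝ) : Set ℂ := {z | r ≤ ‖z‖ ∧ 0 ≤ z.im ∧ z ≠ I * r}

theorem mul_exp_mem_outerUpper {r : ℝ} (hr : 0 < r) {w : ℂ} (hre : 0 ≤ w.re) (h0 : 0 ≤ w.im)
    (hπ : w.im ≤ Real.pi) (hw : w.re ≠ 0 ∨ w.im ≠ Real.pi / 2) : r * exp w ∈ outerUpper r := by
  have hn : ‖(r : ℂ) * exp w‖ = r * Real.exp w.re := by
    rw [norm_mul, norm_real, Real.norm_eq_abs, abs_of_pos hr, norm_exp]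
  have him : ((r : ℂ) * exp w).im = r * (Real.exp w.re * Real.sin w.im) := by
    rw [im_ofReal_mul, exp_im]
  refine ⟨?_, ?_, fun h => ?_⟩
  · rw [hn]
    exact le_mul_of_one_le_right hr.le (Real.one_le_exp hre)
  · rw [him]
    have := Real.sin_nonneg_of_nonneg_of_le_pi h0 hπ
    positivity
  · have h1 : ‖(r : ℂ) * exp w‖ = r := by rw [h]; simp [abs_of_pos hr]
    rw [hn] at h1
    have h2 : w.re = 0 := by
      have : Real.exp w.re = 1 := by
        have : r * (Real.exp w.re - 1) = 0 := by linarith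
        have := (mul_eq_zero.1 this).resolve_left hr.ne'
        linarith
      exact (Real.exp_eq_one_iff _).1 this
    have h3 := hw.resolve_left (not_not.2 h2)
    have h4 : (((r : ℂ) * exp w).re) = 0 := by rw [h]; simp
    rw [re_ofReal_mul, exp_re, h2, Real.exp_zero, one_mul] at h4
    have h5 := (mul_eq_zero.1 h4).resolve_left hr.ne'
    rcases lt_or_gt_of_ne h3 with h6 | h6
    · exact (Real.cos_pos_of_mem_Ioo ⟨by linarith [Real.pi_pos], h6⟩).ne' h5
    · exact (Real.cos_neg_of_pi_div_two_lt_of_lt h6 (by linarith)).ne h5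

open MeasureTheory in
/-- Cauchy's theorem in logarithmic coordinates on the upper outer region. -/
theorem quarter_contour {r : ℝ} (hr : 0 < r) {h : ℂ → ℂ} {c : ℂ}
    (hc : ContinuousOn h (outerUpper r))
    (hd : DifferentiableOn ℂ h {z | r < ‖z‖ ∧ 0 < z.im})
    (hb : ∀ R, ∃ B, ∀ z ∈ outerUpper r, ‖z‖ ≤ R → ‖h z‖ ≤ B)
    (hlim : ∃ C R, ∀ z ∈ outerUpper r, R ≤ ‖z‖ → ‖h z - c‖ ≤ C / ‖z‖) :
    Tendsto (fun S : ℝ => ∫ s in (0 : ℝ)..S, (h (r * Real.exp s) - h (-(r * Real.exp s)))) atTop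
      (𝓝 (I * (∫ φ in (0 : ℝ)..Real.pi, h (r * exp (I * φ))) - I * (Real.pi * c))) := by
  have hπ := Real.pi_pos
  -- In the coordinate `w`, with `z = r e^w`, the outer upper region is the half-strip `Re w ≥ 0`,
  -- `0 ≤ Im w ≤ π`. The real axis becomes the two horizontal sides, the semicircle the left side,
  -- and the branch point `ir` its midpoint `iπ/2`.
  set G : ℂ → ℂ := fun w => h (r * exp w) with hG
  have hexpc : Continuous fun w : ℂ => (r : ℂ) * exp w := by fun_prop
  have hGc : ContinuousOn G {w | 0 ≤ w.re ∧ 0 ≤ w.im ∧ w.im ≤ Real.pi ∧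
      (w.re ≠ 0 ∨ w.im ≠ Real.pi / 2)} :=
    hc.comp hexpc.continuousOn fun w hw => mul_exp_mem_outerUpper hr hw.1 hw.2.1 hw.2.2.1 hw.2.2.2
  have hGd : DifferentiableOn ℂ G {w | 0 < w.re ∧ 0 < w.im ∧ w.im < Real.pi} := by
    refine hd.comp (by fun_prop) fun w hw => ⟨?_, ?_⟩
    · rw [norm_mul, norm_real, Real.norm_eq_abs, abs_of_pos hr, norm_exp]
      exact lt_mul_of_one_lt_right hr (Real.one_lt_exp_iff.2 hw.1)
    · rw [im_ofReal_mul, exp_im]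
      have := Real.sin_pos_of_pos_of_lt_pi hw.2.1 hw.2.2
      positivity
  have hGb : ∀ S, ∃ B, ∀ w : ℂ, 0 ≤ w.re → w.re ≤ S → 0 ≤ w.im → w.im ≤ Real.pi →
      (w.re ≠ 0 ∨ w.im ≠ Real.pi / 2) → ‖G w‖ ≤ B := by
    intro S
    obtain ⟨B, hB⟩ := hb (r * Real.exp S)
    refine ⟨B, fun w h1 h2 h3 h4 h5 => hB _ (mul_exp_mem_outerUpper hr h1 h3 h4 h5) ?_⟩
    rw [norm_mul, norm_real, Real.norm_eq_abs, abs_of_pos hr, norm_exp]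
    gcongr
  have hu : ∀ φ ∈ Set.uIcc 0 Real.pi, 0 ≤ φ ∧ φ ≤ Real.pi := fun φ hφ => by
    rwa [Set.uIcc_of_le hπ.le] at hφ
  have hlow : ContinuousOn (fun s : ℝ => G s) (Set.Ici 0) :=
    hGc.comp continuous_ofReal.continuousOn fun s hs =>
      ⟨by simpa using hs, by simp, by simpa using hπ.le, Or.inr (by simpa using (half_pos hπ).ne)⟩
  have hupp : ContinuousOn (fun s : ℝ => G (s + Real.pi * I)) (Set.Ici 0) :=
    hGc.comp (by fun_prop) fun s hs =>
      ⟨by simpa using hs, by simpa using hπ.le, by simp, Or.inr (by simpa using (half_lt_self hπ).ne')⟩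
  have hsub : ∀ a b : ℝ, 0 ≤ a → 0 ≤ b → Set.uIcc a b ⊆ Set.Ici 0 := fun a b ha hb x hx =>
    (le_min ha hb).trans hx.1
  have hrect : ∀ ε S : ℝ, 0 < ε → ε ≤ S →
      (∫ s in ε..S, G s) - (∫ s in ε..S, G (s + Real.pi * I))
        + I * (∫ φ in (0 : ℝ)..Real.pi, G (S + φ * I))
        - I * (∫ φ in (0 : ℝ)..Real.pi, G (ε + φ * I)) = 0 := by
    intro ε S hε hS
    have := Complex.integral_boundary_rect_eq_zero_of_continuousOn_of_differentiableOn G (ε : ℂ)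
      (S + Real.pi * I) (hGc.mono fun w hw => ?_) (hGd.mono fun w hw => ?_)
    · simpa using this
    · obtain ⟨h1, h2⟩ := mem_reProdIm.1 hw
      simp at h1 h2
      rw [Set.uIcc_of_le hS] at h1
      rw [Set.uIcc_of_le hπ.le] at h2
      exact ⟨hε.le.trans h1.1, h2.1, h2.2, Or.inl (hε.trans_le h1.1).ne'⟩
    · obtain ⟨h1, h2⟩ := mem_reProdIm.1 hw
      have e1 : ((S : ℂ) + Real.pi * I).re = S := by simp
      have e2 : ((S : ℂ) + Real.pi * I).im = Real.pi := by simp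
      rw [e1, ofReal_re, min_eq_left hS] at h1
      rw [e2, ofReal_im, min_eq_left hπ.le, max_eq_right hπ.le] at h2
      exact ⟨hε.trans h1.1, h2.1, h2.2⟩
  -- Moving the left side to `Re w = 0` crosses no singularity except the excluded midpoint, a null
  -- set; local boundedness allows dominated convergence.
  have hrect0 : ∀ S : ℝ, 0 < S →
      (∫ s in (0 : ℝ)..S, G s) - (∫ s in (0 : ℝ)..S, G (s + Real.pi * I))
        + I * (∫ φ in (0 : ℝ)..Real.pi, G (S + φ * I))
        - I * (∫ φ in (0 : ℝ)..Real.pi, G (φ * I)) = 0 := by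
    intro S hS
    obtain ⟨B, hB⟩ := hGb S
    have hprim : ∀ g : ℝ → ℂ, ContinuousOn g (Set.Ici 0) →
        Tendsto (fun ε : ℝ => ∫ s in ε..S, g s) (𝓝[>] 0) (𝓝 (∫ s in (0 : ℝ)..S, g s)) := by
      intro g hg
      have hi : IntegrableOn g (Set.uIcc S 0) :=
        (hg.mono (hsub S 0 hS.le le_rfl)).integrableOn_compact isCompact_uIcc
      have h1 := intervalIntegral.continuousOn_primitive_interval hi
      have h2 : Tendsto (fun ε : ℝ => ∫ s in S..ε, g s) (𝓝[>] 0) (𝓝 (∫ s in S..(0 : ℝ), g s)) := by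
        refine (h1 0 Set.right_mem_uIcc).mono_left ?_
        rw [Set.uIcc_of_ge hS.le]
        exact le_trans (nhdsWithin_le_of_mem (Icc_mem_nhdsGT hS)) le_rfl
      have h3 := h2.neg
      simpa only [← intervalIntegral.integral_symm] using h3
    have hside : Tendsto (fun ε : ℝ => ∫ φ in (0 : ℝ)..Real.pi, G (ε + φ * I)) (𝓝[>] 0)
        (𝓝 (∫ φ in (0 : ℝ)..Real.pi, G (φ * I))) := by
      refine intervalIntegral.tendsto_integral_filter_of_dominated_convergence (fun _ => B) ?_ ?_
        (by simp) ?_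
      · filter_upwards [self_mem_nhdsWithin] with ε hε
        have hε : 0 < ε := hε
        have : ContinuousOn (fun φ : ℝ => G (ε + φ * I)) (Set.uIcc 0 Real.pi) :=
          hGc.comp (by fun_prop) fun φ hφ => by
            have := hu φ hφ
            exact ⟨by simpa using hε.le, by simpa using this.1, by simpa using this.2,
              Or.inl (by simpa using hε.ne')⟩
        exact (this.mono Set.uIoc_subset_uIcc).aestronglyMeasurable measurableSet_uIoc
      · filter_upwards [Ioo_mem_nhdsGT hS] with ε hε
        refine Eventually.of_forall fun φ hφ => ?_
        have := hu φ (Set.uIoc_subset_uIcc hφ)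
        exact hB _ (by simpa using hε.1.le) (by simpa using hε.2.le) (by simpa using this.1)
          (by simpa using this.2) (Or.inl (by simpa using hε.1.ne'))
      · have hne : ∀ᵐ φ : ℝ, φ ≠ Real.pi / 2 := by simp [ae_iff]
        filter_upwards [hne] with φ h1 h2
        have h3 := hu φ (Set.uIoc_subset_uIcc h2)
        have h4 := hGc (φ * I) ⟨by simp, by simpa using h3.1, by simpa using h3.2,
          Or.inr (by simpa using h1)⟩
        have h5 : Tendsto (fun ε : ℝ => (ε : ℂ) + φ * I) (𝓝[>] 0)
            (𝓝[{w | 0 ≤ w.re ∧ 0 ≤ w.im ∧ w.im ≤ Real.pi ∧ (w.re ≠ 0 ∨ w.im ≠ Real.pi / 2)}]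
              (φ * I)) := by
          refine tendsto_nhdsWithin_iff.2 ⟨?_, ?_⟩
          · have : Continuous fun ε : ℝ => (ε : ℂ) + φ * I := by fun_prop
            simpa using (this.tendsto 0).mono_left nhdsWithin_le_nhds
          · filter_upwards [self_mem_nhdsWithin] with ε hε
            have hε : 0 < ε := hε
            exact ⟨by simpa using hε.le, by simpa using h3.1, by simpa using h3.2,
              Or.inl (by simpa using hε.ne')⟩
        exact h4.tendsto.comp h5
    have h1 := (((hprim _ hlow).sub (hprim _ hupp)).add (tendsto_const_nhds
      (x := I * (∫ φ in (0 : ℝ)..Real.pi, G (S + φ * I))))).sub (hside.const_mul I)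
    refine tendsto_nhds_unique h1 (tendsto_const_nhds.congr' ?_)
    filter_upwards [Ioo_mem_nhdsGT hS] with ε hε
    exact (hrect ε S hε.1 hε.2.le).symm
  obtain ⟨C, R, hCR⟩ := hlim
  have hfar : Tendsto (fun S : ℝ => ∫ φ in (0 : ℝ)..Real.pi, G (S + φ * I)) atTop
      (𝓝 (Real.pi * c)) := by
    have h0 : Tendsto (fun S : ℝ => r * Real.exp S) atTop atTop :=
      Real.tendsto_exp_atTop.const_mul_atTop hr
    have h1 : Tendsto (fun S : ℝ => C / (r * Real.exp S) * |Real.pi - 0|) atTop (𝓝 0) := by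
      simpa using (h0.const_div_atTop C).mul_const |Real.pi - 0|
    rw [tendsto_iff_norm_sub_tendsto_zero]
    refine squeeze_zero' (Eventually.of_forall fun _ => norm_nonneg _) ?_ h1
    filter_upwards [eventually_gt_atTop 0, h0.eventually_ge_atTop R] with S hS hR
    have hi : IntervalIntegrable (fun φ : ℝ => G (S + φ * I)) volume 0 Real.pi := by
      refine ContinuousOn.intervalIntegrable (hGc.comp (by fun_prop) fun φ hφ => ?_)
      have := hu φ hφ
      exact ⟨by simpa using hS.le, by simpa using this.1, by simpa using this.2,
        Or.inl (by simpa using hS.ne')⟩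
    have e1 : (∫ φ in (0 : ℝ)..Real.pi, G (S + φ * I)) - Real.pi * c
        = ∫ φ in (0 : ℝ)..Real.pi, (G (S + φ * I) - c) := by
      rw [intervalIntegral.integral_sub hi (by simp)]; simp
    rw [e1]
    refine intervalIntegral.norm_integral_le_of_norm_le_const fun φ hφ => ?_
    have h3 := hu φ (Set.uIoc_subset_uIcc hφ)
    have hn : ‖(r : ℂ) * exp (S + φ * I)‖ = r * Real.exp S := by
      rw [norm_mul, norm_real, Real.norm_eq_abs, abs_of_pos hr, norm_exp]; simp
    have := hCR _ (mul_exp_mem_outerUpper hr (w := S + φ * I) (by simpa using hS.le)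
      (by simpa using h3.1) (by simpa using h3.2) (Or.inl (by simpa using hS.ne'))) (hn ▸ hR)
    rwa [hn] at this
  have hmain := (tendsto_const_nhds (x := I * (∫ φ in (0 : ℝ)..Real.pi, G (φ * I)))).sub
    (hfar.const_mul I)
  have e0 : (fun φ : ℝ => h (r * exp (I * φ))) = fun φ : ℝ => G (φ * I) := by
    funext φ; simp only [hG, mul_comm I]
  rw [e0]
  refine hmain.congr' ?_
  filter_upwards [eventually_gt_atTop 0] with S hS
  have e1 : ∀ s : ℝ, h (r * Real.exp s) - h (-(r * Real.exp s)) = G s - G (s + Real.pi * I) := by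
    intro s
    simp only [hG, Complex.exp_add, exp_pi_mul_I, ofReal_exp]
    ring_nf
  simp only [e1]
  rw [intervalIntegral.integral_sub
    (hlow.mono (hsub 0 S le_rfl hS.le)).intervalIntegrable
    (hupp.mono (hsub 0 S le_rfl hS.le)).intervalIntegrable]
  linear_combination -(hrect0 S hS)

theorem neg_mem_closedNeg {r : ℝ} {z : ℂ} (hz : z ∈ closedPos r) : -z ∈ closedNeg r :=
  ⟨neg_ne_zero.2 hz.1, by simpa using hz.2.1, by simpa using hz.2.2⟩

theorem neg_mem_closedPos {r : ℝ} {z : ℂ} (hz : z ∈ closedNeg r) : -z ∈ closedPos r :=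
  ⟨neg_ne_zero.2 hz.1, by simpa using hz.2.1, by simpa using hz.2.2⟩

theorem outerUpper_subset {r : ℝ} (hr : 0 < r) : outerUpper r ⊆ closedPos r := by
  intro z hz
  have h0 : 0 < ‖z‖ := hr.trans_le hz.1
  refine ⟨norm_pos_iff.1 h0, fun h => ?_, mul_nonneg (by nlinarith [hz.1]) hz.2.1⟩
  have h1 : (z - I * r) * (z + I * r) = 0 := by linear_combination h - (r : ℂ) ^ 2 * I_sq
  rcases mul_eq_zero.1 h1 with h2 | h2
  · exact hz.2.2 (sub_eq_zero.1 h2)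
  · have h3 := hz.2.1
    rw [eq_neg_of_add_eq_zero_left h2] at h3
    simp at h3
    linarith

/-- A pair of bounded functions, holomorphic in the two regions cut out by the contour, continuous
up to the contour, with the same leading behaviour `c / z` at infinity. -/
structure ContourPair (r : ℝ) (fp fm : ℂ → ℂ) (c : ℂ) : Prop where
  cont_pos : ContinuousOn fp (closedPos r)
  cont_neg : ContinuousOn fm (closedNeg r)
  diff_pos : DifferentiableOn ℂ fp (openPos r)
  diff_neg : DifferentiableOn ℂ fm {z | (‖z‖ ^ 2 - r ^ 2) * z.im < 0}
  bound_pos : ∃ B, ∀ z ∈ closedPos r, ‖fp z‖ ≤ B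
  bound_neg : ∃ B, ∀ z ∈ closedNeg r, ‖fm z‖ ≤ B
  decay_pos : ∃ C R, ∀ z ∈ closedPos r, R ≤ ‖z‖ → ‖fp z - c / z‖ ≤ C / ‖z‖ ^ 2
  decay_neg : ∃ C R, ∀ z ∈ closedNeg r, R ≤ ‖z‖ → ‖fm z - c / z‖ ≤ C / ‖z‖ ^ 2

/-- Because `dz = z dw`, the function to integrate in logarithmic coordinates is `z f(z)`, which
tends to `c`. Taking `σ = 1` or `σ = -1` covers the upper or the lower outer region. -/
theorem quarter_contour_mul {r : ℝ} (hr : 0 < r) {f : ℂ → ℂ} {Ω D : Set ℂ} {c : ℂ}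
    (hc : ContinuousOn f Ω) (hd : DifferentiableOn ℂ f D) (hb : ∃ B, ∀ z ∈ Ω, ‖f z‖ ≤ B)
    (hdec : ∃ C R, ∀ z ∈ Ω, R ≤ ‖z‖ → ‖f z - c / z‖ ≤ C / ‖z‖ ^ 2) {σ : ℂ} (hσ : ‖σ‖ = 1)
    (hΩ : ∀ z ∈ outerUpper r, σ * z ∈ Ω) (hD : ∀ z, r < ‖z‖ → 0 < z.im → σ * z ∈ D) :
    Tendsto (fun S : ℝ => ∫ s in (0 : ℝ)..S, (f (σ * (r * Real.exp s)) * (σ * (r * Real.exp s))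
        - f (σ * -(r * Real.exp s)) * (σ * -(r * Real.exp s)))) atTop
      (𝓝 (I * (∫ φ in (0 : ℝ)..Real.pi, f (σ * (r * exp (I * φ))) * (σ * (r * exp (I * φ))))
        - I * (Real.pi * c))) := by
  have hσz : ∀ z : ℂ, ‖σ * z‖ = ‖z‖ := fun z => by rw [norm_mul, hσ, one_mul]
  refine quarter_contour hr (h := fun z => f (σ * z) * (σ * z)) ?_ ?_ ?_ ?_
  · exact (hc.comp (by fun_prop) hΩ).mul (by fun_prop)
  · exact (hd.comp (by fun_prop) fun z hz => hD z hz.1 hz.2).mul (by fun_prop)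
  · obtain ⟨B, hB⟩ := hb
    refine fun R => ⟨B * R, fun z hz hzR => ?_⟩
    rw [norm_mul, hσz]
    exact mul_le_mul (hB _ (hΩ z hz)) hzR (norm_nonneg _) ((norm_nonneg _).trans (hB _ (hΩ z hz)))
  · obtain ⟨C, R, hC⟩ := hdec
    refine ⟨C, R, fun z hz hzR => ?_⟩
    have h0 : 0 < ‖z‖ := hr.trans_le hz.1
    have h1 : σ * z ≠ 0 := norm_pos_iff.1 (by rw [hσz]; exact h0)
    have h2 := hC _ (hΩ z hz) (by rwa [hσz])
    have e1 : f (σ * z) * (σ * z) - c = (f (σ * z) - c / (σ * z)) * (σ * z) := by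
      rw [sub_mul, div_mul_cancel₀ _ h1]
    rw [e1, norm_mul]
    rw [hσz] at h2 ⊢
    calc _ ≤ C / ‖z‖ ^ 2 * ‖z‖ := by gcongr
      _ = C / ‖z‖ := by field_simp

/-- Inversion carries the outer regions to the inner ones. There `f` is bounded and the factor
`-r²/z` decays, so the far side contributes nothing: a bounded function has no residue at `0`. -/
theorem quarter_contour_hat {r : ℝ} (hr : 0 < r) {f : ℂ → ℂ} {Ω D : Set ℂ}
    (hc : ContinuousOn f Ω) (hd : DifferentiableOn ℂ f D) (hb : ∃ B, ∀ z ∈ Ω, ‖f z‖ ≤ B)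
    {σ : ℂ} (hσ : ‖σ‖ = 1) (hΩ : ∀ z ∈ outerUpper r, σ * hat r z ∈ Ω)
    (hD : ∀ z, r < ‖z‖ → 0 < z.im → σ * hat r z ∈ D) :
    Tendsto (fun S : ℝ => ∫ s in (0 : ℝ)..S,
        (f (σ * hat r (r * Real.exp s)) * (σ * hat r (r * Real.exp s))
        - f (σ * hat r (-(r * Real.exp s))) * (σ * hat r (-(r * Real.exp s))))) atTop
      (𝓝 (I * (∫ φ in (0 : ℝ)..Real.pi,
        f (σ * hat r (r * exp (I * φ))) * (σ * hat r (r * exp (I * φ)))))) := by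
  have hσz : ∀ z : ℂ, ‖σ * hat r z‖ = r ^ 2 / ‖z‖ := fun z => by
    rw [norm_mul, hσ, one_mul, norm_hat]
  have hdiff : DifferentiableOn ℂ (fun z => σ * hat r z) {z | z ≠ 0} :=
    (differentiableOn_const σ).mul (differentiableOn_hat r)
  have hne : ∀ z ∈ outerUpper r, z ≠ 0 := fun z hz => norm_pos_iff.1 (hr.trans_le hz.1)
  obtain ⟨B, hB⟩ := hb
  have hbd : ∀ z ∈ outerUpper r, ‖f (σ * hat r z) * (σ * hat r z)‖ ≤ B * r ^ 2 / ‖z‖ := by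
    intro z hz
    rw [norm_mul, hσz, mul_div_assoc]
    exact mul_le_mul_of_nonneg_right (hB _ (hΩ z hz)) (by positivity)
  have := quarter_contour hr (h := fun z => f (σ * hat r z) * (σ * hat r z)) (c := 0) ?_ ?_ ?_ ?_
  · simpa using this
  · exact (hc.comp (hdiff.continuousOn.mono hne) hΩ).mul (hdiff.continuousOn.mono hne)
  · have hne' : {z : ℂ | r < ‖z‖ ∧ 0 < z.im} ⊆ {z | z ≠ 0} := fun z hz =>
      norm_pos_iff.1 (hr.trans hz.1)
    exact (hd.comp (hdiff.mono hne') fun z hz => hD z hz.1 hz.2).mul (hdiff.mono hne')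
  · refine fun R => ⟨B * r ^ 2 / r, fun z hz _ => (hbd z hz).trans ?_⟩
    have hB0 : 0 ≤ B := (norm_nonneg _).trans (hB _ (hΩ z hz))
    have := hz.1
    gcongr
  · exact ⟨B * r ^ 2, 0, fun z hz _ => by rw [sub_zero]; exact hbd z hz⟩

theorem real_mem_closed {r : ℝ} (hr : 0 < r) {s : ℝ} (hs : s ≠ 0) :
    (s : ℂ) ∈ closedPos r ∧ (s : ℂ) ∈ closedNeg r := by
  have h1 : (s : ℂ) ^ 2 + (r : ℂ) ^ 2 ≠ 0 := by
    have : (s : ℂ) ^ 2 + (r : ℂ) ^ 2 = ((s ^ 2 + r ^ 2 : ℝ) : ℂ) := by push_cast; ring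
    rw [this]
    exact ofReal_ne_zero.2 (by positivity)
  exact ⟨⟨ofReal_ne_zero.2 hs, h1, by simp⟩, ⟨ofReal_ne_zero.2 hs, h1, by simp⟩⟩

theorem circle_mem_closed {r : ℝ} (hr : 0 < r) {φ : ℝ} (hφ : Real.cos φ ≠ 0) :
    (r : ℂ) * exp (I * φ) ∈ closedPos r ∧ (r : ℂ) * exp (I * φ) ∈ closedNeg r := by
  have hn : ‖(r : ℂ) * exp (I * φ)‖ = r := by
    rw [norm_mul, norm_real, Real.norm_eq_abs, abs_of_pos hr, norm_exp]; simp
  have h0 : (r : ℂ) * exp (I * φ) ≠ 0 := norm_pos_iff.1 (hn.symm ▸ hr)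
  have h1 : ((r : ℂ) * exp (I * φ)) ^ 2 + (r : ℂ) ^ 2 ≠ 0 := by
    have hr' : (r : ℂ) ≠ 0 := ofReal_ne_zero.2 hr.ne'
    have e1 : ((r : ℂ) * exp (I * φ)) ^ 2 + (r : ℂ) ^ 2
        = (r : ℂ) ^ 2 * (exp (I * φ) * (2 * Complex.cos φ)) := by
      have : exp (I * φ) * exp (-(φ * I)) = 1 := by rw [← Complex.exp_add]; ring_nf; simp
      rw [Complex.two_cos, ← mul_comm I, mul_add]
      rw [show -(φ : ℂ) * I = -(φ * I) by ring, this]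
      ring
    rw [e1, ← ofReal_cos]
    exact mul_ne_zero (pow_ne_zero _ hr') (mul_ne_zero (exp_ne_zero _)
      (mul_ne_zero two_ne_zero (ofReal_ne_zero.2 hφ)))
  exact ⟨⟨h0, h1, by rw [hn]; simp⟩, ⟨h0, h1, by rw [hn]; simp⟩⟩

open KEPotential MeasureTheory

theorem norm_circle {r : ℝ} (hr : 0 < r) (φ : ℝ) : ‖(r : ℂ) * exp (I * φ)‖ = r := by
  rw [norm_mul, norm_real, Real.norm_eq_abs, abs_of_pos hr, norm_exp]; simp

theorem cos_ne_zero_of_mem_Icc {φ : ℝ} (h : φ ∈ Set.Icc 0 Real.pi) (hφ : φ ≠ Real.pi / 2) :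
    Real.cos φ ≠ 0 := fun h0 => hφ <| Real.injOn_cos h
  ⟨by linarith [Real.pi_pos], by linarith [Real.pi_pos]⟩ (by rw [h0, Real.cos_pi_div_two])

theorem intervalIntegrable_circlePull {r : ℝ} (hr : 0 < r) {f : ℂ → ℂ} {Ω : Set ℂ}
    (hc : ContinuousOn f Ω) (hb : ∃ B, ∀ z ∈ Ω, ‖f z‖ ≤ B)
    (hΩ : ∀ φ : ℝ, Real.cos φ ≠ 0 → (r : ℂ) * exp (I * φ) ∈ Ω) :
    IntervalIntegrable (circlePull r f) volume (-Real.pi) 0 ∧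
      IntervalIntegrable (circlePull r f) volume 0 Real.pi := by
  have hπ := Real.pi_pos
  obtain ⟨B, hB⟩ := hb
  have key : ∀ s : Set ℝ, (∀ φ ∈ s, Real.cos φ ≠ 0) → ContinuousOn (circlePull r f) s ∧
      ∀ φ ∈ s, ‖circlePull r f φ‖ ≤ B * r := by
    intro s hs
    refine ⟨(hc.comp (by fun_prop) fun φ hφ => hΩ φ (hs φ hφ)).mul (by fun_prop), fun φ hφ => ?_⟩
    have h1 := hB _ (hΩ φ (hs φ hφ))
    rw [circlePull, norm_mul, mul_assoc, norm_mul, norm_circle hr, norm_I, one_mul]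
    gcongr
  constructor
  · have hs : ∀ φ ∈ Set.uIcc (-Real.pi) 0 \ {-(Real.pi / 2)}, Real.cos φ ≠ 0 := fun φ hφ => by
      have h1 := hφ.1
      rw [Set.uIcc_of_le (by linarith)] at h1
      rw [← Real.cos_neg]
      exact cos_ne_zero_of_mem_Icc ⟨by linarith [h1.2], by linarith [h1.1]⟩
        fun h => hφ.2 (by rw [Set.mem_singleton_iff]; linarith)
    exact intervalIntegrable_of_continuousOn_diff_singleton (key _ hs).1
      fun φ h1 h2 => (key _ hs).2 φ ⟨h1, h2⟩
  · have hs : ∀ φ ∈ Set.uIcc 0 Real.pi \ {Real.pi / 2}, Real.cos φ ≠ 0 := fun φ hφ => by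
      have h1 := hφ.1
      rw [Set.uIcc_of_le hπ.le] at h1
      exact cos_ne_zero_of_mem_Icc h1 hφ.2
    exact intervalIntegrable_of_continuousOn_diff_singleton (key _ hs).1
      fun φ h1 h2 => (key _ hs).2 φ ⟨h1, h2⟩

namespace ContourPair

variable {r : ℝ} {fp fm j : ℂ → ℂ} {c : ℂ}

theorem continuousOn_real (hr : 0 < r) (h : ContourPair r fp fm c)
    (hj : ∀ ζ ∈ closedPos r, ζ ∈ closedNeg r → j ζ = fp ζ - fm ζ) :
    ContinuousOn (fun s : ℝ => j s) {s | s ≠ 0} := by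
  refine ((h.cont_pos.comp continuous_ofReal.continuousOn fun s hs =>
    (real_mem_closed hr hs).1).sub (h.cont_neg.comp continuous_ofReal.continuousOn fun s hs =>
    (real_mem_closed hr hs).2)).congr fun s hs => ?_
  exact hj _ (real_mem_closed hr hs).1 (real_mem_closed hr hs).2

/-- Each of `fp` and `fm` may decay only like `1/z`, but the common leading term `c/z` cancels in
the jump, which is therefore `O(1/z²)` and absolutely integrable. -/
theorem integrable_real (hr : 0 < r) (h : ContourPair r fp fm c)
    (hj : ∀ ζ ∈ closedPos r, ζ ∈ closedNeg r → j ζ = fp ζ - fm ζ) :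
    Integrable (fun s : ℝ => j s) := by
  obtain ⟨B, hB⟩ := h.bound_pos
  obtain ⟨B', hB'⟩ := h.bound_neg
  obtain ⟨C, R, hC⟩ := h.decay_pos
  obtain ⟨C', R', hC'⟩ := h.decay_neg
  have hmeas : AEStronglyMeasurable (fun s : ℝ => j s) volume := by
    have h1 := (h.continuousOn_real hr hj).aestronglyMeasurable (μ := volume)
      (isOpen_ne (x := (0 : ℝ))).measurableSet
    rwa [Measure.restrict_eq_self_of_ae_mem] at h1
    simp [ae_iff]
  set R₀ : ℝ := max 1 (max R R') with hR₀
  set M : ℝ := (|B| + |B'|) * (1 + R₀ ^ 2) + 2 * (|C| + |C'|) with hM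
  refine (integrable_inv_one_add_sq.const_mul M).mono' hmeas ?_
  have hne : ∀ᵐ s : ℝ, s ≠ 0 := by simp [ae_iff]
  filter_upwards [hne] with s hs
  obtain ⟨hp, hm⟩ := real_mem_closed hr hs
  rw [hj _ hp hm, ← div_eq_mul_inv, le_div_iff₀ (by positivity)]
  have hns : ‖(s : ℂ)‖ = |s| := by rw [norm_real, Real.norm_eq_abs]
  rcases le_total R₀ |s| with h1 | h1
  · have hs1 : 1 ≤ |s| := (le_max_left _ _).trans h1
    have h2 := hC s hp (hns ▸ ((le_max_left _ _).trans (le_max_right _ _)).trans h1)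
    have h3 := hC' s hm (hns ▸ ((le_max_right _ _).trans (le_max_right _ _)).trans h1)
    rw [hns, sq_abs] at h2 h3
    have hs2 : 0 < s ^ 2 := by positivity
    have hs3 : 1 ≤ s ^ 2 := by rw [← sq_abs]; nlinarith
    have h4 : ‖fp s - fm s‖ ≤ (|C| + |C'|) / s ^ 2 := by
      calc ‖fp s - fm s‖ = ‖(fp s - c / s) - (fm s - c / s)‖ := by congr 1; ring
        _ ≤ C / s ^ 2 + C' / s ^ 2 := (norm_sub_le _ _).trans (add_le_add h2 h3)
        _ ≤ |C| / s ^ 2 + |C'| / s ^ 2 := by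
            gcongr
            · exact le_abs_self _
            · exact le_abs_self _
        _ = _ := by ring
    have h5 : 0 ≤ (|B| + |B'|) * (1 + R₀ ^ 2) := by positivity
    calc _ ≤ (|C| + |C'|) / s ^ 2 * (1 + s ^ 2) := by gcongr
      _ ≤ (|C| + |C'|) / s ^ 2 * (2 * s ^ 2) := by gcongr; linarith
      _ = 2 * (|C| + |C'|) := by field_simp
      _ ≤ M := by rw [hM]; linarith
  · have h2 : s ^ 2 ≤ R₀ ^ 2 := sq_le_sq.2 (h1.trans (le_abs_self _))
    have h4 : ‖fp s - fm s‖ ≤ |B| + |B'| := (norm_sub_le _ _).trans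
      (add_le_add ((hB _ hp).trans (le_abs_self _)) ((hB' _ hm).trans (le_abs_self _)))
    calc _ ≤ (|B| + |B'|) * (1 + R₀ ^ 2) := by gcongr
      _ ≤ M := by rw [hM]; linarith [abs_nonneg C, abs_nonneg C']

theorem integrable_circle (hr : 0 < r) (h : ContourPair r fp fm c)
    (hj : ∀ ζ ∈ closedPos r, ζ ∈ closedNeg r → j ζ = fp ζ - fm ζ) :
    IntervalIntegrable (circlePull r j) volume (-Real.pi) 0 ∧
      IntervalIntegrable (circlePull r j) volume 0 Real.pi := by
  obtain ⟨B, hB⟩ := h.bound_pos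
  obtain ⟨B', hB'⟩ := h.bound_neg
  refine intervalIntegrable_circlePull hr (Ω := closedPos r ∩ closedNeg r)
    (((h.cont_pos.mono Set.inter_subset_left).sub (h.cont_neg.mono Set.inter_subset_right)).congr
      fun z hz => hj z hz.1 hz.2) ⟨B + B', fun z hz => ?_⟩ fun φ hφ => circle_mem_closed hr hφ
  rw [hj z hz.1 hz.2]
  exact (norm_sub_le _ _).trans (add_le_add (hB z hz.1) (hB' z hz.2))

/-- `fp` lives in the upper outer region and `fm` in the lower one; each contributes half of the
residue `c` at infinity. -/
theorem tendsto_outer (hr : 0 < r) (h : ContourPair r fp fm c) :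
    Tendsto (fun S : ℝ => ∫ s in (0 : ℝ)..S, (r * Real.exp s : ℂ)
      * ((fp (r * Real.exp s) - fm (r * Real.exp s))
        + (fp (-(r * Real.exp s)) - fm (-(r * Real.exp s))))) atTop
      (𝓝 ((∫ φ in (0 : ℝ)..Real.pi, circlePull r fp φ)
        + (∫ φ in (-Real.pi)..0, circlePull r fm φ) - 2 * Real.pi * I * c)) := by
  have h1 := quarter_contour_mul hr h.cont_pos h.diff_pos h.bound_pos h.decay_pos (σ := 1) (by simp)
    (fun z hz => by rw [one_mul]; exact outerUpper_subset hr hz)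
    (fun z h1 h2 => by
      rw [one_mul]
      exact mul_pos (by nlinarith) h2)
  have h2 := quarter_contour_mul hr h.cont_neg h.diff_neg h.bound_neg h.decay_neg (σ := -1)
    (by simp) (fun z hz => by rw [neg_one_mul]; exact neg_mem_closedNeg (outerUpper_subset hr hz))
    (fun z h1 h2 => by
      rw [neg_one_mul, Set.mem_ofPred_eq, norm_neg, neg_im, mul_neg, neg_lt_zero]
      exact mul_pos (by nlinarith) h2)
  have h3 := h1.add h2
  have e1 : I * (∫ φ in (0 : ℝ)..Real.pi, fp (1 * (r * exp (I * φ))) * (1 * (r * exp (I * φ))))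
      = ∫ φ in (0 : ℝ)..Real.pi, circlePull r fp φ := by
    rw [← intervalIntegral.integral_const_mul]
    refine intervalIntegral.integral_congr fun φ _ => ?_
    simp only [circlePull, one_mul]; ring
  have e2 : I * (∫ φ in (0 : ℝ)..Real.pi, fm (-1 * (r * exp (I * φ))) * (-1 * (r * exp (I * φ))))
      = ∫ φ in (-Real.pi)..0, circlePull r fm φ := by
    have := intervalIntegral.integral_comp_sub_right (a := 0) (b := Real.pi) (circlePull r fm)
      Real.pi
    rw [zero_sub, sub_self] at this
    rw [← this, ← intervalIntegral.integral_const_mul]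
    refine intervalIntegral.integral_congr fun φ _ => ?_
    have e3 : exp (I * ((φ - Real.pi : ℝ) : ℂ)) = -exp (I * φ) := by
      push_cast
      rw [mul_sub, Complex.exp_sub, mul_comm I (Real.pi : ℂ), exp_pi_mul_I]
      ring
    simp only [circlePull, e3, neg_one_mul, mul_neg]; ring
  rw [e1, e2] at h3
  have hmem : ∀ s : ℝ, ((r * Real.exp s : ℝ) : ℂ) ∈ closedPos r ∧
      ((r * Real.exp s : ℝ) : ℂ) ∈ closedNeg r := fun s =>
    real_mem_closed hr (mul_pos hr (Real.exp_pos s)).ne'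
  have hmem' : ∀ s : ℝ, (r * Real.exp s : ℂ) ∈ closedPos r ∧
      (r * Real.exp s : ℂ) ∈ closedNeg r := fun s => by simpa using hmem s
  have hexpc : Continuous fun s : ℝ => (r * Real.exp s : ℂ) := by fun_prop
  have hp1 : Continuous fun s : ℝ => fp (r * Real.exp s) :=
    h.cont_pos.comp_continuous hexpc fun s => (hmem' s).1
  have hp2 : Continuous fun s : ℝ => fp (-(r * Real.exp s)) :=
    h.cont_pos.comp_continuous hexpc.neg fun s => neg_mem_closedPos (hmem' s).2
  have hm1 : Continuous fun s : ℝ => fm (r * Real.exp s) :=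
    h.cont_neg.comp_continuous hexpc fun s => (hmem' s).2
  have hm2 : Continuous fun s : ℝ => fm (-(r * Real.exp s)) :=
    h.cont_neg.comp_continuous hexpc.neg fun s => neg_mem_closedNeg (hmem' s).1
  simp only [one_mul, neg_one_mul, neg_neg] at h3
  refine (h3.congr fun S => ?_).trans (by rw [show ∀ a b : ℂ, a - I * (Real.pi * c)
    + (b - I * (Real.pi * c)) = a + b - 2 * Real.pi * I * c by intros; ring])
  refine (intervalIntegral.integral_add
    (((hp1.mul hexpc).sub (hp2.mul hexpc.neg)).intervalIntegrable _ _)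
    (((hm2.mul hexpc.neg).sub (hm1.mul hexpc)).intervalIntegrable _ _)).symm.trans ?_
  refine intervalIntegral.integral_congr fun s _ => ?_
  simp only [Pi.sub_apply, Pi.mul_apply, Pi.neg_apply]
  ring

theorem tendsto_inner (hr : 0 < r) (h : ContourPair r fp fm c) :
    Tendsto (fun S : ℝ => ∫ s in (0 : ℝ)..S, (r * Real.exp (-s) : ℂ)
      * ((fp (r * Real.exp (-s)) - fm (r * Real.exp (-s)))
        + (fp (-(r * Real.exp (-s))) - fm (-(r * Real.exp (-s)))))) atTop
      (𝓝 ((∫ φ in (-Real.pi)..0, circlePull r fp φ)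
        + (∫ φ in (0 : ℝ)..Real.pi, circlePull r fm φ))) := by
  have hr' : (r : ℂ) ≠ 0 := ofReal_ne_zero.2 hr.ne'
  have hreg : ∀ z : ℂ, r < ‖z‖ → 0 < z.im → (‖hat r z‖ ^ 2 - r ^ 2) * (hat r z).im < 0 := by
    intro z h1 h2
    have h0 : 0 < ‖z‖ := hr.trans h1
    rw [hat_region (norm_pos_iff.1 h0), neg_lt_zero]
    have : 0 < (‖z‖ ^ 2 - r ^ 2) * z.im := mul_pos (by nlinarith) h2
    positivity
  have h1 := quarter_contour_hat hr h.cont_pos h.diff_pos h.bound_pos (σ := -1) (by simp)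
    (fun z hz => by
      rw [neg_one_mul]
      exact neg_mem_closedPos (hat_mem_closedNeg hr (outerUpper_subset hr hz)))
    (fun z h1 h2 => by
      have := hreg z h1 h2
      rw [neg_one_mul]
      change 0 < (‖-hat r z‖ ^ 2 - r ^ 2) * (-hat r z).im
      rw [norm_neg, neg_im]
      linarith)
  have h2 := quarter_contour_hat hr h.cont_neg h.diff_neg h.bound_neg (σ := 1) (by simp)
    (fun z hz => by rw [one_mul]; exact hat_mem_closedNeg hr (outerUpper_subset hr hz))
    (fun z h1 h2 => by rw [one_mul]; exact hreg z h1 h2)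
  have h3 := h1.add h2
  have hinv : ∀ φ : ℝ, hat r (r * exp (I * φ)) = -(r * exp (-(I * φ))) := fun φ => by
    rw [hat, Complex.exp_neg]
    have := exp_ne_zero (I * φ)
    field_simp
  have e1 : I * (∫ φ in (0 : ℝ)..Real.pi,
        fp (-1 * hat r (r * exp (I * φ))) * (-1 * hat r (r * exp (I * φ))))
      = ∫ φ in (-Real.pi)..0, circlePull r fp φ := by
    have := intervalIntegral.integral_comp_neg (a := 0) (b := Real.pi) (circlePull r fp)
    rw [neg_zero] at this
    rw [← this, ← intervalIntegral.integral_const_mul]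
    refine intervalIntegral.integral_congr fun φ _ => ?_
    simp only [circlePull, hinv, neg_one_mul, neg_neg, ofReal_neg, mul_neg]; ring
  have e2 : I * (∫ φ in (0 : ℝ)..Real.pi,
        fm (1 * hat r (r * exp (I * φ))) * (1 * hat r (r * exp (I * φ))))
      = ∫ φ in (0 : ℝ)..Real.pi, circlePull r fm φ := by
    have := intervalIntegral.integral_comp_sub_left (a := 0) (b := Real.pi) (circlePull r fm)
      Real.pi
    rw [sub_zero, sub_self] at this
    rw [← this, ← intervalIntegral.integral_const_mul]
    refine intervalIntegral.integral_congr fun φ _ => ?_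
    have e3 : exp (I * ((Real.pi - φ : ℝ) : ℂ)) = -exp (-(I * φ)) := by
      push_cast
      rw [mul_sub, Complex.exp_sub, mul_comm I (Real.pi : ℂ), exp_pi_mul_I, Complex.exp_neg]
      ring
    simp only [circlePull, hinv, e3, one_mul, mul_neg]; ring
  rw [e1, e2] at h3
  have hmem : ∀ s : ℝ, (r * Real.exp (-s) : ℂ) ∈ closedPos r ∧
      (r * Real.exp (-s) : ℂ) ∈ closedNeg r := fun s => by
    simpa using real_mem_closed hr (mul_pos hr (Real.exp_pos (-s))).ne'
  have hexpc : Continuous fun s : ℝ => (r * Real.exp (-s) : ℂ) := by fun_prop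
  have hp1 : Continuous fun s : ℝ => fp (r * Real.exp (-s)) :=
    h.cont_pos.comp_continuous hexpc fun s => (hmem s).1
  have hp2 : Continuous fun s : ℝ => fp (-(r * Real.exp (-s))) :=
    h.cont_pos.comp_continuous hexpc.neg fun s => neg_mem_closedPos (hmem s).2
  have hm1 : Continuous fun s : ℝ => fm (r * Real.exp (-s)) :=
    h.cont_neg.comp_continuous hexpc fun s => (hmem s).2
  have hm2 : Continuous fun s : ℝ => fm (-(r * Real.exp (-s))) :=
    h.cont_neg.comp_continuous hexpc.neg fun s => neg_mem_closedNeg (hmem s).1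
  have hh1 : ∀ s : ℝ, hat r (r * Real.exp s) = -(r * Real.exp (-s)) := fun s => by
    rw [hat, Real.exp_neg]
    push_cast
    have := exp_ne_zero (s : ℂ)
    field_simp
  have hh2 : ∀ s : ℝ, hat r (-(r * Real.exp s)) = r * Real.exp (-s) := fun s => by
    rw [hat, Real.exp_neg]
    push_cast
    have := exp_ne_zero (s : ℂ)
    field_simp
  simp only [one_mul, neg_one_mul, hh1, hh2, neg_neg] at h3
  refine h3.congr fun S => ?_
  refine (intervalIntegral.integral_add
    (((hp1.mul hexpc).sub (hp2.mul hexpc.neg)).intervalIntegrable _ _)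
    (((hm2.mul hexpc.neg).sub (hm1.mul hexpc)).intervalIntegrable _ _)).symm.trans ?_
  refine intervalIntegral.integral_congr fun s _ => ?_
  simp only [Pi.sub_apply, Pi.mul_apply, Pi.neg_apply]
  ring

/-- The integral of the jump of a sectionally holomorphic function along the contour. -/
theorem integral_eq (hr : 0 < r) (h : ContourPair r fp fm c)
    (hj : ∀ ζ ∈ closedPos r, ζ ∈ closedNeg r → j ζ = fp ζ - fm ζ) :
    (∫ s : ℝ in Set.Iio (-r), j s) - (∫ s : ℝ in (-r)..r, j s) + (∫ s : ℝ in Set.Ioi r, j s)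
      - (∫ φ in (0 : ℝ)..Real.pi, circlePull r j φ) + (∫ φ in (-Real.pi)..0, circlePull r j φ)
      = -(2 * Real.pi * I * c) := by
  have hji := h.integrable_real hr hj
  -- Folding the real axis at `0` matches the two horizontal sides of the half-strip; the
  -- substitutions `x = r e^s` and `x = r e^{-s}` then produce the outer and the inner part of the
  -- axis.
  set g : ℝ → ℂ := fun x => j x + j (-x) with hg
  have hji' : Integrable fun x : ℝ => j (-x) := by simpa using hji.comp_neg
  have hgi : Integrable g := hji.add hji'
  have hjc := h.continuousOn_real hr hj
  have hgc : ContinuousOn g {s | s ≠ 0} := by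
    refine hjc.add ((hjc.comp continuous_neg.continuousOn fun s hs => neg_ne_zero.2 hs).congr
      fun s _ => ?_)
    simp
  have hgval : ∀ y : ℝ, 0 < y → (fp y - fm y) + (fp (-y) - fm (-y)) = g y := by
    intro y hy
    obtain ⟨h1, h2⟩ := real_mem_closed hr hy.ne'
    rw [hg]
    simp only
    rw [hj _ h1 h2, hj _ (neg_mem_closedPos h2) (neg_mem_closedNeg h1)]
  have hout : Tendsto (fun S : ℝ => ∫ x in r..r * Real.exp S, g x) atTop
      (𝓝 (∫ x in Set.Ioi r, g x)) :=
    intervalIntegral_tendsto_integral_Ioi r hgi.integrableOn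
      (Real.tendsto_exp_atTop.const_mul_atTop hr)
  have hin : Tendsto (fun S : ℝ => ∫ x in r..r * Real.exp (-S), g x) atTop
      (𝓝 (∫ x in r..(0 : ℝ), g x)) := by
    have h1 : Continuous fun b : ℝ => ∫ x in r..b, g x :=
      intervalIntegral.continuous_primitive (fun a b => hgi.intervalIntegrable) r
    have h2 : Tendsto (fun S : ℝ => r * Real.exp (-S)) atTop (𝓝 0) := by
      simpa using (Real.tendsto_exp_atBot.comp tendsto_neg_atTop_atBot).const_mul r
    exact (h1.tendsto 0).comp h2
  have h1 := h.tendsto_outer hr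
  have h2 := h.tendsto_inner hr
  have s1 : ∀ S : ℝ, (∫ s in (0 : ℝ)..S, (r * Real.exp s : ℂ)
      * ((fp (r * Real.exp s) - fm (r * Real.exp s))
        + (fp (-(r * Real.exp s)) - fm (-(r * Real.exp s))))) = ∫ x in r..r * Real.exp S, g x := by
    intro S
    have := intervalIntegral.integral_deriv_smul_comp'' (a := 0) (b := S)
      (f := fun s => r * Real.exp s) (f' := fun s => r * Real.exp s) (g := g) (by fun_prop)
      (fun s _ => ((Real.hasDerivAt_exp s).const_mul r).hasDerivWithinAt) (by fun_prop)
      (hgc.mono (by rintro _ ⟨s, _, rfl⟩; exact (mul_pos hr (Real.exp_pos s)).ne'))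
    rw [Real.exp_zero, mul_one] at this
    rw [← this]
    refine intervalIntegral.integral_congr fun s _ => ?_
    simp only [Function.comp, real_smul]
    rw [← hgval _ (mul_pos hr (Real.exp_pos s))]
    push_cast
    rfl
  have s2 : ∀ S : ℝ, (∫ s in (0 : ℝ)..S, (r * Real.exp (-s) : ℂ)
      * ((fp (r * Real.exp (-s)) - fm (r * Real.exp (-s)))
        + (fp (-(r * Real.exp (-s))) - fm (-(r * Real.exp (-s))))))
      = -∫ x in r..r * Real.exp (-S), g x := by
    intro S
    have := intervalIntegral.integral_deriv_smul_comp'' (a := 0) (b := S)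
      (f := fun s => r * Real.exp (-s)) (f' := fun s => -(r * Real.exp (-s))) (g := g) (by fun_prop)
      (fun s _ => by
        have := ((hasDerivAt_neg s).exp.const_mul r)
        exact (this.congr_deriv (by ring)).hasDerivWithinAt) (by fun_prop)
      (hgc.mono (by rintro _ ⟨s, _, rfl⟩; exact (mul_pos hr (Real.exp_pos (-s))).ne'))
    simp only [neg_zero, Real.exp_zero, mul_one] at this
    rw [← this, ← intervalIntegral.integral_neg]
    refine intervalIntegral.integral_congr fun s _ => ?_
    simp only [Function.comp, real_smul]
    rw [← hgval _ (mul_pos hr (Real.exp_pos (-s)))]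
    push_cast
    ring
  have o1 := tendsto_nhds_unique hout (h1.congr s1)
  have o2 := tendsto_nhds_unique hin.neg (h2.congr s2)
  rw [← intervalIntegral.integral_symm] at o2
  have g1 : ∫ x in Set.Ioi r, g x
      = (∫ s : ℝ in Set.Ioi r, j s) + ∫ s : ℝ in Set.Iio (-r), j s := by
    have e := integral_comp_neg_Ioi r (fun s : ℝ => j s)
    rw [integral_Iic_eq_integral_Iio] at e
    rw [← e, ← integral_add hji.integrableOn (by simpa using hji'.restrict)]
    refine setIntegral_congr_fun measurableSet_Ioi fun x _ => ?_
    simp [hg]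
  have g2 : ∫ x in (0 : ℝ)..r, g x = ∫ s : ℝ in (-r)..r, j s := by
    have e := intervalIntegral.integral_comp_neg (a := 0) (b := r) (fun s : ℝ => j s)
    rw [neg_zero] at e
    rw [← intervalIntegral.integral_add_adjacent_intervals (b := (0 : ℝ)) hji.intervalIntegrable
      hji.intervalIntegrable, ← e, add_comm,
      ← intervalIntegral.integral_add hji.intervalIntegrable
        (by simpa using hji'.intervalIntegrable)]
    refine intervalIntegral.integral_congr fun x _ => ?_
    simp [hg]
  obtain ⟨p1, p2⟩ := intervalIntegrable_circlePull hr h.cont_pos h.bound_pos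
    fun φ hφ => (circle_mem_closed hr hφ).1
  obtain ⟨m1, m2⟩ := intervalIntegrable_circlePull hr h.cont_neg h.bound_neg
    fun φ hφ => (circle_mem_closed hr hφ).2
  have hcongr : ∀ a b p : ℝ, (∀ φ ∈ Set.uIcc a b, φ ≠ p → Real.cos φ ≠ 0) →
      IntervalIntegrable (circlePull r fp) volume a b →
      IntervalIntegrable (circlePull r fm) volume a b → ∫ φ in a..b, circlePull r j φ
        = (∫ φ in a..b, circlePull r fp φ) - ∫ φ in a..b, circlePull r fm φ := by
    intro a b p hp i1 i2
    rw [← intervalIntegral.integral_sub i1 i2]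
    refine intervalIntegral.integral_congr_ae ?_
    have hne : ∀ᵐ φ : ℝ, φ ≠ p := by simp [ae_iff]
    filter_upwards [hne] with φ h3 h4
    obtain ⟨h5, h6⟩ := circle_mem_closed hr (hp φ (Set.uIoc_subset_uIcc h4) h3)
    simp only [circlePull, hj _ h5 h6]
    ring
  have hπ := Real.pi_pos
  have c1 := hcongr 0 Real.pi (Real.pi / 2) (fun φ h3 h4 => by
    rw [Set.uIcc_of_le hπ.le] at h3
    exact cos_ne_zero_of_mem_Icc h3 h4) p2 m2
  have c2 := hcongr (-Real.pi) 0 (-(Real.pi / 2)) (fun φ h3 h4 => by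
    rw [Set.uIcc_of_le (by linarith)] at h3
    rw [← Real.cos_neg]
    exact cos_ne_zero_of_mem_Icc ⟨by linarith [h3.2], by linarith [h3.1]⟩
      fun h => h4 (by linarith)) p1 m1
  rw [c1, c2, ← g2, o2]
  rw [g1] at o1
  linear_combination o1

end ContourPair

/-! ### Behaviour of `M` at infinity and under inversion -/

theorem exists_bound_of_isBigO {Ω : Set ℂ} {f : ℂ → ℂ} {n : ℕ}
    (h : f =O[cobounded ℂ ⊓ 𝓟 Ω] fun z => z⁻¹ ^ n) :
    ∃ C R, ∀ z ∈ Ω, R ≤ ‖z‖ → ‖f z‖ ≤ C / ‖z‖ ^ n := by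
  obtain ⟨C, hC⟩ := h.bound
  rw [eventually_inf_principal, ← comap_norm_atTop, eventually_comap] at hC
  obtain ⟨R, hR⟩ := eventually_atTop.1 hC
  refine ⟨C, R, fun z hz hzR => ?_⟩
  have := hR ‖z‖ hzR z rfl hz
  rwa [norm_pow, norm_inv, inv_pow, ← div_eq_mul_inv] at this

theorem isBigO_of_exists_bound {Ω : Set ℂ} {f : ℂ → ℂ} {n : ℕ}
    (h : ∃ C R, ∀ z ∈ Ω, R ≤ ‖z‖ → ‖f z‖ ≤ C / ‖z‖ ^ n) :
    f =O[cobounded ℂ ⊓ 𝓟 Ω] fun z => z⁻¹ ^ n := by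
  obtain ⟨C, R, hC⟩ := h
  refine Asymptotics.IsBigO.of_bound C ?_
  rw [eventually_inf_principal, ← comap_norm_atTop, eventually_comap]
  filter_upwards [eventually_ge_atTop R] with b hb z hz hzΩ
  rw [norm_pow, norm_inv, inv_pow, ← div_eq_mul_inv]
  exact hC z hzΩ (hz ▸ hb)

namespace KEPotential

variable {P : KEPotential}

/-- The coefficient of `1/z` in the expansion of the sectionally meromorphic matrix. -/
noncomputable def leadingCoeff (P : KEPotential) (x t : ℝ) : Matrix (Fin 2) (Fin 2) ℂ :=
  !![-(I * ((∫ y in Set.Iic x, (‖P.q y t‖ ^ 2 - P.q0 ^ 2) : ℝ) : ℂ)), -(I * P.q x t);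
     -(I * (starRingEnd ℂ) (P.q x t)), I * ((∫ y in Set.Iic x, (‖P.q y t‖ ^ 2 - P.q0 ^ 2) : ℝ) : ℂ)]

namespace Admissible

variable (hP : P.Admissible)

include hP

theorem isBigO_uM_zero (x t : ℝ) :
    (fun z => P.uM 0 x t z 0 - 1 - z⁻¹ * leadingCoeff P x t 0 0)
        =O[cobounded ℂ ⊓ 𝓟 (closedPos P.q0)] (fun z => z⁻¹ ^ 2) ∧
      (fun z => P.uM 0 x t z 1 - z⁻¹ * leadingCoeff P x t 1 0)
        =O[cobounded ℂ ⊓ 𝓟 (closedPos P.q0)] (fun z => z⁻¹ ^ 2) := by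
  obtain ⟨C, R, h⟩ := (hP.smoothAtBot t).xjost_asymptotics x
  constructor
  · refine isBigO_of_exists_bound ⟨C, R, fun z hz hR => ?_⟩
    refine le_trans (le_of_eq ?_) (h z hz hR _ _ (hP.xjost_uM_zero hz t)).1
    rw [integral_complex_ofReal]
    congr 1
    simp only [leadingCoeff, of_apply, cons_val', cons_val_zero, cons_val_fin_one, q0]
    rw [div_eq_mul_inv]
    ring
  · refine isBigO_of_exists_bound ⟨C, R, fun z hz hR => ?_⟩
    refine le_trans (le_of_eq ?_) (h z hz hR _ _ (hP.xjost_uM_zero hz t)).2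
    congr 1
    simp only [leadingCoeff, of_apply, cons_val', cons_val_zero, cons_val_one, cons_val_fin_one]
    rw [div_eq_mul_inv]
    ring

/-- If `a` and `b` are the `1/z` coefficients of `u_{-,11}` and `u_{+,22}`, then `s₂₂ = 1 + (a +
b)/z + O(1/z²)`, as `γ` differs from `1` only at order `1/z²`. Dividing by `s₂₂` turns `1 + b/z`
into `1 - a/z`, which removes the integral over `(x, ∞)`. -/
theorem isBigO_MPlus (x t : ℝ) (i j : Fin 2) :
    (fun z => P.MPlus x t z i j - (1 : Matrix (Fin 2) (Fin 2) ℂ) i j - z⁻¹ * leadingCoeff P x t i j)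
      =O[cobounded ℂ ⊓ 𝓟 (closedPos P.q0)] fun z => z⁻¹ ^ 2 := by
  set F := cobounded ℂ ⊓ 𝓟 (closedPos P.q0) with hF
  obtain ⟨h1, h2⟩ := hP.isBigO_uM_zero x t
  obtain ⟨h3', h4'⟩ := hP.reflect.isBigO_uM_zero (-x) (-t)
  rw [hP.reflect_q0, ← hF] at h3' h4'
  rw [← hF] at h1 h2
  set a := leadingCoeff P x t 0 0 with ha
  set p := leadingCoeff P x t 1 0 with hp
  set b := leadingCoeff P.reflect (-x) (-t) 0 0 with hb
  have hd : leadingCoeff P.reflect (-x) (-t) 1 0 = leadingCoeff P x t 0 1 := by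
    simp [leadingCoeff, reflect_q]
  rw [hd] at h4'
  set d := leadingCoeff P x t 0 1 with hd
  have hmem : ∀ᶠ z in F, z ∈ closedPos P.q0 := mem_inf_of_right (mem_principal_self _)
  have h3 : (fun z => P.uP 1 x t z 1 - 1 - z⁻¹ * b) =O[F] fun z => z⁻¹ ^ 2 := by
    refine h3'.congr' (hmem.mono fun z hz => ?_) EventuallyEq.rfl
    simp only [hP.uP_one_apply hz x t 1]; rfl
  have h4 : (fun z => P.uP 1 x t z 0 - z⁻¹ * d) =O[F] fun z => z⁻¹ ^ 2 := by
    refine h4'.congr' (hmem.mono fun z hz => ?_) EventuallyEq.rfl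
    simp only [hP.uP_one_apply hz x t 0]; rfl
  have hε : Tendsto (fun z : ℂ => z⁻¹) F (𝓝 0) := tendsto_inv₀_cobounded.mono_left inf_le_left
  have hε2 : Tendsto (fun z : ℂ => z⁻¹ ^ 2) F (𝓝 0) := by simpa using hε.pow 2
  have hεε : (fun z : ℂ => z⁻¹ ^ 2) =O[F] fun z => z⁻¹ ^ 2 := Asymptotics.isBigO_refl _ _
  have hε1 : (fun z : ℂ => z⁻¹) =O[F] fun z => z⁻¹ := Asymptotics.isBigO_refl _ _
  have h21 : (fun z : ℂ => z⁻¹ ^ 2) =O[F] fun z => z⁻¹ := by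
    have := (hε.isBigO_one ℂ).mul hε1
    simpa [sq] using this
  have t0 : ∀ {f : ℂ → ℂ} {u v : ℂ}, (fun z => f z - u - z⁻¹ * v) =O[F] (fun z => z⁻¹ ^ 2) →
      Tendsto f F (𝓝 u) := fun {f u v} h => by
    have h5 := ((h.trans_tendsto hε2).add (hε.mul_const v)).add_const u
    simp only [zero_mul, zero_add] at h5
    refine h5.congr fun z => by ring
  have o1 : ∀ {f : ℂ → ℂ} {v : ℂ}, (fun z => f z - z⁻¹ * v) =O[F] (fun z => z⁻¹ ^ 2) →
      f =O[F] fun z => z⁻¹ := fun {f v} h => by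
    have h5 := (h.trans h21).add (hε1.const_mul_left v)
    refine h5.congr_left fun z => by ring
  have b3 := (t0 h3).isBigO_one ℂ
  have bγ : Tendsto P.gam F (𝓝 1) := by
    have := (hε2.const_mul ((P.q0 : ℂ) ^ 2)).const_add 1
    simp only [mul_zero, add_zero] at this
    refine this.congr fun z => ?_
    rw [gam, div_eq_mul_inv, inv_pow]
  have hN : (fun z => (P.uM 0 x t z 0 * P.uP 1 x t z 1 - P.uM 0 x t z 1 * P.uP 1 x t z 0) - 1
      - z⁻¹ * (a + b)) =O[F] fun z => z⁻¹ ^ 2 := by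
    have e1 := h1.mul b3
    have e2 := (((hε.mul_const a).const_add 1).isBigO_one ℂ).mul h3
    have e3 := hεε.const_mul_left (a * b)
    have e4 := (o1 h2).mul (o1 h4)
    simp only [mul_one, one_mul] at e1 e2
    refine (((e1.add e2).add e3).sub (e4.congr_right fun z => (sq _).symm)).congr_left fun z => ?_
    ring
  have hs : (fun z => P.s22 z - 1 - z⁻¹ * (a + b)) =O[F] fun z => z⁻¹ ^ 2 := by
    have e1 : (fun z => P.s22 z * (1 - P.gam z)) =O[F] fun z => z⁻¹ ^ 2 := by
      have e2 : (fun z => 1 - P.gam z) =O[F] fun z => z⁻¹ ^ 2 := by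
        refine (hεε.const_mul_left (-(P.q0 : ℂ) ^ 2)).congr_left fun z => ?_
        rw [gam, div_eq_mul_inv, inv_pow]; ring
      have e3 : P.s22 =O[F] fun _ => (1 : ℂ) := by
        refine (((t0 hN).div bγ one_ne_zero).congr' ?_).isBigO_one ℂ
        exact hmem.mono fun z hz => by rw [hP.s22_eq hz x t]; rfl
      simpa using e3.mul e2
    refine (hN.add e1).congr' (hmem.mono fun z hz => ?_) EventuallyEq.rfl
    have hg := gam_ne_zero hz
    beta_reduce
    rw [hP.s22_eq hz x t, wr]
    field_simp
    ring
  have hs1 := t0 hs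
  have hsi : (fun z => (P.s22 z)⁻¹) =O[F] fun _ => (1 : ℂ) := (hs1.inv₀ one_ne_zero).isBigO_one ℂ
  have hsne : ∀ᶠ z in F, P.s22 z ≠ 0 := hs1.eventually_ne one_ne_zero
  have hs2 : (fun z => P.s22 z - 1) =O[F] fun z => z⁻¹ := by
    have h5 := (hs.trans h21).add (hε1.const_mul_left (a + b))
    refine h5.congr_left fun z => by ring
  fin_cases j
  · fin_cases i
    · simpa [MPlus] using h1
    · simpa [MPlus] using h2
  · fin_cases i
    · have e1 := hsi.mul (h4.sub ((hε1.mul hs2).const_mul_left d |>.congr_right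
        fun z => (sq _).symm))
      simp only [one_mul] at e1
      refine e1.congr' (hsne.mono fun z hz => ?_) EventuallyEq.rfl
      simp [MPlus]
      field_simp
      ring
    · have e5 : leadingCoeff P x t 1 1 = -a := by simp [leadingCoeff, ha]
      have e2 : (fun z => P.uP 1 x t z 1 - 1 - z⁻¹ * b - (P.s22 z - 1 - z⁻¹ * (a + b))
          - (-a) * (z⁻¹ * (P.s22 z - 1))) =O[F] fun z => z⁻¹ ^ 2 :=
        (h3.sub hs).sub ((hε1.mul hs2).const_mul_left (-a) |>.congr_right fun z => (sq _).symm)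
      have e1 := hsi.mul e2
      simp only [one_mul] at e1
      refine e1.congr' (hsne.mono fun z hz => ?_) EventuallyEq.rfl
      simp [MPlus, e5]
      field_simp
      ring

theorem MMinus_conj {z : ℂ} (hz : z ∈ closedNeg P.q0) (x t : ℝ) :
    P.MMinus x t z
      = !![(starRingEnd ℂ) (P.MPlus x t ((starRingEnd ℂ) z) 1 1),
          -(starRingEnd ℂ) (P.MPlus x t ((starRingEnd ℂ) z) 1 0);
        -(starRingEnd ℂ) (P.MPlus x t ((starRingEnd ℂ) z) 0 1),
          (starRingEnd ℂ) (P.MPlus x t ((starRingEnd ℂ) z) 0 0)] := by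
  ext i j
  fin_cases i <;> fin_cases j <;>
    simp [MMinus, MPlus, hP.uP_zero_conj hz, hP.uM_one_conj hz, hP.s11_conj hz, neg_div]

theorem isBigO_MMinus (x t : ℝ) (i j : Fin 2) :
    (fun z => P.MMinus x t z i j - (1 : Matrix (Fin 2) (Fin 2) ℂ) i j
      - z⁻¹ * leadingCoeff P x t i j)
      =O[cobounded ℂ ⊓ 𝓟 (closedNeg P.q0)] fun z => z⁻¹ ^ 2 := by
  have ht : Tendsto (starRingEnd ℂ) (cobounded ℂ ⊓ 𝓟 (closedNeg P.q0))
      (cobounded ℂ ⊓ 𝓟 (closedPos P.q0)) := by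
    refine Tendsto.inf ?_ (tendsto_principal_principal.2 fun z hz => conj_mem_closedPos hz)
    rw [← tendsto_norm_atTop_iff_cobounded]
    simpa only [RCLike.norm_conj] using tendsto_norm_cobounded_atTop (E := ℂ)
  have hmem : ∀ᶠ z in cobounded ℂ ⊓ 𝓟 (closedNeg P.q0), z ∈ closedNeg P.q0 :=
    mem_inf_of_right (mem_principal_self _)
  have key : ∀ i j, (fun z => (starRingEnd ℂ) (P.MPlus x t ((starRingEnd ℂ) z) i j)
      - (starRingEnd ℂ) ((1 : Matrix (Fin 2) (Fin 2) ℂ) i j)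
      - z⁻¹ * (starRingEnd ℂ) (leadingCoeff P x t i j))
      =O[cobounded ℂ ⊓ 𝓟 (closedNeg P.q0)] fun z => z⁻¹ ^ 2 := fun i j => by
    have h := ((hP.isBigO_MPlus x t i j).comp_tendsto ht).norm_norm
    refine (h.congr (fun z => ?_) fun z => ?_).of_norm_norm
    · rw [← RCLike.norm_conj]; simp [Function.comp]
    · simp [Function.comp]
  fin_cases i <;> fin_cases j
  · refine (key 1 1).congr' (hmem.mono fun z hz => ?_) EventuallyEq.rfl
    simp [hP.MMinus_conj hz, leadingCoeff]
  · refine (key 1 0).neg_left.congr' (hmem.mono fun z hz => ?_) EventuallyEq.rfl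
    simp [hP.MMinus_conj hz, leadingCoeff]; ring
  · refine (key 0 1).neg_left.congr' (hmem.mono fun z hz => ?_) EventuallyEq.rfl
    simp [hP.MMinus_conj hz, leadingCoeff]; ring
  · refine (key 0 0).congr' (hmem.mono fun z hz => ?_) EventuallyEq.rfl
    simp [hP.MMinus_conj hz, leadingCoeff]

theorem isBigO_MM (x t : ℝ) (i j : Fin 2) :
    (fun z => P.MM x t z i j - (1 : Matrix (Fin 2) (Fin 2) ℂ) i j - z⁻¹ * leadingCoeff P x t i j)
      =O[cobounded ℂ ⊓ 𝓟 (P.Sig)ᶜ] fun z => z⁻¹ ^ 2 := by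
  obtain ⟨C, R, h1⟩ := exists_bound_of_isBigO (hP.isBigO_MPlus x t i j)
  obtain ⟨C', R', h2⟩ := exists_bound_of_isBigO (hP.isBigO_MMinus x t i j)
  -- Beyond radius `q₀ + 1` there is no branch point, so a point outside `D⁺` belongs to
  -- `closedNeg`.
  refine isBigO_of_exists_bound ⟨max C C', max R (max R' (P.q0 + 1)), fun z hz hR => ?_⟩
  have hR1 := (le_max_left _ _).trans hR
  have hR2 := (le_max_right _ _).trans hR
  have hR3 := (le_max_left _ _).trans hR2
  have hR4 := (le_max_right _ _).trans hR2
  have hq := hP.q0_pos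
  have hz0 : z ≠ 0 := norm_pos_iff.1 (by linarith)
  by_cases hD : z ∈ P.Dplus
  · simp only [MM, if_pos hD]
    refine (h1 z (openPos_subset_closedPos _ hD) hR1).trans ?_
    gcongr
    exact le_max_left _ _
  · simp only [MM, if_neg hD]
    have hneg : z ∈ closedNeg P.q0 := by
      refine ⟨hz0, fun h => ?_, not_lt.1 hD⟩
      have h5 : ‖z ^ 2‖ = ‖-(P.q0 : ℂ) ^ 2‖ := by rw [eq_neg_of_add_eq_zero_left h]
      rw [norm_neg, norm_pow, norm_pow, norm_real, Real.norm_eq_abs, abs_of_pos hq] at h5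
      nlinarith
    refine (h2 z hneg hR3).trans ?_
    gcongr
    exact le_max_right _ _

theorem MMinus_hat {z : ℂ} (hz : z ∈ closedNeg P.q0) (x t : ℝ) (i : Fin 2) :
    P.MMinus x t z i 0 = -(I * (starRingEnd ℂ) P.qm / z) * P.MPlus x t (hat P.q0 z) i 1 ∧
      P.MMinus x t z i 1 = -(I * P.qm / z) * P.MPlus x t (hat P.q0 z) i 0 := by
  have h1 := hP.qp_ne
  have h2 := hP.qm_ne
  have h3 := hz.1
  constructor
  · have e : (starRingEnd ℂ) P.qp / (P.qm / P.qp) = (starRingEnd ℂ) P.qm := by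
      have h4 := hP.qp_mul_conj
      rw [← qm_mul_conj] at h4
      field_simp
      linear_combination h4
    simp only [MMinus, MPlus, of_apply, cons_val_zero, cons_val_one, hP.uP_zero_hat hz,
      hP.s11_hat hz, Pi.smul_apply, smul_eq_mul]
    rw [← e]
    ring
  · simp [MMinus, MPlus, hP.uM_one_hat hz]

theorem MPlus_hat {z : ℂ} (hz : z ∈ closedPos P.q0) (x t : ℝ) (i : Fin 2) :
    P.MPlus x t z i 0 = -(I * (starRingEnd ℂ) P.qm / z) * P.MMinus x t (hat P.q0 z) i 1 ∧
      P.MPlus x t z i 1 = -(I * P.qm / z) * P.MMinus x t (hat P.q0 z) i 0 := by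
  obtain ⟨h1, h2⟩ := hP.MMinus_hat (hat_mem_closedNeg hP.q0_pos hz) x t i
  rw [hat_hat hP.q0_pos hz.1] at h1 h2
  have hq : (P.q0 : ℂ) ≠ 0 := ofReal_ne_zero.2 hP.q0_pos.ne'
  have hz0 := hz.1
  have hm := qm_mul_conj (P := P)
  rw [h1, h2]
  constructor
  · have e : -(I * (starRingEnd ℂ) P.qm / z) * -(I * P.qm / hat P.q0 z) = 1 := by
      rw [hat]; field_simp
      linear_combination (-I ^ 2) * hm - (P.q0 : ℂ) ^ 2 * I_sq
    rw [← mul_assoc, e, one_mul]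
  · have e : -(I * P.qm / z) * -(I * (starRingEnd ℂ) P.qm / hat P.q0 z) = 1 := by
      rw [hat]; field_simp
      linear_combination (-I ^ 2) * hm - (P.q0 : ℂ) ^ 2 * I_sq
    rw [← mul_assoc, e, one_mul]

end Admissible

end KEPotential

/-! ### Discrete spectrum, residues and absence of spectral singularities -/

namespace KEPotential

variable {P : KEPotential}

theorem isOpen_Dplus : IsOpen P.Dplus := isOpen_openPos P.q0

theorem Dplus_subset : P.Dplus ⊆ closedPos P.q0 := openPos_subset_closedPos P.q0

theorem conj_mem_Dplus {w : ℂ} : (starRingEnd ℂ) w ∈ P.Dplus ↔ w ∈ P.Dminus := by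
  simp only [Dplus, Dminus, Set.mem_ofPred_eq, RCLike.norm_conj, conj_im, mul_neg, neg_pos]

theorem conj_mem_Dminus {w : ℂ} : (starRingEnd ℂ) w ∈ P.Dminus ↔ w ∈ P.Dplus := by
  rw [← conj_mem_Dplus, conj_conj]

theorem Dminus_subset : P.Dminus ⊆ closedNeg P.q0 := fun w hw => by
  have := conj_mem_closedNeg (Dplus_subset (conj_mem_Dplus.2 hw))
  rwa [conj_conj] at this

theorem isOpen_Dminus : IsOpen P.Dminus :=
  isOpen_lt (by fun_prop) continuous_const

theorem hat_mem_Dminus (h0 : 0 < P.q0) {w : ℂ} (hw : w ∈ P.Dplus) : hat P.q0 w ∈ P.Dminus := by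
  have hw0 := (Dplus_subset hw).1
  have hn : 0 < ‖w‖ := norm_pos_iff.2 hw0
  change (‖hat P.q0 w‖ ^ 2 - P.q0 ^ 2) * (hat P.q0 w).im < 0
  rw [hat_region hw0, neg_lt_zero]
  exact mul_pos (by positivity) hw

theorem hat_mem_Dplus (h0 : 0 < P.q0) {w : ℂ} (hw : w ∈ P.Dminus) : hat P.q0 w ∈ P.Dplus := by
  have hw0 := (Dminus_subset hw).1
  have hn : 0 < ‖w‖ := norm_pos_iff.2 hw0
  change 0 < (‖hat P.q0 w‖ ^ 2 - P.q0 ^ 2) * (hat P.q0 w).im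
  rw [hat_region hw0, Left.neg_pos_iff]
  exact mul_neg_of_pos_of_neg (by positivity) hw

theorem mem_Sig_of_mem {w : ℂ} (h1 : w ∈ closedPos P.q0) (h2 : w ∈ closedNeg P.q0)
    (h0 : 0 < P.q0) :
    w ∈ P.Sig := by
  rcases mul_eq_zero.1 (le_antisymm h2.2.2 h1.2.2) with h | h
  · refine Or.inr ?_
    have h3 : (‖w‖ - P.q0) * (‖w‖ + P.q0) = 0 := by linear_combination h
    have h4 : ‖w‖ + P.q0 ≠ 0 := by positivity
    exact sub_eq_zero.1 ((mul_eq_zero.1 h3).resolve_right h4)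
  · exact Or.inl h

namespace Admissible

variable (hP : P.Admissible)

include hP

theorem s22_conj {w : ℂ} (hw : w ∈ closedPos P.q0) :
    P.s22 w = (starRingEnd ℂ) (P.s11 ((starRingEnd ℂ) w)) := by
  rw [hP.s11_conj (conj_mem_closedNeg hw), conj_conj, conj_conj]

theorem s22_eq_zero_iff_hat {w : ℂ} (hw : w ∈ P.Dplus) :
    P.s22 w = 0 ↔ P.s11 (hat P.q0 w) = 0 := by
  rw [hP.s11_hat (Dminus_subset (hat_mem_Dminus hP.q0_pos hw)),
    hat_hat hP.q0_pos (Dplus_subset hw).1, mul_eq_zero,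
    or_iff_right (div_ne_zero hP.qm_ne hP.qp_ne)]

theorem hasDerivAt_s22 {w : ℂ} (hw : w ∈ P.Dplus) : HasDerivAt P.s22 (deriv P.s22 w) w :=
  (hP.differentiableOn_s22.differentiableAt (isOpen_Dplus.mem_nhds hw)).hasDerivAt

theorem psiM_zero_ne_zero {w : ℂ} (hw : w ∈ closedPos P.q0) : P.psiM 0 w 0 0 ≠ 0 := by
  intro h0
  have h := hP.isJost_psiM_zero hw
  have hz : (fun x => P.psiM 0 w x 0) = 0 := by
    have hc : Continuous fun x => laxXMap (P.kk w) (P.q x 0) :=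
      (hP.continuous_laxXMap (P.kk w)).comp (f := fun x : ℝ => (x, (0 : ℝ))) (by fun_prop)
    refine linear_ode_unique hc (fun x => (jost_deriv_eq h).1 x 0) (fun x => ?_) h0
    simp only [Pi.zero_apply, map_zero]
    exact hasDerivAt_const x 0
  have h1 := tendsto_pi_nhds.1 (h.2.2 0) 0
  have h2 : (fun x => (P.expTheta x 0 w 0 • P.psiM 0 w x 0) 0) = fun _ => (0 : ℂ) := by
    funext x
    have := congrFun hz x
    simp only [Pi.zero_apply] at this
    simp [this]
  rw [h2] at h1
  have := tendsto_nhds_unique h1 tendsto_const_nhds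
  simp [asympY_apply] at this

/-- A vanishing Wronskian makes the two columns proportional at `(0,0)`, since `ψ_{-,1}` does not
vanish there; uniqueness in `x` and then in `t` spreads the same constant everywhere. So the choice
defining `bPlus` is a genuine one. -/
theorem psiP_one_eq_smul {w : ℂ} (hw : w ∈ P.Dplus) (h0 : P.s22 w = 0) (x t : ℝ) :
    P.psiP 1 w x t = P.bPlus w • P.psiM 0 w x t := by
  have hw' := Dplus_subset hw
  refine Classical.epsilon_spec (p := fun b : ℂ => ∀ x t, P.psiP 1 w x t = b • P.psiM 0 w x t)
    ?_ x t
  have hM := hP.isJost_psiM_zero hw'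
  have hPl := hP.isJost_psiP_one hw'
  have hwr : wr (P.psiM 0 w 0 0) (P.psiP 1 w 0 0) = 0 := by
    rw [s22, div_eq_zero_iff] at h0
    exact h0.resolve_right (gam_ne_zero hw')
  obtain ⟨b, hb⟩ : ∃ b : ℂ, P.psiP 1 w 0 0 = b • P.psiM 0 w 0 0 := by
    have hne := hP.psiM_zero_ne_zero hw'
    simp only [wr] at hwr
    by_cases h1 : P.psiM 0 w 0 0 0 = 0
    · have h2 : P.psiM 0 w 0 0 1 ≠ 0 := fun h2 => hne (by
        ext i; fin_cases i
        · exact h1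
        · exact h2)
      refine ⟨P.psiP 1 w 0 0 1 / P.psiM 0 w 0 0 1, ?_⟩
      rw [h1] at hwr
      have h3 : P.psiP 1 w 0 0 0 = 0 := by
        have : P.psiM 0 w 0 0 1 * P.psiP 1 w 0 0 0 = 0 := by linear_combination -hwr
        exact (mul_eq_zero.1 this).resolve_left h2
      ext i; fin_cases i
      · simp [h1, h3]
      · simp [h2]
    · refine ⟨P.psiP 1 w 0 0 0 / P.psiM 0 w 0 0 0, ?_⟩
      ext i; fin_cases i
      · simp [h1]
      · simp; field_simp; linear_combination hwr
  have hXc : Continuous fun x => laxXMap (P.kk w) (P.q x 0) :=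
    (hP.continuous_laxXMap (P.kk w)).comp (f := fun x : ℝ => (x, (0 : ℝ))) (by fun_prop)
  have h1 := linear_ode_unique (u := fun x => P.psiP 1 w x 0) (v := fun x => b • P.psiM 0 w x 0) hXc
    (fun x => (jost_deriv_eq hPl).1 x 0) (fun x => by
      rw [map_smul]; exact ((jost_deriv_eq hM).1 x 0).const_smul b) hb
  refine ⟨b, fun x t => ?_⟩
  have hTc : Continuous fun t => laxTMap (P.kk w) ((P.q0 : ℂ) ^ 2) (P.q x t) (P.qx x t) :=
    (hP.continuous_laxTMap (P.kk w) ((P.q0 : ℂ) ^ 2)).comp (f := fun t : ℝ => (x, t))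
      (by fun_prop)
  exact congrFun (linear_ode_unique (u := fun t => P.psiP 1 w x t)
    (v := fun t => b • P.psiM 0 w x t) hTc (fun t => (jost_deriv_eq hPl).2 x t) (fun t => by
      rw [map_smul]; exact ((jost_deriv_eq hM).2 x t).const_smul b) (congrFun h1 x)) t

theorem uP_one_eq_smul {w : ℂ} (hw : w ∈ P.Dplus) (h0 : P.s22 w = 0) (x t : ℝ) :
    P.uP 1 x t w = (P.bPlus w * exp (-2 * I * P.theta x t w)) • P.uM 0 x t w := by
  have he : exp (-2 * I * P.theta x t w) * P.expTheta x t w 0 = P.expTheta x t w 1 := by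
    rw [expTheta_zero, expTheta_one, ← Complex.exp_add]; congr 1; ring
  rw [uP, uM, hP.psiP_one_eq_smul hw h0, smul_smul, smul_smul, ← he]
  congr 1; ring

variable {N : ℕ} {z : Fin N → ℂ} (hS : P.SimpleSpectrum z)

include hS

theorem xi_mem (n : Fin N ⊕ Fin N) : P.xi z n ∈ P.Dminus := by
  rcases n with n | n
  · exact (hS.mem n).1
  · exact hat_mem_Dminus hP.q0_pos (conj_mem_Dplus.2 (hS.mem n).1)

theorem xiHat_mem (n : Fin N ⊕ Fin N) : P.xiHat z n ∈ P.Dplus :=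
  hat_mem_Dplus hP.q0_pos (hP.xi_mem hS n)

theorem xi_ne_zero (n : Fin N ⊕ Fin N) : P.xi z n ≠ 0 := (Dminus_subset (hP.xi_mem hS n)).1

theorem hat_xiHat (n : Fin N ⊕ Fin N) : hat P.q0 (P.xiHat z n) = P.xi z n :=
  hat_hat hP.q0_pos (hP.xi_ne_zero hS n)

theorem xi_inr_im (n : Fin N) : 0 < (P.xi z (Sum.inr n)).im := by
  have h1 : P.xi z (Sum.inr n) = hat P.q0 ((starRingEnd ℂ) (z n)) := rfl
  have h2 := (hS.mem n).2
  have h3 : 0 < ‖z n‖ := norm_pos_iff.2 (Dminus_subset (hS.mem n).1).1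
  have h4 := hP.q0_pos
  rw [h1, hat_im, conj_im, RCLike.norm_conj]
  have : 0 < -(z n).im := by linarith
  positivity

/-- The points `z_n` lie in `Im < 0` and the points `-q₀²/z_n*` in `Im > 0`, so the two families are
disjoint. -/
theorem xi_injective : Function.Injective (P.xi z) := by
  rintro (n | n) (m | m) h
  · exact congrArg _ (hS.inj h)
  · have := hP.xi_inr_im hS m
    rw [← h] at this
    exact absurd this (not_lt.2 (hS.mem n).2.le)
  · have := hP.xi_inr_im hS n
    rw [h] at this
    exact absurd this (not_lt.2 (hS.mem m).2.le)
  · have h2 := congrArg (hat P.q0) h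
    change hat P.q0 (hat P.q0 _) = hat P.q0 (hat P.q0 _) at h2
    rw [hat_hat hP.q0_pos (Dplus_subset (conj_mem_Dplus.2 (hS.mem n).1)).1,
      hat_hat hP.q0_pos (Dplus_subset (conj_mem_Dplus.2 (hS.mem m).1)).1] at h2
    exact congrArg _ (hS.inj ((starRingEnd ℂ).injective h2))

theorem xiHat_injective : Function.Injective (P.xiHat z) := fun n m h => by
  have := congrArg (hat P.q0) h
  rw [hP.hat_xiHat hS, hP.hat_xiHat hS] at this
  exact hP.xi_injective hS this

/-- The hypothesis lists only the zeros in the lower half-plane. The map `w ↦ (-q₀²/w)*` preserves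
`D⁻`, exchanges its upper and lower parts, and preserves the zeros of `s₁₁` by conjugation and
inversion; `D⁻` does not meet the real axis. -/
theorem s11_eq_zero_iff {w : ℂ} (hw : w ∈ P.Dminus) : P.s11 w = 0 ↔ ∃ n, w = P.xi z n := by
  have hw0 := (Dminus_subset hw).1
  rcases lt_trichotomy w.im 0 with him | him | him
  · rw [hS.zeros w hw him]
    constructor
    · rintro ⟨n, rfl⟩
      exact ⟨Sum.inl n, rfl⟩
    · rintro ⟨n | n, rfl⟩
      · exact ⟨n, rfl⟩
      · exact absurd (hP.xi_inr_im hS n) (not_lt.2 him.le)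
  · have hw' : (‖w‖ ^ 2 - P.q0 ^ 2) * w.im < 0 := hw
    rw [him, mul_zero] at hw'
    exact absurd hw' (lt_irrefl _)
  · have hh := hat_mem_Dplus hP.q0_pos hw
    have hn : 0 < ‖w‖ := norm_pos_iff.2 hw0
    have hq := hP.q0_pos
    have e1 : P.s11 w = 0 ↔ P.s11 ((starRingEnd ℂ) (hat P.q0 w)) = 0 := by
      rw [← map_eq_zero (starRingEnd ℂ) (a := P.s11 ((starRingEnd ℂ) (hat P.q0 w))), ← hP.s22_conj (Dplus_subset hh),
        hP.s22_eq_zero_iff_hat hh, hat_hat hP.q0_pos hw0]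
    rw [e1, hS.zeros _ (conj_mem_Dminus.2 hh) (by
      rw [conj_im, hat_im, neg_lt_zero]; positivity)]
    constructor
    · rintro ⟨n, hn⟩
      refine ⟨Sum.inr n, ?_⟩
      change w = hat P.q0 ((starRingEnd ℂ) (z n))
      rw [← hn, conj_conj, hat_hat hP.q0_pos hw0]
    · rintro ⟨n | n, rfl⟩
      · exact absurd him (not_lt.2 (hS.mem n).2.le)
      · refine ⟨n, ?_⟩
        change (starRingEnd ℂ) (hat P.q0 (hat P.q0 ((starRingEnd ℂ) (z n)))) = z n
        rw [hat_hat hP.q0_pos (Dplus_subset (conj_mem_Dplus.2 (hS.mem n).1)).1, conj_conj]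

theorem s22_eq_zero_iff {w : ℂ} (hw : w ∈ P.Dplus) : P.s22 w = 0 ↔ ∃ n, w = P.xiHat z n := by
  rw [hP.s22_eq_zero_iff_hat hw, hP.s11_eq_zero_iff hS (hat_mem_Dminus hP.q0_pos hw)]
  refine exists_congr fun n => ⟨fun h => ?_, fun h => ?_⟩
  · rw [← hat_hat hP.q0_pos (Dplus_subset hw).1, h]; rfl
  · rw [h, hP.hat_xiHat hS]

theorem s22_xiHat (n : Fin N ⊕ Fin N) : P.s22 (P.xiHat z n) = 0 :=
  (hP.s22_eq_zero_iff hS (hP.xiHat_mem hS n)).2 ⟨n, rfl⟩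

/-- Simplicity of `z_n` as a zero of `s₁₁` is transported by the chain rule: through inversion for
the first half of the points, through conjugation for the second. -/
theorem deriv_s22_ne_zero (n : Fin N ⊕ Fin N) : deriv P.s22 (P.xiHat z n) ≠ 0 := by
  intro h0
  have hd := hP.hasDerivAt_s22 (hP.xiHat_mem hS n)
  rw [h0] at hd
  rcases n with n | n
  · refine hS.simple n (HasDerivAt.deriv ?_)
    have hz0 : z n ≠ 0 := hP.xi_ne_zero hS (Sum.inl n)
    have h1 : DifferentiableAt ℂ (hat P.q0) (z n) :=
      (differentiableOn_hat P.q0).differentiableAt (isOpen_ne.mem_nhds hz0)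
    have h2 : HasDerivAt (fun w => P.qm / P.qp * P.s22 (hat P.q0 w)) 0 (z n) := by
      have := (HasDerivAt.comp (z n) (h₂ := P.s22) hd h1.hasDerivAt).const_mul (P.qm / P.qp)
      rw [zero_mul, mul_zero] at this
      exact this
    refine h2.congr_of_eventuallyEq ?_
    filter_upwards [isOpen_Dminus.mem_nhds (hS.mem n).1] with w hw
    exact hP.s11_hat (Dminus_subset hw)
  · refine hS.simple n (HasDerivAt.deriv ?_)
    have e1 : P.xiHat z (Sum.inr n) = (starRingEnd ℂ) (z n) :=
      hat_hat hP.q0_pos (Dplus_subset (conj_mem_Dplus.2 (hS.mem n).1)).1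
    rw [e1] at hd
    have h2 := hd.conj_conj
    rw [conj_conj, map_zero] at h2
    refine h2.congr_of_eventuallyEq ?_
    filter_upwards [isOpen_Dminus.mem_nhds (hS.mem n).1] with w hw
    exact hP.s11_conj (Dminus_subset hw)

/-- The hypothesis bounds `s₁₁` from below only inside `D⁻`. Continuity on `closedNeg` and the
density of `D⁻` in it extend the bound to contour points, and conjugation carries it to `s₂₂`. -/
theorem s22_lower {ζ : ℂ} (hζ : ζ ∈ P.Sig) :
    ∃ c : ℝ, 0 < c ∧ ∀ᶠ w in 𝓝[closedPos P.q0] ζ, c ≤ ‖P.s22 w‖ := by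
  have hζ' : (starRingEnd ℂ) ζ ∈ P.Sig := by
    rcases hζ with h | h
    · exact Or.inl (by simp [h])
    · exact Or.inr (by simpa using h)
  obtain ⟨c, hc, h⟩ := hS.no_singularity _ hζ'
  refine ⟨c, hc, ?_⟩
  rw [eventually_nhdsWithin_iff] at h ⊢
  obtain ⟨U, hU, hUo, hζU⟩ := mem_nhds_iff.1 h
  have hV : (starRingEnd ℂ) ⁻¹' U ∈ 𝓝 ζ :=
    (hUo.preimage continuous_conj).mem_nhds hζU
  filter_upwards [hV] with w hw hwc
  have hw' := conj_mem_closedNeg hwc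
  have hcl : (starRingEnd ℂ) w ∈ closure (U ∩ P.Dminus) :=
    mem_closure_iff_nhdsWithin_neBot.2 (by
      have := mem_closure_iff_nhdsWithin_neBot.1 (closedNeg_subset_closure P.q0 hw')
      rw [nhdsWithin_inter_of_mem (mem_nhdsWithin_of_mem_nhds (hUo.mem_nhds hw))]
      exact this)
  have hcont : ContinuousWithinAt P.s11 (U ∩ P.Dminus) ((starRingEnd ℂ) w) :=
    (hP.continuousOn_s11 _ hw').mono fun v hv => Dminus_subset hv.2
  have hmem := hcont.mem_closure hcl (t := {v | c ≤ ‖v‖}) fun v hv => hU hv.1 hv.2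
  rw [(isClosed_le continuous_const continuous_norm).closure_eq] at hmem
  rw [hP.s22_conj hwc, RCLike.norm_conj]
  exact hmem

theorem s22_ne_zero_of_jump {ζ : ℂ} (h1 : ζ ∈ closedPos P.q0) (h2 : ζ ∈ closedNeg P.q0) :
    P.s22 ζ ≠ 0 := by
  obtain ⟨c, hc, h⟩ := hP.s22_lower hS (mem_Sig_of_mem h1 h2 hP.q0_pos)
  exact norm_pos_iff.1 (hc.trans_le (h.self_of_nhdsWithin h1))

theorem s11_ne_zero_of_jump {ζ : ℂ} (h1 : ζ ∈ closedPos P.q0) (h2 : ζ ∈ closedNeg P.q0) :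
    P.s11 ζ ≠ 0 := by
  rw [hP.s11_conj h2, Ne, map_eq_zero]
  exact hP.s22_ne_zero_of_jump hS (conj_mem_closedPos h2) (conj_mem_closedNeg h1)

theorem s22_ne_zero {w : ℂ} (hw : w ∈ closedPos P.q0) (hn : ∀ n, w ≠ P.xiHat z n) :
    P.s22 w ≠ 0 := by
  rcases hw.2.2.lt_or_eq with h | h
  · exact fun h0 => by
      obtain ⟨n, hn'⟩ := (hP.s22_eq_zero_iff hS h).1 h0
      exact hn n hn'
  · exact hP.s22_ne_zero_of_jump hS hw ⟨hw.1, hw.2.1, h.ge⟩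

theorem jump_of_mem {ζ : ℂ} (h1 : ζ ∈ closedPos P.q0) (h2 : ζ ∈ closedNeg P.q0) (x t : ℝ) :
    P.MMinus x t ζ * P.GG x t ζ = P.MMinus x t ζ - P.MPlus x t ζ :=
  hP.jump h1 h2 (hP.s11_ne_zero_of_jump hS h1 h2) (hP.s22_ne_zero_of_jump hS h1 h2) x t

theorem continuousOn_MPlus (x t : ℝ) (i j : Fin 2) :
    ContinuousOn (fun w => P.MPlus x t w i j) (closedPos P.q0 \ Set.range (P.xiHat z)) := by
  fin_cases j
  · exact (hP.continuousOn_uM_zero x t i).mono Set.sdiff_subset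
  · exact ((hP.continuousOn_uP_one x t i).mono Set.sdiff_subset).div
      (hP.continuousOn_s22.mono Set.sdiff_subset)
      fun w hw => hP.s22_ne_zero hS hw.1 fun n h => hw.2 ⟨n, h.symm⟩

theorem differentiableOn_MPlus (x t : ℝ) (i j : Fin 2) :
    DifferentiableOn ℂ (fun w => P.MPlus x t w i j) (P.Dplus \ Set.range (P.xiHat z)) := by
  fin_cases j
  · exact (hP.differentiableOn_uM_zero x t i).mono Set.sdiff_subset
  · exact ((hP.differentiableOn_uP_one x t i).mono Set.sdiff_subset).div
      (hP.differentiableOn_s22.mono Set.sdiff_subset)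
      fun w hw => hP.s22_ne_zero hS (Dplus_subset hw.1) fun n h => hw.2 ⟨n, h.symm⟩

theorem bounded_MPlus (x t : ℝ) (i j : Fin 2) {ζ : ℂ} (hζ : ζ ∈ P.Sig) (h0 : ζ ≠ 0) :
    ∃ C, ∀ᶠ w in 𝓝[closedPos P.q0] ζ, ‖P.MPlus x t w i j‖ ≤ C := by
  fin_cases j
  · exact hP.bounded_uM_zero x t i h0
  · obtain ⟨C, hC⟩ := hP.bounded_uP_one x t i h0
    obtain ⟨c, hc, h⟩ := hP.s22_lower hS hζ
    refine ⟨C / c, ?_⟩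
    filter_upwards [hC, h] with w h1 h2
    change ‖P.uP 1 x t w i / P.s22 w‖ ≤ _
    rw [norm_div]
    have := (norm_nonneg _).trans h1
    gcongr

/-- The residues of the second column of `M⁺`. -/
theorem tendsto_sub_mul_MPlus (x t : ℝ) (i : Fin 2) (n : Fin N ⊕ Fin N) :
    Tendsto (fun w => (w - P.xiHat z n) * P.MPlus x t w i 1) (𝓝[≠] P.xiHat z n)
      (𝓝 (P.omega z x t n * P.uM 0 x t (P.xiHat z n) i)) := by
  have hmem := hP.xiHat_mem hS n
  have h0 := hP.s22_xiHat hS n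
  have h1 := (hasDerivAt_iff_tendsto_slope.1 (hP.hasDerivAt_s22 hmem)).inv₀
    (hP.deriv_s22_ne_zero hS n)
  have h2 : Tendsto (fun w => P.uP 1 x t w i) (𝓝[≠] P.xiHat z n)
      (𝓝 (P.uP 1 x t (P.xiHat z n) i)) :=
    ((hP.differentiableOn_uP_one x t i).differentiableAt
      (isOpen_Dplus.mem_nhds hmem)).continuousAt.tendsto.mono_left nhdsWithin_le_nhds
  have h3 := h1.mul h2
  rw [hP.uP_one_eq_smul hmem h0] at h3
  refine (h3.congr fun w => ?_).trans (le_of_eq ?_)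
  · rw [slope_def_field, h0, sub_zero, inv_div]
    change _ = _ * (P.uP 1 x t w i / P.s22 w)
    ring
  · congr 1
    rw [omega, CPlus, Pi.smul_apply, smul_eq_mul]
    ring

end Admissible

end KEPotential

/-! ### Bounded one-sided functions and division by `z - ξ` -/

/-- Riemann's theorem at each point of `S`: vanishing of `(z - s) h z` says that `h` is `o(1/(z -
s))`, and the extension takes the limit as its value at `s`. -/
theorem exists_removable_extension {D S : Set ℂ} {h : ℂ → ℂ} (hD : IsOpen D) (hS : S.Finite)
    (hd : DifferentiableOn ℂ h (D \ S))
    (hp : ∀ s ∈ S, Tendsto (fun z => (z - s) * h z) (𝓝[≠] s) (𝓝 0)) :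
    ∃ f : ℂ → ℂ, (∀ z ∉ S, f z = h z) ∧ DifferentiableOn ℂ f D := by
  classical
  refine ⟨fun z => if z ∈ S then limUnder (𝓝[≠] z) h else h z, fun z hz => if_neg hz,
    fun w hw => DifferentiableAt.differentiableWithinAt ?_⟩
  by_cases hwS : w ∈ S
  · have hU : D \ (S \ {w}) ∈ 𝓝 w :=
      (hD.sdiff (hS.subset Set.sdiff_subset).isClosed).mem_nhds ⟨hw, fun h => h.2 rfl⟩
    have ho : (fun z => h z - h w) =o[𝓝[≠] w] fun z => (z - w)⁻¹ := by
      have hne : ∀ᶠ z in 𝓝[≠] w, z ≠ w := self_mem_nhdsWithin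
      rw [Asymptotics.isLittleO_iff_tendsto' (hne.mono fun z hz h0 =>
        absurd h0 (inv_ne_zero (sub_ne_zero.2 hz)))]
      have h1 : Tendsto (fun z => (z - w) * h w) (𝓝[≠] w) (𝓝 0) := by
        have : Continuous fun z => (z - w) * h w := by fun_prop
        simpa using (this.tendsto w).mono_left nhdsWithin_le_nhds
      have := (hp w hwS).sub h1
      rw [sub_zero] at this
      refine this.congr fun z => ?_
      rw [div_inv_eq_mul]; ring
    have := Complex.differentiableOn_update_limUnder_of_isLittleO hU
      (hd.mono fun z hz => ⟨hz.1.1, fun h => hz.1.2 ⟨h, hz.2⟩⟩) ho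
    refine (this.differentiableAt hU).congr_of_eventuallyEq ?_
    filter_upwards [hU] with z hz
    by_cases hzw : z = w
    · subst hzw; simp [hwS]
    · have : z ∉ S := fun h => hz.2 ⟨h, hzw⟩
      simp [this, hzw]
  · have hU : D \ S ∈ 𝓝 w := (hD.sdiff hS.isClosed).mem_nhds ⟨hw, hwS⟩
    refine (hd.differentiableAt hU).congr_of_eventuallyEq ?_
    filter_upwards [hU] with z hz
    exact if_neg hz.2

theorem exists_bound_of_locally_bounded {Ω : Set ℂ} {f : ℂ → ℂ}
    (h : ∀ ζ, f =O[𝓝[Ω] ζ] fun _ => (1 : ℂ))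
    (hinf : f =O[cobounded ℂ ⊓ 𝓟 Ω] fun _ => (1 : ℂ)) : ∃ B, ∀ z ∈ Ω, ‖f z‖ ≤ B := by
  obtain ⟨C, hC⟩ := hinf.bound
  rw [eventually_inf_principal, ← comap_norm_atTop, eventually_comap] at hC
  obtain ⟨R, hR⟩ := eventually_atTop.1 hC
  have hK : ∃ B, ∀ z ∈ Metric.closedBall (0 : ℂ) R, z ∈ Ω → ‖f z‖ ≤ B := by
    refine (isCompact_closedBall (0 : ℂ) R).induction_on
      (p := fun s => ∃ B, ∀ z ∈ s, z ∈ Ω → ‖f z‖ ≤ B) ⟨0, by simp⟩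
      (fun s t hst ⟨B, hB⟩ => ⟨B, fun z hz => hB z (hst hz)⟩)
      (fun s t ⟨B, hB⟩ ⟨B', hB'⟩ => ⟨max B B', fun z hz hzΩ => ?_⟩) fun ζ _ => ?_
    · rcases hz with hz | hz
      · exact (hB z hz hzΩ).trans (le_max_left _ _)
      · exact (hB' z hz hzΩ).trans (le_max_right _ _)
    · obtain ⟨c, hc⟩ := (h ζ).bound
      rw [eventually_nhdsWithin_iff] at hc
      refine ⟨_, mem_nhdsWithin_of_mem_nhds hc, c, fun z hz hzΩ => ?_⟩
      simpa using hz hzΩ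
  obtain ⟨B, hB⟩ := hK
  refine ⟨max B C, fun z hz => ?_⟩
  rcases le_total ‖z‖ R with h1 | h1
  · exact (hB z (by simpa using h1) hz).trans (le_max_left _ _)
  · have := hR ‖z‖ h1 z rfl hz
    rw [norm_one, mul_one] at this
    exact this.trans (le_max_right _ _)

theorem isBigO_inv_pow_cobounded (Ω : Set ℂ) {m n : ℕ} (h : n ≤ m) :
    (fun z : ℂ => z⁻¹ ^ m) =O[cobounded ℂ ⊓ 𝓟 Ω] fun z => z⁻¹ ^ n := by
  obtain ⟨k, rfl⟩ := Nat.exists_eq_add_of_le h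
  have h1 : (fun z : ℂ => z⁻¹ ^ k) =O[cobounded ℂ ⊓ 𝓟 Ω] fun _ => (1 : ℂ) :=
    (((tendsto_inv₀_cobounded (α := ℂ)).mono_left inf_le_left).pow k).isBigO_one ℂ
  simpa [pow_add] using (Asymptotics.isBigO_refl (fun z : ℂ => z⁻¹ ^ n) _).mul h1

theorem isBigO_inv_sub_cobounded (Ω : Set ℂ) (p : ℂ) :
    (fun z : ℂ => (z - p)⁻¹) =O[cobounded ℂ ⊓ 𝓟 Ω] fun z => z⁻¹ := by
  refine Asymptotics.IsBigO.of_bound 2 (Eventually.filter_mono inf_le_left ?_)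
  rw [← comap_norm_atTop, eventually_comap]
  filter_upwards [eventually_ge_atTop (2 * ‖p‖ + 1)] with b hb z hz
  have h0 := norm_nonneg p
  have h1 : ‖z‖ - ‖p‖ ≤ ‖z - p‖ := norm_sub_norm_le z p
  have hz0 : 0 < ‖z‖ := by linarith
  rw [norm_inv, norm_inv, ← div_eq_mul_inv, inv_eq_one_div, div_le_div_iff₀ (by linarith) hz0]
  linarith

theorem isBigO_inv_sub_sub_inv_cobounded (Ω : Set ℂ) (p : ℂ) :
    (fun z : ℂ => (z - p)⁻¹ - z⁻¹) =O[cobounded ℂ ⊓ 𝓟 Ω] fun z => z⁻¹ ^ 2 := by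
  have h := ((isBigO_inv_sub_cobounded Ω p).mul
    (Asymptotics.isBigO_refl (fun z : ℂ => z⁻¹) _)).const_mul_left p
  refine (h.congr' ?_ (EventuallyEq.of_eq (funext fun z => (sq z⁻¹).symm)))
  refine Eventually.filter_mono inf_le_left ?_
  have hc : ({p, 0} : Set ℂ)ᶜ ∈ cobounded ℂ :=
    isBounded_def.1 (Set.toFinite ({p, 0} : Set ℂ)).isBounded
  filter_upwards [hc] with z hz
  simp only [Set.mem_compl_iff, Set.mem_insert_iff, Set.mem_singleton_iff, not_or] at hz
  have := sub_ne_zero.2 hz.1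
  have := hz.2
  field_simp
  ring

/-- A bounded function, holomorphic in an open set `D` and continuous on `Ω ⊇ D`, with leading
behaviour `c / z` at infinity. -/
structure OneSided (Ω D : Set ℂ) (f : ℂ → ℂ) (c : ℂ) : Prop where
  cont : ContinuousOn f Ω
  diff : DifferentiableOn ℂ f D
  bound : ∃ B, ∀ z ∈ Ω, ‖f z‖ ≤ B
  decay : (fun z => f z - c * z⁻¹) =O[cobounded ℂ ⊓ 𝓟 Ω] fun z => z⁻¹ ^ 2

namespace OneSided

variable {Ω D S : Set ℂ} {f h : ℂ → ℂ} {c : ℂ}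

/-- Global boundedness comes from compactness of closed discs. Local boundedness has to be supplied
only at points outside `Ω`, because inside `Ω` the extension is continuous; at infinity the decay
suffices. -/
theorem exists_extension (hD : IsOpen D) (hDΩ : D ⊆ Ω) (hS : S.Finite) (hSD : S ⊆ D)
    (hc : ContinuousOn h (Ω \ S)) (hd : DifferentiableOn ℂ h (D \ S))
    (hp : ∀ s ∈ S, Tendsto (fun z => (z - s) * h z) (𝓝[≠] s) (𝓝 0))
    (hb : ∀ ζ ∉ Ω, h =O[𝓝[Ω] ζ] fun _ => (1 : ℂ))
    (hinf : (fun z => h z - c * z⁻¹) =O[cobounded ℂ ⊓ 𝓟 Ω] fun z => z⁻¹ ^ 2) :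
    ∃ f, (∀ z ∉ S, f z = h z) ∧ OneSided Ω D f c := by
  obtain ⟨f, hf, hfd⟩ := exists_removable_extension hD hS hd hp
  have hnear : ∀ w ∉ S, f =ᶠ[𝓝 w] h := fun w hw => by
    filter_upwards [hS.isClosed.isOpen_compl.mem_nhds hw] with z hz using hf z hz
  have hcont : ContinuousOn f Ω := fun w hw => by
    by_cases hwS : w ∈ S
    · exact (hfd.differentiableAt (hD.mem_nhds (hSD hwS))).continuousAt.continuousWithinAt
    · have h1 : ContinuousWithinAt h Ω w :=
        (hc w ⟨hw, hwS⟩).mono_of_mem_nhdsWithin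
          (inter_mem_nhdsWithin Ω (hS.isClosed.isOpen_compl.mem_nhds hwS))
      exact h1.congr_of_eventuallyEq (mem_nhdsWithin_of_mem_nhds (hnear w hwS)) (hf w hwS)
  have hdecay : (fun z => f z - c * z⁻¹) =O[cobounded ℂ ⊓ 𝓟 Ω] fun z => z⁻¹ ^ 2 := by
    refine hinf.congr' (Eventually.filter_mono inf_le_left ?_) EventuallyEq.rfl
    filter_upwards [isBounded_def.1 hS.isBounded] with z hz
    rw [hf z hz]
  refine ⟨f, hf, hcont, hfd, exists_bound_of_locally_bounded (fun ζ => ?_) ?_, hdecay⟩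
  · by_cases hζ : ζ ∈ Ω
    · exact (hcont ζ hζ).tendsto.isBigO_one ℂ
    · exact (hb ζ hζ).congr' (mem_nhdsWithin_of_mem_nhds
        ((hnear ζ fun h => hζ (hDΩ (hSD h))).mono fun _ h => h.symm)) EventuallyEq.rfl
  · have h1 : (fun z : ℂ => c * z⁻¹) =O[cobounded ℂ ⊓ 𝓟 Ω] fun _ => (1 : ℂ) := by
      simpa using (isBigO_inv_pow_cobounded Ω (zero_le_one)).const_mul_left c
    have h2 := hdecay.trans (isBigO_inv_pow_cobounded Ω (Nat.zero_le 2))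
    simp only [pow_zero] at h2
    simpa using h2.add h1

theorem of_isBigO (hD : IsOpen D) (hDΩ : D ⊆ Ω) (hc : ContinuousOn h Ω)
    (hd : DifferentiableOn ℂ h D) (hb : ∀ ζ ∉ Ω, h =O[𝓝[Ω] ζ] fun _ => (1 : ℂ))
    (hinf : (fun z => h z - c * z⁻¹) =O[cobounded ℂ ⊓ 𝓟 Ω] fun z => z⁻¹ ^ 2) :
    OneSided Ω D h c := by
  obtain ⟨f, hf, h1⟩ := exists_extension (S := ∅) hD hDΩ Set.finite_empty (Set.empty_subset _)
    (hc.mono Set.sdiff_subset) (hd.mono Set.sdiff_subset) (fun _ h => absurd h (Set.notMem_empty _))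
    hb hinf
  rwa [← funext fun z => hf z (Set.notMem_empty z)]

theorem neg (h1 : OneSided Ω D f c) : OneSided Ω D (fun z => -f z) (-c) := by
  refine ⟨h1.cont.neg, h1.diff.neg, ?_, ?_⟩
  · simpa only [norm_neg] using h1.bound
  · refine h1.decay.neg_left.congr_left fun z => ?_
    ring

theorem isBigO_one (h1 : OneSided Ω D f c) (ζ : ℂ) : f =O[𝓝[Ω] ζ] fun _ => (1 : ℂ) := by
  obtain ⟨B, hB⟩ := h1.bound
  refine Asymptotics.IsBigO.of_bound B ?_
  filter_upwards [self_mem_nhdsWithin] with z hz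
  simpa using hB z hz

theorem isBigO_inv (h1 : OneSided Ω D f c) : f =O[cobounded ℂ ⊓ 𝓟 Ω] fun z => z⁻¹ := by
  have h2 := h1.decay.trans (isBigO_inv_pow_cobounded Ω (one_le_two))
  simp only [pow_one] at h2
  simpa using h2.add ((Asymptotics.isBigO_refl (fun z : ℂ => z⁻¹) _).const_mul_left c)

/-- Division by `z - ξ` after subtraction of a constant. -/
theorem isBigO_div_sub (h1 : OneSided Ω D f c) (A ξ : ℂ) :
    (fun z => (f z - A) * (z - ξ)⁻¹ - -A * z⁻¹) =O[cobounded ℂ ⊓ 𝓟 Ω] fun z => z⁻¹ ^ 2 := by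
  have h2 := h1.isBigO_inv.mul (isBigO_inv_sub_cobounded Ω ξ)
  simp only [← sq] at h2
  refine (h2.sub ((isBigO_inv_sub_sub_inv_cobounded Ω ξ).const_mul_left A)).congr_left fun z => ?_
  ring

theorem isBigO_one_div_sub (h1 : OneSided Ω D f c) (A : ℂ) {ξ ζ : ℂ} (hne : ζ ≠ ξ) :
    (fun z => (f z - A) * (z - ξ)⁻¹) =O[𝓝[Ω] ζ] fun _ => (1 : ℂ) := by
  have h2 : Tendsto (fun z : ℂ => (z - ξ)⁻¹) (𝓝[Ω] ζ) (𝓝 (ζ - ξ)⁻¹) := by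
    have : Tendsto (fun z : ℂ => z - ξ) (𝓝[Ω] ζ) (𝓝 (ζ - ξ)) :=
      ((continuous_id.sub continuous_const).tendsto ζ).mono_left nhdsWithin_le_nhds
    exact this.inv₀ (sub_ne_zero.2 hne)
  simpa using ((h1.isBigO_one ζ).sub (Asymptotics.isBigO_const_const A (one_ne_zero (α := ℂ)) _)).mul
    (h2.isBigO_one ℂ)

/-- The side not containing `ξ`. The subtracted constant becomes the new coefficient at infinity,
since `f` itself contributes `O(1/z²)` after division; `hcl` says that `Ω` stays away from the pole.
-/
theorem div_sub (hD : IsOpen D) (hDΩ : D ⊆ Ω) (h1 : OneSided Ω D f c) (A : ℂ) {ξ : ℂ}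
    (hξ : ξ ∉ Ω) (hcl : ∀ ζ ∉ Ω, ζ = ξ → 𝓝[Ω] ζ = ⊥) :
    OneSided Ω D (fun z => (f z - A) * (z - ξ)⁻¹) (-A) := by
  have hne : ∀ z ∈ Ω, z - ξ ≠ 0 := fun z hz => sub_ne_zero.2 (ne_of_mem_of_not_mem hz hξ)
  refine of_isBigO hD hDΩ ?_ ?_ (fun ζ hζ => ?_) (h1.isBigO_div_sub A ξ)
  · exact (h1.cont.sub continuousOn_const).mul
      ((continuous_id.sub continuous_const).continuousOn.inv₀ hne)
  · exact (h1.diff.sub_const A).mul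
      ((differentiableOn_id.sub_const ξ).inv fun z hz => hne z (hDΩ hz))
  · by_cases h : ζ = ξ
    · rw [hcl ζ hζ h, Asymptotics.IsBigO_def]; exact ⟨0, by simp [Asymptotics.IsBigOWith_def]⟩
    · exact h1.isBigO_one_div_sub A h

/-- The side containing `ξ`: subtracting `f ξ` removes the pole, and that same constant, with a
minus sign, becomes the coefficient of `1/z`. This is how a contour integral evaluates `f` at `ξ`.
-/
theorem dslope (hD : IsOpen D) (hDΩ : D ⊆ Ω) (h1 : OneSided Ω D f c) {ξ : ℂ} (hξ : ξ ∈ D) :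
    OneSided Ω D (dslope f ξ) (-f ξ) := by
  have hsl : ∀ z, z ≠ ξ → _root_.dslope f ξ z = (f z - f ξ) * (z - ξ)⁻¹ := fun z hz => by
    rw [dslope_of_ne _ hz, slope_def_field, div_eq_mul_inv]
  refine of_isBigO hD hDΩ ?_ ?_ (fun ζ hζ => ?_) ?_
  · exact (continuousOn_dslope (mem_of_superset (hD.mem_nhds hξ) hDΩ)).2
      ⟨h1.cont, h1.diff.differentiableAt (hD.mem_nhds hξ)⟩
  · exact (Complex.differentiableOn_dslope (hD.mem_nhds hξ)).2 h1.diff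
  · have hne : ζ ≠ ξ := fun h => hζ (h ▸ hDΩ hξ)
    refine (h1.isBigO_one_div_sub (f ξ) hne).congr' (mem_nhdsWithin_of_mem_nhds ?_) EventuallyEq.rfl
    filter_upwards [isOpen_ne.mem_nhds hne] with z hz using (hsl z hz).symm
  · refine (h1.isBigO_div_sub (f ξ) ξ).congr' (Eventually.filter_mono inf_le_left ?_)
      EventuallyEq.rfl
    filter_upwards [isBounded_def.1 (Bornology.isBounded_singleton (x := ξ))] with z hz
    rw [hsl z hz]

variable {r : ℝ} {fp fm : ℂ → ℂ}

theorem contourPair (hp : OneSided (closedPos r) (openPos r) fp c)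
    (hm : OneSided (closedNeg r) {z | (‖z‖ ^ 2 - r ^ 2) * z.im < 0} fm c) :
    ContourPair r fp fm c := by
  refine ⟨hp.cont, hm.cont, hp.diff, hm.diff, hp.bound, hm.bound, ?_, ?_⟩
  · simpa only [div_eq_mul_inv] using exists_bound_of_isBigO hp.decay
  · simpa only [div_eq_mul_inv] using exists_bound_of_isBigO hm.decay

/-- The pair obtained by dividing by `z - ξ` and removing the pole at `ξ`. -/
theorem contourPair_div (hp : OneSided (closedPos r) (openPos r) fp c)
    (hm : OneSided (closedNeg r) {z | (‖z‖ ^ 2 - r ^ 2) * z.im < 0} fm c) {ξ : ℂ}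
    (hξ : (‖ξ‖ ^ 2 - r ^ 2) * ξ.im < 0) :
    ContourPair r (fun z => (fp z - fm ξ) * (z - ξ)⁻¹) (_root_.dslope fm ξ) (-fm ξ) := by
  have hop : IsOpen {z : ℂ | (‖z‖ ^ 2 - r ^ 2) * z.im < 0} := isOpen_lt (by fun_prop) continuous_const
  have hmem : ∀ z : ℂ, (‖z‖ ^ 2 - r ^ 2) * z.im < 0 → z ∉ closedPos r :=
    fun z hz h => absurd hz (not_lt.2 h.2.2)
  refine contourPair (hp.div_sub (isOpen_openPos r) (openPos_subset_closedPos r) _ (hmem ξ hξ)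
    fun ζ _ h => ?_) (hm.dslope hop (fun z hz => ?_) hξ)
  · subst h
    rw [← notMem_closure_iff_nhdsWithin_eq_bot]
    refine fun hcl => ?_
    obtain ⟨z, hz1, hz2⟩ := mem_closure_iff.1 hcl _ hop hξ
    exact hmem z hz1 hz2
  · have h1 : (starRingEnd ℂ) z ∈ openPos r := by
      change 0 < (‖(starRingEnd ℂ) z‖ ^ 2 - r ^ 2) * ((starRingEnd ℂ) z).im
      rw [RCLike.norm_conj, conj_im]
      have : (‖z‖ ^ 2 - r ^ 2) * z.im < 0 := hz
      linarith
    have h2 := conj_mem_closedNeg (openPos_subset_closedPos r h1)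
    rwa [conj_conj] at h2

end OneSided

/-! ### Points missing from the closed regions, and rational singular parts -/

/-- Adding `0` and `±ir` closes the region up, so local boundedness outside it has to be checked at
these three points only. -/
theorem closedPos_nhdsWithin {r : ℝ} {ζ : ℂ} (hζ : ζ ∉ closedPos r) :
    ζ = 0 ∨ ζ = I * r ∨ ζ = -(I * r) ∨ 𝓝[closedPos r] ζ = ⊥ := by
  by_cases h0 : ζ = 0
  · exact Or.inl h0
  by_cases h1 : ζ ^ 2 + (r : ℂ) ^ 2 = 0
  · have h6 : (ζ - I * r) * (ζ + I * r) = 0 := by linear_combination h1 - (r : ℂ) ^ 2 * I_sq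
    rcases mul_eq_zero.1 h6 with h7 | h7
    · exact Or.inr (Or.inl (sub_eq_zero.1 h7))
    · exact Or.inr (Or.inr (Or.inl (eq_neg_of_add_eq_zero_left h7)))
  · refine Or.inr (Or.inr (Or.inr ?_))
    rw [← notMem_closure_iff_nhdsWithin_eq_bot]
    have hcl : closure (closedPos r) ⊆ {z : ℂ | 0 ≤ (‖z‖ ^ 2 - r ^ 2) * z.im} :=
      closure_minimal (fun z hz => hz.2.2) (isClosed_le continuous_const (by fun_prop))
    exact fun h => hζ ⟨h0, h1, hcl h⟩

theorem closedNeg_nhdsWithin {r : ℝ} {ζ : ℂ} (hζ : ζ ∉ closedNeg r) :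
    ζ = 0 ∨ ζ = I * r ∨ ζ = -(I * r) ∨ 𝓝[closedNeg r] ζ = ⊥ := by
  by_cases h0 : ζ = 0
  · exact Or.inl h0
  by_cases h1 : ζ ^ 2 + (r : ℂ) ^ 2 = 0
  · have h6 : (ζ - I * r) * (ζ + I * r) = 0 := by linear_combination h1 - (r : ℂ) ^ 2 * I_sq
    rcases mul_eq_zero.1 h6 with h7 | h7
    · exact Or.inr (Or.inl (sub_eq_zero.1 h7))
    · exact Or.inr (Or.inr (Or.inl (eq_neg_of_add_eq_zero_left h7)))
  · refine Or.inr (Or.inr (Or.inr ?_))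
    rw [← notMem_closure_iff_nhdsWithin_eq_bot]
    have hcl : closure (closedNeg r) ⊆ {z : ℂ | (‖z‖ ^ 2 - r ^ 2) * z.im ≤ 0} :=
      closure_minimal (fun z hz => hz.2.2) (isClosed_le (by fun_prop) continuous_const)
    exact fun h => hζ ⟨h0, h1, hcl h⟩

theorem tendsto_hat {r : ℝ} {ζ : ℂ} (hζ : ζ ≠ 0) {Ω Ω' : Set ℂ} (h : ∀ z ∈ Ω, hat r z ∈ Ω') :
    Tendsto (hat r) (𝓝[Ω] ζ) (𝓝[Ω'] (hat r ζ)) := by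
  refine tendsto_nhdsWithin_iff.2 ⟨?_, ?_⟩
  · exact (continuousAt_const.div continuousAt_id hζ).tendsto.mono_left nhdsWithin_le_nhds
  · filter_upwards [self_mem_nhdsWithin] with z hz using h z hz

theorem tendsto_hat_zero {r : ℝ} (hr : 0 < r) {Ω Ω' : Set ℂ} (h0 : (0 : ℂ) ∉ Ω)
    (h : ∀ z ∈ Ω, hat r z ∈ Ω') : Tendsto (hat r) (𝓝[Ω] 0) (cobounded ℂ ⊓ 𝓟 Ω') := by
  refine tendsto_inf.2 ⟨?_, tendsto_principal.2 ?_⟩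
  · rw [← tendsto_norm_atTop_iff_cobounded]
    simp only [norm_hat]
    have h1 : Tendsto (fun z : ℂ => ‖z‖) (𝓝[Ω] 0) (𝓝[>] 0) := by
      refine tendsto_nhdsWithin_iff.2 ⟨?_, ?_⟩
      · simpa using (continuous_norm.tendsto (0 : ℂ)).mono_left nhdsWithin_le_nhds
      · filter_upwards [self_mem_nhdsWithin] with z hz
        exact norm_pos_iff.2 (ne_of_mem_of_not_mem hz h0)
    simp only [div_eq_mul_inv]
    exact (tendsto_inv_nhdsGT_zero.comp h1).const_mul_atTop (by positivity : 0 < r ^ 2)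
  · filter_upwards [self_mem_nhdsWithin] with z hz using h z hz

theorem hat_I_mul {r : ℝ} (hr : 0 < r) : hat r (I * r) = I * r := by
  have : (r : ℂ) ≠ 0 := ofReal_ne_zero.2 hr.ne'
  rw [hat, div_eq_iff (mul_ne_zero I_ne_zero this)]
  linear_combination -(r : ℂ) ^ 2 * I_sq

theorem hat_neg (r : ℝ) (z : ℂ) : hat r (-z) = -hat r z := by
  rw [hat, hat, div_neg]

/-- The rational function with simple poles `p n` and residues `α n`. -/
noncomputable def polar {ι : Type*} [Fintype ι] (p α : ι → ℂ) (z : ℂ) : ℂ := ∑ n, α n * (z - p n)⁻¹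

section polar

variable {ι : Type*} [Fintype ι] {p : ι → ℂ} (α : ι → ℂ)

theorem differentiableAt_polar {w : ℂ} (hw : w ∉ Set.range p) :
    DifferentiableAt ℂ (polar p α) w := by
  refine DifferentiableAt.fun_sum fun n _ => DifferentiableAt.const_mul ?_ _
  exact (differentiableAt_id.sub_const (p n)).inv (sub_ne_zero.2 fun h => hw ⟨n, h.symm⟩)

theorem isBigO_polar_one {w : ℂ} (hw : w ∉ Set.range p) (Ω : Set ℂ) :
    polar p α =O[𝓝[Ω] w] fun _ => (1 : ℂ) :=
  ((differentiableAt_polar α hw).continuousAt.tendsto.mono_left nhdsWithin_le_nhds).isBigO_one ℂ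

theorem isBigO_polar (Ω : Set ℂ) :
    (fun z => polar p α z - (∑ n, α n) * z⁻¹) =O[cobounded ℂ ⊓ 𝓟 Ω] fun z => z⁻¹ ^ 2 := by
  have h : (fun z => ∑ n, α n * ((z - p n)⁻¹ - z⁻¹)) =O[cobounded ℂ ⊓ 𝓟 Ω] fun z => z⁻¹ ^ 2 :=
    Asymptotics.IsBigO.fun_sum fun n _ => (isBigO_inv_sub_sub_inv_cobounded Ω (p n)).const_mul_left _
  refine h.congr_left fun z => ?_
  rw [polar, Finset.sum_mul, ← Finset.sum_sub_distrib]
  exact Finset.sum_congr rfl fun n _ => by ring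

theorem tendsto_sub_mul_polar (hp : Function.Injective p) (n : ι) :
    Tendsto (fun z => (z - p n) * polar p α z) (𝓝[≠] p n) (𝓝 (α n)) := by
  classical
  have h : ∀ m, Tendsto (fun z => (z - p n) * (α m * (z - p m)⁻¹)) (𝓝[≠] p n)
      (𝓝 (if m = n then α m else 0)) := fun m => by
    split_ifs with hm
    · subst hm
      refine (tendsto_const_nhds (x := α m)).congr' ?_
      filter_upwards [self_mem_nhdsWithin] with z hz
      have : z - p m ≠ 0 := sub_ne_zero.2 hz
      field_simp
    · have hne : p n - p m ≠ 0 := sub_ne_zero.2 fun h => hm (hp h).symm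
      have : ContinuousAt (fun z => (z - p n) * (α m * (z - p m)⁻¹)) (p n) :=
        (continuousAt_id.sub continuousAt_const).mul
          (continuousAt_const.mul ((continuousAt_id.sub continuousAt_const).inv₀ hne))
      simpa using this.tendsto.mono_left nhdsWithin_le_nhds
  have := tendsto_finsetSum Finset.univ fun m _ => h m
  rw [Finset.sum_ite_eq' Finset.univ n, if_pos (Finset.mem_univ n)] at this
  refine this.congr fun z => ?_
  rw [polar, Finset.mul_sum]

end polar

/-- As `z → 0` its image under inversion tends to infinity, where decay of `f` of first order
compensates exactly one factor `1/z`. -/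
theorem isBigO_inv_mul_comp_hat {r : ℝ} (hr : 0 < r) {Ω Ω' : Set ℂ} (h0 : (0 : ℂ) ∉ Ω)
    (h : ∀ z ∈ Ω, hat r z ∈ Ω') {f : ℂ → ℂ} (hf : f =O[cobounded ℂ ⊓ 𝓟 Ω'] fun z => z⁻¹) :
    (fun z => z⁻¹ * f (hat r z)) =O[𝓝[Ω] 0] fun _ => (1 : ℂ) := by
  have hr' : (r : ℂ) ≠ 0 := ofReal_ne_zero.2 hr.ne'
  have h1 := (Asymptotics.isBigO_refl (fun z : ℂ => z⁻¹) (𝓝[Ω] 0)).mul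
    (hf.comp_tendsto (tendsto_hat_zero hr h0 h))
  refine h1.trans (Asymptotics.IsBigO.of_bound ‖((r : ℂ) ^ 2)⁻¹‖ ?_)
  filter_upwards [self_mem_nhdsWithin] with z hz
  have hz0 : z ≠ 0 := ne_of_mem_of_not_mem hz h0
  have : z⁻¹ * ((fun z => z⁻¹) ∘ hat r) z = -((r : ℂ) ^ 2)⁻¹ := by
    simp only [Function.comp, hat]; field_simp
  rw [this, norm_neg, norm_one, mul_one]

/-! ### Reconstruction formula and closed system -/

namespace KEPotential

variable {P : KEPotential}

theorem zero_notMem_closedPos (r : ℝ) : (0 : ℂ) ∉ closedPos r := fun h => h.1 rfl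

theorem zero_notMem_closedNeg (r : ℝ) : (0 : ℂ) ∉ closedNeg r := fun h => h.1 rfl

theorem notMem_closedPos_of_sq {r : ℝ} {ζ : ℂ} (h : ζ = I * r ∨ ζ = -(I * r)) :
    ζ ∉ closedPos r := fun hm => hm.2.1 (by
  rcases h with rfl | rfl <;> linear_combination (r : ℂ) ^ 2 * I_sq)

theorem hat_branch {r : ℝ} (hr : 0 < r) {ζ : ℂ} (h : ζ = I * r ∨ ζ = -(I * r)) :
    hat r ζ = ζ := by
  rcases h with rfl | rfl
  · exact hat_I_mul hr
  · rw [hat_neg, hat_I_mul hr]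

theorem branch_ne_zero {r : ℝ} (hr : 0 < r) {ζ : ℂ} (h : ζ = I * r ∨ ζ = -(I * r)) : ζ ≠ 0 := by
  have : I * (r : ℂ) ≠ 0 := mul_ne_zero I_ne_zero (ofReal_ne_zero.2 hr.ne')
  rcases h with rfl | rfl
  · exact this
  · exact neg_ne_zero.2 this

theorem notMem_closedNeg_of_mem_Dplus {w : ℂ} (hw : w ∈ P.Dplus) : w ∉ closedNeg P.q0 :=
  fun h => absurd h.2.2 (not_le.2 hw)

theorem notMem_closedPos_of_mem_Dminus {w : ℂ} (hw : w ∈ P.Dminus) : w ∉ closedPos P.q0 :=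
  fun h => absurd h.2.2 (not_le.2 hw)

namespace Admissible

variable (hP : P.Admissible)

include hP

theorem branch_mem_Sig {ζ : ℂ} (h : ζ = I * P.q0 ∨ ζ = -(I * P.q0)) : ζ ∈ P.Sig := by
  have h0 := hP.q0_pos
  refine Or.inr ?_
  rcases h with rfl | rfl <;> simp [abs_of_pos h0]

theorem isBigO_inv_MPlus (x t : ℝ) (i j : Fin 2) :
    (fun w => P.MPlus x t w i j - (1 : Matrix (Fin 2) (Fin 2) ℂ) i j)
      =O[cobounded ℂ ⊓ 𝓟 (closedPos P.q0)] fun z => z⁻¹ := by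
  have h1 := (hP.isBigO_MPlus x t i j).trans (isBigO_inv_pow_cobounded _ one_le_two)
  simp only [pow_one] at h1
  refine (h1.add ((Asymptotics.isBigO_refl (fun z : ℂ => z⁻¹) _).const_mul_left
    (leadingCoeff P x t i j))).congr_left fun w => ?_
  ring

theorem isBigO_inv_MMinus (x t : ℝ) (i j : Fin 2) :
    (fun w => P.MMinus x t w i j - (1 : Matrix (Fin 2) (Fin 2) ℂ) i j)
      =O[cobounded ℂ ⊓ 𝓟 (closedNeg P.q0)] fun z => z⁻¹ := by
  have h1 := (hP.isBigO_MMinus x t i j).trans (isBigO_inv_pow_cobounded _ one_le_two)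
  simp only [pow_one] at h1
  refine (h1.add ((Asymptotics.isBigO_refl (fun z : ℂ => z⁻¹) _).const_mul_left
    (leadingCoeff P x t i j))).congr_left fun w => ?_
  ring

theorem isBigO_MPlus_zero (x t : ℝ) :
    (fun w => P.MPlus x t w 0 1 + I * P.qm * w⁻¹) =O[𝓝[closedPos P.q0] 0] fun _ => (1 : ℂ) := by
  have h := (isBigO_inv_mul_comp_hat hP.q0_pos (zero_notMem_closedPos P.q0)
    (fun z hz => hat_mem_closedNeg hP.q0_pos hz)
    (hP.isBigO_inv_MMinus x t 0 0)).const_mul_left (-(I * P.qm))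
  refine h.congr' ?_ EventuallyEq.rfl
  filter_upwards [self_mem_nhdsWithin] with w hw
  rw [(hP.MPlus_hat hw x t 0).2, one_apply_eq]
  ring

theorem isBigO_MMinus_zero (x t : ℝ) :
    (fun w => P.MMinus x t w 0 1 + I * P.qm * w⁻¹) =O[𝓝[closedNeg P.q0] 0] fun _ => (1 : ℂ) := by
  have h := (isBigO_inv_mul_comp_hat hP.q0_pos (zero_notMem_closedNeg P.q0)
    (fun z hz => hat_mem_closedPos hP.q0_pos hz)
    (hP.isBigO_inv_MPlus x t 0 0)).const_mul_left (-(I * P.qm))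
  refine h.congr' ?_ EventuallyEq.rfl
  filter_upwards [self_mem_nhdsWithin] with w hw
  rw [(hP.MMinus_hat hw x t 0).2, one_apply_eq]
  ring

theorem continuousOn_MMinus_one (x t : ℝ) (i : Fin 2) :
    ContinuousOn (fun w => P.MMinus x t w i 1) (closedNeg P.q0) := by
  refine ContinuousOn.congr (f := fun w => -(I * P.qm / w) * P.MPlus x t (hat P.q0 w) i 0) ?_
    fun w hw => (hP.MMinus_hat hw x t i).2
  refine ContinuousOn.mul ((continuousOn_const.div continuousOn_id fun w hw => hw.1).neg) ?_
  exact (hP.continuousOn_uM_zero x t i).comp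
    ((differentiableOn_hat P.q0).continuousOn.mono fun w hw => hw.1)
    fun w hw => hat_mem_closedPos hP.q0_pos hw

theorem differentiableOn_MMinus_one (x t : ℝ) (i : Fin 2) :
    DifferentiableOn ℂ (fun w => P.MMinus x t w i 1) P.Dminus := by
  refine DifferentiableOn.congr (f := fun w => -(I * P.qm / w) * P.MPlus x t (hat P.q0 w) i 0) ?_
    fun w hw => (hP.MMinus_hat (Dminus_subset hw) x t i).2
  refine DifferentiableOn.mul (((differentiableOn_const _).div differentiableOn_id
    fun w hw => (Dminus_subset hw).1).neg) ?_
  exact (hP.differentiableOn_uM_zero x t i).comp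
    ((differentiableOn_hat P.q0).mono fun w hw => (Dminus_subset hw).1)
    fun w hw => hat_mem_Dplus hP.q0_pos hw

variable {N : ℕ} {z : Fin N → ℂ} (hS : P.SimpleSpectrum z)

include hS

theorem isBigO_one_MPlus (x t : ℝ) (i j : Fin 2) {ζ : ℂ} (h : ζ = I * P.q0 ∨ ζ = -(I * P.q0)) :
    (fun w => P.MPlus x t w i j) =O[𝓝[closedPos P.q0] ζ] fun _ => (1 : ℂ) := by
  obtain ⟨C, hC⟩ := hP.bounded_MPlus hS x t i j (hP.branch_mem_Sig h) (branch_ne_zero hP.q0_pos h)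
  exact Asymptotics.IsBigO.of_bound C (hC.mono fun w hw => by simpa using hw)

theorem isBigO_one_MMinus_one (x t : ℝ) (i : Fin 2) {ζ : ℂ} (h : ζ = I * P.q0 ∨ ζ = -(I * P.q0)) :
    (fun w => P.MMinus x t w i 1) =O[𝓝[closedNeg P.q0] ζ] fun _ => (1 : ℂ) := by
  have hζ := branch_ne_zero hP.q0_pos h
  have ht := tendsto_hat (r := P.q0) hζ fun z hz => hat_mem_closedPos hP.q0_pos hz
  rw [hat_branch hP.q0_pos h] at ht
  have h1 := (hP.isBigO_one_MPlus hS x t i 0 h).comp_tendsto ht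
  have h2 : Tendsto (fun w => -(I * P.qm / w)) (𝓝[closedNeg P.q0] ζ) (𝓝 (-(I * P.qm / ζ))) :=
    ((continuousAt_const.div continuousAt_id hζ).neg).tendsto.mono_left nhdsWithin_le_nhds
  have h3 := (h2.isBigO_one ℂ).mul h1
  simp only [Function.comp_def, mul_one] at h3
  refine h3.congr' ?_ EventuallyEq.rfl
  filter_upwards [self_mem_nhdsWithin] with w hw
  exact (hP.MMinus_hat hw x t i).2.symm

theorem xiHat_notMem_closedNeg {w : ℂ} (hw : w ∈ closedNeg P.q0) :
    w ∉ Set.range (P.xiHat z) := by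
  rintro ⟨n, rfl⟩
  exact notMem_closedNeg_of_mem_Dplus (hP.xiHat_mem hS n) hw

theorem xi_notMem_closedPos {w : ℂ} (hw : w ∈ closedPos P.q0) : w ∉ Set.range (P.xi z) := by
  rintro ⟨n, rfl⟩
  exact notMem_closedPos_of_mem_Dminus (hP.xi_mem hS n) hw

theorem notMem_range_xiHat {w : ℂ} (hw : w ∉ closedPos P.q0) : w ∉ Set.range (P.xiHat z) := by
  rintro ⟨n, rfl⟩
  exact hw (Dplus_subset (hP.xiHat_mem hS n))

theorem range_xiHat_subset : Set.range (P.xiHat z) ⊆ P.Dplus := by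
  rintro _ ⟨n, rfl⟩
  exact hP.xiHat_mem hS n

/-- The `(1,2)` entry of `M⁺` with its poles at `0` and at the discrete spectrum removed. -/
theorem exists_regularized_plus (x t : ℝ) :
    ∃ f : ℂ → ℂ, (∀ w ∈ closedPos P.q0, w ∈ closedNeg P.q0 → f w = P.MPlus x t w 0 1
        + I * P.qm * w⁻¹
        - polar (P.xiHat z) (fun n => P.omega z x t n * P.uM 0 x t (P.xiHat z n) 0) w) ∧
      OneSided (closedPos P.q0) (openPos P.q0) f (-(I * P.q x t) + I * P.qm
        - ∑ n, P.omega z x t n * P.uM 0 x t (P.xiHat z n) 0) := by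
  set α : Fin N ⊕ Fin N → ℂ := fun n => P.omega z x t n * P.uM 0 x t (P.xiHat z n) 0 with hα
  suffices h : ∃ f, (∀ w ∉ Set.range (P.xiHat z), f w
      = P.MPlus x t w 0 1 + I * P.qm * w⁻¹ - polar (P.xiHat z) α w) ∧
      OneSided (closedPos P.q0) (openPos P.q0) f (-(I * P.q x t) + I * P.qm - ∑ n, α n) by
    obtain ⟨f, hf, h⟩ := h
    exact ⟨f, fun w _ hw => hf w (hP.xiHat_notMem_closedNeg hS hw), h⟩
  refine OneSided.exists_extension (Ω := closedPos P.q0) (D := openPos P.q0)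
    (S := Set.range (P.xiHat z))
    (h := fun w => P.MPlus x t w 0 1 + I * P.qm * w⁻¹ - polar (P.xiHat z) α w)
    (c := -(I * P.q x t) + I * P.qm - ∑ n, α n)
    (isOpen_openPos _) (openPos_subset_closedPos _) (Set.finite_range _)
    (hP.range_xiHat_subset hS) ?_ ?_ ?_ ?_ ?_
  · refine ((hP.continuousOn_MPlus hS x t 0 1).add (continuousOn_const.mul
      (continuousOn_id.inv₀ fun w hw => hw.1.1))).sub fun w hw => ?_
    exact (differentiableAt_polar α hw.2).continuousAt.continuousWithinAt
  · refine ((hP.differentiableOn_MPlus hS x t 0 1).add ((differentiableOn_const _).mul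
      (differentiableOn_id.inv fun w hw => (Dplus_subset hw.1).1))).sub fun w hw => ?_
    exact (differentiableAt_polar α hw.2).differentiableWithinAt
  -- The residue of `M⁺₁₂` at `ξ̂_n` is the coefficient subtracted by `polar`, and `1/w` is regular
  -- there because `ξ̂_n ≠ 0`.
  · rintro _ ⟨n, rfl⟩
    have hn0 := (Dplus_subset (hP.xiHat_mem hS n)).1
    have h1 : Tendsto (fun w => (w - P.xiHat z n) * (I * P.qm * w⁻¹)) (𝓝[≠] P.xiHat z n) (𝓝 0) := by
      have : ContinuousAt (fun w => (w - P.xiHat z n) * (I * P.qm * w⁻¹)) (P.xiHat z n) :=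
        (continuousAt_id.sub continuousAt_const).mul
          (continuousAt_const.mul (continuousAt_id.inv₀ hn0))
      simpa using this.tendsto.mono_left nhdsWithin_le_nhds
    have h2 := ((hP.tendsto_sub_mul_MPlus hS x t 0 n).add h1).sub
      (tendsto_sub_mul_polar α (hP.xiHat_injective hS) n)
    rw [hα] at h2 ⊢
    simp only [add_zero, sub_self] at h2
    exact h2.congr fun w => by ring
  · intro ζ hζ
    have hpo := isBigO_polar_one α (hP.notMem_range_xiHat hS hζ) (closedPos P.q0)
    rcases closedPos_nhdsWithin hζ with h | h | h | h
    · subst h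
      exact (hP.isBigO_MPlus_zero x t).sub hpo
    all_goals try rw [h]
    rotate_right
    · rw [Asymptotics.IsBigO_def]; exact ⟨0, by simp [Asymptotics.IsBigOWith_def]⟩
    all_goals
      rw [← h]
      have hbr : ζ = I * P.q0 ∨ ζ = -(I * P.q0) := by tauto
      have hζ0 := branch_ne_zero hP.q0_pos hbr
      have h2 : Tendsto (fun w => I * P.qm * w⁻¹) (𝓝[closedPos P.q0] ζ) (𝓝 (I * P.qm * ζ⁻¹)) :=
        (continuousAt_const.mul (continuousAt_id.inv₀ hζ0)).tendsto.mono_left nhdsWithin_le_nhds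
      exact ((hP.isBigO_one_MPlus hS x t 0 1 hbr).add (h2.isBigO_one ℂ)).sub hpo
  · refine ((hP.isBigO_MPlus x t 0 1).sub (isBigO_polar (p := P.xiHat z) α _)).congr_left fun w => ?_
    simp [leadingCoeff]
    ring

/-- The `(1,2)` entry of `M⁻` with the singular parts of `M⁺` subtracted. -/
theorem oneSided_minus (x t : ℝ) :
    OneSided (closedNeg P.q0) P.Dminus (fun w => P.MMinus x t w 0 1 + I * P.qm * w⁻¹
      - polar (P.xiHat z) (fun n => P.omega z x t n * P.uM 0 x t (P.xiHat z n) 0) w)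
      (-(I * P.q x t) + I * P.qm - ∑ n, P.omega z x t n * P.uM 0 x t (P.xiHat z n) 0) := by
  set α : Fin N ⊕ Fin N → ℂ := fun n => P.omega z x t n * P.uM 0 x t (P.xiHat z n) 0 with hα
  have hr0 : (0 : ℂ) ∉ Set.range (P.xiHat z) :=
    hP.notMem_range_xiHat hS (zero_notMem_closedPos P.q0)
  refine OneSided.of_isBigO isOpen_Dminus Dminus_subset ?_ ?_ ?_ ?_
  · refine ((hP.continuousOn_MMinus_one x t 0).add (continuousOn_const.mul
      (continuousOn_id.inv₀ fun w hw => hw.1))).sub fun w hw => ?_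
    exact (differentiableAt_polar α
      (hP.xiHat_notMem_closedNeg hS hw)).continuousAt.continuousWithinAt
  · refine ((hP.differentiableOn_MMinus_one x t 0).add ((differentiableOn_const _).mul
      (differentiableOn_id.inv fun w hw => (Dminus_subset hw).1))).sub fun w hw => ?_
    exact (differentiableAt_polar α
      (hP.xiHat_notMem_closedNeg hS (Dminus_subset hw))).differentiableWithinAt
  · intro ζ hζ
    rcases closedNeg_nhdsWithin hζ with h | h | h | h
    · subst h
      exact (hP.isBigO_MMinus_zero x t).sub (isBigO_polar_one α hr0 _)
    all_goals try rw [h]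
    rotate_right
    · rw [Asymptotics.IsBigO_def]; exact ⟨0, by simp [Asymptotics.IsBigOWith_def]⟩
    all_goals
      rw [← h]
      have hbr : ζ = I * P.q0 ∨ ζ = -(I * P.q0) := by tauto
      have hζ0 := branch_ne_zero hP.q0_pos hbr
      have hpo := isBigO_polar_one α
        (hP.notMem_range_xiHat hS (notMem_closedPos_of_sq hbr)) (closedNeg P.q0)
      have h2 : Tendsto (fun w => I * P.qm * w⁻¹) (𝓝[closedNeg P.q0] ζ) (𝓝 (I * P.qm * ζ⁻¹)) :=
        (continuousAt_const.mul (continuousAt_id.inv₀ hζ0)).tendsto.mono_left nhdsWithin_le_nhds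
      exact ((hP.isBigO_one_MMinus_one hS x t 0 hbr).add (h2.isBigO_one ℂ)).sub hpo
  · refine ((hP.isBigO_MMinus x t 0 1).sub (isBigO_polar (p := P.xiHat z) α _)).congr_left fun w => ?_
    simp [leadingCoeff]
    ring

omit hS in
theorem sigIntegrable_of_contourPair {fp fm j : ℂ → ℂ} {c : ℂ} (h : ContourPair P.q0 fp fm c)
    (hj : ∀ ζ ∈ closedPos P.q0, ζ ∈ closedNeg P.q0 → j ζ = fp ζ - fm ζ) :
    P.SigIntegrable j ∧ P.sigIntegral j = -(2 * Real.pi * I * c) := by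
  have hi := h.integrable_circle hP.q0_pos hj
  exact ⟨⟨h.integrable_real hP.q0_pos hj, hi.1.trans hi.2⟩, h.integral_eq hP.q0_pos hj⟩

/-- The same singular parts are subtracted on both sides, so the jump is still `M⁻G` after a change
of sign of the pair. The coefficient of `1/z` contains `-iq` from the expansion of `M`, `iq_-` from
the pole at `0` and minus the sum of the residues; the contour formula solves for `q`. -/
theorem reconstruction (x t : ℝ) :
    P.SigIntegrable (fun ζ => (P.MMinus x t ζ * P.GG x t ζ) 0 1) ∧
      P.q x t = P.qm + I * ∑ n, P.omega z x t n * P.uM 0 x t (P.xiHat z n) 0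
        + 1 / (2 * (Real.pi : ℂ))
          * P.sigIntegral (fun ζ => (P.MMinus x t ζ * P.GG x t ζ) 0 1) := by
  obtain ⟨f, hf, hp⟩ := hP.exists_regularized_plus hS x t
  have h := OneSided.contourPair hp.neg (hP.oneSided_minus hS x t).neg
  obtain ⟨h1, h2⟩ := hP.sigIntegrable_of_contourPair
    (j := fun ζ => (P.MMinus x t ζ * P.GG x t ζ) 0 1) h fun ζ hζ hζ' => by
      rw [hP.jump_of_mem hS hζ hζ', hf ζ hζ hζ', Matrix.sub_apply]
      ring
  refine ⟨h1, ?_⟩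
  have hpi : (Real.pi : ℂ) ≠ 0 := ofReal_ne_zero.2 Real.pi_ne_zero
  rw [h2]
  field_simp
  linear_combination (P.q x t - P.qm) * I_sq

theorem closed_system (x t : ℝ) (s : Fin N ⊕ Fin N) :
    P.SigIntegrable (fun ζ => (P.MMinus x t ζ * P.GG x t ζ) 0 1 / (ζ - P.xi z s)) ∧
      1 / (2 * (Real.pi : ℂ) * I)
          * P.sigIntegral (fun ζ => (P.MMinus x t ζ * P.GG x t ζ) 0 1 / (ζ - P.xi z s))
        = ∑ n, P.omega z x t n / (P.xi z s - P.xiHat z n) * P.uM 0 x t (P.xiHat z n) 0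
          + P.nu z s * P.uM 0 x t (P.xiHat z s) 0 - P.nu z s := by
  obtain ⟨f, hf, hp⟩ := hP.exists_regularized_plus hS x t
  have hm := hP.oneSided_minus hS x t
  have hξ := hP.xi_mem hS s
  have h := OneSided.contourPair_div hp.neg hm.neg hξ
  obtain ⟨h1, h2⟩ := hP.sigIntegrable_of_contourPair
    (j := fun ζ => (P.MMinus x t ζ * P.GG x t ζ) 0 1 / (ζ - P.xi z s)) h fun ζ hζ hζ' => by
      have hne : ζ ≠ P.xi z s := fun h => hP.xi_notMem_closedPos hS hζ ⟨s, h.symm⟩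
      rw [dslope_of_ne _ hne, slope_def_field, hP.jump_of_mem hS hζ hζ', hf ζ hζ hζ', Matrix.sub_apply]
      simp only [div_eq_mul_inv]
      ring
  refine ⟨h1, ?_⟩
  have hpi : (Real.pi : ℂ) ≠ 0 := ofReal_ne_zero.2 Real.pi_ne_zero
  have hI := I_ne_zero
  rw [h2, (hP.MMinus_hat (Dminus_subset hξ) x t 0).2]
  change _ * -(_ * - -(-(I * P.qm / P.xi z s) * P.uM 0 x t (P.xiHat z s) 0 + _ - _)) = _
  have e : ∑ n, P.omega z x t n / (P.xi z s - P.xiHat z n) * P.uM 0 x t (P.xiHat z n) 0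
      = polar (P.xiHat z) (fun n => P.omega z x t n * P.uM 0 x t (P.xiHat z n) 0) (P.xi z s) := by
    rw [polar]
    exact Finset.sum_congr rfl fun n _ => by rw [div_eq_mul_inv]; ring
  rw [e, nu]
  generalize polar (P.xiHat z) _ _ = p
  field_simp
  ring

end Admissible

end KEPotential

/-! ### The reflectionless case: invertibility of `T` -/

theorem isBigO_polar_inv {ι : Type*} [Fintype ι] {p : ι → ℂ} (α : ι → ℂ) (Ω : Set ℂ) :
    polar p α =O[cobounded ℂ ⊓ 𝓟 Ω] fun z => z⁻¹ := by
  have h1 := (isBigO_polar (p := p) α Ω).trans (isBigO_inv_pow_cobounded Ω one_le_two)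
  simp only [pow_one] at h1
  refine (h1.add ((Asymptotics.isBigO_refl (fun z : ℂ => z⁻¹) _).const_mul_left
    (∑ n, α n))).congr_left fun w => ?_
  ring

theorem isBigO_inv_sq_mul_comp_hat {r : ℝ} (hr : 0 < r) {Ω Ω' : Set ℂ} (h0 : (0 : ℂ) ∉ Ω)
    (h : ∀ z ∈ Ω, hat r z ∈ Ω') {f : ℂ → ℂ} (hf : f =O[cobounded ℂ ⊓ 𝓟 Ω'] fun z => z⁻¹ ^ 2) :
    (fun z => z⁻¹ ^ 2 * f (hat r z)) =O[𝓝[Ω] 0] fun _ => (1 : ℂ) := by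
  have hr' : (r : ℂ) ≠ 0 := ofReal_ne_zero.2 hr.ne'
  have h1 := (Asymptotics.isBigO_refl (fun z : ℂ => z⁻¹ ^ 2) (𝓝[Ω] 0)).mul
    (hf.comp_tendsto (tendsto_hat_zero hr h0 h))
  refine h1.trans (Asymptotics.IsBigO.of_bound ‖((r : ℂ) ^ 4)⁻¹‖ ?_)
  filter_upwards [self_mem_nhdsWithin] with z hz
  have hz0 : z ≠ 0 := ne_of_mem_of_not_mem hz h0
  have : z⁻¹ ^ 2 * ((fun z => z⁻¹ ^ 2) ∘ hat r) z = ((r : ℂ) ^ 4)⁻¹ := by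
    simp only [Function.comp, hat]; field_simp
  rw [this, norm_one, mul_one]

namespace KEPotential

variable {P : KEPotential}

/-- The entry `(m M⁻¹)_i`, up to sign and the factor `det M`, of the product of the row
`m = (polar p α, polar p' β)` with the inverse of `M`. -/
noncomputable def rowProduct {ι : Type*} [Fintype ι] (p α p' β : ι → ℂ)
    (M : ℂ → Matrix (Fin 2) (Fin 2) ℂ) (i : Fin 2) (w : ℂ) : ℂ :=
  polar p α w * M w i 1 - polar p' β w * M w i 0

theorem isBigO_rowProduct {ι : Type*} [Fintype ι] {p α p' β : ι → ℂ}
    {M : ℂ → Matrix (Fin 2) (Fin 2) ℂ} {Ω : Set ℂ} {i : Fin 2}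
    (h : ∀ j, (fun w => M w i j - (1 : Matrix (Fin 2) (Fin 2) ℂ) i j)
      =O[cobounded ℂ ⊓ 𝓟 Ω] fun z => z⁻¹) :
    (fun w => rowProduct p α p' β M i w - ((∑ n, α n) * (1 : Matrix (Fin 2) (Fin 2) ℂ) i 1
      - (∑ n, β n) * (1 : Matrix (Fin 2) (Fin 2) ℂ) i 0) * w⁻¹)
      =O[cobounded ℂ ⊓ 𝓟 Ω] fun z => z⁻¹ ^ 2 := by
  have h1 := (isBigO_polar_inv (p := p) α Ω).mul (h 1)
  have h2 := (isBigO_polar_inv (p := p') β Ω).mul (h 0)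
  simp only [← sq] at h1 h2
  refine ((h1.add ((isBigO_polar (p := p) α Ω).const_mul_left
    ((1 : Matrix (Fin 2) (Fin 2) ℂ) i 1))).sub (h2.add
    ((isBigO_polar (p := p') β Ω).const_mul_left
      ((1 : Matrix (Fin 2) (Fin 2) ℂ) i 0)))).congr_left fun w => ?_
  rw [rowProduct]
  ring

theorem mem_Sig_diff {ζ : ℂ} (h0 : 0 < P.q0) (h1 : ζ ∈ closedPos P.q0) (h2 : ζ ∈ closedNeg P.q0) :
    ζ ∈ P.Sig \ {0, I * P.q0, -(I * P.q0)} := by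
  refine ⟨mem_Sig_of_mem h1 h2 h0, ?_⟩
  rintro (h | h | h)
  · exact h1.1 h
  · exact notMem_closedPos_of_sq (Or.inl h) h1
  · exact notMem_closedPos_of_sq (Or.inr h) h1

namespace Admissible

variable (hP : P.Admissible)

include hP

/-- The Wronskian of the two columns is `γ s₂₂`, and dividing the second one by `s₂₂` leaves `γ`.
Since `γ` vanishes at `±iq₀`, the argument below uses the adjugate of `M` and not its inverse. -/
theorem det_MPlus {w : ℂ} (hw : w ∈ closedPos P.q0) (h0 : P.s22 w ≠ 0) (x t : ℝ) :
    P.MPlus x t w 0 0 * P.MPlus x t w 1 1 - P.MPlus x t w 0 1 * P.MPlus x t w 1 0 = P.gam w := by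
  have h := hP.s22_eq hw x t
  have hg := gam_ne_zero hw
  rw [eq_div_iff hg, wr] at h
  change P.uM 0 x t w 0 * (P.uP 1 x t w 1 / P.s22 w)
    - P.uP 1 x t w 0 / P.s22 w * P.uM 0 x t w 1 = _
  field_simp
  linear_combination -h

theorem sigIntegral_eq_zero {j : ℂ → ℂ} (hj : ∀ ζ ∈ closedPos P.q0, ζ ∈ closedNeg P.q0 → j ζ = 0) :
    P.sigIntegral j = 0 := by
  have h : ContourPair P.q0 (fun _ => 0) (fun _ => 0) 0 :=
    ⟨continuousOn_const, continuousOn_const, differentiableOn_const _, differentiableOn_const _,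
      ⟨0, by simp⟩, ⟨0, by simp⟩, ⟨0, 0, by simp⟩, ⟨0, 0, by simp⟩⟩
  rw [(hP.sigIntegrable_of_contourPair h fun ζ h1 h2 => by rw [hj ζ h1 h2, sub_zero]).2]
  simp

theorem eq_zero_of_contourPair {fp fm : ℂ → ℂ} {c : ℂ} (h : ContourPair P.q0 fp fm c)
    (hj : ∀ ζ ∈ closedPos P.q0, ζ ∈ closedNeg P.q0 → fp ζ = fm ζ) : c = 0 := by
  have h1 := (hP.sigIntegrable_of_contourPair (j := fun ζ => fp ζ - fm ζ) h fun ζ _ _ => rfl).2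
  rw [hP.sigIntegral_eq_zero fun ζ h1 h2 => sub_eq_zero.2 (hj ζ h1 h2)] at h1
  have hpi : (Real.pi : ℂ) ≠ 0 := ofReal_ne_zero.2 Real.pi_ne_zero
  simpa [hpi] using h1.symm

/-- A pair without jump vanishes. -/
theorem eq_zero_of_oneSided {fp fm : ℂ → ℂ} {c : ℂ}
    (hp : OneSided (closedPos P.q0) (openPos P.q0) fp c)
    (hm : OneSided (closedNeg P.q0) P.Dminus fm c)
    (hj : ∀ ζ ∈ closedPos P.q0, ζ ∈ closedNeg P.q0 → fp ζ = fm ζ) :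
    c = 0 ∧ ∀ ξ ∈ P.Dminus, fm ξ = 0 := by
  refine ⟨hP.eq_zero_of_contourPair (OneSided.contourPair hp hm) hj, fun ξ hξ => ?_⟩
  refine neg_eq_zero.1 (hP.eq_zero_of_contourPair (OneSided.contourPair_div hp hm hξ)
    fun ζ h1 h2 => ?_)
  have hne : ζ ≠ ξ := fun h => notMem_closedPos_of_mem_Dminus hξ (h ▸ h1)
  rw [dslope_of_ne _ hne, slope_def_field, hj ζ h1 h2, div_eq_mul_inv]

variable {N : ℕ} {z : Fin N → ℂ} (hS : P.SimpleSpectrum z)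

include hS

/-- The residues at the `ξ_n` are chosen so that the row `(polar ξ, polar ξ̂)` has the inversion
symmetry of the rows of `M`; the poles correspond since inversion exchanges `ξ_n` and `ξ̂_n`. -/
theorem polar_xi_eq (β : Fin N ⊕ Fin N → ℂ) {w : ℂ} (hw : w ≠ 0) :
    polar (P.xi z) (fun n => I * (starRingEnd ℂ) P.qm * β n / P.xiHat z n) w
      = -(I * (starRingEnd ℂ) P.qm / w) * polar (P.xiHat z) β (hat P.q0 w) := by
  rw [polar, polar, Finset.mul_sum]
  refine Finset.sum_congr rfl fun n _ => ?_
  have hq : (P.q0 : ℂ) ≠ 0 := ofReal_ne_zero.2 hP.q0_pos.ne'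
  have hn := hP.xi_ne_zero hS n
  have e : hat P.q0 w - P.xiHat z n = (P.q0 : ℂ) ^ 2 * (w - P.xi z n) / (w * P.xi z n) := by
    rw [hat, xiHat]; field_simp; ring
  rw [e, xiHat, inv_div, ← div_div_eq_mul_div, div_mul_eq_div_div]
  by_cases h : w - P.xi z n = 0
  · simp [h]
  · field_simp

theorem polar_xiHat_eq (β : Fin N ⊕ Fin N → ℂ) {w : ℂ} (hw : w ≠ 0) :
    polar (P.xiHat z) β w = -(I * P.qm / w)
      * polar (P.xi z) (fun n => I * (starRingEnd ℂ) P.qm * β n / P.xiHat z n) (hat P.q0 w) := by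
  rw [hP.polar_xi_eq hS β (hat_ne_zero hP.q0_pos hw), hat_hat hP.q0_pos hw]
  have hq : (P.q0 : ℂ) ≠ 0 := ofReal_ne_zero.2 hP.q0_pos.ne'
  have hm := qm_mul_conj (P := P)
  have e : -(I * P.qm / w) * -(I * (starRingEnd ℂ) P.qm / hat P.q0 w) = 1 := by
    rw [hat]; field_simp
    linear_combination (-I ^ 2) * hm - (P.q0 : ℂ) ^ 2 * I_sq
  rw [← mul_assoc, e, one_mul]

theorem rowProduct_hat (β : Fin N ⊕ Fin N → ℂ) {w : ℂ} (hw : w ∈ closedPos P.q0) (x t : ℝ)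
    (i : Fin 2) :
    rowProduct (P.xi z) (fun n => I * (starRingEnd ℂ) P.qm * β n / P.xiHat z n) (P.xiHat z) β
        (P.MPlus x t) i w
      = (P.q0 : ℂ) ^ 2 * (w⁻¹ ^ 2 * rowProduct (P.xi z)
        (fun n => I * (starRingEnd ℂ) P.qm * β n / P.xiHat z n) (P.xiHat z) β
        (P.MMinus x t) i (hat P.q0 w)) := by
  rw [rowProduct, rowProduct, hP.polar_xi_eq hS β hw.1, hP.polar_xiHat_eq hS β hw.1,
    (hP.MPlus_hat hw x t i).1, (hP.MPlus_hat hw x t i).2, ← qm_mul_conj]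
  generalize polar (P.xi z) _ _ = a
  generalize polar (P.xiHat z) _ _ = b
  have := hw.1
  field_simp
  linear_combination (P.qm * (starRingEnd ℂ) P.qm * (b * P.MMinus x t (hat P.q0 w) i 0
    - a * P.MMinus x t (hat P.q0 w) i 1)) * I_sq

end Admissible

end KEPotential

namespace KEPotential.Admissible

variable {P : KEPotential} (hP : P.Admissible) {N : ℕ} {z : Fin N → ℂ} (hS : P.SimpleSpectrum z)

include hP hS

/-- At `ξ̂_n` the residue of the second entry of the row is `ω_n` times the value of the first,
which is also the residue relation between the columns of `M⁺`; hence the two residues in the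
product cancel. -/
theorem tendsto_sub_mul_rowProduct (x t : ℝ) {α v : Fin N ⊕ Fin N → ℂ} (i : Fin 2)
    (hv : ∀ n, polar (P.xi z) α (P.xiHat z n) = v n) (n : Fin N ⊕ Fin N) :
    Tendsto (fun w => (w - P.xiHat z n) * rowProduct (P.xi z) α (P.xiHat z)
      (fun n => P.omega z x t n * v n) (P.MPlus x t) i w) (𝓝[≠] P.xiHat z n) (𝓝 0) := by
  have hmem := Dplus_subset (hP.xiHat_mem hS n)
  have h1 : Tendsto (polar (P.xi z) α) (𝓝[≠] P.xiHat z n) (𝓝 (v n)) := by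
    rw [← hv n]
    exact (differentiableAt_polar α
      (hP.xi_notMem_closedPos hS hmem)).continuousAt.tendsto.mono_left nhdsWithin_le_nhds
  have h2 : Tendsto (fun w => P.MPlus x t w i 0) (𝓝[≠] P.xiHat z n)
      (𝓝 (P.uM 0 x t (P.xiHat z n) i)) :=
    ((hP.differentiableOn_uM_zero x t i).differentiableAt
      (isOpen_Dplus.mem_nhds (hP.xiHat_mem hS n))).continuousAt.tendsto.mono_left
        nhdsWithin_le_nhds
  have h3 := (h1.mul (hP.tendsto_sub_mul_MPlus hS x t i n)).sub
    ((tendsto_sub_mul_polar (fun n => P.omega z x t n * v n) (hP.xiHat_injective hS) n).mul h2)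
  have e : v n * (P.omega z x t n * P.uM 0 x t (P.xiHat z n) i)
      - P.omega z x t n * v n * P.uM 0 x t (P.xiHat z n) i = 0 := by ring
  rw [e] at h3
  refine h3.congr fun w => ?_
  rw [rowProduct]
  ring

/-- In the reflectionless case the row products of a solution of the residue conditions vanish. -/
theorem rowProduct_MPlus_eq_zero
    (hG : ∀ x t, ∀ ζ ∈ P.Sig \ {0, I * P.q0, -(I * P.q0)}, P.GG x t ζ = 0) (x t : ℝ)
    {v : Fin N ⊕ Fin N → ℂ}
    (hv : ∀ n, polar (P.xi z) (fun n => I * (starRingEnd ℂ) P.qm * (P.omega z x t n * v n)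
      / P.xiHat z n) (P.xiHat z n) = v n) (i : Fin 2) {w : ℂ} (hw : w ∈ P.Dplus)
    (hwn : w ∉ Set.range (P.xiHat z)) :
    rowProduct (P.xi z) (fun n => I * (starRingEnd ℂ) P.qm * (P.omega z x t n * v n)
      / P.xiHat z n) (P.xiHat z) (fun n => P.omega z x t n * v n) (P.MPlus x t) i w = 0 := by
  have hrel := fun {w : ℂ} (hw : w ∈ closedPos P.q0) =>
    hP.rowProduct_hat hS (fun n => P.omega z x t n * v n) hw x t i
  have hpole := hP.tendsto_sub_mul_rowProduct hS x t i hv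
  beta_reduce at hrel
  set β : Fin N ⊕ Fin N → ℂ := fun n => P.omega z x t n * v n with hβ
  set α : Fin N ⊕ Fin N → ℂ := fun n => I * (starRingEnd ℂ) P.qm * (P.omega z x t n * v n)
    / P.xiHat z n with hα
  set Fp := rowProduct (P.xi z) α (P.xiHat z) β (P.MPlus x t) i with hFp
  set Fm := rowProduct (P.xi z) α (P.xiHat z) β (P.MMinus x t) i with hFm
  set a : ℂ := (∑ n, α n) * (1 : Matrix (Fin 2) (Fin 2) ℂ) i 1
      - (∑ n, β n) * (1 : Matrix (Fin 2) (Fin 2) ℂ) i 0 with ha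
  have hdp : (fun w => Fp w - a * w⁻¹) =O[cobounded ℂ ⊓ 𝓟 (closedPos P.q0)] fun z => z⁻¹ ^ 2 :=
    isBigO_rowProduct fun j => hP.isBigO_inv_MPlus x t i j
  have hdm : (fun w => Fm w - a * w⁻¹) =O[cobounded ℂ ⊓ 𝓟 (closedNeg P.q0)] fun z => z⁻¹ ^ 2 :=
    isBigO_rowProduct fun j => hP.isBigO_inv_MMinus x t i j
  have hq := hP.q0_pos
  have hqC : (P.q0 : ℂ) ≠ 0 := ofReal_ne_zero.2 hq.ne'
  have hrel' : ∀ w ∈ closedNeg P.q0, Fm w = (P.q0 : ℂ) ^ 2 * (w⁻¹ ^ 2 * Fp (hat P.q0 w)) := by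
    intro w hw
    have := hw.1
    rw [hrel (hat_mem_closedPos hq hw), hat_hat hq hw.1, hat]
    field_simp
  have hjump : ∀ ζ ∈ closedPos P.q0, ζ ∈ closedNeg P.q0 → Fp ζ = Fm ζ := by
    intro ζ h1 h2
    have h3 := hP.jump_of_mem hS h1 h2 x t
    rw [hG x t ζ (mem_Sig_diff hq h1 h2), mul_zero] at h3
    rw [hFp, hFm, rowProduct, rowProduct, sub_eq_zero.1 h3.symm]
  clear_value Fm a
  -- The behaviour `a/w` at infinity forces, by inversion, a singular part `-a/w` at `0`. Adding
  -- `a/w` removes it and doubles the coefficient at infinity.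
  obtain ⟨fp, hfp, hOp⟩ : ∃ f, (∀ w ∉ Set.range (P.xiHat z), f w = Fp w + a * w⁻¹) ∧
      OneSided (closedPos P.q0) (openPos P.q0) f (2 * a) := by
    refine OneSided.exists_extension (isOpen_openPos _) (openPos_subset_closedPos _)
      (Set.finite_range _) (hP.range_xiHat_subset hS) ?_ ?_ ?_ ?_ ?_
    · refine ContinuousOn.add (ContinuousOn.sub (ContinuousOn.mul (fun w hw => ?_)
        (hP.continuousOn_MPlus hS x t i 1)) (ContinuousOn.mul (fun w hw => ?_)
        (hP.continuousOn_MPlus hS x t i 0)))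
        (continuousOn_const.mul (continuousOn_id.inv₀ fun w hw => hw.1.1))
      · exact (differentiableAt_polar α
          (hP.xi_notMem_closedPos hS hw.1)).continuousAt.continuousWithinAt
      · exact (differentiableAt_polar β hw.2).continuousAt.continuousWithinAt
    · refine DifferentiableOn.add (DifferentiableOn.sub (DifferentiableOn.mul (fun w hw => ?_)
        (hP.differentiableOn_MPlus hS x t i 1)) (DifferentiableOn.mul (fun w hw => ?_)
        (hP.differentiableOn_MPlus hS x t i 0)))
        ((differentiableOn_const _).mul (differentiableOn_id.inv
          fun w hw => (Dplus_subset hw.1).1))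
      · exact (differentiableAt_polar α
          (hP.xi_notMem_closedPos hS (Dplus_subset hw.1))).differentiableWithinAt
      · exact (differentiableAt_polar β hw.2).differentiableWithinAt
    · rintro _ ⟨n, rfl⟩
      have hn0 := (Dplus_subset (hP.xiHat_mem hS n)).1
      have h1 : Tendsto (fun w => (w - P.xiHat z n) * (a * w⁻¹)) (𝓝[≠] P.xiHat z n) (𝓝 0) := by
        have : ContinuousAt (fun w => (w - P.xiHat z n) * (a * w⁻¹)) (P.xiHat z n) :=
          (continuousAt_id.sub continuousAt_const).mul
            (continuousAt_const.mul (continuousAt_id.inv₀ hn0))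
        simpa using this.tendsto.mono_left nhdsWithin_le_nhds
      have h2 := (hpole n).add h1
      rw [add_zero] at h2
      exact h2.congr fun w => by ring
    · intro ζ hζ
      have hpo := isBigO_polar_one β (hP.notMem_range_xiHat hS hζ) (closedPos P.q0)
      rcases closedPos_nhdsWithin hζ with h | h | h | h
      · subst h
        refine ((isBigO_inv_sq_mul_comp_hat hq (zero_notMem_closedPos P.q0)
          (fun w hw => hat_mem_closedNeg hq hw) hdm).const_mul_left ((P.q0 : ℂ) ^ 2)).congr' ?_
          EventuallyEq.rfl
        filter_upwards [self_mem_nhdsWithin] with w hw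
        have := hw.1
        rw [hrel hw, hat]
        field_simp
        ring
      all_goals try rw [h]
      rotate_right
      · rw [Asymptotics.IsBigO_def]; exact ⟨0, by simp [Asymptotics.IsBigOWith_def]⟩
      all_goals
        rw [← h]
        have hbr : ζ = I * P.q0 ∨ ζ = -(I * P.q0) := by tauto
        have hζ0 := branch_ne_zero hq hbr
        have hζn : ζ ∉ Set.range (P.xi z) := by
          rintro ⟨n, hn⟩
          have h1 := hP.hat_xiHat hS n
          rw [hn] at h1
          refine hP.notMem_range_xiHat hS hζ ⟨n, ?_⟩
          rw [xiHat, hn]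
          exact hat_branch hq hbr
        have h2 : Tendsto (fun w => a * w⁻¹) (𝓝[closedPos P.q0] ζ) (𝓝 (a * ζ⁻¹)) :=
          (continuousAt_const.mul (continuousAt_id.inv₀ hζ0)).tendsto.mono_left nhdsWithin_le_nhds
        have h3 := ((isBigO_polar_one α hζn (closedPos P.q0)).mul
          (hP.isBigO_one_MPlus hS x t i 1 hbr)).sub (hpo.mul (hP.isBigO_one_MPlus hS x t i 0 hbr))
        simp only [mul_one] at h3
        exact h3.add (h2.isBigO_one ℂ)
    · refine hdp.congr_left fun w => ?_
      ring
  -- This is `Fm + a/w` away from the `ξ_n`. Writing it as the inversion of `fp` makes its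
  -- regularity at the `ξ_n` automatic.
  have hOm : OneSided (closedNeg P.q0) P.Dminus
      (fun w => (P.q0 : ℂ) ^ 2 * (w⁻¹ ^ 2 * fp (hat P.q0 w)) + 2 * a * w⁻¹) (2 * a) := by
    refine OneSided.of_isBigO isOpen_Dminus Dminus_subset ?_ ?_ ?_ ?_
    · exact ((continuousOn_const.mul (((continuousOn_id.inv₀ fun w hw => hw.1).pow 2).mul
        (hOp.cont.comp ((differentiableOn_hat P.q0).continuousOn.mono fun w hw => hw.1)
          fun w hw => hat_mem_closedPos hq hw)))).add
        (continuousOn_const.mul (continuousOn_id.inv₀ fun w hw => hw.1))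
    · exact (((differentiableOn_const _).mul (((differentiableOn_id.inv
        fun w hw => (Dminus_subset hw).1).pow 2).mul
        (hOp.diff.comp ((differentiableOn_hat P.q0).mono fun w hw => (Dminus_subset hw).1)
          fun w hw => hat_mem_Dplus hq hw)))).add
        ((differentiableOn_const _).mul (differentiableOn_id.inv
          fun w hw => (Dminus_subset hw).1))
    · intro ζ hζ
      rcases closedNeg_nhdsWithin hζ with h | h | h | h
      · subst h
        refine ((isBigO_inv_sq_mul_comp_hat hq (zero_notMem_closedNeg P.q0)
          (fun w hw => hat_mem_closedPos hq hw) hOp.decay).const_mul_left ((P.q0 : ℂ) ^ 2)).congr'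
          ?_ EventuallyEq.rfl
        filter_upwards [self_mem_nhdsWithin] with w hw
        have := hw.1
        generalize hu : fp (hat P.q0 w) = u
        rw [hat]
        field_simp
        ring
      all_goals try rw [h]
      rotate_right
      · rw [Asymptotics.IsBigO_def]; exact ⟨0, by simp [Asymptotics.IsBigOWith_def]⟩
      all_goals
        rw [← h]
        have hbr : ζ = I * P.q0 ∨ ζ = -(I * P.q0) := by tauto
        have hζ0 := branch_ne_zero hq hbr
        have ht := tendsto_hat (r := P.q0) hζ0 fun w hw => hat_mem_closedPos hq hw
        have hi : Tendsto (fun w : ℂ => w⁻¹) (𝓝[closedNeg P.q0] ζ) (𝓝 ζ⁻¹) :=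
          (continuousAt_id.inv₀ hζ0).tendsto.mono_left nhdsWithin_le_nhds
        have h3 := ((hi.pow 2).isBigO_one ℂ).mul ((hOp.isBigO_one _).comp_tendsto ht)
        simp only [Function.comp_def, mul_one] at h3
        exact (h3.const_mul_left _).add ((hi.const_mul (2 * a)).isBigO_one ℂ)
    · refine hdm.congr' ?_ EventuallyEq.rfl
      have hfin := isBounded_def.1 (Set.finite_range (P.xi z)).isBounded
      filter_upwards [mem_inf_of_left hfin, mem_inf_of_right (mem_principal_self _)] with w hw1 hw2
      have hne : hat P.q0 w ∉ Set.range (P.xiHat z) := by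
        rintro ⟨n, hn⟩
        refine hw1 ⟨n, ?_⟩
        rw [← hat_hat hq hw2.1, ← hn, hP.hat_xiHat hS]
      have := hw2.1
      rw [hfp _ hne, hrel' w hw2]
      generalize hu : Fp (hat P.q0 w) = u
      rw [hat]
      field_simp
      ring
  have hjump' : ∀ ζ ∈ closedPos P.q0, ζ ∈ closedNeg P.q0 →
      fp ζ = (P.q0 : ℂ) ^ 2 * (ζ⁻¹ ^ 2 * fp (hat P.q0 ζ)) + 2 * a * ζ⁻¹ := by
    intro ζ h1 h2
    have := h1.1
    rw [hfp _ (hP.xiHat_notMem_closedNeg hS h2),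
      hfp _ (hP.xiHat_notMem_closedNeg hS (hat_mem_closedNeg hq h1)), hjump ζ h1 h2, hrel' ζ h2]
    generalize hu : Fp (hat P.q0 ζ) = u
    rw [hat]
    field_simp
    ring
  -- There is no jump, so the coefficient `2a` at infinity is zero and the minus function vanishes
  -- on `D⁻`; inversion brings this back to `Fp` on `D⁺`.
  obtain ⟨ha0, hz⟩ := hP.eq_zero_of_oneSided hOp hOm hjump'
  have ha0' : a = 0 := by simpa using ha0
  have h1 := hz _ (hat_mem_Dminus hq hw)
  have hw0 := (Dplus_subset hw).1
  rw [hat_hat hq hw0, hfp w hwn, ha0', mul_zero, zero_mul, zero_mul, add_zero, add_zero] at h1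
  have h2 : (hat P.q0 w)⁻¹ ≠ 0 := inv_ne_zero (hat_ne_zero hq hw0)
  exact (mul_eq_zero.1 ((mul_eq_zero.1 h1).resolve_left (pow_ne_zero 2 hqC))).resolve_left
    (pow_ne_zero 2 h2)

/-- A kernel vector `v` would give a row with poles of residue `ω_n v_n` at the `ξ̂_n` and the
mirrored ones at the `ξ_n`. Its products with both rows of `M⁺` vanish by
`rowProduct_MPlus_eq_zero`, and inverting `M⁺` kills the row. -/
theorem matT_det_ne_zero
    (hG : ∀ x t, ∀ ζ ∈ P.Sig \ {0, I * P.q0, -(I * P.q0)}, P.GG x t ζ = 0) (x t : ℝ) :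
    (P.matT z x t).det ≠ 0 := by
  intro hdet
  obtain ⟨v, hv0, hv⟩ := Matrix.exists_mulVec_eq_zero_iff.2 hdet
  refine hv0 (funext fun s => ?_)
  have hq := hP.q0_pos
  have hqC : (P.q0 : ℂ) ≠ 0 := ofReal_ne_zero.2 hq.ne'
  set β : Fin N ⊕ Fin N → ℂ := fun n => P.omega z x t n * v n with hβ
  -- The equation `T v = 0` read as values of a rational function; by inversion it says that the
  -- first entry of the row takes the value `v_n` at `ξ̂_n`.
  have hsys : ∀ s, polar (P.xiHat z) β (P.xi z s) = -(P.nu z s * v s) := by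
    intro s
    have h := congrFun hv s
    simp only [mulVec, dotProduct, matT, of_apply, add_mul, Finset.sum_add_distrib, ite_mul,
      zero_mul, Finset.sum_ite_eq, Finset.mem_univ, if_true, Pi.zero_apply] at h
    rw [← eq_neg_iff_add_eq_zero] at h
    rw [← h, polar]
    exact Finset.sum_congr rfl fun n _ => by rw [hβ, div_eq_mul_inv]; ring
  have hres : ∀ n, polar (P.xi z) (fun n => I * (starRingEnd ℂ) P.qm * (P.omega z x t n * v n)
      / P.xiHat z n) (P.xiHat z n) = v n := by
    intro n
    have hn := hP.xi_ne_zero hS n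
    rw [hP.polar_xi_eq hS (fun n => P.omega z x t n * v n) (Dplus_subset (hP.xiHat_mem hS n)).1,
      hP.hat_xiHat hS, hsys, nu, xiHat]
    have hm := qm_mul_conj (P := P)
    field_simp
    linear_combination (-I ^ 2 * v n) * hm - ((P.q0 : ℂ) ^ 2 * v n) * I_sq
  have hzero : ∀ w ∈ P.Dplus, w ∉ Set.range (P.xiHat z) → polar (P.xiHat z) β w = 0 := by
    intro w hw hwn
    have h0 := hP.rowProduct_MPlus_eq_zero hS hG x t hres 0 hw hwn
    have h1 := hP.rowProduct_MPlus_eq_zero hS hG x t hres 1 hw hwn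
    have hw' := Dplus_subset hw
    have hd := hP.det_MPlus hw' (hP.s22_ne_zero hS hw' fun n h => hwn ⟨n, h.symm⟩) x t
    rw [rowProduct] at h0 h1
    refine (mul_eq_zero.1 ?_).resolve_right (gam_ne_zero hw')
    rw [← hd]
    linear_combination P.MPlus x t w 0 1 * h1 - P.MPlus x t w 1 1 * h0
  have hβ0 : β = 0 := by
    funext n
    refine tendsto_nhds_unique (tendsto_sub_mul_polar β (hP.xiHat_injective hS) n)
      ((tendsto_const_nhds (x := (0 : ℂ))).congr' ?_)
    have hfin : (Set.range (P.xiHat z) \ {P.xiHat z n}).Finite :=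
      (Set.finite_range _).subset Set.sdiff_subset
    filter_upwards [mem_nhdsWithin_of_mem_nhds (isOpen_Dplus.mem_nhds (hP.xiHat_mem hS n)),
      mem_nhdsWithin_of_mem_nhds (hfin.isClosed.isOpen_compl.mem_nhds fun h => h.2 rfl),
      self_mem_nhdsWithin] with w h1 h2 h3
    rw [hzero w h1 fun h => h2 ⟨h, h3⟩, mul_zero]
  -- Vanishing of the residues `ω_n v_n` is put back into `T v = 0`, where only `ν_s v_s = 0`
  -- remains with `ν_s ≠ 0`; nothing has to be known about `ω_n`.
  have h := hsys s
  rw [hβ0, polar] at h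
  simp only [Pi.zero_apply, zero_mul, Finset.sum_const_zero] at h
  have hnu : P.nu z s ≠ 0 :=
    div_ne_zero (mul_ne_zero I_ne_zero hP.qm_ne) (hP.xi_ne_zero hS s)
  exact (mul_eq_zero.1 (neg_eq_zero.1 h.symm)).resolve_left hnu

/-- Without jump the contour integrals vanish and the closed system reads `T u = ν`. The Schur
complement of `T` in the bordered matrix is `-ωᵀ T⁻¹ ν = -ωᵀ u`, and `ωᵀ u` is the sum in the
formula for `q`. -/
theorem reflectionless
    (hG : ∀ x t, ∀ ζ ∈ P.Sig \ {0, I * P.q0, -(I * P.q0)}, P.GG x t ζ = 0) (x t : ℝ) :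
    P.q x t = P.qm - I * ((P.bordered z x t).det / (P.matT z x t).det) := by
  have hdet := hP.matT_det_ne_zero hS hG x t
  have hG' : ∀ ζ ∈ closedPos P.q0, ζ ∈ closedNeg P.q0 →
      (P.MMinus x t ζ * P.GG x t ζ) 0 1 = 0 := fun ζ h1 h2 => by
    rw [hG x t ζ (mem_Sig_diff hP.q0_pos h1 h2), mul_zero, Matrix.zero_apply]
  set u : Fin N ⊕ Fin N → ℂ := fun n => P.uM 0 x t (P.xiHat z n) 0 with hu
  have hTu : P.matT z x t *ᵥ u = P.nu z := by
    funext s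
    have h := (hP.closed_system hS x t s).2
    rw [hP.sigIntegral_eq_zero fun ζ h1 h2 => by rw [hG' ζ h1 h2, zero_div], mul_zero] at h
    simp only [mulVec, dotProduct, matT, of_apply, add_mul, Finset.sum_add_distrib, ite_mul,
      zero_mul, Finset.sum_ite_eq, Finset.mem_univ, if_true]
    exact (sub_eq_zero.1 h.symm)
  have hq := (hP.reconstruction hS x t).2
  rw [hP.sigIntegral_eq_zero hG', mul_zero, add_zero] at hq
  have := invertibleOfIsUnitDet _ (isUnit_iff_ne_zero.2 hdet)
  have hinv : ⅟(P.matT z x t) *ᵥ P.nu z = u := by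
    rw [← hTu, mulVec_mulVec, invOf_mul_self, one_mulVec]
  have hb : (P.bordered z x t).det = (P.matT z x t).det * -(∑ n, P.omega z x t n * u n) := by
    rw [bordered, det_fromBlocks₁₁]
    congr 1
    rw [det_unique, Matrix.mul_assoc, Matrix.sub_apply, Matrix.zero_apply, zero_sub]
    congr 1
    rw [← hinv]
    rfl
  rw [hb, mul_div_cancel_left₀ _ hdet, hq]
  ring

end KEPotential.Admissible

/-! ### Assembly of the four claims -/

theorem mainTheorem6 (P : KEPotential) (hP : P.Admissible) (N : ℕ) (z : Fin N → ℂ)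
    (hz : P.SimpleSpectrum z) :
    (∃ M1 : ℝ → ℝ → Matrix (Fin 2) (Fin 2) ℂ, ∀ x t,
      (∀ i j, (fun w : ℂ => (P.MM x t w - 1 - w⁻¹ • M1 x t) i j)
        =O[cobounded ℂ ⊓ 𝓟 (P.Sig)ᶜ] fun w : ℂ => (w⁻¹) ^ 2) ∧
      P.q x t = I * M1 x t 0 1) ∧
    (∀ x t,
      P.SigIntegrable (fun ζ => (P.MMinus x t ζ * P.GG x t ζ) 0 1) ∧
      P.q x t = P.qm
        + I * ∑ n, P.CPlus (P.xiHat z n) * exp (-2 * I * P.theta x t (P.xiHat z n))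
            * P.uM 0 x t (P.xiHat z n) 0
        + 1 / (2 * (Real.pi : ℂ))
          * P.sigIntegral (fun ζ => (P.MMinus x t ζ * P.GG x t ζ) 0 1)) ∧
    (∀ x t, ∀ s : Fin N ⊕ Fin N,
      P.SigIntegrable (fun ζ => (P.MMinus x t ζ * P.GG x t ζ) 0 1 / (ζ - P.xi z s)) ∧
      ∑ n, (P.CPlus (P.xiHat z n) * exp (-2 * I * P.theta x t (P.xiHat z n))
              / (P.xi z s - P.xiHat z n)
            + if s = n then I * P.qm / P.xi z s else 0) * P.uM 0 x t (P.xiHat z n) 0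
        - I * P.qm / P.xi z s
        - 1 / (2 * (Real.pi : ℂ) * I)
          * P.sigIntegral
              (fun ζ => (P.MMinus x t ζ * P.GG x t ζ) 0 1 / (ζ - P.xi z s)) = 0) ∧
    ((∀ x t, ∀ ζ ∈ P.Sig \ {0, I * P.q0, -(I * P.q0)}, P.GG x t ζ = 0) →
      ∀ x t, (P.matT z x t).det ≠ 0 ∧
        P.q x t = P.qm - I * ((P.bordered z x t).det / (P.matT z x t).det)) := by
  refine ⟨⟨P.leadingCoeff, fun x t => ⟨fun i j => ?_, ?_⟩⟩, fun x t => ?_, fun x t s => ?_,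
    fun hG x t => ⟨hP.matT_det_ne_zero hz hG x t, hP.reflectionless hz hG x t⟩⟩
  · exact hP.isBigO_MM x t i j
  · change P.q x t = I * -(I * P.q x t)
    linear_combination P.q x t * I_sq
  · exact hP.reconstruction hz x t
  · obtain ⟨h1, h2⟩ := hP.closed_system hz x t s
    refine ⟨h1, ?_⟩
    rw [h2]
    simp only [add_mul, Finset.sum_add_distrib, ite_mul, zero_mul, Finset.sum_ite_eq,
      Finset.mem_univ, if_true, KEPotential.omega, KEPotential.nu]
    ring
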